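/- Let $B$ be a smooth manifold of dimension $g$ and $\Lambda\subset T^*B$ a Lagrangian covering, i.e. a bundle of lattices locally spanned by the differentials $dx^1,\dots,dx^g$ of local coordinates (action coordinates). Let $X=T^*B/\Lambda\to B$, with action-angle coordinates $(x,y)$, be the associated symplectic manifold fibred in Lagrangian tori (every symplectic manifold fibred in Lagrangian tori with a Lagrangian section is of this form), let $\hat X=TB/\Lambda^\vee\to B$ be the dual fibration with dual coordinates $(x,w)$, and let $Z=X\times_B\hat X$. Let $\mathcal P$ be the Poincaré line bundle on $Z$: its sections are the functions $s(x,y,w)$, periodic in $y$, with $s(x,y,w+\mu)=e^{-2\pi i\mu\cdot y}s(x,y,w)$ for $\mu\in\Lambda^\vee$, and its connection is $\nabla_{\mathcal P}=d+2\pi i\sum_j w^j\,dy_j$, with curvature $\mathbb F$. Let $S\subset X$ be a closed submanifold, $Z_S=S\times_B\hat X$ with projections $p_S\colon Z_S\to S$ and $\hat p_S\colon Z_S\to\hat X^S:=\hat p(Z_S)\subset\hat X$, and assume that $\hat X^S$ is a closed submanifold of $\hat X$ and that $\hat p_S$ is a submersion onto it. Let $\mathcal E$ be a sheaf of $\mathcal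 C^\infty_S$-modules (complex-valued functions) with a flat connection $\nabla$, and let $\nabla^{\mathcal E}$ be the connection on $p_S^*\mathcal E\otimes\mathcal P|_{Z_S}$ obtained by coupling the pull-back of $\nabla$ with $\nabla_{\mathcal P}$. Let $\nabla_r^{\mathcal E}$ be its projection to the relative differentials $\Omega^\bullet_{Z_S/\hat X^S}$, and let $R^j\hat p_{S,*}\ker\nabla_r^{\mathcal E}$ denote the $j$-th cohomology sheaf of the complex $\bigl(\hat p_{S,*}(p_S^*\mathcal E\otimes\mathcal P|_{Z_S}\otimes\Omega^\bullet_{Z_S/\hat X^S}),\nabla_r^{\mathcal E}\bigr)$. Fix a smooth splitting of $0\to\hat p_S^*\Omega^1_{\hat X^S}\to\Omega^1_{Z_S}\to\Omega^1_{Z_S/\hat X^S}\to0$ (for example the one given by the Gauss–Manin connection, when the latter restricts to $Z_S$), and let $\nabla^{\mathcal E}=\nabla^{\mathcal E}_r+\hat\nabla^{\mathcal E}$ be the corresponding decomposition. Suppose that $R^j\hat p_{S,*}\ker\nabla_r^{\mathcal E}$ is supported on a closed submanifold $\hat S$ of $\hat X$ contained in $\hat X^S$, and that $\mathbb F$ vanishes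 on $S\times_B\hat S$, in the sense that $\mathbb F(\theta,u)=0$ on $S\times_B\hat S$ for all vectors $\theta$ tangent to $S\times_B\hat S$ and all $u$ tangent to the fibres of $\hat p_S$. Then $\hat\nabla^{\mathcal E}$ induces a connection on $R^j\hat p_{S,*}\ker\nabla_r^{\mathcal E}$: there is a morphism of sheaves $$D\colon R^j\hat p_{S,*}\ker\nabla_r^{\mathcal E}\to R^j\hat p_{S,*}\ker\nabla_r^{\mathcal E}\otimes_{\mathcal C^\infty_{\hat X^S}}\Omega^1_{\hat S},\qquad D(hs)=h\,Ds+s\otimes d(h|_{\hat S}),$$ such that for every $\nabla_r^{\mathcal E}$-closed relative form $\tau$ over the preimage of an open subset of $\hat X^S$ and every vector field $v$ on this open set that is tangent to $\hat S$, $D_{v|_{\hat S}}[\tau]$ is locally the class of a $\nabla_r^{\mathcal E}$-closed form that coincides on $S\times_B\hat S$ with $\hat\nabla^{\mathcal E}_v\tau$. -/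

import Mathlib

open scoped Manifold ContDiff Topology TensorProduct

noncomputable section

universe u

namespace FourierMukai

/-! ### Smooth spaces, germs of smooth functions, vector fields -/

/-- A topological space together with, for every point `y`, the algebra of those complex-valued
functions that are smooth on a neighbourhood of `y`.  Only the concrete instances below are used. -/
class SmoothSpace (Y : Type*) extends TopologicalSpace Y where
  smoothNear : Y → Subalgebra ℂ (Y → ℂ)
  eventually_mem : ∀ y, ∀ φ ∈ smoothNear y, ∀ᶠ y' in 𝓝 y, φ ∈ smoothNear y'

section Germs

variable {Y : Type*} [SmoothSpace Y]

/-- `smoothNear y`: the functions that are smooth on a neighbourhood of `y`. -/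
abbrev smoothNear (y : Y) : Subalgebra ℂ (Y → ℂ) := SmoothSpace.smoothNear y

/-- The ideal of functions that vanish on a neighbourhood of `y`. -/
def vanishingNear (y : Y) : Ideal (smoothNear y) where
  carrier := {φ | ∀ᶠ y' in 𝓝 y, (φ : Y → ℂ) y' = 0}
  zero_mem' := Filter.Eventually.of_forall fun _ => rfl
  add_mem' := by
    intro a b ha hb
    filter_upwards [ha, hb] with y' h1 h2
    simp [h1, h2]
  smul_mem' := by
    intro c a ha
    filter_upwards [ha] with y' h1
    simp [h1]

/-- The stalk at `y` of the sheaf of smooth complex-valued functions. -/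
def SGerm (y : Y) : Type _ := smoothNear y ⧸ vanishingNear y

instance (y : Y) : CommRing (SGerm y) :=
  inferInstanceAs (CommRing (smoothNear y ⧸ vanishingNear y))

instance (y : Y) : Algebra ℂ (SGerm y) :=
  inferInstanceAs (Algebra ℂ (smoothNear y ⧸ vanishingNear y))

/-- The germ at `y` of a function (`0` if it is not smooth near `y`). -/
def germ (y : Y) (φ : Y → ℂ) : SGerm y :=
  open Classical in
  if h : φ ∈ smoothNear y then Ideal.Quotient.mk (vanishingNear y) ⟨φ, h⟩ else 0

lemma germ_of_mem {y : Y} {φ : Y → ℂ} (h : φ ∈ smoothNear y) :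
    germ y φ = Ideal.Quotient.mk (vanishingNear y) ⟨φ, h⟩ := dif_pos h

lemma germ_mul {y : Y} {φ ψ : Y → ℂ} (h : φ ∈ smoothNear y) (h' : ψ ∈ smoothNear y) :
    germ y (φ * ψ) = germ y φ * germ y ψ := by
  rw [germ_of_mem h, germ_of_mem h', germ_of_mem (mul_mem h h')]
  rfl

/-- Germs at `y` of (complexified) smooth vector fields, as derivations of germs of functions. -/
abbrev Der (y : Y) : Type _ := Derivation ℂ (SGerm y) (SGerm y)

/-- A family of germs of vector fields is, near `y₀`, a smooth vector field. -/
def IsVectorFieldNear (v : ∀ y : Y, Der y) (y₀ : Y) : Prop :=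
  ∀ φ ∈ smoothNear y₀, ∃ ψ ∈ smoothNear y₀, ∀ᶠ y in 𝓝 y₀, v y (germ y φ) = germ y ψ

end Germs

/-- Smooth maps. -/
structure IsSmoothMap {Y' Y : Type*} [SmoothSpace Y'] [SmoothSpace Y] (f : Y' → Y) : Prop where
  continuous : Continuous f
  comp_mem : ∀ y' : Y', ∀ φ ∈ smoothNear (f y'), φ ∘ f ∈ smoothNear y'

section Pullback

variable {Y' Y : Type*} [SmoothSpace Y'] [SmoothSpace Y] {f : Y' → Y}

/-- Pull-back of functions along a smooth map `f` with `f y' = y`, before passing to germs. -/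
def pullbackFun (hf : IsSmoothMap f) (y' : Y') (y : Y) (h : f y' = y) :
    smoothNear y →ₐ[ℂ] smoothNear y' where
  toFun φ := ⟨(φ : Y → ℂ) ∘ f, hf.comp_mem y' φ (h ▸ φ.2)⟩
  map_one' := rfl
  map_mul' _ _ := rfl
  map_zero' := rfl
  map_add' _ _ := rfl
  commutes' _ := rfl

/-- Pull-back of germs along a smooth map `f` with `f y' = y`. -/
def pullback (hf : IsSmoothMap f) (y' : Y') (y : Y) (h : f y' = y) : SGerm y →ₐ[ℂ] SGerm y' :=
  (Ideal.quotientMapₐ (vanishingNear y') (pullbackFun hf y' y h) (by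
    intro φ hφ
    subst h
    exact hf.continuous.continuousAt.eventually hφ) :
      (smoothNear y ⧸ vanishingNear y) →ₐ[ℂ] (smoothNear y' ⧸ vanishingNear y'))

/-- A smooth map is a submersion: every germ of a vector field downstairs lifts. -/
def IsSubmersion (hf : IsSmoothMap f) : Prop :=
  ∀ (y' : Y') (v : Der (f y')), ∃ θ : Der y', ∀ r : SGerm (f y'),
    θ (pullback hf y' _ rfl r) = pullback hf y' _ rfl (v r)

end Pullback

/-! ### Subsets and parametrized spaces -/

/-- On a subset, the smooth functions are locally the restrictions of smooth functions. -/
instance subsetSmoothSpace {Y : Type*} [SmoothSpace Y] (A : Set Y) : SmoothSpace A where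
  toTopologicalSpace := instTopologicalSpaceSubtype
  smoothNear a :=
    { carrier := {φ | ∃ ψ ∈ smoothNear (a : Y), ∀ᶠ a' in 𝓝 a, φ a' = ψ a'}
      mul_mem' := by
        rintro _ _ ⟨ψ, hψ, h1⟩ ⟨ψ', hψ', h2⟩
        refine ⟨ψ * ψ', mul_mem hψ hψ', ?_⟩
        filter_upwards [h1, h2] with a' e1 e2
        simp [e1, e2]
      add_mem' := by
        rintro _ _ ⟨ψ, hψ, h1⟩ ⟨ψ', hψ', h2⟩
        refine ⟨ψ + ψ', add_mem hψ hψ', ?_⟩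
        filter_upwards [h1, h2] with a' e1 e2
        simp [e1, e2]
      algebraMap_mem' := fun c =>
        ⟨algebraMap ℂ (Y → ℂ) c, Subalgebra.algebraMap_mem _ c,
          Filter.Eventually.of_forall fun _ => rfl⟩ }
  eventually_mem := by
    rintro a φ ⟨ψ, hψ, h⟩
    have h1 : ∀ᶠ a' : A in 𝓝 a, ψ ∈ smoothNear (a' : Y) :=
      continuous_subtype_val.continuousAt.eventually (SmoothSpace.eventually_mem _ ψ hψ)
    filter_upwards [h1, h.eventually_nhds] with a' h2 h3
    exact ⟨ψ, h2, h3⟩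

lemma isSmoothMap_val {Y : Type*} [SmoothSpace Y] (A : Set Y) :
    IsSmoothMap (Subtype.val : A → Y) where
  continuous := continuous_subtype_val
  comp_mem _ φ hφ := ⟨φ, hφ, Filter.Eventually.of_forall fun _ => rfl⟩

lemma IsSmoothMap.restrict {Y' Y : Type*} [SmoothSpace Y'] [SmoothSpace Y] {f : Y' → Y}
    (hf : IsSmoothMap f) {A' : Set Y'} {A : Set Y} (h : ∀ a : A', f a ∈ A) :
    IsSmoothMap (fun a : A' => (⟨f a, h a⟩ : A)) where
  continuous := (hf.continuous.comp continuous_subtype_val).subtype_mk _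
  comp_mem a φ := by
    rintro ⟨ψ, hψ, e⟩
    refine ⟨ψ ∘ f, hf.comp_mem _ ψ hψ, ?_⟩
    have hc : Continuous (fun a : A' => (⟨f a, h a⟩ : A)) :=
      (hf.continuous.comp continuous_subtype_val).subtype_mk _
    exact hc.continuousAt.eventually e

/-- Restriction of germs to a subset. -/
def restrictGerm {Y : Type*} [SmoothSpace Y] {A : Set Y} (a : A) :
    SGerm (a : Y) →ₐ[ℂ] SGerm a :=
  pullback (isSmoothMap_val A) a a rfl

instance restrictAlgebra {Y : Type*} [SmoothSpace Y] (A : Set Y) (a : A) :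
    Algebra (SGerm (a : Y)) (SGerm a) :=
  (restrictGerm a).toRingHom.toAlgebra

/-- A family of parametrizations of `Y` by open subsets of a normed space. -/
structure Plots (Y : Type*) (F : Type*) [NormedAddCommGroup F] where
  ι : Type*
  dom : ι → Set F
  map : ι → F → Y

section Plots

variable {Y F : Type*} [NormedAddCommGroup F] [NormedSpace ℝ F]

/-- The final topology for which all parametrizations are continuous. -/
@[reducible]
def Plots.topology (P : Plots Y F) : TopologicalSpace Y :=
  ⨆ i, TopologicalSpace.coinduced (fun a : P.dom i => P.map i a) inferInstance

/-- The smooth structure for which a function is smooth iff it is so in all parametrizations. -/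
@[reducible]
def Plots.smoothSpace (P : Plots Y F) : SmoothSpace Y where
  toTopologicalSpace := P.topology
  smoothNear y :=
    { carrier := {φ | ∃ U : Set Y, IsOpen[P.topology] U ∧ y ∈ U ∧
        ∀ i, ContDiffOn ℝ ∞ (φ ∘ P.map i) (P.dom i ∩ P.map i ⁻¹' U)}
      mul_mem' := by
        rintro φ ψ ⟨U, hU, hy, h⟩ ⟨U', hU', hy', h'⟩
        refine ⟨U ∩ U', @IsOpen.inter _ P.topology _ _ hU hU', ⟨hy, hy'⟩, fun i => ?_⟩
        exact ((h i).mono fun a ha => ⟨ha.1, ha.2.1⟩).mul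
          ((h' i).mono fun a ha => ⟨ha.1, ha.2.2⟩)
      add_mem' := by
        rintro φ ψ ⟨U, hU, hy, h⟩ ⟨U', hU', hy', h'⟩
        refine ⟨U ∩ U', @IsOpen.inter _ P.topology _ _ hU hU', ⟨hy, hy'⟩, fun i => ?_⟩
        exact ((h i).mono fun a ha => ⟨ha.1, ha.2.1⟩).add
          ((h' i).mono fun a ha => ⟨ha.1, ha.2.2⟩)
      algebraMap_mem' := fun c =>
        ⟨Set.univ, @isOpen_univ _ P.topology, trivial, fun _ => contDiffOn_const⟩ }
  eventually_mem := by
    rintro y φ ⟨U, hU, hy, h⟩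
    exact Filter.mem_of_superset (@IsOpen.mem_nhds _ P.topology y U hU hy)
      fun y' hy' => ⟨U, hU, hy', h⟩

/-- The part of a subset `A` of `Y` seen in the parametrization `i`. -/
def Plots.preim (P : Plots Y F) (A : Set Y) (i : P.ι) : Set F := P.dom i ∩ P.map i ⁻¹' A

/-- `A` is a closed embedded submanifold: it is closed, and in the parametrizations it can locally
be straightened to a linear subspace by a diffeomorphism. -/
def Plots.IsClosedSubmanifold (P : Plots Y F) (A : Set Y) : Prop :=
  IsClosed[P.topology] A ∧
  ∀ i, ∀ a ∈ P.preim A i, ∃ φ : OpenPartialHomeomorph F F, ∃ W : Submodule ℝ F,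
    a ∈ φ.source ∧ φ.source ⊆ P.dom i ∧ ContDiffOn ℝ ∞ φ φ.source ∧
    ContDiffOn ℝ ∞ φ.symm φ.target ∧ ∀ a' ∈ φ.source, a' ∈ P.preim A i ↔ φ a' ∈ W

lemma Plots.isSmoothMap {Y' F' : Type*} [NormedAddCommGroup F'] [NormedSpace ℝ F']
    (P : Plots Y F) (P' : Plots Y' F') (f : Y' → Y) (t : P'.ι → P.ι) (k : F' → F)
    (hk : ContDiff ℝ ∞ k) (hdom : ∀ i, ∀ a ∈ P'.dom i, k a ∈ P.dom (t i))
    (hmap : ∀ i a, f (P'.map i a) = P.map (t i) (k a)) :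
    @IsSmoothMap Y' Y P'.smoothSpace P.smoothSpace f := by
  let _ := P'.smoothSpace
  let _ := P.smoothSpace
  have hcont : Continuous f := by
    refine continuous_def.2 fun U hU => ?_
    have hU' : ∀ i, IsOpen ((fun a : P.dom i => P.map i a) ⁻¹' U) := by
      intro i
      exact isOpen_coinduced.1 (isOpen_iSup_iff.1 hU i)
    refine isOpen_iSup_iff.2 fun i => isOpen_coinduced.2 ?_
    have hc : Continuous (fun a : P'.dom i => (⟨k a, hdom i a a.2⟩ : P.dom (t i))) :=
      (hk.continuous.comp continuous_subtype_val).subtype_mk _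
    have := (hU' (t i)).preimage hc
    convert this using 1
    ext a
    simp [hmap]
  refine ⟨hcont, ?_⟩
  rintro y φ ⟨U, hU, hy, h⟩
  refine ⟨f ⁻¹' U, hU.preimage hcont, hy, fun i => ?_⟩
  have h1 : (φ ∘ f) ∘ P'.map i = (φ ∘ P.map (t i)) ∘ k := by
    funext a
    simp [hmap]
  rw [h1]
  refine (h (t i)).comp hk.contDiffOn ?_
  rintro a ⟨ha, ha'⟩
  refine ⟨hdom i a ha, ?_⟩
  simpa [hmap] using ha'

end Plots

/-! ### The dual torus fibrations -/

/-- The model space of the base. -/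
abbrev Model (g : ℕ) : Type := Fin g → ℝ

section Base

variable {g : ℕ} {B : Type*} [TopologicalSpace B] [ChartedSpace (Model g) B]

variable (g) in
/-- The tangent space of the base. -/
abbrev Tan (b : B) : Type := TangentSpace 𝓘(ℝ, Model g) b

variable (g) in
/-- The cotangent space of the base. -/
abbrev Cot (b : B) : Type := Tan g b →L[ℝ] ℝ

/-- The covector `dx^j` at `b`, where `x` are the coordinates of the chart `e`. -/
def dcoord (e : OpenPartialHomeomorph B (Model g)) (b : B) (j : Fin g) : Cot g b :=
  (ContinuousLinearMap.proj j : (Model g) →L[ℝ] ℝ).comp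
    (mfderiv 𝓘(ℝ, Model g) 𝓘(ℝ, Model g) e b : Tan g b →L[ℝ] Model g)

/-- The vector `∑ m^j ∂/∂x^j` at `b`, where `x` are the coordinates of the chart `e`. -/
def coordVec (e : OpenPartialHomeomorph B (Model g)) (b : B) (m : Model g) : Tan g b :=
  ContinuousLinearMap.inverse
    (mfderiv 𝓘(ℝ, Model g) 𝓘(ℝ, Model g) e b : Tan g b →L[ℝ] Model g) m

/-- `e` is a smooth chart of `B` whose coordinates are action coordinates for the family of
subgroups `Λ` of the cotangent spaces: `Λ` is the `ℤ`-span of `dx^1, …, dx^g`. -/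
def IsActionChart (Λ : ∀ b : B, AddSubgroup (Cot g b))
    (e : OpenPartialHomeomorph B (Model g)) : Prop :=
  e ∈ IsManifold.maximalAtlas 𝓘(ℝ, Model g) ∞ B ∧
  ∀ b ∈ e.source, ∀ η : Cot g b,
    η ∈ Λ b ↔ ∃ n : Fin g → ℤ, η = ∑ j, (n j : ℝ) • dcoord e b j

variable (g B) in
/-- A Lagrangian covering `Λ ⊆ T*B`: a bundle of lattices in the cotangent spaces that is locally
spanned by the differentials of a coordinate system. -/
structure LagrangianLattice where
  lattice : ∀ b : B, AddSubgroup (Cot g b)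
  exists_chart : ∀ b : B, ∃ e, IsActionChart lattice e ∧ b ∈ e.source

namespace LagrangianLattice

variable (L : LagrangianLattice g B)

/-- The dual lattice in the tangent space. -/
def dualLattice (b : B) : AddSubgroup (Tan g b) where
  carrier := {v | ∀ η ∈ L.lattice b, ∃ n : ℤ, η v = n}
  zero_mem' := fun η _ => ⟨0, by simp⟩
  add_mem' := by
    intro v v' h h' η hη
    obtain ⟨n, hn⟩ := h η hη
    obtain ⟨n', hn'⟩ := h' η hη
    exact ⟨n + n', by rw [map_add, hn, hn']; push_cast; rfl⟩
  neg_mem' := by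
    intro v h η hη
    obtain ⟨n, hn⟩ := h η hη
    exact ⟨-n, by rw [map_neg, hn]; push_cast; rfl⟩

/-- Action charts. -/
abbrev ActionChart : Type _ :=
  {e : OpenPartialHomeomorph B (Model g) // IsActionChart L.lattice e}

/-- An action chart around a given point. -/
def chart (b : B) : OpenPartialHomeomorph B (Model g) := (L.exists_chart b).choose

/-- The symplectic manifold `X = T*B / Λ`, fibred over `B` in Lagrangian tori. -/
structure X where
  base : B
  angle : Cot g base ⧸ L.lattice base

/-- The dual fibration `TB / Λ^∨`, that is `R¹f_*ℝ / R¹f_*ℤ`. -/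
structure Xhat where
  base : B
  angle : Tan g base ⧸ L.dualLattice base

/-- The fibre product of the two fibrations over `B`. -/
structure Z where
  base : B
  angle : Cot g base ⧸ L.lattice base
  dual : Tan g base ⧸ L.dualLattice base

/-- Action-angle coordinates `(x, y)` on `X`. -/
def plotsX : Plots L.X (Model g × Model g) where
  ι := L.ActionChart
  dom e := e.1.target ×ˢ Set.univ
  map e a := ⟨e.1.symm a.1, ((∑ j, a.2 j • dcoord e.1 (e.1.symm a.1) j : Cot g _))⟩

/-- The coordinates `(x, w)` on the dual fibration. -/
def plotsXhat : Plots L.Xhat (Model g × Model g) where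
  ι := L.ActionChart
  dom e := e.1.target ×ˢ Set.univ
  map e a := ⟨e.1.symm a.1, ((coordVec e.1 (e.1.symm a.1) a.2 : Tan g _))⟩

/-- The coordinates `(x, y, w)` on the fibre product. -/
def plotsZ : Plots L.Z (Model g × Model g × Model g) where
  ι := L.ActionChart
  dom e := e.1.target ×ˢ Set.univ
  map e a := ⟨e.1.symm a.1, ((∑ j, a.2.1 j • dcoord e.1 (e.1.symm a.1) j : Cot g _)),
    ((coordVec e.1 (e.1.symm a.1) a.2.2 : Tan g _))⟩

instance : SmoothSpace L.X := L.plotsX.smoothSpace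
instance : SmoothSpace L.Xhat := L.plotsXhat.smoothSpace
instance : SmoothSpace L.Z := L.plotsZ.smoothSpace

variable {L}

/-- The first projection of the fibre product. -/
def Z.left (z : L.Z) : L.X := ⟨z.base, z.angle⟩

/-- The second projection of the fibre product. -/
def Z.right (z : L.Z) : L.Xhat := ⟨z.base, z.dual⟩

lemma isSmoothMap_left : IsSmoothMap (Z.left : L.Z → L.X) :=
  Plots.isSmoothMap L.plotsX L.plotsZ Z.left id (fun a => (a.1, a.2.1)) (by fun_prop)
    (fun _ _ ha => ⟨ha.1, trivial⟩) (fun _ _ => rfl)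

lemma isSmoothMap_right : IsSmoothMap (Z.right : L.Z → L.Xhat) :=
  Plots.isSmoothMap L.plotsXhat L.plotsZ Z.right id (fun a => (a.1, a.2.2)) (by fun_prop)
    (fun _ _ ha => ⟨ha.1, trivial⟩) (fun _ _ => rfl)

end LagrangianLattice

end Base

open LagrangianLattice

section Setting

variable {g : ℕ} {B : Type*} [TopologicalSpace B] [ChartedSpace (Model g) B]
variable {L : LagrangianLattice g B}

/-! ### The spaces attached to a submanifold `S` of `X` -/

/-- `Z_S`, the fibre product over `B` of `S` and the dual fibration. -/
def ZS (S : Set L.X) : Set L.Z := {z | z.left ∈ S}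

/-- The image of `Z_S` in the dual fibration. -/
def XhatS (S : Set L.X) : Set L.Xhat := Z.right '' ZS S

variable {S : Set L.X}

/-- The projection of `Z_S` to `S`. -/
def pS (z : ZS S) : S := ⟨z.1.left, z.2⟩

/-- The projection of `Z_S` to its image in the dual fibration. -/
def phatS (z : ZS S) : XhatS S := ⟨z.1.right, Set.mem_image_of_mem _ z.2⟩

lemma isSmoothMap_pS : IsSmoothMap (pS : ZS S → S) :=
  isSmoothMap_left.restrict fun a => a.2

lemma isSmoothMap_phatS : IsSmoothMap (phatS : ZS S → XhatS S) :=
  isSmoothMap_right.restrict fun a => Set.mem_image_of_mem _ a.2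

/-- Germs on `S` act on germs on `Z_S`. -/
instance pSAlgebra (z : ZS S) : Algebra (SGerm (pS z)) (SGerm z) :=
  (pullback isSmoothMap_pS z (pS z) rfl).toRingHom.toAlgebra

/-- Pull-back of germs from the image of `Z_S` in the dual fibration. -/
abbrev pullHat (z : ZS S) (ξ : XhatS S) (h : phatS z = ξ) : SGerm ξ →ₐ[ℂ] SGerm z :=
  pullback isSmoothMap_phatS z ξ h

/-! ### Relative vector fields and splittings -/

/-- Germs of vector fields on `Z_S` tangent to the fibres of the projection `phatS`. -/
def vertical (z : ZS S) : Submodule (SGerm z) (Der z) where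
  carrier := {u | ∀ r, u (pullHat z _ rfl r) = 0}
  zero_mem' := fun _ => rfl
  add_mem' := by
    intro u u' h h' r
    simp [h r, h' r]
  smul_mem' := by
    intro c u h r
    simp [h r]

/-- The Lie bracket of two vertical fields. -/
def vbracket {z : ZS S} (u u' : vertical z) : vertical z :=
  ⟨⁅(u : Der z), (u' : Der z)⁆, fun r => by
    rw [Derivation.commutator_apply, u.2 r, u'.2 r, map_zero, map_zero, sub_zero]⟩

/-- A smooth splitting of the exact sequence of relative differentials of `phatS`, given dually by
the horizontal lift of vector fields. -/
structure Splitting (S : Set L.X) where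
  lift : ∀ z : ZS S, Der (phatS z) → Der z
  lift_add : ∀ z v v', lift z (v + v') = lift z v + lift z v'
  lift_smul : ∀ z (r : SGerm (phatS z)) v, lift z (r • v) = pullHat z _ rfl r • lift z v
  lift_apply : ∀ z v r, lift z v (pullHat z _ rfl r) = pullHat z _ rfl (v r)
  smooth : ∀ (z₀ : ZS S) (v : ∀ ξ : XhatS S, Der ξ), IsVectorFieldNear v (phatS z₀) →
    IsVectorFieldNear (fun z => lift z (v (phatS z))) z₀

/-- The Lie bracket of a horizontal lift with a vertical field. -/
def Splitting.hbracket (h : Splitting S) {z : ZS S} (v : Der (phatS z)) (u : vertical z) :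
    vertical z :=
  ⟨⁅h.lift z v, (u : Der z)⁆, fun r => by
    rw [Derivation.commutator_apply, u.2 r, h.lift_apply, u.2, map_zero, sub_zero]⟩

/-! ### The Poincaré bundle -/

/-- The lifts to the tangent space of `B` of the second component of a point of `Z_S`. -/
def WLift (z : ZS S) : Type := {w : Tan g z.1.base // (w : Tan g _ ⧸ L.dualLattice _) = z.1.dual}

/-- The `j`-th dual coordinate of a lift, in an action chart. -/
def WLift.coord {z : ZS S} (e : OpenPartialHomeomorph B (Model g)) (w : WLift z) (j : Fin g) : ℝ :=
  dcoord e z.1.base j w.1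

/-- The function `exp (2πi ∑ m^j y_j)` in an action chart; it does not depend on the choice of a
representative when the `m^j` are integers. -/
def character (e : OpenPartialHomeomorph B (Model g)) (m : Model g) (z : ZS S) : ℂ :=
  Complex.exp (2 * Real.pi * Complex.I *
    ((Quotient.out z.1.angle : Cot g z.1.base) (coordVec e z.1.base m) : ℝ))

/-- The branch near `z₀` of the `j`-th dual coordinate `w^j` that has the value prescribed by the
lift `w₀` at `z₀`. -/
def branch {z₀ : ZS S} (e : OpenPartialHomeomorph B (Model g)) (w₀ : WLift z₀) (j : Fin g)
    (z : ZS S) : ℂ :=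
  (toIcoMod (zero_lt_one' ℝ) (w₀.coord e j - 1 / 2)
    (dcoord e z.1.base j (Quotient.out z.1.dual : Tan g z.1.base)) : ℝ)

/-- The connection form `2πi ∑ w^j dy_j` of the Poincaré bundle in the gauge given by a lift;
`2πi dy_j` is written as the logarithmic differential of `exp (2πi y_j)`. -/
def connForm (z : ZS S) (w : WLift z) (θ : Der z) : SGerm z :=
  ∑ j, germ z (branch (L.chart z.1.base) w j) *
    (germ z (character (L.chart z.1.base) (-Pi.single j 1)) *
      θ (germ z (character (L.chart z.1.base) (Pi.single j 1))))

/-- The curvature of the Poincaré bundle, on two vector fields on `Z_S`. -/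
def curvature (z : ZS S) (w : WLift z) (θ θ' : Der z) : SGerm z :=
  θ (connForm z w θ') - θ' (connForm z w θ) - connForm z w ⁅θ, θ'⁆

/-! ### Sheaves of modules with a flat connection -/

/-- A sheaf of modules over the smooth functions of a smooth space, with a flat connection.  The
sheaf is given by its stalks and by the families of germs that are sections near a point
(its étalé space); the connection is given by the covariant derivatives of germs. -/
structure FlatModule (Y : Type*) [SmoothSpace Y] where
  stalk : Y → Type u
  [addCommGroup : ∀ y, AddCommGroup (stalk y)]
  [module : ∀ y, Module (SGerm y) (stalk y)]
  IsSectionNear : (∀ y, stalk y) → Y → Prop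
  congr : ∀ s t y, IsSectionNear s y → (∀ᶠ y' in 𝓝 y, s y' = t y') → IsSectionNear t y
  eventually : ∀ s y, IsSectionNear s y → ∀ᶠ y' in 𝓝 y, IsSectionNear s y'
  exists_section : ∀ y (e : stalk y), ∃ s, IsSectionNear s y ∧ s y = e
  eq_near : ∀ s t y, IsSectionNear s y → IsSectionNear t y → s y = t y →
    ∀ᶠ y' in 𝓝 y, s y' = t y'
  add : ∀ s t y, IsSectionNear s y → IsSectionNear t y → IsSectionNear (s + t) y
  smul : ∀ φ s y, φ ∈ smoothNear y → IsSectionNear s y →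
    IsSectionNear (fun y' => germ y' φ • s y') y
  conn : ∀ y, Der y → stalk y → stalk y
  conn_add_left : ∀ y v v' e, conn y (v + v') e = conn y v e + conn y v' e
  conn_smul_left : ∀ y (r : SGerm y) v e, conn y (r • v) e = r • conn y v e
  conn_add : ∀ y v e e', conn y v (e + e') = conn y v e + conn y v e'
  conn_leibniz : ∀ y v (r : SGerm y) e, conn y v (r • e) = r • conn y v e + v r • e
  flat : ∀ y v v' e, conn y ⁅v, v'⁆ e = conn y v (conn y v' e) - conn y v' (conn y v e)
  conn_section : ∀ v s y, IsVectorFieldNear v y → IsSectionNear s y →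
    IsSectionNear (fun y' => conn y' (v y') (s y')) y

attribute [instance] FlatModule.addCommGroup FlatModule.module

/-! ### The coupled connection -/

variable (E : FlatModule S)

/-- The stalk of the pull-back of `E` to `Z_S`. -/
abbrev PullStalk (z : ZS S) : Type _ := SGerm z ⊗[SGerm (pS z)] E.stalk (pS z)

/-- Families of elements of the stalk of the pull-back of `E`, one for each gauge of the Poincaré
bundle at `z`; those that satisfy `IsAutomorphic` form the stalk of the tensor product of the
pull-back of `E` with the Poincaré bundle. -/
abbrev TwStalk (z : ZS S) : Type _ := WLift z → PullStalk E z

variable {E}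

/-- The change of gauge of the Poincaré bundle: translating the lift by `μ` in the dual lattice
multiplies by `exp (-2πi ∑ μ^j y_j)`. -/
def IsAutomorphic {z : ZS S} (m : TwStalk E z) : Prop :=
  ∀ w w' : WLift z, m w' = germ z (character (L.chart z.1.base)
    (fun j => w.coord (L.chart z.1.base) j - w'.coord (L.chart z.1.base) j)) • m w

/-- The image of `θ` in the pull-back of the tangent sheaf of `S`, as `∑ aᵢ ⊗ vᵢ`. -/
structure DerRep {z : ZS S} (θ : Der z) where
  n : ℕ
  coeff : Fin n → SGerm z
  field : Fin n → Der (pS z)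
  spec : ∀ r, θ (algebraMap (SGerm (pS z)) (SGerm z) r) =
    ∑ i, coeff i * algebraMap (SGerm (pS z)) (SGerm z) (field i r)

/-- The pull-back of the connection of `E`:
`a ⊗ e ↦ θ a ⊗ e + a • ∑ aᵢ ⊗ ∇_{vᵢ} e` if the image of `θ` is `∑ aᵢ ⊗ vᵢ`. -/
def pullConnAux {z : ZS S} (θ : Der z) (R : DerRep θ) : PullStalk E z →+ PullStalk E z :=
  TensorProduct.liftAddHom
    (AddMonoidHom.mk' (fun a => AddMonoidHom.mk'
      (fun e => θ a ⊗ₜ e + ∑ i, (a * R.coeff i) ⊗ₜ E.conn _ (R.field i) e)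
      (by
        intro e e'
        simp only [E.conn_add, TensorProduct.tmul_add, Finset.sum_add_distrib]
        abel))
      (by
        intro a a'
        ext e
        simp only [map_add, add_mul, TensorProduct.add_tmul, Finset.sum_add_distrib,
          AddMonoidHom.mk'_apply, AddMonoidHom.add_apply]
        abel))
    (by
      intro r a e
      have h1 : θ (r • a) = r • θ a + ∑ i, R.field i r • (a * R.coeff i) := by
        simp only [Algebra.smul_def, Derivation.leibniz, R.spec, Finset.mul_sum]
        congr 1
        exact Finset.sum_congr rfl fun i _ => by
          rw [Algebra.algebraMap_self, RingHom.id_apply]; ring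
      simp only [AddMonoidHom.mk'_apply, E.conn_leibniz, TensorProduct.tmul_add,
        Finset.sum_add_distrib, ← TensorProduct.smul_tmul, h1, TensorProduct.add_tmul,
        TensorProduct.sum_tmul, smul_mul_assoc]
      abel)

variable (E) in
/-- The pull-back of the connection of `E` along the projection of `Z_S` to `S`.  (On the smooth
manifolds considered, a representation of `θ` exists, and the result does not depend on it.) -/
def pullConn {z : ZS S} (θ : Der z) : PullStalk E z →+ PullStalk E z :=
  open Classical in
  if h : Nonempty (DerRep θ) then pullConnAux θ h.some else 0

/-- The coupled connection: the pull-back of the connection of `E`, coupled with the connection of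
the Poincaré bundle. -/
def cov {z : ZS S} (θ : Der z) : TwStalk E z →+ TwStalk E z :=
  AddMonoidHom.mk' (fun m w => pullConn E θ (m w) + connForm z w θ • m w) (by
    intro m m'
    funext w
    simp only [Pi.add_apply, map_add, smul_add]
    abel)

lemma pullConn_smul {z : ZS S} (θ : Der z) (a : SGerm z) (ha : θ a = 0) (m : PullStalk E z) :
    pullConn E θ (a • m) = a • pullConn E θ m := by
  unfold pullConn
  split_ifs with h
  · induction m using TensorProduct.induction_on with
    | zero => simp
    | add m m' h1 h2 => rw [smul_add, map_add, map_add, h1, h2, smul_add]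
    | tmul b e =>
      simp only [pullConnAux, TensorProduct.smul_tmul', TensorProduct.liftAddHom_tmul,
        AddMonoidHom.mk'_apply, smul_add, Finset.smul_sum, smul_eq_mul, Derivation.leibniz, ha,
        mul_zero, add_zero, mul_assoc]
  · simp

lemma cov_smul {z : ZS S} (θ : Der z) (a : SGerm z) (ha : θ a = 0) (m : TwStalk E z) :
    cov θ (a • m) = a • cov θ m := by
  funext w
  simp only [cov, AddMonoidHom.mk'_apply, Pi.smul_apply, pullConn_smul θ a ha, smul_add]
  rw [smul_comm]

/-! ### The complex of relative forms -/

variable (E) in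
/-- Relative `q`-cochains at `z`; those that are alternating and multilinear are the germs of
relative `q`-forms. -/
abbrev Coch (q : ℕ) (z : ZS S) : Type _ := (Fin q → vertical z) → TwStalk E z

/-- The relative part of the coupled connection on relative `q`-forms (Koszul formula). -/
def dRel {q : ℕ} {z : ZS S} (τ : Coch E q z) : Coch E (q + 1) z := fun u =>
  ∑ i : Fin (q + 1), (-1 : ℤ) ^ (i : ℕ) •
    (cov (u i : Der z) (τ (u ∘ i.succAbove)) +
      ∑ k : Fin q, if k.castSucc < i then
        τ (Function.update (u ∘ i.succAbove) k (vbracket (u k.castSucc) (u i))) else 0)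

/-- The complementary part of the coupled connection on relative `q`-forms, in the direction `v`,
for a given splitting. -/
def nablaHat (h : Splitting S) {q : ℕ} {z : ZS S} (v : Der (phatS z)) (τ : Coch E q z) :
    Coch E q z := fun u =>
  cov (h.lift z v) (τ u) - ∑ k : Fin q, τ (Function.update u k (h.hbracket v (u k)))

/-- A family of elements of the stalks of the tensor product of the pull-back of `E` with the
Poincaré bundle is, near `z₀`, a section: in every gauge at `z₀` it is a finite sum of products of
smooth functions and sections of `E`. -/
def IsTwSectionNear (c : ∀ z : ZS S, TwStalk E z) (z₀ : ZS S) : Prop :=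
  ∀ w₀ : WLift z₀, ∃ (n : ℕ) (a : Fin n → ZS S → ℂ) (s : Fin n → ∀ p, E.stalk p),
    (∀ i, a i ∈ smoothNear z₀) ∧ (∀ i, E.IsSectionNear (s i) (pS z₀)) ∧
    ∀ᶠ z in 𝓝 z₀, ∀ w : WLift z,
      (∀ j, |w.coord (L.chart z₀.1.base) j - w₀.coord (L.chart z₀.1.base) j| < 1 / 2) →
      c z w = ∑ i, germ z (a i) ⊗ₜ s i (pS z)

/-- A family of cochains is, at `z₀`, a smooth relative `q`-form with values in the tensor product
of the pull-back of `E` with the Poincaré bundle. -/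
def IsFormAt {q : ℕ} (T : ∀ z : ZS S, Coch E q z) (z₀ : ZS S) : Prop :=
  (∃ α : AlternatingMap (SGerm z₀) (vertical z₀) (TwStalk E z₀) (Fin q), ⇑α = T z₀) ∧
  (∀ u, IsAutomorphic (T z₀ u)) ∧
  ∀ u : Fin q → ∀ z : ZS S, vertical z,
    (∀ k, IsVectorFieldNear (fun z => (u k z : Der z)) z₀) →
    IsTwSectionNear (fun z => T z fun k => u k z) z₀

/-- A family of cochains is a section over the preimage of `U ⊆ XhatS S`. -/
def IsFormOn {q : ℕ} (T : ∀ z : ZS S, Coch E q z) (U : Set (XhatS S)) : Prop :=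
  ∀ z, phatS z ∈ U → IsFormAt T z

/-- The fibre of the projection `phatS` over `ξ`. -/
abbrev Fib (ξ : XhatS S) : Type _ := {z : ZS S // phatS z = ξ}

variable (E) in
/-- Families of cochains along the fibre over `ξ`. -/
def FibCoch (q : ℕ) (ξ : XhatS S) : Type _ := ∀ z : Fib ξ, Coch E q z.1

instance (q : ℕ) (ξ : XhatS S) : AddCommGroup (FibCoch E q ξ) :=
  inferInstanceAs (AddCommGroup (∀ z : Fib ξ, Coch E q z.1))

instance (q : ℕ) (ξ : XhatS S) : Module (SGerm ξ) (FibCoch E q ξ) where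
  smul r τ := fun z => pullHat z.1 ξ z.2 r • τ z
  one_smul τ := by
    funext z
    change pullHat z.1 ξ z.2 1 • τ z = τ z
    rw [map_one, one_smul]
  mul_smul r r' τ := by
    funext z
    change pullHat z.1 ξ z.2 (r * r') • τ z = pullHat z.1 ξ z.2 r • pullHat z.1 ξ z.2 r' • τ z
    rw [map_mul, mul_smul]
  smul_zero r := by
    funext z
    change pullHat z.1 ξ z.2 r • (0 : Coch E q z.1) = 0
    rw [smul_zero]
  smul_add r τ τ' := by
    funext z
    change pullHat z.1 ξ z.2 r • (τ z + τ' z) =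
      pullHat z.1 ξ z.2 r • τ z + pullHat z.1 ξ z.2 r • τ' z
    rw [smul_add]
  add_smul r r' τ := by
    funext z
    change pullHat z.1 ξ z.2 (r + r') • τ z =
      pullHat z.1 ξ z.2 r • τ z + pullHat z.1 ξ z.2 r' • τ z
    rw [map_add, add_smul]
  zero_smul τ := by
    funext z
    change pullHat z.1 ξ z.2 0 • τ z = 0
    rw [map_zero, zero_smul]

/-- The relative part of the coupled connection along a fibre. -/
def dFib (q : ℕ) (ξ : XhatS S) : FibCoch E q ξ →ₗ[SGerm ξ] FibCoch E (q + 1) ξ where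
  toFun τ := fun z => dRel (τ z)
  map_add' τ τ' := by
    funext z u
    change dRel (τ z + τ' z) u = dRel (τ z) u + dRel (τ' z) u
    simp only [dRel, Pi.add_apply, map_add, ← Finset.sum_add_distrib, ← smul_add]
    refine Finset.sum_congr rfl fun i _ => ?_
    congr 1
    have : ∀ k : Fin q, (if k.castSucc < i then
        τ z (Function.update (u ∘ i.succAbove) k (vbracket (u k.castSucc) (u i))) +
        τ' z (Function.update (u ∘ i.succAbove) k (vbracket (u k.castSucc) (u i))) else 0) =
        (if k.castSucc < i then
          τ z (Function.update (u ∘ i.succAbove) k (vbracket (u k.castSucc) (u i))) else 0) +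
        (if k.castSucc < i then
          τ' z (Function.update (u ∘ i.succAbove) k (vbracket (u k.castSucc) (u i))) else 0) := by
      intro k
      split_ifs <;> simp
    simp only [this, Finset.sum_add_distrib]
    abel
  map_smul' r τ := by
    funext z u
    change dRel (pullHat z.1 ξ z.2 r • τ z) u = pullHat z.1 ξ z.2 r • dRel (τ z) u
    obtain ⟨z, rfl⟩ := z
    simp only [dRel, Pi.smul_apply, Finset.smul_sum]
    refine Finset.sum_congr rfl fun i _ => ?_
    rw [smul_comm]
    congr 1
    rw [cov_smul _ _ ((u i).2 r), smul_add, Finset.smul_sum]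
    congr 1
    refine Finset.sum_congr rfl fun k _ => ?_
    split_ifs <;> simp

/-- Restriction of a family of cochains to a fibre. -/
def toFib {q : ℕ} (T : ∀ z : ZS S, Coch E q z) (ξ : XhatS S) : FibCoch E q ξ := fun z => T z.1

lemma IsTwSectionNear.add {c c' : ∀ z : ZS S, TwStalk E z} {z₀ : ZS S}
    (h : IsTwSectionNear c z₀) (h' : IsTwSectionNear c' z₀) :
    IsTwSectionNear (fun z => c z + c' z) z₀ := by
  intro w₀
  obtain ⟨n, a, s, ha, hs, e⟩ := h w₀
  obtain ⟨n', a', s', ha', hs', e'⟩ := h' w₀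
  refine ⟨n + n', Fin.append a a', Fin.append s s', ?_, ?_, ?_⟩
  · intro i
    refine Fin.addCases (fun i => ?_) (fun i => ?_) i
    · simpa using ha i
    · simpa using ha' i
  · intro i
    refine Fin.addCases (fun i => ?_) (fun i => ?_) i
    · simpa using hs i
    · simpa using hs' i
  · filter_upwards [e, e'] with z hz hz' w hw
    rw [Pi.add_apply, hz w hw, hz' w hw, Fin.sum_univ_add]
    simp

/-- The stalk at `ξ` of the direct image of the sheaf of relative `q`-forms with values in the
tensor product of the pull-back of `E` with the Poincaré bundle.  (A section over the preimage of a
neighbourhood of `ξ` is recorded through its germs at the points of the fibre over `ξ`, which is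
compact.) -/
def formStalk (q : ℕ) (ξ : XhatS S) : Submodule (SGerm ξ) (FibCoch E q ξ) where
  carrier := {τ | ∃ U : Set (XhatS S), IsOpen U ∧ ξ ∈ U ∧
    ∃ T : ∀ z : ZS S, Coch E q z, IsFormOn T U ∧ toFib T ξ = τ}
  zero_mem' := by
    refine ⟨Set.univ, isOpen_univ, trivial, fun _ => 0, fun z _ => ⟨⟨0, rfl⟩, ?_, ?_⟩, rfl⟩
    · intro u w w'
      simp
    · intro u _ w₀
      exact ⟨0, Fin.elim0, Fin.elim0, fun i => i.elim0, fun i => i.elim0,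
        Filter.Eventually.of_forall fun z w _ => by simp⟩
  add_mem' := by
    rintro _ _ ⟨U, hU, hξ, T, hT, rfl⟩ ⟨U', hU', hξ', T', hT', rfl⟩
    refine ⟨U ∩ U', hU.inter hU', ⟨hξ, hξ'⟩, fun z => T z + T' z, fun z hz => ?_, rfl⟩
    obtain ⟨⟨α, hα⟩, h1, h2⟩ := hT z hz.1
    obtain ⟨⟨α', hα'⟩, h1', h2'⟩ := hT' z hz.2
    refine ⟨⟨α + α', ?_⟩, ?_, ?_⟩
    · change _ = T z + T' z
      rw [← hα, ← hα']
      rfl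
    · intro u w w'
      change T z u w' + T' z u w' = _ • (T z u w + T' z u w)
      rw [h1 u w w', h1' u w w', smul_add]
    · intro u hu
      exact (h2 u hu).add (h2' u hu)
  smul_mem' := by
    rintro r _ ⟨U, hU, hξ, T, hT, rfl⟩
    obtain ⟨⟨φ, hφ⟩, rfl⟩ := Ideal.Quotient.mk_surjective (I := vanishingNear ξ) r
    obtain ⟨V, hV, hVo, hξV⟩ := eventually_nhds_iff.1 (SmoothSpace.eventually_mem ξ φ hφ)
    refine ⟨U ∩ V, hU.inter hVo, ⟨hξ, hξV⟩, fun z => germ z (φ ∘ phatS) • T z,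
      fun z hz => ?_, ?_⟩
    · have hφz : φ ∘ phatS ∈ smoothNear z := isSmoothMap_phatS.comp_mem z φ (hV _ hz.2)
      obtain ⟨⟨α, hα⟩, h1, h2⟩ := hT z hz.1
      refine ⟨⟨germ z (φ ∘ phatS) • α, ?_⟩, ?_, ?_⟩
      · change _ = germ z (φ ∘ phatS) • T z
        rw [← hα]
        rfl
      · intro u w w'
        simp only [Pi.smul_apply]
        rw [h1 u w w', smul_comm]
      · intro u hu w₀
        obtain ⟨n, a, s, ha, hs, e⟩ := h2 u hu w₀
        refine ⟨n, fun i => (φ ∘ phatS) * a i, s, fun i => mul_mem hφz (ha i), hs, ?_⟩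
        have ha' : ∀ᶠ z' in 𝓝 z, ∀ i, a i ∈ smoothNear z' :=
          Filter.eventually_all.2 fun i => SmoothSpace.eventually_mem z _ (ha i)
        filter_upwards [e, ha', SmoothSpace.eventually_mem z _ hφz] with z' h3 h4 h5 w hw
        simp only [Pi.smul_apply]
        rw [h3 w hw, Finset.smul_sum]
        refine Finset.sum_congr rfl fun i _ => ?_
        rw [germ_mul h5 (h4 i), TensorProduct.smul_tmul', smul_eq_mul]
    · funext z
      change germ z.1 (φ ∘ phatS) • T z.1 = pullHat z.1 ξ z.2 _ • T z.1
      congr 1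
      have hφz : φ ∘ phatS ∈ smoothNear z.1 :=
        isSmoothMap_phatS.comp_mem z.1 φ (by rw [z.2]; exact hφ)
      rw [germ_of_mem hφz]
      rfl

variable (E) in
/-- The stalk of the kernel of the relative part of the coupled connection. -/
def cocycles (q : ℕ) (ξ : XhatS S) : Submodule (SGerm ξ) (FibCoch E q ξ) :=
  formStalk q ξ ⊓ LinearMap.ker (dFib q ξ)

variable (E) in
/-- The stalk of the image of the relative part of the coupled connection. -/
def coboundaries : ∀ (q : ℕ) (ξ : XhatS S), Submodule (SGerm ξ) (FibCoch E q ξ)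
  | 0, _ => ⊥
  | q + 1, ξ => (formStalk q ξ).map (dFib q ξ)

variable (E) in
/-- The stalk at `ξ` of the `j`-th higher direct image under `phatS` of the kernel of the relative
part of the coupled connection, i.e. of the `j`-th cohomology sheaf of the direct image of the
complex of relative forms. -/
abbrev RStalk (j : ℕ) (ξ : XhatS S) : Type _ :=
  cocycles E j ξ ⧸ (coboundaries E j ξ).submoduleOf (cocycles E j ξ)

/-- A family of cochains is a closed relative form over the preimage of `U`. -/
def IsClosedOn {q : ℕ} (T : ∀ z : ZS S, Coch E q z) (U : Set (XhatS S)) : Prop :=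
  IsFormOn T U ∧ ∀ z, phatS z ∈ U → dRel (T z) = 0

/-- The germ at `ξ` of the section of the higher direct image given by a closed form. -/
def IsClosedOn.cls {j : ℕ} {T : ∀ z : ZS S, Coch E j z} {U : Set (XhatS S)} (hT : IsClosedOn T U)
    (hU : IsOpen U) (ξ : XhatS S) (hξ : ξ ∈ U) : RStalk E j ξ :=
  Submodule.Quotient.mk ⟨toFib T ξ, ⟨U, hU, hξ, T, hT.1, rfl⟩, by
    funext z
    exact hT.2 z.1 (by rw [z.2]; exact hξ)⟩

/-! ### Connections on the higher direct image -/

variable {Shat : Set (XhatS S)}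

/-- The part of `Z_S` over `Shat`, i.e. the fibre product of `S` and `Shat` over `B`. -/
def ZSS (Shat : Set (XhatS S)) : Set (ZS S) := {z | phatS z ∈ Shat}

/-- Germs at a point of the fibre product of `S` and `Shat` of functions on `Z_S` that vanish on
this fibre product. -/
def vanishingIdeal (z : ZSS Shat) : Ideal (SGerm (z : ZS S)) :=
  RingHom.ker (restrictGerm z)

variable (Shat) in
/-- The curvature of the Poincaré bundle vanishes on the fibre product of `S` and `Shat` over `B`.
Only the component of the curvature with one argument tangent to the fibres of `phatS` is required
to vanish (this component is the anticommutator of the relative part of the coupled connection and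
its complementary part). -/
def CurvatureVanishes : Prop :=
  ∀ (z : ZSS Shat) (w : WLift z.1) (θ : Der z.1),
    (∀ a ∈ vanishingIdeal z, θ a ∈ vanishingIdeal z) →
    ∀ u ∈ vertical z.1, curvature z.1 w θ u ∈ vanishingIdeal z

variable (E Shat) in
/-- A connection, along the submanifold `Shat`, on the `j`-th higher direct image `R`: a morphism
of sheaves from `R` to `R ⊗ Ω¹` (`Ω¹` the differentials of `Shat`, the tensor product being over the
smooth functions on `XhatS S`) that satisfies the Leibniz rule.  It is given by the covariant
derivatives `∇_v : R → R ⊗ C^∞` for the vector fields `v` on `Shat`. -/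
structure Connection (j : ℕ) where
  toFun : ∀ ξ : Shat, Der ξ → RStalk E j ξ.1 → SGerm ξ ⊗[SGerm ξ.1] RStalk E j ξ.1
  add_left : ∀ ξ v v' s, toFun ξ (v + v') s = toFun ξ v s + toFun ξ v' s
  smul_left : ∀ ξ (r : SGerm ξ) v s, toFun ξ (r • v) s = r • toFun ξ v s
  add : ∀ ξ v s s', toFun ξ v (s + s') = toFun ξ v s + toFun ξ v s'
  leibniz : ∀ (ξ : Shat) (v : Der ξ) (r : SGerm ξ.1) (s : RStalk E j ξ.1), toFun ξ v (r • s) =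
    r • toFun ξ v s + v (restrictGerm ξ r) ⊗ₜ s
  smooth : ∀ (ξ₀ : Shat) (v : ∀ ξ : Shat, Der ξ), IsVectorFieldNear v ξ₀ →
    ∀ (T : ∀ z : ZS S, Coch E j z) (U : Set (XhatS S)) (hT : IsClosedOn T U) (hU : IsOpen U),
      ξ₀.1 ∈ U → ∃ (U' : Set (XhatS S)) (hU' : IsOpen U') (hs : U' ⊆ U)
        (T' : ∀ z : ZS S, Coch E j z) (hT' : IsClosedOn T' U'), ξ₀.1 ∈ U' ∧
        ∀ (ξ : Shat) (hξ : ξ.1 ∈ U'),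
          toFun ξ (v ξ) (hT.cls hU ξ.1 (hs hξ)) = 1 ⊗ₜ hT'.cls hU' ξ.1 hξ

/-- The connection `D` is induced by the complementary part of the coupled connection: if the
vector field `v` on `XhatS S` restricts to the vector field `v'` on `Shat`, and `T` is a closed
relative form, then locally `D_{v'} [T]` is the class of a closed relative form that coincides with
the complementary derivative of `T` along `v` on the fibre product of `S` and `Shat`. -/
def Connection.IsInducedBy {j : ℕ} (D : Connection E Shat j) (h : Splitting S) : Prop :=
  ∀ (ξ₀ : Shat) (v : ∀ ξ : XhatS S, Der ξ) (v' : ∀ ξ : Shat, Der ξ),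
    IsVectorFieldNear v ξ₀.1 → IsVectorFieldNear v' ξ₀ →
    (∀ᶠ ξ : Shat in 𝓝 ξ₀, ∀ r : SGerm ξ.1,
      v' ξ (restrictGerm ξ r) = restrictGerm ξ (v ξ.1 r)) →
    ∀ (T : ∀ z : ZS S, Coch E j z) (U : Set (XhatS S)) (hT : IsClosedOn T U) (hU : IsOpen U),
      ξ₀.1 ∈ U → ∃ (U' : Set (XhatS S)) (hU' : IsOpen U') (hs : U' ⊆ U)
        (T' : ∀ z : ZS S, Coch E j z) (hT' : IsClosedOn T' U'), ξ₀.1 ∈ U' ∧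
        (∀ z : ZSS Shat, phatS z.1 ∈ U' → ∀ u w,
          nablaHat h (v (phatS z.1)) (T z.1) u w - T' z.1 u w ∈
            vanishingIdeal z • (⊤ : Submodule (SGerm z.1) (PullStalk E z.1))) ∧
        ∀ (ξ : Shat) (hξ : ξ.1 ∈ U'),
          D.toFun ξ (v' ξ) (hT.cls hU ξ.1 (hs hξ)) = 1 ⊗ₜ hT'.cls hU' ξ.1 hξ

end Setting

end FourierMukai

end

/-! The obstruction to letting the complementary derivative act on relative cohomology is its
commutator with the relative one, that is, the curvature of the Poincaré bundle with one argument
along the fibres of `phatS`. For a vector field `V` on `XhatS S`, contracting the curvature with the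
lift of `V` and restricting to the fibres gives the form `2πi ∑ V(w^j) dy_j` (`curvature_eq`). If a
function `m` has this form as its fibrewise differential, then the derivative along `V` plus
multiplication by `m` commutes with the relative connection (`dRel_hatOp`). It therefore acts on the
stalks of the higher direct image at all points near the given one, not only at those of `Shat`. If
`m` vanishes over `Shat`, the correction is invisible there.

Such an `m` exists once `V` is well chosen. Near a point of `Shat` the coordinate fields of `Shat`
are extended to fields for which the functions `C_j = V(w^j)` are invariant under a retraction to
`Shat` (`exists_adapted_field`, `exists_baseData`). Vanishing of the curvature says that `∑ C_j y_j`
is locally constant along the fibres over `Shat` (`BaseData.sum_sub_eq_zero`). Hence `m(q) = 2πi ∑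
C_j (y_j(q) - y_j(q'))`, with `q'` any point near `q` over the retraction of `phatS q`, depends
neither on `q'` nor on the branch of `y`. The local functions have the same germs, glue along the
compact fibre (`exists_glue`, `BaseData.exists_isPrimitive`) and serve over a neighbourhood by the
tube lemma (`exists_localData`).

The connection is then `D_v s = ∑ f_k v(s_k) ⊗ (∇̂_{V_k} + m_k) s`, with a partition of unity `f_k`
along `Shat` and local frames `V_k` with dual coordinates `s_k` (`GlobalData.connection`). Its
Leibniz rule expresses that `v = ∑ f_k v(s_k) V_k` along `Shat`. The form representing `D_v [τ]`
differs from `∇̂_v τ` by the derivative along a field that vanishes on `Shat` and by multiples of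
the `m_k`, and both vanish over `Shat` (`GlobalData.isInducedBy`).

All of this needs that a vector field, here a derivation of the stalk into itself, is determined by
its values on coordinates. Hadamard's lemma alone only shows that a derivation killing the
coordinates has values that are flat at the base point. `IsGermDerivation.eventuallyEq_zero` proves
that they vanish. Were `D f` nonzero at points accumulating at `p`, gluing functions on small
disjoint balls around such points would turn `D` into a derivation of sequences of functions,
nonzero on some bounded sequence of numbers. For every smooth function of one variable a Baire
category argument produces sequences on which the chain rule holds (`exists_obeysChainRule`). A
recursive choice of spikes produces a function for which it fails on all of them
(`exists_not_obeysChainRule`). -/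

noncomputable section

namespace FourierMukai

open Filter Metric

/-! ### Hadamard's lemma -/

section Hadamard

variable {E : Type*} [NormedAddCommGroup E] [NormedSpace ℝ E]

/-- Integrals over the unit interval depend smoothly on parameters. -/
lemma contDiff_integral_unitInterval {P F : Type*} [NormedAddCommGroup P] [NormedSpace ℝ P]
    [NormedAddCommGroup F] [NormedSpace ℝ F]
    {g : P → ℝ → F} (hg : ContDiff ℝ ∞ (fun x : P × ℝ => g x.1 x.2)) :
    ContDiff ℝ ∞ (fun p => ∫ t in (0 : ℝ)..1, g p t) := by
  -- The integral is the value at `0` of the convolution of the indicator of `(0, 1]` with a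
  -- compactly supported function. The bump is `1` on `[-1, 1]`, so the cut-off does not change the
  -- integral.
  let β : ContDiffBump (0 : ℝ) := ⟨1, 2, by norm_num, by norm_num⟩
  let G : P → ℝ → F := fun p x => β x • g p (-x)
  have hG : ContDiff ℝ ∞ (fun x : P × ℝ => G x.1 x.2) := by
    have h1 : ContDiff ℝ ∞ (fun x : P × ℝ => g x.1 (-x.2)) :=
      hg.comp (contDiff_fst.prodMk contDiff_snd.neg)
    exact (β.contDiff.comp contDiff_snd).smul h1
  have hsupp : ∀ p x, p ∈ (Set.univ : Set P) → x ∉ closedBall (0 : ℝ) 2 → G p x = 0 := by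
    intro p x _ hx
    have : β x = 0 := β.zero_of_le_dist (by
      simp only [mem_closedBall, not_le] at hx
      exact hx.le)
    simp [G, this]
  have hloc : MeasureTheory.LocallyIntegrable
      (Set.indicator (Set.Ioc (0 : ℝ) 1) (fun _ => (1 : ℝ))) MeasureTheory.volume := by
    refine MeasureTheory.Integrable.locallyIntegrable ?_
    rw [MeasureTheory.integrable_indicator_iff measurableSet_Ioc]
    exact MeasureTheory.integrableOn_const (by simp)
  have key := MeasureTheory.contDiffOn_convolution_right_with_param (𝕜 := ℝ) (n := ⊤)
    (ContinuousLinearMap.lsmul ℝ ℝ : ℝ →L[ℝ] F →L[ℝ] F) isOpen_univ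
    (isCompact_closedBall (0 : ℝ) 2) hsupp hloc hG.contDiffOn
  rw [Set.univ_prod_univ, contDiffOn_univ] at key
  have h2 := key.comp (contDiff_id.prodMk contDiff_const : ContDiff ℝ ∞ (fun p : P => (p, (0 : ℝ))))
  convert h2 using 1
  funext p
  simp only [Function.comp, MeasureTheory.convolution, ContinuousLinearMap.lsmul_apply, id]
  rw [intervalIntegral.integral_of_le zero_le_one, ← MeasureTheory.integral_indicator
    measurableSet_Ioc]
  congr 1
  funext t
  by_cases ht : t ∈ Set.Ioc (0 : ℝ) 1
  · have hb : β (-t) = 1 := β.one_of_mem_closedBall (by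
      simp only [mem_closedBall, dist_zero_right, Real.norm_eq_abs, abs_neg]
      exact abs_le.2 ⟨by linarith [ht.1], ht.2⟩)
    simp [G, ht, hb]
  · simp [ht]

/-- Hadamard's lemma, with smooth dependence on the base point. -/
lemma exists_hadamard {F : Type*} [NormedAddCommGroup F] [NormedSpace ℝ F] [CompleteSpace F]
    {f : E → F} (hf : ContDiff ℝ ∞ f) :
    ∃ Γ : E × E → (E →L[ℝ] F), ContDiff ℝ ∞ Γ ∧ (∀ q x, f x = f q + Γ (q, x) (x - q)) ∧
      ∀ q, Γ (q, q) = fderiv ℝ f q := by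
  have hf' : ContDiff ℝ ∞ (fderiv ℝ f) := hf.fderiv_right (by simp)
  refine ⟨fun x => ∫ t in (0 : ℝ)..1, fderiv ℝ f (x.1 + t • (x.2 - x.1)), ?_, ?_, ?_⟩
  · refine contDiff_integral_unitInterval (g := fun (x : E × E) t => fderiv ℝ f (x.1 + t • (x.2 - x.1))) ?_
    exact hf'.comp (by fun_prop)
  · intro q x
    have hd : ∀ t : ℝ, HasDerivAt (fun t : ℝ => f (q + t • (x - q)))
        (fderiv ℝ f (q + t • (x - q)) (x - q)) t := by
      intro t
      have h1 : HasDerivAt (fun t : ℝ => q + t • (x - q)) (x - q) t := by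
        simpa using ((hasDerivAt_id t).smul_const (x - q)).const_add q
      exact ((hf.differentiable (by simp)).differentiableAt.hasFDerivAt).comp_hasDerivAt t h1
    have hc : Continuous (fun t : ℝ => fderiv ℝ f (q + t • (x - q))) :=
      hf'.continuous.comp (by fun_prop)
    have h3 := intervalIntegral.integral_eq_sub_of_hasDerivAt (a := 0) (b := 1) (fun t _ => hd t)
      ((hc.clm_apply continuous_const).intervalIntegrable _ _)
    rw [ContinuousLinearMap.intervalIntegral_apply (hc.intervalIntegrable _ _), h3]
    simp
  · intro q
    simp

end Hadamard

/-! ### Smooth series of rescaled functions -/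

section Series

variable {E : Type*} [NormedAddCommGroup E] [NormedSpace ℝ E]

/-- Each derivative costs one factor `|c|`; with `c` the inverse of a radius, this is the loss that
the weights in the series below have to absorb. -/
lemma norm_iteratedFDeriv_rescale_le {H : E → ℂ} (hH : ContDiff ℝ ∞ H) (q : E) (c : ℝ) (j : ℕ)
    (x : E) :
    ‖iteratedFDeriv ℝ j (fun x => H (c • (x - q))) x‖ ≤
      |c| ^ j * ‖iteratedFDeriv ℝ j H (c • (x - q))‖ := by
  have h1 : (fun x => H (c • (x - q))) =
      fun x => (H ∘ (c • ContinuousLinearMap.id ℝ E)) (x - q) := by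
    funext x; simp
  rw [h1, iteratedFDeriv_comp_sub, ContinuousLinearMap.iteratedFDeriv_comp_right _ hH _
    (by exact_mod_cast le_top)]
  refine (ContinuousMultilinearMap.norm_compContinuousLinearMap_le _ _).trans ?_
  simp only [Finset.prod_const, Finset.card_univ, Fintype.card_fin]
  rw [mul_comm]
  refine mul_le_mul ?_ (le_of_eq (by simp)) (norm_nonneg _) (by positivity)
  refine pow_le_pow_left₀ (norm_nonneg _) ?_ _
  rw [norm_smul, Real.norm_eq_abs]
  exact mul_le_of_le_one_right (abs_nonneg _) ContinuousLinearMap.norm_id_le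

/-- A series of rescaled smooth functions with rapidly decreasing weights is smooth. -/
lemma contDiff_tsum_rescale {q : ℕ → E} {r : ℕ → ℝ} (hr : ∀ k, 0 < r k) (hr1 : ∀ k, r k ≤ 1)
    {a : ℕ → ℂ} {C : ℝ} (ha : ∀ k, ‖a k‖ ≤ C * ((1 / 2) ^ k * r k ^ k)) {H : ℕ → E → ℂ}
    (hH : ∀ k, ContDiff ℝ ∞ (H k))
    (hb : ∀ j : ℕ, ∃ M : ℝ, ∀ᶠ k in atTop, ∀ x, ‖iteratedFDeriv ℝ j (H k) x‖ ≤ M) :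
    ContDiff ℝ ∞ (fun x => ∑' k, a k * H k ((r k)⁻¹ • (x - q k))) := by
  choose M hM using hb
  have hsm : ∀ k, ContDiff ℝ ∞ (fun x => H k ((r k)⁻¹ • (x - q k))) := fun k =>
    (hH k).comp (by fun_prop)
  refine contDiff_tsum_of_eventually (N := ⊤) (v := fun j k => C * (1 / 2) ^ k * M j)
    (fun k => contDiff_const.mul (hsm k)) ?_ ?_
  · intro j _
    exact ((summable_geometric_of_lt_one (by norm_num) (by norm_num)).mul_left C).mul_right _
  · intro j _
    rw [Nat.cofinite_eq_atTop]
    -- For the `j`-th derivative only the terms with `k ≥ j` are estimated: there `r k ^ k * (r k)⁻¹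
    -- ^ j ≤ 1`, and the geometric factor makes the bounds summable.
    filter_upwards [hM j, eventually_ge_atTop j] with k hk hkj x
    have h0 : iteratedFDeriv ℝ j (fun x => a k * H k ((r k)⁻¹ • (x - q k))) x =
        a k • iteratedFDeriv ℝ j (fun x => H k ((r k)⁻¹ • (x - q k))) x := by
      have := iteratedFDeriv_const_smul_apply (𝕜 := ℝ) (i := j) (a := a k) (x := x)
        (f := fun x => H k ((r k)⁻¹ • (x - q k)))
        ((hsm k).contDiffAt.of_le (by exact_mod_cast le_top))
      simpa [Pi.smul_def] using this
    rw [h0, norm_smul]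
    have h1 := norm_iteratedFDeriv_rescale_le (hH k) (q k) (r k)⁻¹ j x
    have hM0 : 0 ≤ M j := (norm_nonneg _).trans (hk x)
    have hC : 0 ≤ C * (1 / 2) ^ k := by
      have := (norm_nonneg _).trans (ha k)
      have hpos : 0 < r k ^ k := pow_pos (hr k) _
      rw [← mul_assoc] at this
      exact nonneg_of_mul_nonneg_left this hpos
    calc ‖a k‖ * ‖iteratedFDeriv ℝ j (fun x => H k ((r k)⁻¹ • (x - q k))) x‖
        ≤ (C * ((1 / 2) ^ k * r k ^ k)) * (|(r k)⁻¹| ^ j * M j) := by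
          refine mul_le_mul (ha k) (h1.trans ?_) (norm_nonneg _) ((norm_nonneg _).trans (ha k))
          exact mul_le_mul_of_nonneg_left (hk _) (by positivity)
      _ = (C * (1 / 2) ^ k * M j) * (r k ^ k * (r k)⁻¹ ^ j) := by
          rw [abs_of_pos (inv_pos.2 (hr k))]; ring
      _ ≤ (C * (1 / 2) ^ k * M j) * 1 := by
          refine mul_le_mul_of_nonneg_left ?_ (mul_nonneg hC hM0)
          calc r k ^ k * (r k)⁻¹ ^ j ≤ r k ^ j * (r k)⁻¹ ^ j :=
                mul_le_mul_of_nonneg_right (pow_le_pow_of_le_one (hr k).le (hr1 k) hkj)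
                  (by have := hr k; positivity)
            _ = 1 := by rw [← mul_pow, mul_inv_cancel₀ (hr k).ne', one_pow]
      _ = C * (1 / 2) ^ k * M j := mul_one _

/-- Sequences of smooth functions whose derivatives are bounded on the unit ball, uniformly in the
index. -/
structure IsUnifSmooth (H : ℕ → E → ℂ) : Prop where
  contDiff : ∀ k, ContDiff ℝ ∞ (H k)
  bound : ∀ j : ℕ, ∃ M : ℝ, ∀ᶠ k in atTop, ∀ x, ‖x‖ ≤ 1 → ‖iteratedFDeriv ℝ j (H k) x‖ ≤ M

lemma IsUnifSmooth.add {H H' : ℕ → E → ℂ} (h : IsUnifSmooth H) (h' : IsUnifSmooth H') :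
    IsUnifSmooth (fun k x => H k x + H' k x) where
  contDiff k := (h.contDiff k).add (h'.contDiff k)
  bound j := by
    obtain ⟨M, hM⟩ := h.bound j
    obtain ⟨M', hM'⟩ := h'.bound j
    refine ⟨M + M', ?_⟩
    filter_upwards [hM, hM'] with k h1 h2 x hx
    have := iteratedFDeriv_add_apply (𝕜 := ℝ) (i := j) (x := x)
      ((h.contDiff k).contDiffAt.of_le (by exact_mod_cast le_top))
      ((h'.contDiff k).contDiffAt.of_le (by exact_mod_cast le_top))
    have e : (fun x => H k x + H' k x) = H k + H' k := rfl
    rw [e, this]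
    exact (norm_add_le _ _).trans (add_le_add (h1 x hx) (h2 x hx))

lemma IsUnifSmooth.mul {H H' : ℕ → E → ℂ} (h : IsUnifSmooth H) (h' : IsUnifSmooth H') :
    IsUnifSmooth (fun k x => H k x * H' k x) where
  contDiff k := (h.contDiff k).mul (h'.contDiff k)
  bound j := by
    choose M hM using h.bound
    choose M' hM' using h'.bound
    refine ⟨∑ i ∈ Finset.range (j + 1), (j.choose i : ℝ) * M i * M' (j - i), ?_⟩
    have e1 : ∀ᶠ k in atTop, ∀ i ∈ Finset.range (j + 1), ∀ x, ‖x‖ ≤ 1 →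
        ‖iteratedFDeriv ℝ i (H k) x‖ ≤ M i :=
      (Filter.eventually_all_finset _).2 fun i _ => hM i
    have e2 : ∀ᶠ k in atTop, ∀ i ∈ Finset.range (j + 1), ∀ x, ‖x‖ ≤ 1 →
        ‖iteratedFDeriv ℝ (j - i) (H' k) x‖ ≤ M' (j - i) :=
      (Filter.eventually_all_finset _).2 fun i _ => hM' (j - i)
    filter_upwards [e1, e2] with k h1 h2 x hx
    refine (norm_iteratedFDeriv_mul_le (h.contDiff k) (h'.contDiff k) x
      (n := j) (by exact_mod_cast le_top)).trans ?_
    refine Finset.sum_le_sum fun i hi => ?_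
    have := h1 i hi x hx
    refine mul_le_mul (mul_le_mul_of_nonneg_left this (by positivity)) (h2 i hi x hx)
      (norm_nonneg _) (mul_nonneg (by positivity) ((norm_nonneg _).trans this))

/-- The affine maps send the unit ball into one fixed ball of radius `R + R'`, on which each
derivative of `Φ` is bounded by compactness. The uniformly smooth sequences used below arise from
this case by sums and products. -/
lemma isUnifSmooth_comp_affine {E' : Type*} [NormedAddCommGroup E'] [NormedSpace ℝ E']
    [FiniteDimensional ℝ E'] {Φ : E' → ℂ} (hΦ : ContDiff ℝ ∞ Φ) {c : ℕ → E'} {A : ℕ → E →L[ℝ] E'}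
    {R R' : ℝ} (hc : ∀ k, ‖c k‖ ≤ R) (hA : ∀ k, ‖A k‖ ≤ R') :
    IsUnifSmooth (fun k y => Φ (c k + A k y)) where
  contDiff k := hΦ.comp (by fun_prop)
  bound j := by
    have : ProperSpace E' := FiniteDimensional.proper ℝ E'
    have hcont : Continuous (iteratedFDeriv ℝ j Φ) :=
      hΦ.continuous_iteratedFDeriv (by exact_mod_cast le_top)
    obtain ⟨M, hM⟩ := (isCompact_closedBall (0 : E') (R + R')).exists_bound_of_continuousOn
      hcont.continuousOn
    have hR' : 0 ≤ R' := (norm_nonneg _).trans (hA 0)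
    refine ⟨M * R' ^ j, Filter.Eventually.of_forall fun k x hx => ?_⟩
    have hsm : ContDiff ℝ ∞ (fun y => Φ (c k + y)) := hΦ.comp (by fun_prop)
    have e : (fun y => Φ (c k + A k y)) = (fun y => Φ (c k + y)) ∘ (A k) := rfl
    rw [e, ContinuousLinearMap.iteratedFDeriv_comp_right _ hsm _ (by exact_mod_cast le_top),
      iteratedFDeriv_comp_add_left]
    refine (ContinuousMultilinearMap.norm_compContinuousLinearMap_le _ _).trans ?_
    have hx' : ‖A k x‖ ≤ R' := ((A k).le_opNorm x).trans (by
      calc ‖A k‖ * ‖x‖ ≤ R' * 1 := mul_le_mul (hA k) hx (norm_nonneg _) hR'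
        _ = R' := mul_one _)
    have h1 : ‖iteratedFDeriv ℝ j Φ (c k + A k x)‖ ≤ M := hM _ (by
      simp only [mem_closedBall, dist_zero_right]
      exact (norm_add_le _ _).trans (add_le_add (hc k) hx'))
    refine mul_le_mul h1 ?_ (by positivity) ((norm_nonneg _).trans h1)
    simp only [Finset.prod_const, Finset.card_univ, Fintype.card_fin]
    exact pow_le_pow_left₀ (norm_nonneg _) (hA k) _

lemma isUnifSmooth_const {s : ℕ → ℂ} {R : ℝ} (hs : ∀ k, ‖s k‖ ≤ R) :
    IsUnifSmooth (fun k (_ : E) => s k) := by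
  have := isUnifSmooth_comp_affine (E := E) (E' := ℂ) (Φ := id) contDiff_id (c := s)
    (A := fun _ => 0) hs (R' := 0) (by simp)
  simpa using this

end Series

end FourierMukai

end

noncomputable section

namespace FourierMukai

open Filter Metric

/-! ### Derivations of germs of smooth functions on a vector space -/

section LocalDerivation

set_option linter.unusedSectionVars false

variable {E : Type*} [NormedAddCommGroup E] [NormedSpace ℝ E]

/-- Smoothness on a neighbourhood of a point. -/
def SmoothNear (p : E) (f : E → ℂ) : Prop := ∀ᶠ x in 𝓝 p, ContDiffAt ℝ ∞ f x

lemma _root_.ContDiff.smoothNear {f : E → ℂ} (hf : ContDiff ℝ ∞ f) (p : E) : SmoothNear p f :=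
  Eventually.of_forall fun _ => hf.contDiffAt

/-- An operator on functions that induces a derivation of the germs at `p` of smooth functions. -/
structure IsGermDerivation (p : E) (D : (E → ℂ) → E → ℂ) : Prop where
  smooth : ∀ f, SmoothNear p f → SmoothNear p (D f)
  congr : ∀ f g, SmoothNear p f → f =ᶠ[𝓝 p] g → D f =ᶠ[𝓝 p] D g
  add : ∀ f g, SmoothNear p f → SmoothNear p g → D (f + g) =ᶠ[𝓝 p] D f + D g
  mul : ∀ f g, SmoothNear p f → SmoothNear p g → D (f * g) =ᶠ[𝓝 p] f * D g + g * D f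
  const : ∀ c : ℂ, D (fun _ => c) =ᶠ[𝓝 p] 0

/-- A sequence of disjoint balls converging to `p`. -/
structure BallSeq (p : E) where
  q : ℕ → E
  r : ℕ → ℝ
  pos : ∀ k, 0 < r k
  le_one : ∀ k, r k ≤ 1
  tendsto_q : Tendsto q atTop (𝓝 p)
  tendsto_r : Tendsto r atTop (𝓝 0)
  disj : ∀ k l, k ≠ l → Disjoint (ball (q k) (r k)) (ball (q l) (r l))

namespace BallSeq

variable [FiniteDimensional ℝ E] {p : E} (S : BallSeq p)

/-- The point of the `k`-th ball with rescaled coordinate `y`. -/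
def pt (k : ℕ) (y : E) : E := S.q k + S.r k • y

/-- Rapidly decreasing weights. -/
def wt (k : ℕ) : ℝ := (1 / 2) ^ k * S.r k ^ k

lemma wt_pos (k : ℕ) : 0 < S.wt k := mul_pos (by positivity) (pow_pos (S.pos k) k)

variable (E) in
/-- A fixed bump function. -/
def bump : ContDiffBump (0 : E) := ⟨1 / 2, 1, by norm_num, by norm_num⟩

/-- Almost all balls lie in any given neighbourhood of `p`; so identities between germs at `p`
become identities on the balls of large index. -/
lemma eventually_pt {P : E → Prop} (h : ∀ᶠ x in 𝓝 p, P x) :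
    ∀ᶠ k in atTop, ∀ y, ‖y‖ ≤ 1 → P (S.pt k y) := by
  obtain ⟨ε, hε, hP⟩ := Metric.eventually_nhds_iff.1 h
  have h1 := Metric.tendsto_nhds.1 S.tendsto_q (ε / 2) (half_pos hε)
  have h2 := Metric.tendsto_nhds.1 S.tendsto_r (ε / 2) (half_pos hε)
  filter_upwards [h1, h2] with k h3 h4 y hy
  refine hP ?_
  have h5 : dist (S.pt k y) (S.q k) ≤ S.r k := by
    rw [pt, dist_eq_norm, add_sub_cancel_left, norm_smul, Real.norm_of_nonneg (S.pos k).le]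
    exact mul_le_of_le_one_right (S.pos k).le hy
  rw [Real.dist_eq, sub_zero, abs_of_pos (S.pos k)] at h4
  linarith [dist_triangle (S.pt k y) (S.q k) p]

/-- The function that is, on the `k`-th ball, a multiple of the rescaled function `H k`, cut off. -/
def glue (H : ℕ → E → ℂ) (x : E) : ℂ :=
  ∑' k, (S.wt k : ℂ) * ((bump E ((S.r k)⁻¹ • (x - S.q k)) : ℂ) * H k ((S.r k)⁻¹ • (x - S.q k)))

lemma bump_eq_zero {k : ℕ} {x : E} (hx : x ∉ ball (S.q k) (S.r k)) :
    bump E ((S.r k)⁻¹ • (x - S.q k)) = 0 := by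
  refine (bump E).zero_of_le_dist ?_
  rw [dist_zero_right, norm_smul, norm_inv, Real.norm_of_nonneg (S.pos k).le]
  rw [mem_ball, dist_eq_norm, not_lt] at hx
  change (1 : ℝ) ≤ _
  rw [inv_mul_eq_div, one_le_div (S.pos k)]
  exact hx

lemma glue_of_mem (H : ℕ → E → ℂ) {k : ℕ} {x : E} (hx : x ∈ ball (S.q k) (S.r k)) :
    S.glue H x = S.wt k *
      ((bump E ((S.r k)⁻¹ • (x - S.q k)) : ℂ) * H k ((S.r k)⁻¹ • (x - S.q k))) := by
  refine tsum_eq_single k fun l hl => ?_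
  rw [S.bump_eq_zero (fun h => Set.disjoint_left.1 (S.disj k l hl.symm) hx h)]
  simp

lemma glue_of_forall_notMem (H : ℕ → E → ℂ) {x : E} (hx : ∀ k, x ∉ ball (S.q k) (S.r k)) :
    S.glue H x = 0 := by
  unfold glue
  simp [fun k => S.bump_eq_zero (hx k)]

lemma pt_inv (k : ℕ) (x : E) : S.pt k ((S.r k)⁻¹ • (x - S.q k)) = x := by
  simp [pt, (S.pos k).ne']

lemma norm_rescale_lt {k : ℕ} {x : E} (hx : x ∈ ball (S.q k) (S.r k)) :
    ‖(S.r k)⁻¹ • (x - S.q k)‖ < 1 := by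
  rw [norm_smul, norm_inv, Real.norm_of_nonneg (S.pos k).le, inv_mul_eq_div, div_lt_one (S.pos k)]
  rwa [mem_ball, dist_eq_norm] at hx

lemma pt_mem {k : ℕ} {y : E} (hy : ‖y‖ < 1) : S.pt k y ∈ ball (S.q k) (S.r k) := by
  rw [mem_ball, pt, dist_eq_norm, add_sub_cancel_left, norm_smul, Real.norm_of_nonneg (S.pos k).le]
  exact mul_lt_of_lt_one_right (S.pos k) hy

lemma glue_pt (H : ℕ → E → ℂ) {k : ℕ} {y : E} (hy : ‖y‖ < 1) :
    S.glue H (S.pt k y) = S.wt k * ((bump E y : ℂ) * H k y) := by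
  rw [S.glue_of_mem H (S.pt_mem hy)]
  simp [pt, (S.pos k).ne']

lemma glue_pt' (H : ℕ → E → ℂ) {k : ℕ} {y : E} (hy : ‖y‖ < 1 / 2) :
    S.glue H (S.pt k y) = S.wt k * H k y := by
  rw [S.glue_pt H (by linarith), (bump E).one_of_mem_closedBall (by simpa [bump] using hy.le)]
  simp

lemma ext_of_pt {f g : E → ℂ} (h : ∀ k y, ‖y‖ < 1 → f (S.pt k y) = g (S.pt k y))
    (h' : ∀ x, (∀ k, x ∉ ball (S.q k) (S.r k)) → f x = g x) : f = g := by
  funext x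
  by_cases hx : ∃ k, x ∈ ball (S.q k) (S.r k)
  · obtain ⟨k, hk⟩ := hx
    have := h k _ (S.norm_rescale_lt hk)
    rwa [S.pt_inv] at this
  · push Not at hx
    exact h' x hx

/-- The bump vanishes outside the unit ball, so bounds on that ball are bounds everywhere; the
rapidly decreasing weights then give smoothness even at `p`, where the balls accumulate. -/
lemma contDiff_glue {H : ℕ → E → ℂ} (hH : IsUnifSmooth H) : ContDiff ℝ ∞ (S.glue H) := by
  have hb : IsUnifSmooth (fun (_ : ℕ) (y : E) => ((bump E y : ℝ) : ℂ)) := by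
    have := isUnifSmooth_comp_affine (E := E) (E' := E) (Φ := fun y => ((bump E y : ℝ) : ℂ))
      (Complex.ofRealCLM.contDiff.comp (bump E).contDiff) (c := fun _ => 0)
      (A := fun _ => ContinuousLinearMap.id ℝ E) (R := 0) (R' := 1) (by simp)
      (fun _ => ContinuousLinearMap.norm_id_le)
    simpa using this
  have hm := hb.mul hH
  refine contDiff_tsum_rescale S.pos S.le_one (C := 1) (a := fun k => (S.wt k : ℂ)) ?_
    hm.contDiff ?_
  · intro k
    rw [Complex.norm_real, Real.norm_of_nonneg (S.wt_pos k).le, one_mul, wt]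
  · intro j
    obtain ⟨M, hM⟩ := hm.bound j
    refine ⟨max M 0, ?_⟩
    filter_upwards [hM] with k hk x
    by_cases hx : ‖x‖ ≤ 1
    · exact (hk x hx).trans (le_max_left _ _)
    · have h0 : (fun y => ((bump E y : ℝ) : ℂ) * H k y) =ᶠ[𝓝 x] fun _ => 0 := by
        push Not at hx
        filter_upwards [(isOpen_lt continuous_const continuous_norm).mem_nhds hx] with y hy
        rw [(bump E).zero_of_le_dist (by simpa [bump] using (le_of_lt hy))]
        simp
      rw [(h0.iteratedFDeriv (𝕜 := ℝ) j).self_of_nhds]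
      simp

variable (D : (E → ℂ) → E → ℂ)

/-- The rescaled derivative of a sequence of functions. -/
def nd (H : ℕ → E → ℂ) (k : ℕ) (y : E) : ℂ :=
  -- On the `k`-th ball the glued function is `H k` times the glued constant `1`. Subtracting `H k`
  -- times the derivative of the latter removes the contribution of weights and cut-offs; dividing
  -- by the weight leaves what ought to be the derivative of `H k`.
  (D (S.glue H) (S.pt k y) - H k y * D (S.glue fun _ _ => 1) (S.pt k y)) / S.wt k

variable {D}

lemma isUnifSmooth_one : IsUnifSmooth (fun (_ : ℕ) (_ : E) => (1 : ℂ)) :=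
  isUnifSmooth_const (R := 1) (by simp)

lemma nd_add (hD : IsGermDerivation p D) {H H' : ℕ → E → ℂ} (hH : IsUnifSmooth H) (hH' : IsUnifSmooth H') :
    ∀ᶠ k in atTop, ∀ y, ‖y‖ < 1 / 2 →
      S.nd D (fun k y => H k y + H' k y) k y = S.nd D H k y + S.nd D H' k y := by
  have h1 := hD.add _ _ ((S.contDiff_glue hH).smoothNear p) ((S.contDiff_glue hH').smoothNear p)
  have h2 : S.glue H + S.glue H' = S.glue (fun k y => H k y + H' k y) := by
    refine S.ext_of_pt (fun k y hy => ?_) fun x hx => ?_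
    · rw [Pi.add_apply, S.glue_pt _ hy, S.glue_pt _ hy, S.glue_pt _ hy]
      ring
    · simp [S.glue_of_forall_notMem _ hx]
  rw [h2] at h1
  filter_upwards [S.eventually_pt h1] with k hk y hy
  have := hk y (by linarith)
  simp only [nd, this, Pi.add_apply]
  ring

/-- The products `glue H * glue H'` and `glue (H * H') * glue 1` coincide; applying `D` to both and
cancelling a weight gives the Leibniz rule. It holds for large `k` only, because `D` sees nothing
but germs at `p`. -/
lemma nd_mul (hD : IsGermDerivation p D) {H H' : ℕ → E → ℂ} (hH : IsUnifSmooth H) (hH' : IsUnifSmooth H') :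
    ∀ᶠ k in atTop, ∀ y, ‖y‖ < 1 / 2 →
      S.nd D (fun k y => H k y * H' k y) k y = H k y * S.nd D H' k y + H' k y * S.nd D H k y := by
  have s1 := (S.contDiff_glue hH).smoothNear p
  have s2 := (S.contDiff_glue hH').smoothNear p
  have s3 := (S.contDiff_glue (hH.mul hH')).smoothNear p
  have s4 := (S.contDiff_glue (E := E) isUnifSmooth_one).smoothNear p
  have h1 := hD.mul _ _ s1 s2
  have h3 := hD.mul _ _ s3 s4
  have h2 : S.glue H * S.glue H' = S.glue (fun k y => H k y * H' k y) * S.glue fun _ _ => 1 := by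
    refine S.ext_of_pt (fun k y hy => ?_) fun x hx => ?_
    · simp only [Pi.mul_apply, S.glue_pt _ hy]
      ring
    · simp [S.glue_of_forall_notMem _ hx]
  rw [h2] at h1
  filter_upwards [S.eventually_pt h1, S.eventually_pt h3] with k hk hk' y hy
  have e1 := hk y (by linarith)
  rw [hk' y (by linarith)] at e1
  simp only [Pi.add_apply, Pi.mul_apply, S.glue_pt' _ hy] at e1
  have hw : (S.wt k : ℂ) ≠ 0 := by exact_mod_cast (S.wt_pos k).ne'
  have e2 : H k y * H' k y * D (S.glue fun _ _ => 1) (S.pt k y) +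
      D (S.glue fun k y => H k y * H' k y) (S.pt k y) =
      H k y * D (S.glue H') (S.pt k y) + H' k y * D (S.glue H) (S.pt k y) := by
    refine mul_left_cancel₀ hw ?_
    linear_combination e1
  simp only [nd]
  field_simp
  linear_combination e2

lemma exists_norm_q_le : ∃ R, ∀ k, ‖S.q k‖ ≤ R := by
  obtain ⟨R, hR⟩ := S.tendsto_q.norm.bddAbove_range
  exact ⟨R, fun k => hR ⟨k, rfl⟩⟩

/-- The sequence of the restrictions of a smooth function to the balls. -/
lemma isUnifSmooth_pt {f : E → ℂ} (hf : ContDiff ℝ ∞ f) :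
    IsUnifSmooth (fun k y => f (S.pt k y)) := by
  obtain ⟨R, hR⟩ := S.exists_norm_q_le
  refine isUnifSmooth_comp_affine hf (c := S.q) (A := fun k => S.r k • ContinuousLinearMap.id ℝ E)
    (R' := 1) hR fun k => ?_
  rw [norm_smul, Real.norm_of_nonneg (S.pos k).le]
  exact mul_le_one₀ (S.le_one k) (norm_nonneg _) ContinuousLinearMap.norm_id_le

/-- For a sequence cut out of a single function `f`, the glued function is `f * glue 1`, and the
Leibniz rule of `D` returns `D f`. -/
lemma nd_pt (hD : IsGermDerivation p D) {f : E → ℂ} (hf : ContDiff ℝ ∞ f) :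
    ∀ᶠ k in atTop, ∀ y, ‖y‖ < 1 / 2 → S.nd D (fun k y => f (S.pt k y)) k y = D f (S.pt k y) := by
  have h1 := hD.mul f _ (hf.smoothNear p)
    ((S.contDiff_glue (E := E) isUnifSmooth_one).smoothNear p)
  have h2 : (f * S.glue fun _ _ => 1) = S.glue (fun k y => f (S.pt k y)) := by
    refine S.ext_of_pt (fun k y hy => ?_) fun x hx => ?_
    · simp only [Pi.mul_apply, S.glue_pt _ hy]
      ring
    · simp [S.glue_of_forall_notMem _ hx]
  rw [h2] at h1
  filter_upwards [S.eventually_pt h1] with k hk y hy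
  have e1 := hk y (by linarith)
  simp only [Pi.add_apply, Pi.mul_apply, S.glue_pt' _ hy] at e1
  have hw : (S.wt k : ℂ) ≠ 0 := by exact_mod_cast (S.wt_pos k).ne'
  simp only [nd, e1]
  field_simp
  ring

lemma nd_const (hD : IsGermDerivation p D) (c : ℂ) :
    ∀ᶠ k in atTop, ∀ y, ‖y‖ < 1 / 2 → S.nd D (fun _ _ => c) k y = 0 := by
  filter_upwards [S.nd_pt hD (f := fun _ => c) contDiff_const,
    S.eventually_pt (hD.const c)] with k h1 h2 y hy
  rw [h1 y hy, h2 y (by linarith), Pi.zero_apply]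

lemma nd_sub (hD : IsGermDerivation p D) {H H' : ℕ → E → ℂ} (hH : IsUnifSmooth H)
    (hH' : IsUnifSmooth H') :
    ∀ᶠ k in atTop, ∀ y, ‖y‖ < 1 / 2 →
      S.nd D (fun k y => H k y - H' k y) k y = S.nd D H k y - S.nd D H' k y := by
  have hm : IsUnifSmooth (fun (_ : ℕ) (_ : E) => (-1 : ℂ)) := isUnifSmooth_const (R := 1) (by simp)
  filter_upwards [S.nd_add hD hH (hm.mul hH'), S.nd_mul hD hm hH', S.nd_const hD (-1)]
    with k h1 h2 h3 y hy
  have e : (fun k y => H k y - H' k y) = fun k y => H k y + (-1) * H' k y := by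
    funext k y; ring
  rw [e, h1 y hy, h2 y hy, h3 y hy]
  ring

lemma nd_congr {H H' : ℕ → E → ℂ} (h : ∀ k y, ‖y‖ < 1 → H k y = H' k y) {k : ℕ} {y : E}
    (hy : ‖y‖ < 1) : S.nd D H k y = S.nd D H' k y := by
  have : S.glue H = S.glue H' := by
    refine S.ext_of_pt (fun k y hy => ?_) fun x hx => ?_
    · rw [S.glue_pt _ hy, S.glue_pt _ hy, h k y hy]
    · simp [S.glue_of_forall_notMem _ hx]
  rw [nd, nd, this, h k y hy]

/-- Locality in the index of the ball. -/
lemma nd_eq_zero (hD : IsGermDerivation p D) {H : ℕ → E → ℂ} (hH : IsUnifSmooth H) {K : Set ℕ}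
    (hK : ∀ k ∈ K, ∀ y, H k y = 0) :
    ∀ᶠ k in atTop, k ∈ K → ∀ y, ‖y‖ < 1 / 2 → S.nd D H k y = 0 := by
  classical
  -- The indicator sequence of `K` annihilates `H`. In the Leibniz rule for this product, at an
  -- index in `K`, the only term left is the derivative of `H`.
  have hs : IsUnifSmooth (fun k (_ : E) => if k ∈ K then (1 : ℂ) else 0) :=
    isUnifSmooth_const (R := 1) fun k => by split_ifs <;> simp
  filter_upwards [S.nd_mul hD hs hH, S.nd_const hD 0] with k h1 h2 hk y hy
  have e : (fun k y => (if k ∈ K then (1 : ℂ) else 0) * H k y) = fun _ _ => 0 := by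
    funext k y
    split_ifs with h
    · simp [hK k h y]
    · simp
  have := h1 y hy
  rw [e, h2 y hy, hK k hk y] at this
  simpa [hk] using this.symm

lemma continuousOn_nd (hD : IsGermDerivation p D) {H : ℕ → E → ℂ} (hH : IsUnifSmooth H) :
    ∀ᶠ k in atTop, ContinuousOn (S.nd D H k) (ball 0 (1 / 2)) := by
  filter_upwards [S.eventually_pt (hD.smooth _ ((S.contDiff_glue hH).smoothNear p)),
    S.eventually_pt (hD.smooth _ ((S.contDiff_glue (E := E) isUnifSmooth_one).smoothNear p))]
    with k h1 h2 y hy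
  have hy' : ‖y‖ ≤ 1 := by
    rw [mem_ball_zero_iff] at hy
    linarith
  have hp : ContinuousAt (S.pt k) y := by
    unfold pt
    fun_prop
  refine ContinuousAt.continuousWithinAt ?_
  have c1 : ContinuousAt (fun y => D (S.glue H) (S.pt k y)) y :=
    ContinuousAt.comp (h1 y hy').continuousAt hp
  have c2 : ContinuousAt (fun y => D (S.glue fun _ _ => 1) (S.pt k y)) y :=
    ContinuousAt.comp (h2 y hy').continuousAt hp
  exact (c1.sub ((hH.contDiff k).continuous.continuousAt.mul c2)).div_const _

end BallSeq

/-! ### From a derivation to a sequence of numbers -/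

/-- Points that accumulate at `p` can be taken as centres of disjoint balls. -/
lemma exists_ballSeq {p : E} {P : E → Prop} (h : ∃ᶠ x in 𝓝[≠] p, P x) :
    ∃ S : BallSeq p, ∀ k, P (S.q k) := by
  have h1 : ∀ ε : ℝ, ∃ x, 0 < ε → (0 < dist x p ∧ dist x p < ε ∧ P x) := by
    intro ε
    by_cases hε : 0 < ε
    · obtain ⟨x, hx, h2, h3⟩ := (h.and_eventually
        ((eventually_mem_nhdsWithin).and (mem_nhdsWithin_of_mem_nhds (ball_mem_nhds p hε)))).exists
      exact ⟨x, fun _ => ⟨dist_pos.2 h2, h3, hx⟩⟩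
    · exact ⟨p, fun h => absurd h hε⟩
  choose x hx using h1
  -- Each centre is less than a quarter as far from `p` as the preceding one, so the balls whose
  -- radius is a quarter of the distance to `p` are disjoint.
  let q : ℕ → E := fun n => Nat.rec (x 1) (fun _ y => x (dist y p / 4)) n
  have hq0 : q 0 = x 1 := rfl
  have hqs : ∀ n, q (n + 1) = x (dist (q n) p / 4) := fun n => rfl
  have hpos : ∀ n, 0 < dist (q n) p := by
    intro n
    induction n with
    | zero => exact (hx 1 one_pos).1
    | succ n ih => rw [hqs]; exact (hx _ (by positivity)).1
  have hP : ∀ n, P (q n) := by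
    intro n
    cases n with
    | zero => exact (hx 1 one_pos).2.2
    | succ n => rw [hqs]; exact (hx _ (div_pos (hpos n) (by norm_num))).2.2
  have hlt : ∀ n, dist (q (n + 1)) p < dist (q n) p / 4 := fun n =>
    (hx _ (div_pos (hpos n) (by norm_num))).2.1
  have hle : ∀ n m, n < m → dist (q m) p ≤ dist (q n) p / 4 := by
    intro n m hnm
    induction m, hnm using Nat.le_induction with
    | base => exact (hlt n).le
    | succ m _ ih => linarith [hlt m, hpos m]
  have hgeo : ∀ n, dist (q n) p ≤ (1 / 2) ^ n := by
    intro n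
    induction n with
    | zero => rw [hq0, pow_zero]; exact (hx 1 one_pos).2.1.le
    | succ n ih => rw [pow_succ]; linarith [hlt n, hpos n]
  have hdist : Tendsto (fun n => dist (q n) p) atTop (𝓝 0) :=
    squeeze_zero (fun _ => dist_nonneg) hgeo
      (tendsto_pow_atTop_nhds_zero_of_lt_one (by norm_num) (by norm_num))
  have hdisj : ∀ k l, k < l → Disjoint (ball (q k) (dist (q k) p / 4))
      (ball (q l) (dist (q l) p / 4)) := by
    intro k l hkl
    refine Set.disjoint_left.2 fun z h1 h2 => ?_
    rw [mem_ball] at h1 h2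
    have t1 := dist_triangle (q k) z p
    have t2 := dist_triangle z (q l) p
    rw [dist_comm] at h1
    linarith [hle k l hkl, hpos k]
  refine ⟨⟨q, fun n => dist (q n) p / 4, fun n => div_pos (hpos n) (by norm_num), fun n => ?_,
    tendsto_iff_dist_tendsto_zero.2 hdist, by simpa using hdist.div_const 4, fun k l hkl => ?_⟩, hP⟩
  · have : dist (q n) p ≤ 1 := (hgeo n).trans (pow_le_one₀ (by norm_num) (by norm_num))
    linarith
  · rcases lt_or_gt_of_ne hkl with h | h
    · exact hdisj k l h
    · exact (hdisj l k h).symm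

end LocalDerivation

end FourierMukai

end

noncomputable section

namespace FourierMukai

open Filter Metric

section LocalDerivation

variable {E : Type*} [NormedAddCommGroup E] [NormedSpace ℝ E] [FiniteDimensional ℝ E] {p : E}

/-- A derivation that kills the linear forms but not all germs does not kill all bounded sequences
of numbers on some sequence of balls. -/
lemma exists_nd_frequently_ne_zero {D : (E → ℂ) → E → ℂ} (hD : IsGermDerivation p D)
    (hlin : ∀ ℓ : E →L[ℝ] ℝ, D (fun x => (ℓ x : ℂ)) =ᶠ[𝓝 p] 0)
    {f : E → ℂ} (hf : ContDiff ℝ ∞ f) (hne : ∃ᶠ x in 𝓝[≠] p, D f x ≠ 0) :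
    ∃ (S : BallSeq p) (s : ℕ → ℂ) (R : ℝ), (∀ k, ‖s k‖ ≤ R) ∧
      ∃ᶠ k in atTop, S.nd D (fun k _ => s k) k 0 ≠ 0 := by
  obtain ⟨S, hS⟩ := exists_ballSeq hne
  obtain ⟨R, hR⟩ := S.exists_norm_q_le
  obtain ⟨Γ, hΓ, hΓf, -⟩ := exists_hadamard hf
  let b := Module.finBasis ℝ E
  let n := Module.finrank ℝ E
  let ℓ : Fin n → E →L[ℝ] ℝ := fun i => LinearMap.toContinuousLinearMap (b.coord i)
  have hbsum : ∀ x : E, ∑ i, ℓ i x • b i = x := fun x => b.sum_repr x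
  -- Suppose all bounded sequences of numbers have vanishing derivative at the centres. Hadamard's
  -- lemma around `q k` writes `f` as `f (q k)` plus a sum of products of `ℓ i - ℓ i (q k)` with
  -- smooth functions. The first factors vanish at the centre, and so do their derivatives, whence
  -- `D f (q k) = 0`.
  by_contra hcon
  push Not at hcon
  have hseq : ∀ g : E → ℂ, Continuous g → ∃ M, ∀ k, ‖g (S.q k)‖ ≤ M := by
    intro g hg
    obtain ⟨M, hM⟩ := ((hg.continuousAt.tendsto.comp S.tendsto_q).norm).bddAbove_range
    exact ⟨M, fun k => hM ⟨k, rfl⟩⟩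
  have hzero : ∀ g : E → ℂ, Continuous g →
      ∀ᶠ k in atTop, S.nd D (fun k _ => g (S.q k)) k 0 = 0 := by
    intro g hg
    obtain ⟨M, hM⟩ := hseq g hg
    have := hcon S (fun k => g (S.q k)) M hM
    simpa [Filter.not_frequently] using this
  have hLc : ∀ i, ContDiff ℝ ∞ (fun x => (ℓ i x : ℂ)) := fun i =>
    Complex.ofRealCLM.contDiff.comp (ℓ i).contDiff
  have hG : ∀ i, IsUnifSmooth (fun k y => Γ (S.q k, S.pt k y) (b i)) := by
    intro i
    have h1 : ContDiff ℝ ∞ (fun x : E × E => Γ x (b i)) := hΓ.clm_apply contDiff_const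
    have h2 := isUnifSmooth_comp_affine (E := E) h1 (c := fun k => (S.q k, S.q k))
      (A := fun k => (0 : E →L[ℝ] E).prod (S.r k • ContinuousLinearMap.id ℝ E)) (R := R) (R' := 1)
      (fun k => by simpa [Prod.norm_def] using hR k) (fun k => by
        refine ContinuousLinearMap.opNorm_le_bound _ zero_le_one fun y => ?_
        simp only [ContinuousLinearMap.prod_apply, zero_apply,
          smul_apply, ContinuousLinearMap.id_apply, Prod.norm_def, norm_zero,
          norm_smul, Real.norm_of_nonneg (S.pos k).le]
        refine max_le (by positivity) (mul_le_mul_of_nonneg_right (S.le_one k) (norm_nonneg _)))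
    simpa [BallSeq.pt] using h2
  have hconst : ∀ g : E → ℂ, Continuous g → IsUnifSmooth (fun k (_ : E) => g (S.q k)) := by
    intro g hg
    obtain ⟨M, hM⟩ := hseq g hg
    exact isUnifSmooth_const hM
  let T : Fin n → ℕ → E → ℂ := fun i k y => (ℓ i (S.pt k y) : ℂ) - (ℓ i (S.q k) : ℂ)
  have hTu : ∀ i, IsUnifSmooth (T i) := by
    intro i
    have h1 := (S.isUnifSmooth_pt (hLc i)).add
      ((isUnifSmooth_const (E := E) (s := fun _ => (-1 : ℂ)) (R := 1) (by simp)).mul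
        (hconst _ (hLc i).continuous))
    have e : (fun k y => (ℓ i (S.pt k y) : ℂ) + -1 * (ℓ i (S.q k) : ℂ)) = T i := by
      funext k y; simp only [T]; ring
    rwa [e] at h1
  have hT0 : ∀ i, ∀ᶠ k in atTop, S.nd D (T i) k 0 = 0 := by
    intro i
    filter_upwards [S.nd_sub hD (S.isUnifSmooth_pt (hLc i)) (hconst _ (hLc i).continuous),
      S.nd_pt hD (hLc i), hzero _ (hLc i).continuous, S.eventually_pt (hlin (ℓ i))]
      with k h1 h2 h3 h4
    have := h1 0 (by simp)
    rw [h2 0 (by simp), h3, h4 0 (by simp)] at this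
    simpa using this
  have hsumU : ∀ s : Finset (Fin n),
      IsUnifSmooth (fun k y => ∑ i ∈ s, T i k y * Γ (S.q k, S.pt k y) (b i)) ∧
      ∀ᶠ k in atTop, S.nd D (fun k y => ∑ i ∈ s, T i k y * Γ (S.q k, S.pt k y) (b i)) k 0 = 0 := by
    classical
    intro s
    induction s using Finset.induction_on with
    | empty =>
      simp only [Finset.sum_empty]
      refine ⟨isUnifSmooth_const (R := 0) (by simp), ?_⟩
      filter_upwards [S.nd_const hD 0] with k hk
      exact hk 0 (by simp)
    | insert i s hi ih =>
      simp only [Finset.sum_insert hi]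
      refine ⟨((hTu i).mul (hG i)).add ih.1, ?_⟩
      filter_upwards [ih.2, hT0 i, S.nd_add hD ((hTu i).mul (hG i)) ih.1,
        S.nd_mul hD (hTu i) (hG i)] with k h1 h2 h3 h4
      rw [h3 0 (by simp), h4 0 (by simp), h1, h2]
      simp [T, BallSeq.pt]
  have hfin := hsumU Finset.univ
  have hexp : (fun k y => f (S.pt k y)) = fun k y => f (S.q k) +
      ∑ i, T i k y * Γ (S.q k, S.pt k y) (b i) := by
    funext k y
    have h1 := hΓf (S.q k) (S.pt k y)
    conv at h1 => rhs; rw [← hbsum (S.pt k y - S.q k)]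
    rw [h1]
    simp only [map_sum, map_smul, Complex.real_smul, map_sub, Complex.ofReal_sub, T]
  have hlast : ∀ᶠ k in atTop, D f (S.q k) = 0 := by
    filter_upwards [S.nd_pt hD hf, S.nd_add hD (hconst f hf.continuous) hfin.1, hfin.2,
      hzero f hf.continuous] with k h1 h2 h3 h4
    have e1 := h1 0 (by simp)
    rw [hexp, h2 0 (by simp), h3, h4] at e1
    simpa [BallSeq.pt] using e1.symm
  obtain ⟨k, hk⟩ := hlast.exists
  exact hS k hk

/-- One can even assume that the derivative of the sequence does not vanish anywhere. -/
lemma exists_nd_ne_zero {D : (E → ℂ) → E → ℂ} (hD : IsGermDerivation p D)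
    {S : BallSeq p} {s : ℕ → ℂ} {R : ℝ} (hs : ∀ k, ‖s k‖ ≤ R)
    (hfr : ∃ᶠ k in atTop, S.nd D (fun k _ => s k) k 0 ≠ 0) :
    ∃ (S' : BallSeq p) (s' : ℕ → ℂ), (∀ k, ‖s' k‖ ≤ R) ∧
      ∀ᶠ k in atTop, ∀ y, ‖y‖ < 1 / 2 → S'.nd D (fun k _ => s' k) k y ≠ 0 := by
  have hu : IsUnifSmooth (fun k (_ : E) => s k) := isUnifSmooth_const hs
  have h1 : ∃ᶠ k in atTop, ∃ η : ℝ, 0 < η ∧ η ≤ 1 / 2 ∧ ∀ y, ‖y‖ < η →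
      S.nd D (fun k _ => s k) k y ≠ 0 := by
    refine (hfr.and_eventually (S.continuousOn_nd hD hu)).mono ?_
    rintro k ⟨h2, h3⟩
    have h4 : ContinuousAt (S.nd D (fun k _ => s k) k) 0 :=
      h3.continuousAt (ball_mem_nhds 0 (by norm_num))
    obtain ⟨ε, hε, h5⟩ := Metric.eventually_nhds_iff.1 (h4.eventually_ne h2)
    exact ⟨min ε (1 / 2), by positivity, min_le_right _ _, fun y hy =>
      h5 (by simpa using hy.trans_le (min_le_left _ _))⟩
  obtain ⟨φ, hφ, h2⟩ := Filter.extraction_of_frequently_atTop h1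
  choose η hη hη' hne using h2
  -- A subsequence of the balls, each shrunk to the radius `r * η` on which continuity excludes
  -- zeros of the derivative.
  let S' : BallSeq p :=
    { q := fun k => S.q (φ k)
      r := fun k => S.r (φ k) * η k
      pos := fun k => mul_pos (S.pos _) (hη k)
      le_one := fun k => mul_le_one₀ (S.le_one _) (hη k).le ((hη' k).trans (by norm_num))
      tendsto_q := S.tendsto_q.comp hφ.tendsto_atTop
      tendsto_r := by
        refine squeeze_zero (fun k => (mul_pos (S.pos _) (hη k)).le) (fun k => ?_)
          (S.tendsto_r.comp hφ.tendsto_atTop)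
        exact mul_le_of_le_one_right (S.pos _).le ((hη' k).trans (by norm_num))
      disj := fun k l hkl => by
        refine (S.disj (φ k) (φ l) (hφ.injective.ne hkl)).mono (ball_subset_ball ?_)
          (ball_subset_ball ?_) <;>
        exact mul_le_of_le_one_right (S.pos _).le ((hη' _).trans (by norm_num)) }
  have hpt : ∀ k y, S'.pt k y = S.pt (φ k) (η k • y) := by
    intro k y
    simp [BallSeq.pt, S', mul_smul]
  refine ⟨S', fun k => s (φ k), fun k => hs _, ?_⟩
  have hu' : IsUnifSmooth (fun k (_ : E) => s (φ k)) := isUnifSmooth_const fun k => hs (φ k)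
  have hA : ContDiff ℝ ∞ (S.glue fun _ _ => 1) := S.contDiff_glue BallSeq.isUnifSmooth_one
  have hW : ContDiff ℝ ∞ (S.glue fun k _ => s k) := S.contDiff_glue hu
  have hsmall : ∀ k (y : E), ‖y‖ < 1 → ‖η k • y‖ < η k := by
    intro k y hy
    rw [norm_smul, Real.norm_of_nonneg (hη k).le]
    exact mul_lt_of_lt_one_right (hη k) hy
  -- On the shrunk balls the old gluings of `s` and of `1` differ by the factor `s (φ k)`. The
  -- Leibniz rule for the new balls thus expresses the old derivative of `s` through the new one; if
  -- the new one had a zero, so would the old one.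
  have hcongr : ∀ k (y : E), ‖y‖ < 1 → (S.glue fun k _ => s k) (S'.pt k y) =
      s (φ k) * (S.glue fun _ _ => 1) (S'.pt k y) := by
    intro k y hy
    have := (hsmall k y hy).trans_le (hη' k)
    rw [hpt, S.glue_pt' _ this, S.glue_pt' _ this]
    ring
  filter_upwards [S'.nd_pt hD hA, S'.nd_pt hD hW, S'.nd_mul hD hu' (S'.isUnifSmooth_pt hA)]
    with k h1 h2 h3 y hy h0
  have e1 := h2 y hy
  rw [S'.nd_congr hcongr (by linarith), h3 y hy, h1 y hy, h0, mul_zero, add_zero, hpt] at e1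
  have hy1 : ‖y‖ < 1 := by linarith
  refine hne k (η k • y) (hsmall k y hy1) ?_
  rw [BallSeq.nd, ← e1, sub_self, zero_div]

end LocalDerivation

end FourierMukai

end

noncomputable section

namespace FourierMukai

open Filter Metric

/-! ### Sums of spikes on the line, in classes converging to the rational numbers. -/

section Spikes

/-- A sequence of numbers: those with `l.unpair.1 = n` converge to the `n`-th rational number. -/
def spike (l : ℕ) : ℝ := (Denumerable.ofNat ℚ l.unpair.1 : ℝ) + √2 * (1 / 2) ^ l.unpair.2

lemma spike_ne_ratCast (l : ℕ) (x : ℚ) : spike l ≠ x := by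
  intro h
  have h1 : Irrational (√2 * (1 / 2 : ℝ) ^ l.unpair.2) := by
    have h2 := irrational_sqrt_two.mul_ratCast (q := (1 / 2 : ℚ) ^ l.unpair.2) (by positivity)
    convert h2 using 1
    push_cast
    rfl
  refine (h1.ratCast_add (Denumerable.ofNat ℚ l.unpair.1)) ⟨x, ?_⟩
  rw [← h, spike]

lemma spike_injective : Function.Injective spike := by
  intro k l h
  have h2 : k.unpair.2 = l.unpair.2 := by
    by_contra hne
    have h3 : (1 / 2 : ℚ) ^ k.unpair.2 - (1 / 2) ^ l.unpair.2 ≠ 0 := by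
      rw [sub_ne_zero]
      intro h4
      exact hne (pow_right_injective₀ (a := (1 / 2 : ℚ)) (by norm_num) (by norm_num) h4)
    have h5 := irrational_sqrt_two.mul_ratCast h3
    refine h5 ⟨Denumerable.ofNat ℚ l.unpair.1 - Denumerable.ofNat ℚ k.unpair.1, ?_⟩
    simp only [spike] at h
    push_cast
    linarith
  have h1 : k.unpair.1 = l.unpair.1 := by
    simp only [spike, h2, add_left_inj, Rat.cast_inj] at h
    exact (Denumerable.eqv ℚ).symm.injective h
  have := congrArg₂ Nat.pair h1 h2
  simpa using this

lemma tendsto_spike (n : ℕ) :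
    Tendsto (fun i => spike (Nat.pair n i)) atTop (𝓝 (Denumerable.ofNat ℚ n : ℝ)) := by
  have : Tendsto (fun i : ℕ => (Denumerable.ofNat ℚ n : ℝ) + √2 * (1 / 2 : ℝ) ^ i) atTop
      (𝓝 ((Denumerable.ofNat ℚ n : ℝ) + √2 * 0)) :=
    ((tendsto_pow_atTop_nhds_zero_of_lt_one (by norm_num) (by norm_num)).const_mul _).const_add _
  simpa [spike] using this

/-- `Nat.pair n` is increasing, so a statement about almost all members of the class `n` is one
about almost all indices, restricted to the class. -/
lemma eventually_unpair {P : ℕ → Prop} (n : ℕ) (h : ∀ᶠ i in atTop, P (Nat.pair n i)) :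
    ∀ᶠ k in atTop, k.unpair.1 = n → P k := by
  obtain ⟨N, hN⟩ := eventually_atTop.1 h
  filter_upwards [eventually_gt_atTop (Nat.pair n N)] with k hk hkn
  have h1 : Nat.pair n k.unpair.2 = k := by rw [← hkn, Nat.pair_unpair]
  rw [← h1]
  refine hN _ ?_
  by_contra hlt
  push Not at hlt
  have := Nat.pair_lt_pair_right n hlt
  omega

/-- The spikes of one class accumulate only at a rational number, while `spike l` is irrational; so
it has positive distance from the rest of each class. The restriction to the finitely many classes
up to that of `l` is essential, since all spikes together are dense. -/
lemma exists_gap (l : ℕ) : ∃ δ : ℝ, 0 < δ ∧ δ ≤ 1 ∧ ∀ k, k ≠ l → k.unpair.1 ≤ l.unpair.1 →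
    2 * δ ≤ |spike k - spike l| := by
  have h1 : ∀ n : ℕ, ∃ δ : ℝ, 0 < δ ∧ ∀ k, k ≠ l → k.unpair.1 = n →
      2 * δ ≤ |spike k - spike l| := by
    intro n
    have hlim : Tendsto (fun i => |spike (Nat.pair n i) - spike l|) atTop
        (𝓝 |(Denumerable.ofNat ℚ n : ℝ) - spike l|) := ((tendsto_spike n).sub_const _).abs
    have hpos : 0 < |(Denumerable.ofNat ℚ n : ℝ) - spike l| :=
      abs_pos.2 (sub_ne_zero.2 (spike_ne_ratCast l _).symm)
    obtain ⟨N, hN⟩ := eventually_atTop.1 (eventually_unpair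
      (P := fun k => |(Denumerable.ofNat ℚ n : ℝ) - spike l| / 2 < |spike k - spike l|) n
      (hlim.eventually (lt_mem_nhds (half_lt_self hpos))))
    have hfin : ∀ M : ℕ, ∃ δ : ℝ, 0 < δ ∧ ∀ k < M, k ≠ l → 2 * δ ≤ |spike k - spike l| := by
      intro M
      induction M with
      | zero => exact ⟨1, one_pos, fun k hk => absurd hk (Nat.not_lt_zero k)⟩
      | succ M ih =>
        obtain ⟨δ, hδ, h⟩ := ih
        by_cases hM : M = l
        · refine ⟨δ, hδ, fun k hk hkl => h k ?_ hkl⟩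
          omega
        · have : 0 < |spike M - spike l| := abs_pos.2 (sub_ne_zero.2 (spike_injective.ne hM))
          refine ⟨min δ (|spike M - spike l| / 2), by positivity, fun k hk hkl => ?_⟩
          rcases Nat.lt_succ_iff_lt_or_eq.1 hk with h2 | rfl
          · have := h k h2 hkl
            have := min_le_left δ (|spike M - spike l| / 2)
            linarith
          · have := min_le_right δ (|spike k - spike l| / 2)
            linarith
    obtain ⟨δ, hδ, h⟩ := hfin N
    refine ⟨min δ (|(Denumerable.ofNat ℚ n : ℝ) - spike l| / 4), by positivity,
      fun k hkl hkn => ?_⟩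
    by_cases hk : k < N
    · have := h k hk hkl
      have := min_le_left δ (|(Denumerable.ofNat ℚ n : ℝ) - spike l| / 4)
      linarith
    · have := hN k (not_lt.1 hk) hkn
      have := min_le_right δ (|(Denumerable.ofNat ℚ n : ℝ) - spike l| / 4)
      linarith
  choose δ hδ h using h1
  have h2 : ∀ M : ℕ, ∃ ε : ℝ, 0 < ε ∧ ε ≤ 1 ∧ ∀ n ≤ M, ε ≤ δ n := by
    intro M
    induction M with
    | zero => exact ⟨min 1 (δ 0), lt_min one_pos (hδ 0), min_le_left _ _, fun n hn => by
        rw [Nat.le_zero.1 hn]; exact min_le_right _ _⟩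
    | succ M ih =>
      obtain ⟨ε, h3, h4, h5⟩ := ih
      refine ⟨min ε (δ (M + 1)), lt_min h3 (hδ _), (min_le_left _ _).trans h4, fun n hn => ?_⟩
      rcases Nat.le_succ_iff.1 hn with h6 | rfl
      · exact (min_le_left _ _).trans (h5 n h6)
      · exact min_le_right _ _
  obtain ⟨ε, h3, h4, h5⟩ := h2 l.unpair.1
  refine ⟨ε, h3, h4, fun k hk hkl => ?_⟩
  have := h _ k hk rfl
  have := h5 _ hkl
  linarith

/-- Widths of disjoint enough spikes. -/
def width (l : ℕ) : ℝ := (exists_gap l).choose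

lemma width_pos (l : ℕ) : 0 < width l := (exists_gap l).choose_spec.1
lemma width_le_one (l : ℕ) : width l ≤ 1 := (exists_gap l).choose_spec.2.1
lemma two_mul_width_le {k l : ℕ} (h : k ≠ l) (hkl : k.unpair.1 ≤ l.unpair.1) :
    2 * width l ≤ |spike k - spike l| := (exists_gap l).choose_spec.2.2 k h hkl

/-- Heights of spikes. -/
def height (l : ℕ) : ℝ := (1 / 2) ^ l * width l ^ (l + 1)

lemma height_pos (l : ℕ) : 0 < height l := mul_pos (by positivity) (pow_pos (width_pos l) _)

/-- A function with spikes of prescribed values. -/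
def spikes (w : ℕ → ℂ) (t : ℝ) : ℂ :=
  ∑' l, w l * ((BallSeq.bump ℝ ((width l)⁻¹ • (t - spike l)) : ℝ) : ℂ)

variable {w w' : ℕ → ℂ} {C C' : ℝ}

lemma contDiff_bump_ofReal : ContDiff ℝ ∞ (fun t : ℝ => ((BallSeq.bump ℝ t : ℝ) : ℂ)) :=
  Complex.ofRealCLM.contDiff.comp (BallSeq.bump ℝ).contDiff

lemma norm_le_of_height (hw : ∀ l, ‖w l‖ ≤ C * height l) (l : ℕ) :
    ‖w l‖ ≤ C * ((1 / 2) ^ l * width l ^ l) := by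
  refine (hw l).trans ?_
  have hC : 0 ≤ C := by
    have := (norm_nonneg _).trans (hw l)
    exact nonneg_of_mul_nonneg_left this (height_pos l)
  refine mul_le_mul_of_nonneg_left (mul_le_mul_of_nonneg_left ?_ (by positivity)) hC
  exact pow_le_pow_of_le_one (width_pos l).le (width_le_one l) (Nat.le_succ l)

lemma exists_bound_iteratedFDeriv_bump (j : ℕ) :
    ∃ M : ℝ, ∀ x, ‖iteratedFDeriv ℝ j (fun t : ℝ => ((BallSeq.bump ℝ t : ℝ) : ℂ)) x‖ ≤ M := by
  have hc : HasCompactSupport (fun t : ℝ => ((BallSeq.bump ℝ t : ℝ) : ℂ)) :=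
    (BallSeq.bump ℝ).hasCompactSupport.comp_left Complex.ofReal_zero
  obtain ⟨M, hM⟩ := (hc.iteratedFDeriv (𝕜 := ℝ) j).exists_bound_of_continuous
    (contDiff_bump_ofReal.continuous_iteratedFDeriv (by exact_mod_cast le_top))
  exact ⟨M, hM⟩

lemma contDiff_spikes (hw : ∀ l, ‖w l‖ ≤ C * height l) : ContDiff ℝ ∞ (spikes w) := by
  refine contDiff_tsum_rescale width_pos width_le_one (norm_le_of_height hw)
    (H := fun _ t => ((BallSeq.bump ℝ t : ℝ) : ℂ)) (fun _ => contDiff_bump_ofReal) fun j => ?_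
  obtain ⟨M, hM⟩ := exists_bound_iteratedFDeriv_bump j
  exact ⟨M, Eventually.of_forall fun _ => hM⟩

lemma summable_spikes (hw : ∀ l, ‖w l‖ ≤ C * height l) (t : ℝ) :
    Summable fun l => w l * ((BallSeq.bump ℝ ((width l)⁻¹ • (t - spike l)) : ℝ) : ℂ) := by
  refine Summable.of_norm_bounded (g := fun l => C * (1 / 2) ^ l)
    ((summable_geometric_of_lt_one (by norm_num) (by norm_num)).mul_left C) fun l => ?_
  have hC : 0 ≤ C := nonneg_of_mul_nonneg_left ((norm_nonneg _).trans (hw l)) (height_pos l)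
  rw [norm_mul, Complex.norm_real, Real.norm_of_nonneg (BallSeq.bump ℝ).nonneg]
  refine (mul_le_of_le_one_right (norm_nonneg _) (BallSeq.bump ℝ).le_one).trans
    ((norm_le_of_height hw l).trans ?_)
  refine mul_le_mul_of_nonneg_left ?_ hC
  exact mul_le_of_le_one_right (by positivity) (pow_le_one₀ (width_pos l).le (width_le_one l))

lemma spikes_add (hw : ∀ l, ‖w l‖ ≤ C * height l) (hw' : ∀ l, ‖w' l‖ ≤ C' * height l) :
    spikes (fun l => w l + w' l) = fun t => spikes w t + spikes w' t := by
  funext t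
  simp only [spikes, add_mul]
  exact (summable_spikes hw t).tsum_add (summable_spikes hw' t)

lemma bump_rescale_eventually {k l : ℕ} (h : 2 * width l ≤ |spike k - spike l|) :
    ∀ᶠ t in 𝓝 (spike k), BallSeq.bump ℝ ((width l)⁻¹ • (t - spike l)) = 0 := by
  have hc : Continuous fun t : ℝ => |t - spike l| := by fun_prop
  have : width l < |spike k - spike l| := by
    have := width_pos l
    linarith
  filter_upwards [hc.continuousAt.eventually (lt_mem_nhds this)] with t ht
  refine (BallSeq.bump ℝ).zero_of_le_dist ?_
  rw [dist_zero_right, norm_smul, norm_inv, Real.norm_of_nonneg (width_pos l).le, Real.norm_eq_abs]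
  change (1 : ℝ) ≤ _
  rw [inv_mul_eq_div, one_le_div (width_pos l)]
  exact ht.le

lemma bump_rescale_eventually_one (k : ℕ) :
    ∀ᶠ t in 𝓝 (spike k), BallSeq.bump ℝ ((width k)⁻¹ • (t - spike k)) = 1 := by
  have hc : Continuous fun t : ℝ => (width k)⁻¹ • (t - spike k) := by fun_prop
  have h0 : (width k)⁻¹ • (spike k - spike k) = 0 := by simp
  have := hc.continuousAt (x := spike k)
  rw [ContinuousAt, h0] at this
  exact this.eventually (BallSeq.bump ℝ).eventuallyEq_one

/-- The condition says that no other spike with a nonzero coefficient reaches the centre of the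
`k`-th one. For an arbitrary coefficient sequence this fails for spikes of lower class than `k`,
which therefore have to be treated apart. -/
lemma spikes_spike {k : ℕ} (hk : ∀ l, l ≠ k → w l ≠ 0 → 2 * width l ≤ |spike k - spike l|) :
    spikes w (spike k) = w k := by
  rw [spikes, tsum_eq_single k, (bump_rescale_eventually_one k).self_of_nhds]
  · simp
  · intro l hl
    by_cases h0 : w l = 0
    · simp [h0]
    · rw [(bump_rescale_eventually (hk l hl h0)).self_of_nhds]
      simp

/-- The series is differentiated term by term. Each term is constant near `spike k`, on a
neighbourhood that depends on the term. -/
lemma deriv_spikes_spike (hw : ∀ l, ‖w l‖ ≤ C * height l) {k : ℕ}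
    (hk : ∀ l, l ≠ k → w l ≠ 0 → 2 * width l ≤ |spike k - spike l|) :
    deriv (spikes w) (spike k) = 0 := by
  obtain ⟨M, hM⟩ := exists_bound_iteratedFDeriv_bump 1
  have hC : 0 ≤ C := nonneg_of_mul_nonneg_left ((norm_nonneg _).trans (hw 0)) (height_pos 0)
  have hM0 : 0 ≤ M := (norm_nonneg _).trans (hM 0)
  have hd : ∀ l, ContDiff ℝ ∞ fun t : ℝ =>
      w l * ((BallSeq.bump ℝ ((width l)⁻¹ • (t - spike l)) : ℝ) : ℂ) := fun l =>
    contDiff_const.mul (contDiff_bump_ofReal.comp (by fun_prop))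
  have hbd : ∀ l t, ‖deriv (fun t : ℝ =>
      w l * ((BallSeq.bump ℝ ((width l)⁻¹ • (t - spike l)) : ℝ) : ℂ)) t‖ ≤
        C * M * (1 / 2) ^ l := by
    intro l t
    have hdiff : Differentiable ℝ fun t : ℝ =>
        ((BallSeq.bump ℝ ((width l)⁻¹ • (t - spike l)) : ℝ) : ℂ) :=
      (contDiff_bump_ofReal.comp (by fun_prop)).differentiable (n := ∞) (by simp)
    rw [deriv_const_mul _ (hdiff t), norm_mul]
    have h1 : ‖deriv (fun t : ℝ => ((BallSeq.bump ℝ ((width l)⁻¹ • (t - spike l)) : ℝ) : ℂ)) t‖ ≤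
        (width l)⁻¹ * M := by
      have h2 := norm_iteratedFDeriv_rescale_le contDiff_bump_ofReal (spike l) (width l)⁻¹ 1 t
      rw [norm_iteratedFDeriv_one, ← norm_deriv_eq_norm_fderiv] at h2
      refine h2.trans ?_
      rw [pow_one, abs_of_pos (inv_pos.2 (width_pos l))]
      exact mul_le_mul_of_nonneg_left (hM _) (inv_pos.2 (width_pos l)).le
    refine (mul_le_mul (hw l) h1 (norm_nonneg _) (mul_nonneg hC (height_pos l).le)).trans ?_
    -- The exponent `l + 1` in `height` keeps this bounded after the division by the width, also for
    -- `l = 0`.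
    have h3 : height l * (width l)⁻¹ = (1 / 2) ^ l * width l ^ l := by
      rw [height, pow_succ, mul_assoc, mul_assoc, mul_inv_cancel₀ (width_pos l).ne', mul_one]
    calc C * height l * ((width l)⁻¹ * M) = C * M * (height l * (width l)⁻¹) := by ring
      _ ≤ C * M * (1 / 2) ^ l := by
        rw [h3]
        refine mul_le_mul_of_nonneg_left ?_ (mul_nonneg hC hM0)
        exact mul_le_of_le_one_right (by positivity)
          (pow_le_one₀ (width_pos l).le (width_le_one l))
  have := deriv_tsum_apply (y₀ := 0) ((summable_geometric_of_lt_one (r := (1 / 2 : ℝ))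
    (by norm_num) (by norm_num)).mul_left (C * M)) (fun l => (hd l).differentiable (by simp)) hbd
    (summable_spikes hw 0) (spike k)
  unfold spikes
  rw [this]
  refine (tsum_congr fun l => ?_).trans tsum_zero
  by_cases h0 : w l = 0
  · simp [h0]
  · have hloc : (fun t : ℝ => w l * ((BallSeq.bump ℝ ((width l)⁻¹ • (t - spike l)) : ℝ) : ℂ))
        =ᶠ[𝓝 (spike k)] fun _ => if l = k then w l else 0 := by
      by_cases hl : l = k
      · subst hl
        filter_upwards [bump_rescale_eventually_one l] with t ht
        simp only [ht, if_true]
        simp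
      · filter_upwards [bump_rescale_eventually (hk l hl h0)] with t ht
        simp only [ht, hl, if_false]
        simp
    rw [hloc.deriv_eq, deriv_const]

end Spikes

end FourierMukai

end

noncomputable section

namespace FourierMukai

open Filter Metric

set_option linter.unusedSectionVars false

/-! ### Derivations of germs that kill the linear forms vanish. -/

section LocalDerivation

variable {E : Type*} [NormedAddCommGroup E] [NormedSpace ℝ E] [FiniteDimensional ℝ E] {p : E}
  {D : (E → ℂ) → E → ℂ}

/-- First-order expansion of a function of one linear form along a bounded sequence of values. -/
lemma nd_comp_form (hD : IsGermDerivation p D) (S : BallSeq p) (ℓ : E →L[ℝ] ℝ) {G : ℝ → ℂ}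
    (hG : ContDiff ℝ ∞ G) {t : ℕ → ℝ} {R : ℝ} (ht : ∀ k, |t k| ≤ R) :
    ∀ᶠ k in atTop, ∀ y, ‖y‖ < 1 / 2 → ℓ y = t k →
      S.nd D (fun _ y => G (ℓ y)) k y = S.nd D (fun k _ => G (t k)) k y + deriv G (t k) *
        (S.nd D (fun _ y => (ℓ y : ℂ)) k y - S.nd D (fun k _ => (t k : ℂ)) k y) := by
  obtain ⟨Γ, hΓ, hΓG, hΓd⟩ := exists_hadamard hG
  have hℓ : IsUnifSmooth (fun (_ : ℕ) y => (ℓ y : ℂ)) := by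
    have := isUnifSmooth_comp_affine (E := E) Complex.ofRealCLM.contDiff (c := fun _ => (0 : ℝ))
      (A := fun _ => ℓ) (R := 0) (R' := ‖ℓ‖) (by simp) (fun _ => le_rfl)
    simpa using this
  have htu : IsUnifSmooth (fun k (_ : E) => (t k : ℂ)) :=
    isUnifSmooth_const (R := R) fun k => by simpa using ht k
  obtain ⟨M, hM⟩ := (isCompact_closedBall (0 : ℝ) R).exists_bound_of_continuousOn
    hG.continuous.continuousOn
  have hGt : IsUnifSmooth (fun k (_ : E) => G (t k)) :=
    isUnifSmooth_const (R := M) fun k => hM _ (by simpa using ht k)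
  have hγ : IsUnifSmooth (fun k y => Γ (t k, ℓ y) 1) := by
    have h1 : ContDiff ℝ ∞ (fun x : ℝ × ℝ => Γ x 1) := hΓ.clm_apply contDiff_const
    have h2 := isUnifSmooth_comp_affine (E := E) h1 (c := fun k => (t k, (0 : ℝ)))
      (A := fun _ => (0 : E →L[ℝ] ℝ).prod ℓ) (R := R) (R' := ‖(0 : E →L[ℝ] ℝ).prod ℓ‖)
      (fun k => by simpa [Prod.norm_def] using ht k) (fun _ => le_rfl)
    simpa using h2
  have hdiff : IsUnifSmooth (fun k y => (ℓ y : ℂ) - (t k : ℂ)) := by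
    have h1 := hℓ.add ((isUnifSmooth_const (E := E) (s := fun _ => (-1 : ℂ)) (R := 1)
      (by simp)).mul htu)
    simpa [← sub_eq_add_neg] using h1
  -- Hadamard's expansion of `G` around the moving value `t k`. Where `ℓ y = t k`, the factor `ℓ y -
  -- t k` is zero, so in the Leibniz rule only its derivative survives, multiplied by `Γ (t k, t k)
  -- 1`, the derivative of `G` at `t k`.
  have e : (fun (k : ℕ) y => G (ℓ y)) =
      fun k y => G (t k) + ((ℓ y : ℂ) - (t k : ℂ)) * Γ (t k, ℓ y) 1 := by
    funext k y
    rw [hΓG (t k) (ℓ y)]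
    have : Γ (t k, ℓ y) (ℓ y - t k) = (ℓ y - t k) • Γ (t k, ℓ y) 1 := by
      rw [← map_smul, smul_eq_mul, mul_one]
    rw [this, Complex.real_smul, Complex.ofReal_sub]
  filter_upwards [S.nd_add hD hGt (hdiff.mul hγ), S.nd_mul hD hdiff hγ, S.nd_sub hD hℓ htu]
    with k h1 h2 h3 y hy hyt
  rw [e, h1 y hy, h2 y hy, h3 y hy, hyt, hΓd, sub_self, zero_mul, zero_add, fderiv_apply_one_eq_deriv]

/-- The values at which the spikes are tested. -/
def testVal (k : ℕ) : ℝ := if |spike k| < 1 / 2 then spike k else 0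

lemma abs_testVal_lt (k : ℕ) : |testVal k| < 1 / 2 := by
  unfold testVal
  split_ifs with h
  · exact h
  · simp

/-- The property that a function of one variable is differentiated correctly at almost all spikes
of a class. -/
def ObeysChainRule (D : (E → ℂ) → E → ℂ) (S : BallSeq p) (e : E) (G : ℝ → ℂ) (n : ℕ) : Prop :=
  ∀ᶠ k in atTop, k.unpair.1 = n → |spike k| < 1 / 2 →
    S.nd D (fun k _ => G (testVal k)) k (testVal k • e) =
      deriv G (testVal k) * S.nd D (fun k _ => (testVal k : ℂ)) k (testVal k • e)

/-- For a fixed number `t` the constant sequences have derivative zero, so `nd_comp_form` gives the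
chain rule for `G ∘ ℓ` at `t • e` from some index on. The sets of `t` for which a given index
suffices are closed and cover an interval; by Baire's theorem one of them has interior points, hence
contains a neighbourhood of a rational number, and with it almost all spikes of the corresponding
class. Comparison with `nd_comp_form` along these spikes leaves the chain rule for the sequence of
numbers. -/
lemma exists_obeysChainRule (hD : IsGermDerivation p D) (S : BallSeq p) (ℓ : E →L[ℝ] ℝ) {e : E}
    (he : ‖e‖ = 1) (hℓe : ℓ e = 1) {G : ℝ → ℂ} (hG : ContDiff ℝ ∞ G) :
    ∃ n, |(Denumerable.ofNat ℚ n : ℝ)| < 1 / 4 ∧ ObeysChainRule D S e G n := by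
  have hℓ : ∀ {Φ : ℝ → ℂ}, ContDiff ℝ ∞ Φ → IsUnifSmooth (fun (_ : ℕ) y => Φ (ℓ y)) := by
    intro Φ hΦ
    have := isUnifSmooth_comp_affine (E := E) hΦ (c := fun _ => (0 : ℝ))
      (A := fun _ => ℓ) (R := 0) (R' := ‖ℓ‖) (by simp) (fun _ => le_rfl)
    simpa using this
  have hid : IsUnifSmooth (fun (_ : ℕ) y => (ℓ y : ℂ)) := hℓ Complex.ofRealCLM.contDiff
  have hnorm : ∀ {t : ℝ}, |t| < 1 / 2 → ‖t • e‖ < 1 / 2 := fun {t} ht => by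
    rwa [norm_smul, he, mul_one]
  -- The derivatives are known to be continuous for large indices only; the second bound `N ≤ k` in
  -- `A m` is what makes these sets closed.
  obtain ⟨N, hN⟩ := eventually_atTop.1 ((S.continuousOn_nd hD (hℓ hG)).and
    (S.continuousOn_nd hD hid))
  let A : ℕ → Set (Set.Icc (-1 / 4 : ℝ) (1 / 4)) := fun m => {t | ∀ k, m ≤ k → N ≤ k →
    S.nd D (fun _ y => G (ℓ y)) k ((t : ℝ) • e) =
      deriv G t * S.nd D (fun _ y => (ℓ y : ℂ)) k ((t : ℝ) • e)}
  have hIcc : ∀ t : Set.Icc (-1 / 4 : ℝ) (1 / 4), |(t : ℝ)| < 1 / 2 := by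
    intro t
    rw [abs_lt]
    have h1 := t.2.1
    have h2 := t.2.2
    constructor <;> linarith
  have hclosed : ∀ m, IsClosed (A m) := by
    intro m
    simp only [A, Set.ofPred_forall]
    refine isClosed_iInter fun k => isClosed_iInter fun _ => isClosed_iInter fun hk => ?_
    have hc : Continuous fun t : Set.Icc (-1 / 4 : ℝ) (1 / 4) => (t : ℝ) • e := by fun_prop
    have hcomp : ∀ {F : E → ℂ}, ContinuousOn F (ball 0 (1 / 2)) →
        Continuous fun t : Set.Icc (-1 / 4 : ℝ) (1 / 4) => F ((t : ℝ) • e) := fun hF =>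
      hF.comp_continuous hc fun t => by simpa using hnorm (hIcc t)
    have hdG : Continuous (deriv G) := hG.continuous_deriv (by simp)
    exact isClosed_eq (hcomp (hN k hk).1)
      ((hdG.comp continuous_subtype_val).mul (hcomp (hN k hk).2))
  have hunion : ⋃ m, A m = Set.univ := by
    refine Set.eq_univ_of_forall fun t => ?_
    have h1 := nd_comp_form hD S ℓ hG (t := fun _ => (t : ℝ)) (R := |(t : ℝ)|) fun _ => le_rfl
    obtain ⟨m, hm⟩ := eventually_atTop.1
      ((h1.and (S.nd_const hD (G t))).and (S.nd_const hD ((t : ℝ) : ℂ)))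
    refine Set.mem_iUnion.2 ⟨m, fun k hk _ => ?_⟩
    obtain ⟨⟨h2, h3⟩, h4⟩ := hm k hk
    have hy := hnorm (hIcc t)
    rw [h2 _ hy (by simp [hℓe]), h3 _ hy, h4 _ hy, zero_add, sub_zero]
  have : Nonempty (Set.Icc (-1 / 4 : ℝ) (1 / 4)) := ⟨⟨0, by constructor <;> norm_num⟩⟩
  obtain ⟨m, t₀, ht₀⟩ := nonempty_interior_of_iUnion_of_closed hclosed hunion
  obtain ⟨V, hV, hVo, ht₀V⟩ := mem_interior.1 ht₀
  obtain ⟨O, hO, rfl⟩ := isOpen_induced_iff.1 hVo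
  -- The interior point `t₀` is interior relative to the closed interval and may be an end point; a
  -- rational number is therefore taken in the open interval, close to it.
  have hcl : (t₀ : ℝ) ∈ closure (Set.Ioo (-1 / 4 : ℝ) (1 / 4)) := by
    rw [closure_Ioo (by norm_num)]
    exact t₀.2
  obtain ⟨x, hx⟩ := Rat.denseRange_cast.exists_mem_open (hO.inter isOpen_Ioo)
    (mem_closure_iff.1 hcl O hO ht₀V)
  obtain ⟨n, rfl⟩ : ∃ n, Denumerable.ofNat ℚ n = x := ⟨Denumerable.eqv ℚ x, (Denumerable.eqv ℚ).symm_apply_apply x⟩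
  refine ⟨n, abs_lt.2 ⟨by have := hx.2.1; linarith, hx.2.2⟩, ?_⟩
  have h1 := eventually_unpair (P := fun k => spike k ∈ O ∩ Set.Ioo (-1 / 4) (1 / 4)) n
    ((tendsto_spike n).eventually ((hO.inter isOpen_Ioo).mem_nhds hx))
  have h2 := nd_comp_form hD S ℓ hG (t := testVal) (R := 1 / 2) fun k => (abs_testVal_lt k).le
  filter_upwards [h1, h2, eventually_ge_atTop m, eventually_ge_atTop N] with k h3 h4 h5 h6 hkn hk
  have ht : testVal k = spike k := if_pos hk
  have hmem := h3 hkn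
  rw [← ht] at hmem
  have h7 := hV (show (⟨testVal k, hmem.2.1.le, hmem.2.2.le⟩ : Set.Icc (-1 / 4 : ℝ) (1 / 4)) ∈ _
    from hmem.1) k h5 h6
  have h8 := h4 (testVal k • e) (hnorm (abs_testVal_lt k)) (by simp [hℓe])
  simp only at h7
  rw [h7] at h8
  linear_combination -h8

/-- The three possible values of a spike. -/
def spikeVal (s : ℕ → ℂ) (c : Fin 3) (k : ℕ) : ℂ :=
  ![0, (height k : ℂ), height k * s k] c

lemma norm_spikeVal_le {s : ℕ → ℂ} {R : ℝ} (hR : 1 ≤ R) (hs : ∀ k, ‖s k‖ ≤ R) (c : Fin 3) (k : ℕ) :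
    ‖spikeVal s c k‖ ≤ R * height k := by
  have h := height_pos k
  fin_cases c
  · simp only [spikeVal, Fin.zero_eta, Matrix.cons_val_zero, norm_zero]
    positivity
  · simp only [spikeVal, Fin.mk_one, Matrix.cons_val_one, Matrix.cons_val_zero, Complex.norm_real,
      Real.norm_of_nonneg h.le]
    exact le_mul_of_one_le_left h.le hR
  · simp only [spikeVal, Fin.reduceFinMk, Matrix.cons_val, norm_mul, Complex.norm_real,
      Real.norm_of_nonneg h.le]
    rw [mul_comm]
    exact mul_le_mul_of_nonneg_right (hs k) h.le

/-- A choice of the values of the spikes, for the classes below `n`. -/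
def spikesBelow (s : ℕ → ℂ) (o : ℕ → Fin 3) (n l : ℕ) : ℂ :=
  if l.unpair.1 < n then spikeVal s (o l.unpair.1) l else 0

lemma height_le_one (k : ℕ) : height k ≤ 1 :=
  mul_le_one₀ (pow_le_one₀ (by norm_num) (by norm_num)) (pow_pos (width_pos k) _).le
    (pow_le_one₀ (width_pos k).le (width_le_one k))

lemma isUnifSmooth_comp_testVal {G : ℝ → ℂ} (hG : Continuous G) :
    IsUnifSmooth (fun k (_ : E) => G (testVal k)) := by
  obtain ⟨M, hM⟩ := (isCompact_closedBall (0 : ℝ) (1 / 2)).exists_bound_of_continuousOn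
    hG.continuousOn
  exact isUnifSmooth_const (R := M) fun k => hM _ (by simpa using (abs_testVal_lt k).le)

/-- There is a function that is differentiated wrongly at infinitely many spikes of each class. -/
lemma exists_not_obeysChainRule (hD : IsGermDerivation p D) (S : BallSeq p) {e : E} (he : ‖e‖ = 1)
    {s : ℕ → ℂ} {R : ℝ} (hs : ∀ k, ‖s k‖ ≤ R)
    (hne : ∀ᶠ k in atTop, ∀ y, ‖y‖ < 1 / 2 → S.nd D (fun k _ => s k) k y ≠ 0) :
    ∃ G : ℝ → ℂ, ContDiff ℝ ∞ G ∧ ∀ n, |(Denumerable.ofNat ℚ n : ℝ)| < 1 / 4 →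
      ¬ ObeysChainRule D S e G n := by
  set R' := max 1 R with hR'
  have hR1 : 1 ≤ R' := le_max_left _ _
  have hs' : ∀ k, ‖s k‖ ≤ R' := fun k => (hs k).trans (le_max_right _ _)
  have hnorm : ∀ k, ‖testVal k • e‖ < 1 / 2 := fun k => by
    rw [norm_smul, he, mul_one]
    exact abs_testVal_lt k
  have hbelow : ∀ o n l, ‖spikesBelow s o n l‖ ≤ R' * height l := by
    intro o n l
    unfold spikesBelow
    split_ifs
    · exact norm_spikeVal_le hR1 hs' _ _
    · rw [norm_zero]
      exact mul_nonneg (by linarith) (height_pos l).le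
  have hvalU : ∀ c, IsUnifSmooth (fun k (_ : E) => spikeVal s c k) := fun c =>
    isUnifSmooth_const (R := R') fun k => (norm_spikeVal_le hR1 hs' c k).trans
      (mul_le_of_le_one_right (by linarith) (height_le_one k))
  -- `Q o n c` is the chain rule for the class `n` when its spikes take the values of option `c`.
  -- Other spikes of class at least `n` do not reach the test points, and the spike itself has
  -- derivative zero there; so the right-hand side involves only the classes below `n` and does not
  -- depend on `c`.
  let Q : (ℕ → Fin 3) → ℕ → Fin 3 → Prop := fun o n c => ∀ᶠ k in atTop,
    k.unpair.1 = n → |spike k| < 1 / 2 →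
    S.nd D (fun k _ => spikeVal s c k) k (testVal k • e) =
      deriv (spikes (spikesBelow s o n)) (testVal k) *
        S.nd D (fun k _ => (testVal k : ℂ)) k (testVal k • e) -
      S.nd D (fun k _ => spikes (spikesBelow s o n) (testVal k)) k (testVal k • e)
  -- The three options cannot all obey the rule: option `0` makes the right-hand side vanish, then
  -- `height` and `height * s` have derivative zero, and the Leibniz rule forces the derivative of
  -- `s` to vanish, contrary to `hne`.
  have hex : ∀ o n, ∃ c, |(Denumerable.ofNat ℚ n : ℝ)| < 1 / 4 → ¬ Q o n c := by
    intro o n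
    by_contra hcon
    push Not at hcon
    obtain ⟨hn, h0⟩ := hcon 0
    have h1 := (hcon 1).2
    have h2 := (hcon 2).2
    have hsu : IsUnifSmooth (fun k (_ : E) => s k) := isUnifSmooth_const hs
    have hall : ∀ᶠ k in atTop, k.unpair.1 = n → ¬ |spike k| < 1 / 2 := by
      filter_upwards [h0, h1, h2, hne, S.nd_mul hD (hvalU 1) hsu, S.nd_const hD 0]
        with k e0 e1 e2 e3 e4 e5 hk hk'
      have e0 := e0 hk hk'
      have e1 := e1 hk hk'
      have e2 := e2 hk hk'
      have e4 := e4 _ (hnorm k)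
      have f0 : (fun k (_ : E) => spikeVal s 0 k) = fun _ _ => 0 := rfl
      have f2 : (fun k (_ : E) => spikeVal s 1 k * s k) = fun k _ => spikeVal s 2 k := rfl
      rw [f0, e5 _ (hnorm k)] at e0
      rw [f2, e1, e2, ← e0, mul_zero, add_zero] at e4
      have hh : spikeVal s 1 k ≠ 0 := by
        change ((height k : ℝ) : ℂ) ≠ 0
        exact_mod_cast (height_pos k).ne'
      exact e3 _ (hnorm k) ((mul_eq_zero.1 e4.symm).resolve_left hh)
    have hev : ∀ᶠ k in atTop, k.unpair.1 = n → |spike k| < 1 / 2 := by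
      refine eventually_unpair n ?_
      exact (tendsto_spike n).abs.eventually (gt_mem_nhds (by linarith))
    obtain ⟨K, hK⟩ := eventually_atTop.1 (hall.and hev)
    have h3 := hK (Nat.pair n K) (Nat.right_le_pair n K)
    exact h3.1 (by simp) (h3.2 (by simp))
  choose f hf using hex
  -- The option that fails for the class `n` depends on the options of lower classes, hence the
  -- recursion.
  let o : ℕ → Fin 3 := Nat.lt_wfRel.wf.fix (C := fun _ => Fin 3)
    (fun n prev => f (fun m => if h : m < n then prev m h else 0) n)
  have ho : ∀ n, o n = f (fun m => if m < n then o m else 0) n := by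
    intro n
    have := Nat.lt_wfRel.wf.fix_eq (C := fun _ => Fin 3)
      (fun n prev => f (fun m => if h : m < n then prev m h else 0) n) n
    simp only [dite_eq_ite] at this
    exact this
  let w : ℕ → ℂ := fun l => spikeVal s (o l.unpair.1) l
  have hw : ∀ l, ‖w l‖ ≤ R' * height l := fun l => norm_spikeVal_le hR1 hs' _ _
  refine ⟨spikes w, contDiff_spikes hw, fun n hn hP => ?_⟩
  have hb : spikesBelow s (fun m => if m < n then o m else 0) n = spikesBelow s o n := by
    funext l
    unfold spikesBelow
    split_ifs with hl
    · simp [hl]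
    · rfl
  refine hf (fun m => if m < n then o m else 0) n hn ?_
  rw [← ho]
  simp only [Q, hb]
  -- The spikes of class at least `n`. At the spikes of class `n` their sum takes the prescribed
  -- values with derivative zero, by the choice of the widths.
  let v : ℕ → ℂ := fun l => if l.unpair.1 < n then 0 else w l
  have hv : ∀ l, ‖v l‖ ≤ R' * height l := by
    intro l
    simp only [v]
    split_ifs
    · rw [norm_zero]
      exact mul_nonneg (by linarith) (height_pos l).le
    · exact hw l
  have hwv : spikes w = fun t => spikes (spikesBelow s o n) t + spikes v t := by
    rw [← spikes_add (hbelow o n) hv]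
    congr 1
    funext l
    simp only [spikesBelow, v, w]
    split_ifs <;> simp
  have hgap : ∀ k, k.unpair.1 = n → ∀ l, l ≠ k → v l ≠ 0 → 2 * width l ≤ |spike k - spike l| := by
    intro k hk l hl hvl
    refine two_mul_width_le hl.symm ?_
    by_contra hlt
    exact hvl (if_pos (by omega))
  let K : Set ℕ := {k | k.unpair.1 = n ∧ |spike k| < 1 / 2}
  have hcv : ContDiff ℝ ∞ (spikes v) := contDiff_spikes hv
  have hcb : ContDiff ℝ ∞ (spikes (spikesBelow s o n)) := contDiff_spikes (hbelow o n)
  have hvU := isUnifSmooth_comp_testVal (E := E) hcv.continuous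
  have hbU := isUnifSmooth_comp_testVal (E := E) hcb.continuous
  have hzero : ∀ k ∈ K, ∀ _y : E, spikes v (testVal k) - spikeVal s (o n) k = 0 := by
    rintro k ⟨hk, hk'⟩ _
    have ht : testVal k = spike k := if_pos hk'
    rw [ht, spikes_spike (hgap k hk), sub_eq_zero]
    simp [v, w, hk]
  have hdU : IsUnifSmooth (fun k (_ : E) => spikes v (testVal k) - spikeVal s (o n) k) := by
    have h1 := hvU.add ((isUnifSmooth_const (E := E) (s := fun _ => (-1 : ℂ)) (R := 1)
      (by simp)).mul (hvalU (o n)))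
    simpa [← sub_eq_add_neg] using h1
  filter_upwards [hP, S.nd_add hD hbU hvU, S.nd_sub hD hvU (hvalU (o n)), S.nd_eq_zero hD hdU hzero]
    with k h1 h2 h3 h4 hk hk'
  have h1 := h1 hk hk'
  have h4 := h4 ⟨hk, hk'⟩ _ (hnorm k)
  rw [h3 _ (hnorm k), sub_eq_zero] at h4
  have ht : testVal k = spike k := if_pos hk'
  have hder : deriv (spikes w) (testVal k) = deriv (spikes (spikesBelow s o n)) (testVal k) := by
    rw [hwv, deriv_fun_add (hcb.differentiable (by simp) _) (hcv.differentiable (by simp) _)]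
    nth_rewrite 2 [ht]
    rw [deriv_spikes_spike hv (hgap k hk), add_zero]
  rw [hder] at h1
  simp only [hwv] at h1
  rw [h2 _ (hnorm k), h4] at h1
  linear_combination h1

/-- A derivation of the germs of smooth functions that kills the linear forms is zero. -/
theorem IsGermDerivation.eventuallyEq_zero (hD : IsGermDerivation p D)
    (hlin : ∀ ℓ : E →L[ℝ] ℝ, D (fun x => (ℓ x : ℂ)) =ᶠ[𝓝 p] 0) {f : E → ℂ} (hf : SmoothNear p f) :
    D f =ᶠ[𝓝 p] 0 := by
  obtain ⟨ε, hε, hball⟩ := Metric.eventually_nhds_iff.1 hf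
  let χ : ContDiffBump p := ⟨ε / 4, ε / 2, by positivity, by linarith⟩
  let f₁ : E → ℂ := fun x => (χ x : ℂ) * f x
  have hf₁ : ContDiff ℝ ∞ f₁ := by
    rw [contDiff_iff_contDiffAt]
    intro x
    by_cases hx : dist x p < ε
    · exact (Complex.ofRealCLM.contDiff.comp χ.contDiff).contDiffAt.mul (hball hx)
    · have h1 : ∀ᶠ y in 𝓝 x, ε / 2 < dist y p :=
        (continuous_id.dist continuous_const).continuousAt.eventually
          (lt_mem_nhds (by simp only [id]; linarith))
      have h2 : f₁ =ᶠ[𝓝 x] fun _ => 0 := by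
        filter_upwards [h1] with y hy
        simp [f₁, χ.zero_of_le_dist hy.le]
      exact contDiffAt_const.congr_of_eventuallyEq h2
  have hff : f =ᶠ[𝓝 p] f₁ := by
    filter_upwards [χ.eventuallyEq_one] with x hx
    simp [f₁, hx]
  refine (hD.congr f f₁ hf hff).trans ?_
  by_contra hcon
  rcases subsingleton_or_nontrivial E with hE | hE
  · have : f₁ = fun _ => f₁ p := funext fun x => by rw [Subsingleton.elim x p]
    rw [this] at hcon
    exact hcon (hD.const _)
  have hfr : ∃ᶠ x in 𝓝 p, D f₁ x ≠ 0 := by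
    rw [Filter.Frequently]
    intro h
    refine hcon ?_
    filter_upwards [h] with x hx
    simpa using hx
  -- The balls need centres different from `p`. If `p` itself is a point where `D f₁` does not
  -- vanish, continuity supplies others.
  have hne : ∃ᶠ x in 𝓝[≠] p, D f₁ x ≠ 0 := by
    by_cases hp : D f₁ p = 0
    · rw [Filter.Frequently, eventually_nhdsWithin_iff]
      intro h
      refine hfr ?_
      filter_upwards [h] with x hx hx0
      refine hx ?_ hx0
      rintro rfl
      exact hx0 hp
    · have hc : ContinuousAt (D f₁) p :=
        (hD.smooth _ (hf₁.smoothNear p)).self_of_nhds.continuousAt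
      have : (𝓝[≠] p).NeBot := Module.punctured_nhds_neBot ℝ E p
      exact ((hc.eventually_ne hp).filter_mono nhdsWithin_le_nhds).frequently
  obtain ⟨S, s, R, hs, hfr⟩ := exists_nd_frequently_ne_zero hD hlin hf₁ hne
  obtain ⟨S', s', hs', hev⟩ := exists_nd_ne_zero hD hs hfr
  obtain ⟨e, he⟩ := exists_norm_eq (E := E) zero_le_one
  obtain ⟨ℓ, -, hℓ⟩ := exists_dual_vector ℝ e
    (by rw [← norm_ne_zero_iff, he]; norm_num)
  -- `G` breaks the chain rule in every class whose limit is smaller than `1 / 4` in absolute value,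
  -- whereas the Baire argument finds such a class in which it holds.
  obtain ⟨G, hG, hbad⟩ := exists_not_obeysChainRule hD S' he hs' hev
  obtain ⟨n, hn, hgood⟩ := exists_obeysChainRule hD S' ℓ he (by simpa [he] using hℓ) hG
  exact hbad n hn hgood

end LocalDerivation

end FourierMukai

end

noncomputable section

namespace FourierMukai

open Filter Metric

set_option linter.unusedSectionVars false

/-! ### Germs of functions, and derivations induced by operators on functions. -/

section GermLemmas

variable {Y : Type*} [SmoothSpace Y] {y : Y}

lemma germ_eq_iff {φ ψ : Y → ℂ} (hφ : φ ∈ smoothNear y) (hψ : ψ ∈ smoothNear y) :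
    germ y φ = germ y ψ ↔ φ =ᶠ[𝓝 y] ψ := by
  rw [germ_of_mem hφ, germ_of_mem hψ]
  refine (Ideal.Quotient.eq (I := vanishingNear y)).trans ?_
  change (∀ᶠ y' in 𝓝 y, φ y' - ψ y' = 0) ↔ _
  simp only [sub_eq_zero]
  rfl

lemma exists_germ (r : SGerm y) : ∃ φ ∈ smoothNear y, germ y φ = r := by
  obtain ⟨⟨φ, hφ⟩, rfl⟩ := Ideal.Quotient.mk_surjective (I := vanishingNear y) r
  exact ⟨φ, hφ, germ_of_mem hφ⟩

lemma germ_add {φ ψ : Y → ℂ} (hφ : φ ∈ smoothNear y) (hψ : ψ ∈ smoothNear y) :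
    germ y (φ + ψ) = germ y φ + germ y ψ := by
  rw [germ_of_mem hφ, germ_of_mem hψ, germ_of_mem (add_mem hφ hψ)]
  rfl

lemma const_mem (c : ℂ) : (fun _ : Y => c) ∈ smoothNear y := Subalgebra.algebraMap_mem _ c

lemma germ_const (c : ℂ) : germ y (fun _ => c) = algebraMap ℂ (SGerm y) c := by
  rw [germ_of_mem (const_mem c)]
  rfl

lemma germ_const_zero : germ y (fun _ => (0 : ℂ)) = 0 := by rw [germ_const, map_zero]

lemma germ_const_one : germ y (fun _ => (1 : ℂ)) = 1 := by rw [germ_const, map_one]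

lemma germ_sub {φ ψ : Y → ℂ} (hφ : φ ∈ smoothNear y) (hψ : ψ ∈ smoothNear y) :
    germ y (φ - ψ) = germ y φ - germ y ψ := by
  rw [germ_of_mem hφ, germ_of_mem hψ, germ_of_mem (sub_mem hφ hψ)]
  rfl

lemma germ_sum {ι : Type*} (s : Finset ι) {φ : ι → Y → ℂ} (hφ : ∀ i, φ i ∈ smoothNear y) :
    germ y (∑ i ∈ s, φ i) = ∑ i ∈ s, germ y (φ i) := by
  classical
  induction s using Finset.induction_on with
  | empty => exact germ_const_zero
  | insert i s hi ih =>
    rw [Finset.sum_insert hi, Finset.sum_insert hi, germ_add (hφ i) (sum_mem fun i _ => hφ i), ih]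

lemma pullback_germ {Y' : Type*} [SmoothSpace Y'] {f : Y' → Y} (hf : IsSmoothMap f) (y' : Y')
    (h : f y' = y) {φ : Y → ℂ} (hφ : φ ∈ smoothNear y) :
    pullback hf y' y h (germ y φ) = germ y' (φ ∘ f) := by
  subst h
  rw [germ_of_mem hφ, germ_of_mem (hf.comp_mem y' φ hφ)]
  rfl

lemma der_sum_apply {ι : Type*} (s : Finset ι) (θ : ι → Der y) (r : SGerm y) :
    (∑ i ∈ s, θ i) r = ∑ i ∈ s, θ i r := by
  classical
  induction s using Finset.induction_on with
  | empty => simp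
  | insert i s hi ih => rw [Finset.sum_insert hi, Finset.sum_insert hi, Derivation.add_apply, ih]

/-- An operator on functions that induces a derivation of the germs at `y`. -/
structure IsDerOp (y : Y) (T : (Y → ℂ) → Y → ℂ) : Prop where
  smooth : ∀ φ ∈ smoothNear y, T φ ∈ smoothNear y
  congr : ∀ φ ∈ smoothNear y, ∀ ψ ∈ smoothNear y, φ =ᶠ[𝓝 y] ψ → T φ =ᶠ[𝓝 y] T ψ
  add : ∀ φ ∈ smoothNear y, ∀ ψ ∈ smoothNear y, T (φ + ψ) =ᶠ[𝓝 y] T φ + T ψ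
  mul : ∀ φ ∈ smoothNear y, ∀ ψ ∈ smoothNear y, T (φ * ψ) =ᶠ[𝓝 y] φ * T ψ + ψ * T φ
  const : ∀ c : ℂ, T (fun _ => c) =ᶠ[𝓝 y] 0

lemma IsDerOp.germ_eq {T : (Y → ℂ) → Y → ℂ} (hT : IsDerOp y T) {φ ψ : Y → ℂ}
    (hφ : φ ∈ smoothNear y) (hψ : ψ ∈ smoothNear y) (h : germ y φ = germ y ψ) :
    germ y (T φ) = germ y (T ψ) :=
  (germ_eq_iff (hT.smooth φ hφ) (hT.smooth ψ hψ)).2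
    (hT.congr φ hφ ψ hψ ((germ_eq_iff hφ hψ).1 h))

lemma IsDerOp.germ_mul {T : (Y → ℂ) → Y → ℂ} (hT : IsDerOp y T) {φ ψ : Y → ℂ}
    (hφ : φ ∈ smoothNear y) (hψ : ψ ∈ smoothNear y) :
    germ y (T (φ * ψ)) = germ y φ * germ y (T ψ) + germ y ψ * germ y (T φ) := by
  rw [← FourierMukai.germ_mul hφ (hT.smooth _ hψ), ← FourierMukai.germ_mul hψ (hT.smooth _ hφ),
    ← germ_add (mul_mem hφ (hT.smooth _ hψ)) (mul_mem hψ (hT.smooth _ hφ))]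
  exact (germ_eq_iff (hT.smooth _ (mul_mem hφ hψ)) (add_mem (mul_mem hφ (hT.smooth _ hψ))
    (mul_mem hψ (hT.smooth _ hφ)))).2 (hT.mul φ hφ ψ hψ)

/-- The derivation of germs induced by an operator on functions. -/
def IsDerOp.der {T : (Y → ℂ) → Y → ℂ} (hT : IsDerOp y T) : Der y :=
  Derivation.mk'
    { toFun := fun r => germ y (T (exists_germ r).choose)
      map_add' := by
        intro r r'
        obtain ⟨h1, e1⟩ := (exists_germ r).choose_spec
        obtain ⟨h2, e2⟩ := (exists_germ r').choose_spec
        obtain ⟨h3, e3⟩ := (exists_germ (r + r')).choose_spec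
        rw [← germ_add (hT.smooth _ h1) (hT.smooth _ h2),
          hT.germ_eq h3 (add_mem h1 h2) (by rw [e3, germ_add h1 h2, e1, e2])]
        exact (germ_eq_iff (hT.smooth _ (add_mem h1 h2))
          (add_mem (hT.smooth _ h1) (hT.smooth _ h2))).2 (hT.add _ h1 _ h2)
      map_smul' := by
        intro c r
        obtain ⟨h1, e1⟩ := (exists_germ r).choose_spec
        obtain ⟨h3, e3⟩ := (exists_germ (c • r)).choose_spec
        rw [hT.germ_eq h3 (mul_mem (const_mem c) h1)
          (by rw [e3, FourierMukai.germ_mul (const_mem c) h1, e1, germ_const, Algebra.smul_def]),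
          hT.germ_mul (const_mem c) h1,
          (germ_eq_iff (hT.smooth _ (const_mem c)) (const_mem 0)).2 (hT.const c), germ_const_zero,
          mul_zero, add_zero, germ_const, RingHom.id_apply, Algebra.smul_def] }
    (by
      intro r r'
      obtain ⟨h1, e1⟩ := (exists_germ r).choose_spec
      obtain ⟨h2, e2⟩ := (exists_germ r').choose_spec
      obtain ⟨h3, e3⟩ := (exists_germ (r * r')).choose_spec
      have := hT.germ_mul h1 h2
      rw [← hT.germ_eq h3 (mul_mem h1 h2) (by rw [e3, FourierMukai.germ_mul h1 h2, e1, e2]),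
        e1, e2] at this
      exact this)

lemma IsDerOp.der_germ {T : (Y → ℂ) → Y → ℂ} (hT : IsDerOp y T) {φ : Y → ℂ}
    (hφ : φ ∈ smoothNear y) : hT.der (germ y φ) = germ y (T φ) := by
  obtain ⟨h1, e1⟩ := (exists_germ (germ y φ)).choose_spec
  exact hT.germ_eq h1 hφ e1

end GermLemmas

section PartialHomeomorph

variable {Y : Type*} [TopologicalSpace Y] {W : Type*} [TopologicalSpace W]
  {κ : OpenPartialHomeomorph Y W} {y : Y}

lemma eventually_symm (hy : y ∈ κ.source) {P : Y → Prop} (h : ∀ᶠ y' in 𝓝 y, P y') :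
    ∀ᶠ x in 𝓝 (κ y), P (κ.symm x) := by
  have := κ.continuousAt_symm (κ.map_source hy)
  rw [ContinuousAt, κ.left_inv hy] at this
  exact this.eventually h

lemma eventually_apply (hy : y ∈ κ.source) {P : W → Prop} (h : ∀ᶠ x in 𝓝 (κ y), P x) :
    ∀ᶠ y' in 𝓝 y, P (κ y') := (κ.continuousAt hy).eventually h

lemma eventually_left_inv (hy : y ∈ κ.source) : ∀ᶠ y' in 𝓝 y, y' ∈ κ.source ∧ κ.symm (κ y') = y' :=
  Filter.mem_of_superset (κ.open_source.mem_nhds hy) fun _ h => ⟨h, κ.left_inv h⟩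

lemma eventually_right_inv (hy : y ∈ κ.source) :
    ∀ᶠ x in 𝓝 (κ y), x ∈ κ.target ∧ κ (κ.symm x) = x :=
  Filter.mem_of_superset (κ.open_target.mem_nhds (κ.map_source hy))
    fun _ h => ⟨h, κ.right_inv h⟩

lemma eventually_iff_symm (hy : y ∈ κ.source) {P : Y → Prop} :
    (∀ᶠ y' in 𝓝 y, P y') ↔ ∀ᶠ x in 𝓝 (κ y), P (κ.symm x) := by
  refine ⟨eventually_symm hy, fun h => ?_⟩
  filter_upwards [eventually_apply hy h, eventually_left_inv hy] with y' h1 h2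
  rwa [h2.2] at h1

end PartialHomeomorph

/-! ### Smooth charts: coordinate fields and the chain rule for derivations of germs. -/

section Charts

variable {Y : Type*} [SmoothSpace Y] {W : Type*} [NormedAddCommGroup W] [NormedSpace ℝ W]

/-- `κ` is a chart for the smooth structure. -/
def IsSmoothChart (κ : OpenPartialHomeomorph Y W) : Prop :=
  ∀ y ∈ κ.source, ∀ φ : Y → ℂ, φ ∈ smoothNear y ↔ SmoothNear (κ y) (φ ∘ κ.symm)

lemma SmoothNear.congr {p : W} {f f' : W → ℂ} (h : SmoothNear p f) (h' : f =ᶠ[𝓝 p] f') :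
    SmoothNear p f' := by
  filter_upwards [h, h'.eventuallyEq_nhds] with x hx hx'
  exact hx.congr_of_eventuallyEq hx'.symm

variable {κ : OpenPartialHomeomorph Y W} {y : Y}

lemma IsSmoothChart.mem_of_eventuallyEq (hκ : IsSmoothChart κ) (hy : y ∈ κ.source) {φ ψ : Y → ℂ}
    (hφ : φ ∈ smoothNear y) (h : φ =ᶠ[𝓝 y] ψ) : ψ ∈ smoothNear y :=
  (hκ y hy ψ).2 (((hκ y hy φ).1 hφ).congr (eventually_symm hy h))

/-- The axioms of a `SmoothSpace` do not make smoothness a property of the germ; a chart does. Then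
either both functions are smooth, or both sides are the default value `0`. -/
lemma IsSmoothChart.germ_congr (hκ : IsSmoothChart κ) (hy : y ∈ κ.source) {φ ψ : Y → ℂ}
    (h : φ =ᶠ[𝓝 y] ψ) : germ y φ = germ y ψ := by
  by_cases hφ : φ ∈ smoothNear y
  · exact (germ_eq_iff hφ (hκ.mem_of_eventuallyEq hy hφ h)).2 h
  · have hψ : ψ ∉ smoothNear y := fun hψ => hφ (hκ.mem_of_eventuallyEq hy hψ h.symm)
    have h0 : ∀ {χ : Y → ℂ}, χ ∉ smoothNear y → germ y χ = 0 := fun h => dif_neg h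
    rw [h0 hφ, h0 hψ]

lemma IsSmoothChart.comp_mem (hκ : IsSmoothChart κ) (hy : y ∈ κ.source) {f : W → ℂ}
    (hf : SmoothNear (κ y) f) : (fun y' => f (κ y')) ∈ smoothNear y := by
  refine (hκ y hy _).2 (hf.congr ?_)
  filter_upwards [eventually_right_inv hy] with x hx
  simp [hx.2]

/-- A map to a normed space is smooth near a point. -/
def SmoothVec {V : Type*} [NormedAddCommGroup V] [NormedSpace ℝ V] (y : Y) (u : Y → V) : Prop :=
  ∀ ℓ : V →L[ℝ] ℝ, (fun y' => (ℓ (u y') : ℂ)) ∈ smoothNear y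

section Vec

variable {V V' : Type*} [NormedAddCommGroup V] [NormedSpace ℝ V] [FiniteDimensional ℝ V]
  [NormedAddCommGroup V'] [NormedSpace ℝ V'] [FiniteDimensional ℝ V']

lemma contDiffAt_of_forall_dual {f : W → V} {x : W}
    (h : ∀ ℓ : V →L[ℝ] ℝ, ContDiffAt ℝ ∞ (fun x => ℓ (f x)) x) : ContDiffAt ℝ ∞ f x := by
  let b := Module.finBasis ℝ V
  have e : f = fun x => ∑ i, (LinearMap.toContinuousLinearMap (b.coord i) (f x)) • b i := by
    funext x
    exact (b.sum_repr (f x)).symm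
  rw [e]
  exact ContDiffAt.sum fun i _ => (h _).smul contDiffAt_const

lemma contDiffAt_ofReal_iff {f : W → ℝ} {x : W} :
    ContDiffAt ℝ ∞ (fun x => (f x : ℂ)) x ↔ ContDiffAt ℝ ∞ f x := by
  refine ⟨fun h => ?_, fun h => Complex.ofRealCLM.contDiff.contDiffAt.comp x h⟩
  have := Complex.reCLM.contDiff.contDiffAt.comp x h
  simpa [Function.comp_def] using this

lemma IsSmoothChart.smoothVec_iff (hκ : IsSmoothChart κ) (hy : y ∈ κ.source) {u : Y → V} :
    SmoothVec y u ↔ ∀ᶠ x in 𝓝 (κ y), ContDiffAt ℝ ∞ (u ∘ κ.symm) x := by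
  constructor
  · intro h
    let b := Module.finBasis ℝ V
    have h1 : ∀ i, ∀ᶠ x in 𝓝 (κ y), ContDiffAt ℝ ∞
        (fun x => LinearMap.toContinuousLinearMap (b.coord i) (u (κ.symm x))) x := fun i =>
      ((hκ y hy _).1 (h (LinearMap.toContinuousLinearMap (b.coord i)))).mono fun x hx =>
        contDiffAt_ofReal_iff.1 hx
    filter_upwards [eventually_all.2 h1] with x hx
    have e : u ∘ κ.symm = fun x =>
        ∑ i, (LinearMap.toContinuousLinearMap (b.coord i) (u (κ.symm x))) • b i := by
      funext x
      exact (b.sum_repr _).symm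
    rw [e]
    exact ContDiffAt.sum fun i _ => (hx i).smul contDiffAt_const
  · intro h ℓ
    refine (hκ y hy _).2 (h.mono fun x hx => ?_)
    exact contDiffAt_ofReal_iff.2 (ℓ.contDiff.contDiffAt.comp x hx)

lemma IsSmoothChart.smoothVec_self [FiniteDimensional ℝ W] (hκ : IsSmoothChart κ)
    (hy : y ∈ κ.source) : SmoothVec y κ := by
  rw [hκ.smoothVec_iff hy]
  filter_upwards [(eventually_right_inv hy).eventually_nhds] with x hx
  exact contDiffAt_id.congr_of_eventuallyEq (hx.mono fun x h => h.2)

lemma IsSmoothChart.continuousAt_vec (hκ : IsSmoothChart κ) (hy : y ∈ κ.source) {u : Y → V}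
    (hu : SmoothVec y u) : ContinuousAt u y := by
  have h1 := ((hκ.smoothVec_iff hy).1 hu).self_of_nhds.continuousAt
  have h2 : ContinuousAt ((u ∘ κ.symm) ∘ κ) y := h1.comp (κ.continuousAt hy)
  refine h2.congr ?_
  filter_upwards [eventually_left_inv hy] with y' h
  simp [h.2]

lemma IsSmoothChart.smoothVec_comp (hκ : IsSmoothChart κ) (hy : y ∈ κ.source) {u : Y → V}
    (hu : SmoothVec y u) {Φ : V → V'} (hΦ : ∀ᶠ x in 𝓝 (u y), ContDiffAt ℝ ∞ Φ x) :
    SmoothVec y (Φ ∘ u) := by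
  have hc := hκ.continuousAt_vec hy hu
  rw [hκ.smoothVec_iff hy] at hu ⊢
  filter_upwards [hu, eventually_symm hy (hc.eventually hΦ)] with x h1 h2
  exact ContDiffAt.comp (f := u ∘ κ.symm) x h2 h1

lemma IsSmoothChart.smoothVec_complex (hκ : IsSmoothChart κ) (hy : y ∈ κ.source) {φ : Y → ℂ} :
    SmoothVec y φ ↔ φ ∈ smoothNear y := by
  rw [hκ.smoothVec_iff hy, hκ y hy]
  rfl

lemma IsSmoothChart.vec_comp_mem (hκ : IsSmoothChart κ) (hy : y ∈ κ.source) {u : Y → V}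
    (hu : SmoothVec y u) {Φ : V → ℂ} (hΦ : SmoothNear (u y) Φ) :
    (fun y' => Φ (u y')) ∈ smoothNear y :=
  (hκ.smoothVec_complex hy).1 (hκ.smoothVec_comp hy hu hΦ)

end Vec

variable [FiniteDimensional ℝ W]

/-- The derivative of functions along a vector field given in a chart. -/
def fieldOp (κ : OpenPartialHomeomorph Y W) (X : W → W) (φ : Y → ℂ) (y : Y) : ℂ :=
  fderiv ℝ (φ ∘ κ.symm) (κ y) (X (κ y))

lemma fieldOp_mem (hκ : IsSmoothChart κ) (hy : y ∈ κ.source) {X : W → W}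
    (hX : ∀ᶠ x in 𝓝 (κ y), ContDiffAt ℝ ∞ X x) {φ : Y → ℂ} (hφ : φ ∈ smoothNear y) :
    fieldOp κ X φ ∈ smoothNear y := by
  refine hκ.comp_mem hy (f := fun x => fderiv ℝ (φ ∘ κ.symm) x (X x)) ?_
  filter_upwards [hX, (hκ y hy φ).1 hφ] with x h1 h2
  exact (h2.fderiv_right (m := ∞) (by simp)).clm_apply h1

lemma isDerOp_fieldOp (hκ : IsSmoothChart κ) (hy : y ∈ κ.source) {X : W → W}
    (hX : ∀ᶠ x in 𝓝 (κ y), ContDiffAt ℝ ∞ X x) : IsDerOp y (fieldOp κ X) where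
  smooth φ hφ := fieldOp_mem hκ hy hX hφ
  congr φ hφ ψ hψ h := by
    have h1 : ∀ᶠ x in 𝓝 (κ y), (φ ∘ κ.symm) x = (ψ ∘ κ.symm) x := eventually_symm hy h
    filter_upwards [eventually_apply hy h1.eventually_nhds] with y' h2
    rw [fieldOp, fieldOp, Filter.EventuallyEq.fderiv_eq h2]
  add φ hφ ψ hψ := by
    filter_upwards [eventually_apply hy ((hκ y hy φ).1 hφ), eventually_apply hy ((hκ y hy ψ).1 hψ)]
      with y' h1 h2
    have e : (φ + ψ) ∘ κ.symm = φ ∘ κ.symm + ψ ∘ κ.symm := rfl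
    rw [Pi.add_apply, fieldOp, fieldOp, fieldOp, e,
      fderiv_add (h1.differentiableAt (by simp)) (h2.differentiableAt (by simp))]
    rfl
  mul φ hφ ψ hψ := by
    filter_upwards [eventually_apply hy ((hκ y hy φ).1 hφ), eventually_apply hy ((hκ y hy ψ).1 hψ),
      eventually_left_inv hy] with y' h1 h2 h3
    have e : (φ * ψ) ∘ κ.symm = (φ ∘ κ.symm) * (ψ ∘ κ.symm) := rfl
    rw [Pi.add_apply, fieldOp, e,
      fderiv_mul (h1.differentiableAt (by simp)) (h2.differentiableAt (by simp))]
    simp [fieldOp, h3.2]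
  const c := Eventually.of_forall fun y' => by
    have e : (fun _ : Y => c) ∘ κ.symm = fun _ => c := rfl
    rw [fieldOp, e]
    simp

/-- The germs of the vector field given by `X` in a chart (`0` where this makes no sense). -/
def chartField (κ : OpenPartialHomeomorph Y W) (X : W → W) (y : Y) : Der y :=
  open Classical in
  if h : IsDerOp y (fieldOp κ X) then h.der else 0

lemma chartField_germ (hκ : IsSmoothChart κ) (hy : y ∈ κ.source) {X : W → W}
    (hX : ∀ᶠ x in 𝓝 (κ y), ContDiffAt ℝ ∞ X x) {φ : Y → ℂ} (hφ : φ ∈ smoothNear y) :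
    chartField κ X y (germ y φ) = germ y (fieldOp κ X φ) := by
  rw [chartField, dif_pos (isDerOp_fieldOp hκ hy hX)]
  exact IsDerOp.der_germ _ hφ

lemma isVectorFieldNear_chartField (hκ : IsSmoothChart κ) (hy : y ∈ κ.source) {X : W → W}
    (hX : ∀ᶠ x in 𝓝 (κ y), ContDiffAt ℝ ∞ X x) : IsVectorFieldNear (chartField κ X) y := by
  intro φ hφ
  refine ⟨fieldOp κ X φ, fieldOp_mem hκ hy hX hφ, ?_⟩
  filter_upwards [eventually_apply hy hX.eventually_nhds, SmoothSpace.eventually_mem y φ hφ,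
    eventually_left_inv hy] with y' h1 h2 h3
  exact chartField_germ hκ h3.1 h1 h2

/-- The derivation of functions on the model space induced by a derivation of germs. -/
def modelOp (κ : OpenPartialHomeomorph Y W) (θ : Der y) (f : W → ℂ) : W → ℂ :=
  (exists_germ (θ (germ y (fun y' => f (κ y'))))).choose ∘ κ.symm

lemma modelOp_eventuallyEq (hy : y ∈ κ.source) (θ : Der y) {f : W → ℂ}
    {φ : Y → ℂ} (hφ : φ ∈ smoothNear y) (h : θ (germ y (fun y' => f (κ y'))) = germ y φ) :
    modelOp κ θ f =ᶠ[𝓝 (κ y)] φ ∘ κ.symm := by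
  obtain ⟨h1, e1⟩ := (exists_germ (θ (germ y (fun y' => f (κ y'))))).choose_spec
  exact eventually_symm hy ((germ_eq_iff h1 hφ).1 (e1.trans h))

lemma isGermDerivation_modelOp (hκ : IsSmoothChart κ) (hy : y ∈ κ.source) (θ : Der y) :
    IsGermDerivation (κ y) (modelOp κ θ) where
  smooth f hf := by
    obtain ⟨h1, e1⟩ := (exists_germ (θ (germ y (fun y' => f (κ y'))))).choose_spec
    exact (hκ y hy _).1 h1
  congr f f' hf h := by
    obtain ⟨h1, e1⟩ := (exists_germ (θ (germ y (fun y' => f (κ y'))))).choose_spec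
    refine (modelOp_eventuallyEq hy θ h1 (e1.symm)).trans
      (modelOp_eventuallyEq hy θ h1 ?_).symm
    rw [e1, hκ.germ_congr hy (eventually_apply hy h)]
  add f f' hf hf' := by
    obtain ⟨h1, e1⟩ := (exists_germ (θ (germ y (fun y' => f (κ y'))))).choose_spec
    obtain ⟨h2, e2⟩ := (exists_germ (θ (germ y (fun y' => f' (κ y'))))).choose_spec
    refine modelOp_eventuallyEq hy θ (add_mem h1 h2) ?_
    rw [germ_add h1 h2, e1, e2, ← map_add, ← germ_add (hκ.comp_mem hy hf) (hκ.comp_mem hy hf')]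
    rfl
  mul f f' hf hf' := by
    obtain ⟨h1, e1⟩ := (exists_germ (θ (germ y (fun y' => f (κ y'))))).choose_spec
    obtain ⟨h2, e2⟩ := (exists_germ (θ (germ y (fun y' => f' (κ y'))))).choose_spec
    have m1 := hκ.comp_mem hy hf
    have m2 := hκ.comp_mem hy hf'
    refine (modelOp_eventuallyEq hy θ (add_mem (mul_mem m1 h2) (mul_mem m2 h1)) ?_).trans ?_
    · rw [germ_add (mul_mem m1 h2) (mul_mem m2 h1), germ_mul m1 h2, germ_mul m2 h1, e1, e2]
      have := θ.leibniz (germ y fun y' => f (κ y')) (germ y fun y' => f' (κ y'))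
      rw [← germ_mul m1 m2] at this
      exact this
    · filter_upwards [eventually_right_inv hy] with x hx
      simp [modelOp, hx.2]
  const c := by
    refine modelOp_eventuallyEq hy θ (const_mem 0) ?_
    rw [germ_const, germ_const_zero, Derivation.map_algebraMap]

/-- A derivation of germs that kills the coordinates of a chart is zero. -/
theorem IsSmoothChart.der_eq_zero (hκ : IsSmoothChart κ) (hy : y ∈ κ.source) {θ : Der y}
    (h : ∀ ℓ : W →L[ℝ] ℝ, θ (germ y fun y' => (ℓ (κ y') : ℂ)) = 0) : θ = 0 := by
  ext r
  obtain ⟨φ, hφ, rfl⟩ := exists_germ r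
  have hD := isGermDerivation_modelOp hκ hy θ
  have h1 := hD.eventuallyEq_zero (f := φ ∘ κ.symm) (fun ℓ => by
    refine modelOp_eventuallyEq hy θ (const_mem 0) ?_
    rw [germ_const_zero, h ℓ]) ((hκ y hy φ).1 hφ)
  obtain ⟨h2, e2⟩ := (exists_germ (θ (germ y (fun y' => (φ ∘ κ.symm) (κ y'))))).choose_spec
  have e3 : germ y (fun y' => (φ ∘ κ.symm) (κ y')) = germ y φ :=
    hκ.germ_congr hy ((eventually_left_inv hy).mono fun y' h => by simp [h.2])
  rw [← e3, ← e2]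
  change _ = (0 : SGerm y)
  rw [← germ_const_zero, germ_eq_iff h2 (const_mem 0)]
  exact (eventually_iff_symm hy).2 h1

/-- Expansion of a derivation in the coordinate vector fields. -/
theorem IsSmoothChart.der_eq_sum (hκ : IsSmoothChart κ) (hy : y ∈ κ.source) (θ : Der y)
    {ι : Type*} [Fintype ι] (b : Module.Basis ι ℝ W) :
    θ = ∑ i, θ (germ y fun y' => (b.coord i (κ y') : ℂ)) • chartField κ (fun _ => b i) y := by
  rw [← sub_eq_zero]
  refine hκ.der_eq_zero hy fun ℓ => ?_
  have hc : ∀ i, (fun y' => (b.coord i (κ y') : ℂ)) ∈ smoothNear y := fun i =>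
    hκ.smoothVec_self hy (LinearMap.toContinuousLinearMap (b.coord i))
  have hℓ : germ y (fun y' => (ℓ (κ y') : ℂ)) =
      ∑ i, algebraMap ℂ (SGerm y) (ℓ (b i) : ℂ) * germ y fun y' => (b.coord i (κ y') : ℂ) := by
    simp_rw [← germ_const, ← germ_mul (const_mem _) (hc _)]
    rw [← germ_sum _ fun i => mul_mem (const_mem _) (hc i)]
    congr 1
    funext y'
    conv_lhs => rw [← b.sum_repr (κ y')]
    simp only [map_sum, map_smul, smul_eq_mul, Complex.ofReal_sum, Complex.ofReal_mul,
      Finset.sum_apply, Pi.mul_apply]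
    exact Finset.sum_congr rfl fun i _ => mul_comm _ _
  have hd : ∀ i, chartField κ (fun _ => b i) y (germ y fun y' => (ℓ (κ y') : ℂ)) =
      algebraMap ℂ (SGerm y) (ℓ (b i) : ℂ) := by
    intro i
    rw [chartField_germ hκ hy (Eventually.of_forall fun _ => contDiffAt_const)
      (hκ.smoothVec_self hy ℓ), ← germ_const]
    refine hκ.germ_congr hy ?_
    filter_upwards [eventually_apply hy (eventually_right_inv hy).eventually_nhds] with y' h1
    have h2 : (fun y' => (ℓ (κ y') : ℂ)) ∘ κ.symm =ᶠ[𝓝 (κ y')] fun x => (ℓ x : ℂ) :=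
      h1.mono fun x hx => by simp [hx.2]
    rw [fieldOp, h2.fderiv_eq]
    have h3 : HasFDerivAt (fun x => (ℓ x : ℂ)) (Complex.ofRealCLM.comp ℓ) (κ y') :=
      (Complex.ofRealCLM.comp ℓ).hasFDerivAt
    rw [h3.fderiv]
    rfl
  rw [Derivation.sub_apply, der_sum_apply, sub_eq_zero]
  simp only [Derivation.smul_apply, hd, smul_eq_mul]
  conv_lhs => rw [hℓ]
  rw [map_sum]
  refine Finset.sum_congr rfl fun i _ => ?_
  rw [Derivation.leibniz, Derivation.map_algebraMap, smul_zero, add_zero, smul_eq_mul, mul_comm]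

/-- The chain rule. -/
theorem IsSmoothChart.der_comp (hκ : IsSmoothChart κ) (hy : y ∈ κ.source) (θ : Der y)
    {V : Type*} [NormedAddCommGroup V] [NormedSpace ℝ V] [FiniteDimensional ℝ V]
    {ι : Type*} [Fintype ι] (b : Module.Basis ι ℝ V) {u : Y → V} (hu : SmoothVec y u) {Φ : V → ℂ}
    (hΦ : SmoothNear (u y) Φ) :
    θ (germ y fun y' => Φ (u y')) = ∑ i, germ y (fun y' => fderiv ℝ Φ (u y') (b i)) *
      θ (germ y fun y' => (b.coord i (u y') : ℂ)) := by
  have hco : ∀ i, (fun y' => (b.coord i (u y') : ℂ)) ∈ smoothNear y := fun i =>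
    hu (LinearMap.toContinuousLinearMap (b.coord i))
  have hd : ∀ i, (fun y' => fderiv ℝ Φ (u y') (b i)) ∈ smoothNear y := fun i =>
    hκ.vec_comp_mem hy hu (Φ := fun v => fderiv ℝ Φ v (b i))
      (hΦ.mono fun v hv => (hv.fderiv_right (m := ∞) (by simp)).clm_apply contDiffAt_const)
  have hcomp := hκ.vec_comp_mem hy hu hΦ
  have hX : ∀ c : W, ∀ᶠ x in 𝓝 (κ y), ContDiffAt ℝ ∞ (fun _ : W => c) x := fun c =>
    Eventually.of_forall fun _ => contDiffAt_const
  -- For the coordinate fields of the chart this is the chain rule of calculus; a general derivation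
  -- is a combination of them by `der_eq_sum`.
  have key : ∀ c : W, chartField κ (fun _ => c) y (germ y fun y' => Φ (u y')) =
      ∑ i, germ y (fun y' => fderiv ℝ Φ (u y') (b i)) *
        chartField κ (fun _ => c) y (germ y fun y' => (b.coord i (u y') : ℂ)) := by
    intro c
    rw [chartField_germ hκ hy (hX c) hcomp]
    simp only [fun i => chartField_germ hκ hy (hX c) (hco i)]
    simp only [fun i => (germ_mul (hd i) (fieldOp_mem hκ hy (hX c) (hco i))).symm]
    rw [← germ_sum _ fun i => mul_mem (hd i) (fieldOp_mem hκ hy (hX c) (hco i))]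
    refine hκ.germ_congr hy ?_
    filter_upwards [eventually_apply hy ((hκ.smoothVec_iff hy).1 hu),
      (hκ.continuousAt_vec hy hu).eventually hΦ, eventually_left_inv hy] with y' h1 h2 h3
    have e1 : (fun y' => Φ (u y')) ∘ κ.symm = Φ ∘ (u ∘ κ.symm) := rfl
    have h4 := h1.differentiableAt (by simp)
    have h5 : DifferentiableAt ℝ Φ ((u ∘ κ.symm) (κ y')) := by
      simpa [h3.2] using h2.differentiableAt (by simp)
    rw [fieldOp, e1, fderiv_comp _ h5 h4]
    simp only [ContinuousLinearMap.comp_apply, Finset.sum_apply, Pi.mul_apply, Function.comp_apply,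
      h3.2]
    conv_lhs => rw [← b.sum_repr (fderiv ℝ (u ∘ κ.symm) (κ y') c), map_sum]
    refine Finset.sum_congr rfl fun i _ => ?_
    have h6 : HasFDerivAt ((fun y' => (b.coord i (u y') : ℂ)) ∘ κ.symm)
        ((Complex.ofRealCLM.comp (LinearMap.toContinuousLinearMap (b.coord i))).comp
          (fderiv ℝ (u ∘ κ.symm) (κ y'))) (κ y') :=
      (Complex.ofRealCLM.comp (LinearMap.toContinuousLinearMap (b.coord i))).hasFDerivAt.comp _
        h4.hasFDerivAt
    rw [fieldOp, h6.fderiv, map_smul, Complex.real_smul, mul_comm]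
    rfl
  let c := Module.finBasis ℝ W
  have hθ := hκ.der_eq_sum hy θ c
  have happ : ∀ r, θ r = ∑ i, θ (germ y fun y' => (c.coord i (κ y') : ℂ)) *
      chartField κ (fun _ => c i) y r := by
    intro r
    conv_lhs => rw [hθ]
    rw [der_sum_apply]
    rfl
  rw [happ]
  simp only [key, fun i => happ (germ y fun y' => (b.coord i (u y') : ℂ)), Finset.mul_sum]
  rw [Finset.sum_comm]
  refine Finset.sum_congr rfl fun i _ => Finset.sum_congr rfl fun j _ => ?_
  ring

end Charts

end FourierMukai

end

noncomputable section

namespace FourierMukai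

open Filter Metric

set_option linter.unusedSectionVars false

/-! ### Composition of charts, and charts of straightened subspaces. -/

section ChartConstructions

variable {Y : Type*} [SmoothSpace Y] {W W' : Type*} [NormedAddCommGroup W] [NormedSpace ℝ W]
  [NormedAddCommGroup W'] [NormedSpace ℝ W'] {κ : OpenPartialHomeomorph Y W}

lemma SmoothNear.comp {p : W} {f : W' → ℂ} {k : W → W'} (hf : SmoothNear (k p) f)
    (hk : ∀ᶠ x in 𝓝 p, ContDiffAt ℝ ∞ k x) : SmoothNear p (f ∘ k) := by
  filter_upwards [hk, hk.self_of_nhds.continuousAt.eventually hf] with x h1 h2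
  exact h2.comp x h1

lemma eventually_contDiffAt {k : W → W'} {O : Set W} (hO : IsOpen O) (hk : ContDiffOn ℝ ∞ k O)
    {p : W} (hp : p ∈ O) : ∀ᶠ x in 𝓝 p, ContDiffAt ℝ ∞ k x :=
  Filter.mem_of_superset (hO.mem_nhds hp) fun _ h => hk.contDiffAt (hO.mem_nhds h)

/-- A chart followed by a diffeomorphism. -/
lemma IsSmoothChart.trans (hκ : IsSmoothChart κ) {φ : OpenPartialHomeomorph W W'}
    (h1 : ContDiffOn ℝ ∞ φ φ.source) (h2 : ContDiffOn ℝ ∞ φ.symm φ.target) :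
    IsSmoothChart (κ.trans φ) := by
  intro y hy f
  rw [OpenPartialHomeomorph.trans_source] at hy
  have hφ : κ y ∈ φ.source := hy.2
  rw [hκ y hy.1]
  constructor
  · intro h
    have h3 : SmoothNear (φ.symm (φ (κ y))) (f ∘ κ.symm) := by rwa [φ.left_inv hφ]
    exact h3.comp (eventually_contDiffAt φ.open_target h2 (φ.map_source hφ))
  · intro h
    have h3 := SmoothNear.comp (k := φ) (p := κ y) h (eventually_contDiffAt φ.open_source h1 hφ)
    refine h3.congr ?_
    filter_upwards [φ.open_source.mem_nhds hφ] with x hx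
    simp [φ.left_inv hx]

variable [FiniteDimensional ℝ W]

lemma exists_projection (W₀ : Submodule ℝ W) :
    ∃ P : W →L[ℝ] W₀, ∀ w : W₀, P w = w :=
  Submodule.ClosedComplemented.of_finiteDimensional W₀

variable {A : Type*} [SmoothSpace A] [Nonempty A] {ι : A → Y}

/-- The chart of a subspace that is straightened to a linear subspace by a chart. -/
def subChart (hι : Topology.IsInducing ι) (hinj : Function.Injective ι)
    (κ : OpenPartialHomeomorph Y W)
    (W₀ : Submodule ℝ W) (hW : ∀ y ∈ κ.source, y ∈ Set.range ι ↔ κ y ∈ W₀) :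
    OpenPartialHomeomorph A W₀ where
  toFun a := (exists_projection W₀).choose (κ (ι a))
  invFun w := Function.invFun ι (κ.symm w)
  source := ι ⁻¹' κ.source
  target := Subtype.val ⁻¹' κ.target
  map_source' a ha := by
    have h1 : κ (ι a) ∈ W₀ := (hW _ ha).1 ⟨a, rfl⟩
    have h2 := (exists_projection W₀).choose_spec ⟨_, h1⟩
    simp only [Set.mem_preimage]
    rw [h2]
    exact κ.map_source ha
  map_target' w hw := by
    have h1 : κ.symm w ∈ Set.range ι :=
      (hW _ (κ.map_target hw)).2 (by rw [κ.right_inv hw]; exact w.2)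
    simp only [Set.mem_preimage]
    rw [Function.invFun_eq h1]
    exact κ.map_target hw
  left_inv' a ha := by
    have h1 : κ (ι a) ∈ W₀ := (hW _ ha).1 ⟨a, rfl⟩
    have h2 := (exists_projection W₀).choose_spec ⟨_, h1⟩
    simp only at h2
    simp only [h2, κ.left_inv ha]
    exact Function.leftInverse_invFun hinj a
  right_inv' w hw := by
    have h1 : κ.symm w ∈ Set.range ι :=
      (hW _ (κ.map_target hw)).2 (by rw [κ.right_inv hw]; exact w.2)
    have h2 := (exists_projection W₀).choose_spec w
    simp only [Function.invFun_eq h1, κ.right_inv hw, h2]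
  open_source := κ.open_source.preimage hι.continuous
  open_target := κ.open_target.preimage continuous_subtype_val
  continuousOn_toFun := by
    refine (exists_projection W₀).choose.continuous.comp_continuousOn ?_
    exact κ.continuousOn.comp hι.continuous.continuousOn fun a ha => ha
  continuousOn_invFun := by
    rw [hι.continuousOn_iff]
    have h1 : ContinuousOn (fun w : W₀ => κ.symm w) (Subtype.val ⁻¹' κ.target) :=
      κ.continuousOn_symm.comp continuous_subtype_val.continuousOn fun w hw => hw
    refine h1.congr fun w hw => ?_
    have h1 : κ.symm w ∈ Set.range ι :=
      (hW _ (κ.map_target hw)).2 (by rw [κ.right_inv hw]; exact w.2)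
    exact Function.invFun_eq h1

variable (hι : Topology.IsInducing ι) (hinj : Function.Injective ι)
    {W₀ : Submodule ℝ W} (hW : ∀ y ∈ κ.source, y ∈ Set.range ι ↔ κ y ∈ W₀)

lemma coe_subChart {a : A} (ha : ι a ∈ κ.source) : (subChart hι hinj κ W₀ hW a : W) = κ (ι a) := by
  have h1 : κ (ι a) ∈ W₀ := (hW _ ha).1 ⟨a, rfl⟩
  have h2 := (exists_projection W₀).choose_spec ⟨_, h1⟩
  simp only at h2
  change (((exists_projection W₀).choose (κ (ι a)) : W₀) : W) = _
  rw [h2]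

lemma apply_subChart_symm {w : W₀} (hw : (w : W) ∈ κ.target) :
    ι ((subChart hι hinj κ W₀ hW).symm w) = κ.symm w := by
  have h1 : κ.symm w ∈ Set.range ι :=
    (hW _ (κ.map_target hw)).2 (by rw [κ.right_inv hw]; exact w.2)
  exact Function.invFun_eq h1

/-- A function on `W₀` extends to `W` by composition with the projection; this is the local
extension that smoothness on a subspace asks for. -/
lemma isSmoothChart_subChart (hκ : IsSmoothChart κ)
    (hmem : ∀ (a : A) (φ : A → ℂ), φ ∈ smoothNear a ↔ ∃ ψ ∈ smoothNear (ι a), φ =ᶠ[𝓝 a] ψ ∘ ι) :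
    IsSmoothChart (subChart hι hinj κ W₀ hW) := by
  intro a ha φ
  set κ' := subChart hι hinj κ W₀ hW with hκ'
  have hcoe : (κ' a : W) = κ (ι a) := coe_subChart hι hinj hW ha
  rw [hmem]
  constructor
  · rintro ⟨ψ, hψ, e⟩
    have h1 : SmoothNear (κ' a : W) (ψ ∘ κ.symm) := by
      rw [hcoe]
      exact (hκ _ ha ψ).1 hψ
    have h2 := SmoothNear.comp (k := W₀.subtypeL) (p := κ' a) h1
      (Eventually.of_forall fun x => W₀.subtypeL.contDiff.contDiffAt)
    refine h2.congr ?_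
    filter_upwards [eventually_symm ha e, κ'.open_target.mem_nhds (κ'.map_source ha)] with w h3 h4
    have h5 := apply_subChart_symm hι hinj hW h4
    simp only [Function.comp_apply] at h3 ⊢
    rw [h3, h5]
    rfl
  · intro h
    refine ⟨fun y => (φ ∘ κ'.symm) ((exists_projection W₀).choose (κ y)), ?_, ?_⟩
    · refine hκ.comp_mem ha (f := (φ ∘ κ'.symm) ∘ (exists_projection W₀).choose) ?_
      exact SmoothNear.comp (k := (exists_projection W₀).choose) h
        (Eventually.of_forall fun x => (exists_projection W₀).choose.contDiff.contDiffAt)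
    · filter_upwards [eventually_left_inv ha] with a' ha'
      change _ = φ (κ'.symm (κ' a'))
      rw [ha'.2]

end ChartConstructions

/-! ### Charts obtained from parametrizations. -/

section GoodPlots

variable {Y F : Type*} [NormedAddCommGroup F] [NormedSpace ℝ F]

/-- Parametrizations that are local diffeomorphisms. -/
structure Plots.Good (P : Plots Y F) : Prop where
  isOpen_dom : ∀ i, IsOpen (P.dom i)
  surj : ∀ y, ∃ i, ∃ a ∈ P.dom i, P.map i a = y
  transition : ∀ i, ∀ a ∈ P.dom i, ∀ i', ∀ a' ∈ P.dom i', P.map i a = P.map i' a' →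
    ∃ t : F → F, (∀ᶠ x in 𝓝 a, ContDiffAt ℝ ∞ t x) ∧ t a = a' ∧ ∀ᶠ x in 𝓝 a, P.map i x = P.map i' (t x)
  injOn : ∀ i, ∀ a ∈ P.dom i, ∃ O, IsOpen O ∧ a ∈ O ∧ O ⊆ P.dom i ∧ Set.InjOn (P.map i) O

variable {P : Plots Y F}

lemma Plots.isOpen_iff' (P : Plots Y F) (U : Set Y) :
    IsOpen[P.topology] U ↔ ∀ i, IsOpen ((fun a : P.dom i => P.map i a) ⁻¹' U) := by
  rw [Plots.topology, isOpen_iSup_iff]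
  exact forall_congr' fun i => isOpen_coinduced

lemma Plots.Good.isOpen_iff (hP : P.Good) (U : Set Y) :
    IsOpen[P.topology] U ↔ ∀ i, IsOpen (P.dom i ∩ P.map i ⁻¹' U) := by
  rw [P.isOpen_iff']
  refine forall_congr' fun i => ?_
  rw [(hP.isOpen_dom i).isOpenEmbedding_subtypeVal.isOpen_iff_image_isOpen]
  convert Iff.rfl using 2
  ext a
  simp [and_comm]

lemma Plots.Good.isOpen_image (hP : P.Good) (i : P.ι) {O : Set F} (hO : IsOpen O)
    (hOd : O ⊆ P.dom i) : IsOpen[P.topology] (P.map i '' O) := by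
  rw [hP.isOpen_iff]
  intro i'
  rw [isOpen_iff_mem_nhds]
  rintro a' ⟨ha', a, haO, e⟩
  obtain ⟨t, ht, hta, hmap⟩ := hP.transition i' a' ha' i a (hOd haO) e.symm
  have h1 : ∀ᶠ x in 𝓝 a', t x ∈ O :=
    ht.self_of_nhds.continuousAt.eventually (by rw [hta]; exact hO.mem_nhds haO)
  filter_upwards [h1, hmap, (hP.isOpen_dom i').mem_nhds ha'] with x h2 h3 h4
  exact ⟨h4, t x, h2, h3.symm⟩

lemma Plots.Good.continuousOn (hP : P.Good) (i : P.ι) :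
    @ContinuousOn F Y _ P.topology (P.map i) (P.dom i) := by
  let _ := P.topology
  refine (continuousOn_open_iff (hP.isOpen_dom i)).2 fun U hU => ?_
  exact (hP.isOpen_iff U).1 hU i

/-- The chart inverse to an injective piece of a parametrization. -/
def Plots.Good.chart (hP : P.Good) (i : P.ι) {O : Set F} (hO : IsOpen O) (hOd : O ⊆ P.dom i)
    (hinj : Set.InjOn (P.map i) O) (hne : O.Nonempty) :
    @OpenPartialHomeomorph Y F P.topology _ :=
  let _ := P.topology
  (show OpenPartialHomeomorph F Y from
    have : Nonempty F := ⟨hne.some⟩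
    { (hinj.bijOn_image.toPartialEquiv (P.map i) O (P.map i '' O)) with
      open_source := hO
      open_target := hP.isOpen_image i hO hOd
      continuousOn_toFun := (hP.continuousOn i).mono hOd
      continuousOn_invFun := by
        refine (continuousOn_open_iff (hP.isOpen_image i hO hOd)).2 fun U hU => ?_
        convert hP.isOpen_image i (hO.inter hU) (Set.inter_subset_left.trans hOd) using 1
        ext y
        constructor
        · rintro ⟨⟨a, ha, rfl⟩, h⟩
          have h1 : Function.invFunOn (P.map i) O (P.map i a) = a := hinj.leftInvOn_invFunOn ha
          have h2 : Function.invFunOn (P.map i) O (P.map i a) ∈ U := h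
          exact ⟨a, ⟨ha, by rwa [h1] at h2⟩, rfl⟩
        · rintro ⟨a, ⟨ha, haU⟩, rfl⟩
          have h1 : Function.invFunOn (P.map i) O (P.map i a) = a := hinj.leftInvOn_invFunOn ha
          refine ⟨⟨a, ha, rfl⟩, ?_⟩
          change Function.invFunOn (P.map i) O (P.map i a) ∈ U
          rwa [h1] }).symm

lemma Plots.Good.exists_chart (hP : P.Good) (i : P.ι) {a : F} (ha : a ∈ P.dom i) :
    letI := P.smoothSpace
    ∃ κ : OpenPartialHomeomorph Y F, IsSmoothChart κ ∧ P.map i a ∈ κ.source ∧ κ (P.map i a) = a ∧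
      κ.target ⊆ P.dom i ∧ ∀ x, κ.symm x = P.map i x := by
  obtain ⟨O, hO, haO, hOd, hinj⟩ := hP.injOn i a ha
  let _ := P.smoothSpace
  have hsymm : ∀ x, (hP.chart i hO hOd hinj ⟨a, haO⟩).symm x = P.map i x := fun x => rfl
  have hsrc : P.map i a ∈ (hP.chart i hO hOd hinj ⟨a, haO⟩).source := ⟨a, haO, rfl⟩
  have htgt : (hP.chart i hO hOd hinj ⟨a, haO⟩).target = O := rfl
  generalize hP.chart i hO hOd hinj ⟨a, haO⟩ = κ at hsymm hsrc htgt
  have hinv : ∀ x ∈ O, P.map i x ∈ κ.source ∧ κ (P.map i x) = x := by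
    intro x hx
    rw [← htgt] at hx
    rw [← hsymm]
    exact ⟨κ.map_target hx, κ.right_inv hx⟩
  refine ⟨κ, ?_, hsrc, (hinv a haO).2, htgt.trans_subset hOd, hsymm⟩
  intro y hy φ
  have hfun : φ ∘ κ.symm = φ ∘ P.map i := by
    funext x
    simp [hsymm]
  rw [hfun]
  have hyO : κ y ∈ O := htgt ▸ κ.map_source hy
  have hky : P.map i (κ y) = y := by rw [← hsymm, κ.left_inv hy]
  constructor
  · rintro ⟨U, hU, hyU, h⟩
    have hop := (hP.isOpen_iff U).1 hU i
    exact eventually_contDiffAt hop (h i) ⟨hOd hyO, by rw [Set.mem_preimage, hky]; exact hyU⟩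
  · intro h
    obtain ⟨O', hO's, hO', hyO'⟩ := _root_.eventually_nhds_iff.1 (h.and (hO.mem_nhds hyO))
    have hsub : O' ⊆ P.dom i := fun x hx => hOd (hO's x hx).2
    refine ⟨P.map i '' O', hP.isOpen_image i hO' hsub, ⟨κ y, hyO', hky⟩, fun i' => ?_⟩
    rintro x ⟨hx, x', hx', e⟩
    obtain ⟨t, ht, htx, hmap⟩ := hP.transition i' x hx i x' (hsub hx') e.symm
    have h1 : ContDiffAt ℝ ∞ (φ ∘ P.map i) (t x) := by
      rw [htx]
      exact (hO's x' hx').1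
    refine (ContDiffAt.congr_of_eventuallyEq (h1.comp x ht.self_of_nhds) ?_).contDiffWithinAt
    filter_upwards [hmap] with x'' h2
    simp [h2]

end GoodPlots

end FourierMukai

end

noncomputable section

namespace FourierMukai

open Filter Metric LagrangianLattice

set_option linter.unusedSectionVars false

/-! ### Action charts and their integral changes of coordinates. -/

section ActionCharts

variable {g : ℕ} {B : Type*} [TopologicalSpace B] [ChartedSpace (Model g) B]
  [IsManifold 𝓘(ℝ, Model g) ∞ B] {L : LagrangianLattice g B}
  {e e' : OpenPartialHomeomorph B (Model g)} {b : B}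

lemma IsActionChart.mdifferentiable (he : IsActionChart L.lattice e) :
    e.MDifferentiable 𝓘(ℝ, Model g) 𝓘(ℝ, Model g) :=
  ⟨(contMDiffOn_of_mem_maximalAtlas he.1).mdifferentiableOn (by simp),
    (contMDiffOn_symm_of_mem_maximalAtlas he.1).mdifferentiableOn (by simp)⟩

lemma IsActionChart.isInvertible (he : IsActionChart L.lattice e) (hb : b ∈ e.source) :
    (mfderiv 𝓘(ℝ, Model g) 𝓘(ℝ, Model g) e b : Tan g b →L[ℝ] Model g).IsInvertible :=
  ⟨he.mdifferentiable.mfderiv hb, rfl⟩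

lemma dcoord_coordVec (he : IsActionChart L.lattice e) (hb : b ∈ e.source) (j : Fin g)
    (m : Model g) : dcoord e b j (coordVec e b m) = m j := by
  have := (he.isInvertible hb).self_apply_inverse m
  change (mfderiv 𝓘(ℝ, Model g) 𝓘(ℝ, Model g) e b : Tan g b →L[ℝ] Model g) (coordVec e b m) j = _
  exact congrFun this j

lemma coordVec_dcoord (he : IsActionChart L.lattice e) (hb : b ∈ e.source) (v : Tan g b) :
    coordVec e b (fun j => dcoord e b j v) = v :=
  (he.isInvertible hb).inverse_apply_self v

lemma coordVec_sub (m m' : Model g) : coordVec e b (m - m') = coordVec e b m - coordVec e b m' :=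
  map_sub _ _ _

lemma coordVec_zero : coordVec e b (0 : Model g) = 0 := map_zero _

/-- The covector `∑ y_j dx^j`. -/
def covec (e : OpenPartialHomeomorph B (Model g)) (b : B) (y : Model g) : Cot g b :=
  ∑ j, y j • dcoord e b j

lemma covec_apply (y : Model g) (v : Tan g b) : covec e b y v = ∑ j, y j * dcoord e b j v := by
  simp [covec]

lemma covec_sub (y y' : Model g) : covec e b (y - y') = covec e b y - covec e b y' := by
  refine ContinuousLinearMap.ext fun v => ?_
  change covec e b (y - y') v = covec e b y v - covec e b y' v
  simp [covec_apply, sub_mul]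

lemma covec_zero : covec e b (0 : Model g) = 0 := by simp [covec]

lemma covec_coordVec (he : IsActionChart L.lattice e) (hb : b ∈ e.source) (y m : Model g) :
    covec e b y (coordVec e b m) = ∑ j, y j * m j := by
  simp [covec_apply, dcoord_coordVec he hb]

lemma covec_coordVec_single (he : IsActionChart L.lattice e) (hb : b ∈ e.source) (y : Model g)
    (j : Fin g) : covec e b y (coordVec e b (Pi.single j 1)) = y j := by
  rw [covec_coordVec he hb, Finset.sum_eq_single j] <;> simp +contextual

lemma covec_eq (he : IsActionChart L.lattice e) (hb : b ∈ e.source) (η : Cot g b) :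
    covec e b (fun j => η (coordVec e b (Pi.single j 1))) = η := by
  refine ContinuousLinearMap.ext fun v => ?_
  conv_rhs => rw [← coordVec_dcoord he hb v]
  rw [covec_apply]
  have : (fun j => dcoord e b j v) = ∑ j, dcoord e b j v • (Pi.single j 1 : Model g) := by
    funext i
    simp [Finset.sum_apply, Pi.single_apply]
  have h2 : coordVec e b (fun j => dcoord e b j v) =
      ∑ j, dcoord e b j v • coordVec e b (Pi.single j 1) := by
    rw [this]
    exact (map_sum (ContinuousLinearMap.inverse
      (mfderiv 𝓘(ℝ, Model g) 𝓘(ℝ, Model g) e b : Tan g b →L[ℝ] Model g)) _ _).trans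
      (Finset.sum_congr rfl fun j _ => map_smul _ _ _)
  rw [h2, map_sum]
  refine Finset.sum_congr rfl fun j _ => ?_
  rw [map_smul, smul_eq_mul, mul_comm]

lemma covec_mem_lattice_iff (he : IsActionChart L.lattice e) (hb : b ∈ e.source) (y : Model g) :
    covec e b y ∈ L.lattice b ↔ ∃ n : Fin g → ℤ, ∀ j, y j = n j := by
  rw [he.2 b hb]
  refine exists_congr fun n => ⟨fun h j => ?_, fun h => ?_⟩
  · have h1 := covec_coordVec_single he hb y j
    have h2 := covec_coordVec_single he hb (fun j => (n j : ℝ)) j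
    rw [h] at h1
    exact h1.symm.trans h2
  · simp only [covec, h]

lemma coordVec_mem_dualLattice_iff (he : IsActionChart L.lattice e) (hb : b ∈ e.source)
    (w : Model g) : coordVec e b w ∈ L.dualLattice b ↔ ∃ n : Fin g → ℤ, ∀ j, w j = n j := by
  constructor
  · intro h
    have h1 : ∀ j, ∃ n : ℤ, w j = n := by
      intro j
      obtain ⟨n, hn⟩ := h (dcoord e b j) ((he.2 b hb _).2 ⟨Pi.single j 1, by
        rw [Finset.sum_eq_single j] <;> simp +contextual⟩)
      exact ⟨n, by rw [← hn, dcoord_coordVec he hb]⟩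
    choose n hn using h1
    exact ⟨n, hn⟩
  · rintro ⟨n, hn⟩ η hη
    obtain ⟨k, rfl⟩ := (he.2 b hb η).1 hη
    refine ⟨∑ j, k j * n j, ?_⟩
    have := covec_coordVec he hb (fun j => (k j : ℝ)) w
    rw [covec] at this
    rw [this]
    push_cast
    exact Finset.sum_congr rfl fun j _ => by rw [hn]

/-- The charts `e` and `e'` are related at `b` by the integral matrix `M`. -/
def ChartRel (e e' : OpenPartialHomeomorph B (Model g)) (M : Matrix (Fin g) (Fin g) ℤ) (b : B) :
    Prop :=
  b ∈ e.source ∧ b ∈ e'.source ∧ ∀ i, dcoord e' b i = ∑ j, (M i j : ℝ) • dcoord e b j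

lemma ChartRel.coordVec_eq (he' : IsActionChart L.lattice e')
    (he : IsActionChart L.lattice e) {M : Matrix (Fin g) (Fin g) ℤ} (h : ChartRel e e' M b)
    (w : Model g) : coordVec e b w = coordVec e' b (fun i => ∑ j, M i j * w j) := by
  rw [← coordVec_dcoord he' h.2.1 (coordVec e b w)]
  congr 1
  funext i
  rw [h.2.2 i]
  simp [dcoord_coordVec he h.1]

lemma ChartRel.covec_eq {M : Matrix (Fin g) (Fin g) ℤ} (h : ChartRel e e' M b)
    (y : Model g) : covec e' b y = covec e b (fun j => ∑ i, y i * M i j) := by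
  simp only [covec, h.2.2, Finset.smul_sum, smul_smul, Finset.sum_smul]
  rw [Finset.sum_comm]

lemma mfderiv_eq_comp (he : IsActionChart L.lattice e) (he' : IsActionChart L.lattice e')
    (hb : b ∈ e.source) (hb' : b ∈ e'.source) :
    (mfderiv 𝓘(ℝ, Model g) 𝓘(ℝ, Model g) e' b : Tan g b →L[ℝ] Model g) =
      (fderiv ℝ (e' ∘ e.symm) (e b)).comp
        (mfderiv 𝓘(ℝ, Model g) 𝓘(ℝ, Model g) e b : Tan g b →L[ℝ] Model g) := by
  have h1 : MDifferentiableAt 𝓘(ℝ, Model g) 𝓘(ℝ, Model g) e b := he.mdifferentiable.mdifferentiableAt hb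
  have h2 : MDifferentiableAt 𝓘(ℝ, Model g) 𝓘(ℝ, Model g) (e' ∘ e.symm) (e b) := by
    refine MDifferentiableAt.comp (I' := 𝓘(ℝ, Model g)) _ ?_ (he.mdifferentiable.mdifferentiableAt_symm (e.map_source hb))
    rw [e.left_inv hb]
    exact he'.mdifferentiable.mdifferentiableAt hb'
  have h3 := mfderiv_comp b h2 h1
  have h4 : e' =ᶠ[𝓝 b] (e' ∘ e.symm) ∘ e := by
    filter_upwards [e.open_source.mem_nhds hb] with b' hb'
    simp [e.left_inv hb']
  rw [h4.mfderiv_eq, h3, mfderiv_eq_fderiv]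
  rfl

lemma contDiffAt_transition (he : IsActionChart L.lattice e) (he' : IsActionChart L.lattice e')
    (hb : b ∈ e.source) (hb' : b ∈ e'.source) : ContDiffAt ℝ ∞ (e' ∘ e.symm) (e b) := by
  rw [← contMDiffAt_iff_contDiffAt]
  refine ContMDiffAt.comp (I' := 𝓘(ℝ, Model g)) _ ?_
    (contMDiffAt_symm_of_mem_maximalAtlas he.1 (e.map_source hb))
  rw [e.left_inv hb]
  exact contMDiffAt_of_mem_maximalAtlas he'.1 hb'

lemma eventually_mem_both (hb : b ∈ e.source) (hb' : b ∈ e'.source) :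
    ∀ᶠ b' in 𝓝 b, b' ∈ e.source ∧ b' ∈ e'.source :=
  (e.open_source.inter e'.open_source).mem_nhds ⟨hb, hb'⟩

/-- The entries of the matrix relating the two coframes are integers, because both span the lattice,
and continuous, because they are partial derivatives of the transition map. Hence they are locally
constant. -/
lemma exists_chartRel (he : IsActionChart L.lattice e) (he' : IsActionChart L.lattice e')
    (hb : b ∈ e.source) (hb' : b ∈ e'.source) :
    ∃ M : Matrix (Fin g) (Fin g) ℤ, ∀ᶠ b' in 𝓝 b, ChartRel e e' M b' := by
  have hint : ∀ b' ∈ e.source, b' ∈ e'.source → ∀ i j, ∃ n : ℤ,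
      dcoord e' b' i (coordVec e b' (Pi.single j 1)) = n := by
    intro b' h1 h2 i j
    have h3 : dcoord e' b' i ∈ L.lattice b' := (he'.2 b' h2 _).2 ⟨Pi.single i 1, by
      rw [Finset.sum_eq_single i] <;> simp +contextual⟩
    obtain ⟨n, hn⟩ := (he.2 b' h1 _).1 h3
    refine ⟨n j, ?_⟩
    rw [hn]
    exact covec_coordVec_single he h1 (fun j => (n j : ℝ)) j
  have hcont : ∀ i j, ContinuousAt (fun b' => fderiv ℝ (e' ∘ e.symm) (e b') (Pi.single j 1) i) b := by
    intro i j
    have h1 : ContinuousAt (fderiv ℝ (e' ∘ e.symm)) (e b) :=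
      ((contDiffAt_transition he he' hb hb').fderiv_right (m := 0) (by simp)).continuousAt
    have h2 : ContinuousAt (fun b' => fderiv ℝ (e' ∘ e.symm) (e b')) b :=
      ContinuousAt.comp (g := fderiv ℝ (e' ∘ e.symm)) h1 (e.continuousAt hb)
    exact ((continuous_apply i).continuousAt).comp (h2.clm_apply continuousAt_const)
  have hval : ∀ b' ∈ e.source, b' ∈ e'.source → ∀ i j,
      dcoord e' b' i (coordVec e b' (Pi.single j 1)) =
        fderiv ℝ (e' ∘ e.symm) (e b') (Pi.single j 1) i := by
    intro b' h1 h2 i j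
    have h3 := (he.isInvertible h1).self_apply_inverse (Pi.single j 1 : Model g)
    rw [dcoord, mfderiv_eq_comp he he' h1 h2]
    change fderiv ℝ (e' ∘ e.symm) (e b') ((mfderiv 𝓘(ℝ, Model g) 𝓘(ℝ, Model g) e b' :
      Tan g b' →L[ℝ] Model g) (ContinuousLinearMap.inverse _ _)) i = _
    rw [h3]
  choose M hM using hint b hb hb'
  refine ⟨M, ?_⟩
  have hev : ∀ᶠ b' in 𝓝 b, ∀ i j,
      |fderiv ℝ (e' ∘ e.symm) (e b') (Pi.single j 1) i -
        fderiv ℝ (e' ∘ e.symm) (e b) (Pi.single j 1) i| < 1 := by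
    refine eventually_all.2 fun i => eventually_all.2 fun j => ?_
    have := Metric.continuousAt_iff'.1 (hcont i j) 1 one_pos
    simpa [Real.dist_eq] using this
  filter_upwards [hev, eventually_mem_both hb hb'] with b' h1 h2
  refine ⟨h2.1, h2.2, fun i => ?_⟩
  have hMb : ∀ j, dcoord e' b' i (coordVec e b' (Pi.single j 1)) = M i j := by
    intro j
    obtain ⟨n, hn⟩ := hint b' h2.1 h2.2 i j
    have h3 := h1 i j
    rw [← hval b' h2.1 h2.2, ← hval b hb hb', hn, hM i j] at h3
    have h4 : |n - M i j| < 1 := by exact_mod_cast h3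
    rw [Int.abs_lt_one_iff, sub_eq_zero] at h4
    rw [hn, h4]
  rw [← covec_eq he h2.1 (dcoord e' b' i)]
  simp only [hMb]
  rfl

lemma ChartRel.mul_eq_one (he : IsActionChart L.lattice e)
    {M N : Matrix (Fin g) (Fin g) ℤ} (h : ChartRel e e' M b) (h' : ChartRel e' e N b) :
    N * M = 1 := by
  ext j k
  have h1 := dcoord_coordVec he h.1 j (Pi.single k 1)
  rw [h'.2.2 j] at h1
  simp only [sum_apply, smul_apply, h.2.2, smul_eq_mul,
    dcoord_coordVec he h.1] at h1
  have h2 : ∀ x, ∑ i, (M x i : ℝ) * (Pi.single k 1 : Model g) i = M x k := by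
    intro x
    rw [Finset.sum_eq_single k] <;> simp +contextual
  simp only [h2] at h1
  rw [Matrix.mul_apply, Matrix.one_apply]
  have h3 : ((∑ i, N j i * M i k : ℤ) : ℝ) = (if j = k then (1 : ℤ) else 0 : ℤ) := by
    push_cast
    rw [h1, Pi.single_apply]
  exact_mod_cast h3

end ActionCharts

end FourierMukai

end

noncomputable section

namespace FourierMukai

open Filter Metric LagrangianLattice

set_option linter.unusedSectionVars false

/-! ### The parametrizations of the torus fibrations are local diffeomorphisms. -/

section GoodPlots

variable {g : ℕ} {B : Type*} [TopologicalSpace B] [ChartedSpace (Model g) B]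
  {L : LagrangianLattice g B}

/-- All components of a vector are integers. -/
def IsIntegral (y : Model g) : Prop := ∃ n : Fin g → ℤ, ∀ j, y j = n j

lemma IsIntegral.add {y y' : Model g} (h : IsIntegral y) (h' : IsIntegral y') :
    IsIntegral (y + y') := by
  obtain ⟨n, hn⟩ := h
  obtain ⟨n', hn'⟩ := h'
  exact ⟨n + n', fun j => by simp [hn, hn']⟩

lemma IsIntegral.neg {y : Model g} (h : IsIntegral y) : IsIntegral (-y) := by
  obtain ⟨n, hn⟩ := h
  exact ⟨-n, fun j => by simp [hn]⟩

lemma isIntegral_single (j : Fin g) : IsIntegral (Pi.single j 1 : Model g) :=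
  ⟨Pi.single j 1, fun i => by by_cases h : i = j <;> simp [h]⟩

lemma IsIntegral.eq_zero {y : Model g} (h : IsIntegral y) (h' : ∀ j, |y j| < 1) : y = 0 := by
  obtain ⟨n, hn⟩ := h
  funext j
  have h1 := h' j
  rw [hn] at h1 ⊢
  have h2 : |n j| < 1 := by exact_mod_cast h1
  rw [Int.abs_lt_one_iff] at h2
  simp [h2]

lemma Z_mk_eq_iff {b : B} {η η' : Cot g b} {v v' : Tan g b} :
    (⟨b, η, v⟩ : L.Z) = ⟨b, η', v'⟩ ↔ η - η' ∈ L.lattice b ∧ v - v' ∈ L.dualLattice b := by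
  rw [Z.mk.injEq]
  simp only [heq_eq_eq, true_and]
  rw [eq_comm, QuotientAddGroup.eq, eq_comm, QuotientAddGroup.eq, neg_add_eq_sub, neg_add_eq_sub]

lemma plotsZ_apply (e : L.ActionChart) {b : B} (hb : b ∈ e.1.source) (y w : Model g) :
    L.plotsZ.map e (e.1 b, y, w) = ⟨b, covec e.1 b y, coordVec e.1 b w⟩ := by
  have : ∀ b', b' = b → (⟨b', covec e.1 b' y, coordVec e.1 b' w⟩ : L.Z) =
      ⟨b, covec e.1 b y, coordVec e.1 b w⟩ := by
    rintro b' rfl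
    rfl
  exact this _ (e.1.left_inv hb)

lemma plotsX_apply (e : L.ActionChart) {b : B} (hb : b ∈ e.1.source) (y : Model g) :
    L.plotsX.map e (e.1 b, y) = ⟨b, covec e.1 b y⟩ := by
  have : ∀ b', b' = b → (⟨b', covec e.1 b' y⟩ : L.X) = ⟨b, covec e.1 b y⟩ := by
    rintro b' rfl
    rfl
  exact this _ (e.1.left_inv hb)

lemma plotsXhat_apply (e : L.ActionChart) {b : B} (hb : b ∈ e.1.source) (w : Model g) :
    L.plotsXhat.map e (e.1 b, w) = ⟨b, coordVec e.1 b w⟩ := by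
  have : ∀ b', b' = b → (⟨b', coordVec e.1 b' w⟩ : L.Xhat) = ⟨b, coordVec e.1 b w⟩ := by
    rintro b' rfl
    rfl
  exact this _ (e.1.left_inv hb)

variable [IsManifold 𝓘(ℝ, Model g) ∞ B]

lemma plotsZ_eq_iff (e : L.ActionChart) {b : B} (hb : b ∈ e.1.source) (y w y' w' : Model g) :
    L.plotsZ.map e (e.1 b, y, w) = L.plotsZ.map e (e.1 b, y', w') ↔
      IsIntegral (y - y') ∧ IsIntegral (w - w') := by
  rw [plotsZ_apply e hb, plotsZ_apply e hb, Z_mk_eq_iff, ← covec_sub, ← coordVec_sub,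
    covec_mem_lattice_iff e.2 hb, coordVec_mem_dualLattice_iff e.2 hb]
  rfl

lemma exists_action_chart (L : LagrangianLattice g B) (b : B) :
    ∃ e : L.ActionChart, b ∈ e.1.source :=
  ⟨⟨L.chart b, (L.exists_chart b).choose_spec.1⟩, (L.exists_chart b).choose_spec.2⟩

lemma exists_plotsZ_eq (e : L.ActionChart) (z : L.Z) (hz : z.base ∈ e.1.source) :
    ∃ y w, L.plotsZ.map e (e.1 z.base, y, w) = z := by
  obtain ⟨b, η, v⟩ := z
  obtain ⟨η, rfl⟩ := QuotientAddGroup.mk_surjective η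
  obtain ⟨v, rfl⟩ := QuotientAddGroup.mk_surjective v
  refine ⟨fun j => η (coordVec e.1 b (Pi.single j 1)), fun j => dcoord e.1 b j v, ?_⟩
  rw [plotsZ_apply e hz, covec_eq e.2 hz, coordVec_dcoord e.2 hz]

/-- On the fibres two action charts differ by integral matrices, and a point determines its
coordinates up to integral vectors; the transition map is the linear one, shifted by the integral
vector that matches the two given points. A parametrization is injective on balls of radius `1 / 2`
in `y` and `w`, where two points cannot differ by a nonzero integral vector. -/
lemma goodZ (L : LagrangianLattice g B) : L.plotsZ.Good where
  isOpen_dom e := e.1.open_target.prod isOpen_univ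
  surj z := by
    obtain ⟨e, he⟩ := exists_action_chart L z.base
    obtain ⟨y, w, h⟩ := exists_plotsZ_eq e z he
    exact ⟨e, _, ⟨e.1.map_source he, trivial⟩, h⟩
  transition := by
    rintro e ⟨x, y, w⟩ ha e' ⟨x', y', w'⟩ ha' h
    have hx : x ∈ e.1.target := ha.1
    have hx' : x' ∈ e'.1.target := ha'.1
    obtain ⟨b, hb, rfl⟩ : ∃ b ∈ e.1.source, e.1 b = x :=
      ⟨_, e.1.map_target hx, e.1.right_inv hx⟩
    obtain ⟨b', hb', rfl⟩ : ∃ b ∈ e'.1.source, e'.1 b = x' :=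
      ⟨_, e'.1.map_target hx', e'.1.right_inv hx'⟩
    have hbb : b = b' := by
      have := congrArg Z.base h
      simpa [plotsZ_apply e hb, plotsZ_apply e' hb'] using this
    subst hbb
    obtain ⟨M, hM⟩ := exists_chartRel e.2 e'.2 hb hb'
    obtain ⟨N, hN⟩ := exists_chartRel e'.2 e.2 hb' hb
    let ty : Model g → Model g := fun y i => ∑ j, y j * N j i
    let tw : Model g → Model g := fun w i => ∑ j, M i j * w j
    have key : ∀ b', ChartRel e.1 e'.1 M b' → ChartRel e'.1 e.1 N b' → ∀ y w,
        L.plotsZ.map e (e.1 b', y, w) = L.plotsZ.map e' (e'.1 b', ty y, tw w) := by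
      intro b' h1 h2 y w
      rw [plotsZ_apply e h1.1, plotsZ_apply e' h1.2.1, h1.coordVec_eq e'.2 e.2, h2.covec_eq]
    rw [key b hM.self_of_nhds hN.self_of_nhds, plotsZ_eq_iff e' hb'] at h
    refine ⟨fun a => (e'.1 (e.1.symm a.1), ty a.2.1 - (ty y - y'), tw a.2.2 - (tw w - w')),
      ?_, ?_, ?_⟩
    · have h1 : ∀ᶠ x in 𝓝 (e.1 b), ContDiffAt ℝ ∞ (e'.1 ∘ e.1.symm) x := by
        filter_upwards [eventually_symm hb (eventually_mem_both hb hb'), eventually_right_inv hb]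
          with x h3 h4
        have := contDiffAt_transition e.2 e'.2 h3.1 h3.2
        rwa [h4.2] at this
      have h2 : ∀ᶠ a : Model g × Model g × Model g in 𝓝 (e.1 b, y, w),
          ContDiffAt ℝ ∞ (e'.1 ∘ e.1.symm) a.1 := continuousAt_fst.eventually h1
      filter_upwards [h2] with a h3
      have hty : ContDiff ℝ ∞ ty := by fun_prop
      have htw : ContDiff ℝ ∞ tw := by fun_prop
      exact (ContDiffAt.comp (f := Prod.fst) a h3 contDiffAt_fst).prodMk
        (((hty.comp (contDiff_fst.comp contDiff_snd)).sub contDiff_const).contDiffAt.prodMk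
          ((htw.comp (contDiff_snd.comp contDiff_snd)).sub contDiff_const).contDiffAt)
    · simp [e.1.left_inv hb]
    · have h1 : ∀ᶠ x in 𝓝 (e.1 b), (ChartRel e.1 e'.1 M (e.1.symm x) ∧
          ChartRel e'.1 e.1 N (e.1.symm x)) ∧ e.1 (e.1.symm x) = x :=
        (eventually_symm hb (hM.and hN)).and ((eventually_right_inv hb).mono fun _ h => h.2)
      have h2 : ∀ᶠ a : Model g × Model g × Model g in 𝓝 (e.1 b, y, w),
          (ChartRel e.1 e'.1 M (e.1.symm a.1) ∧ ChartRel e'.1 e.1 N (e.1.symm a.1)) ∧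
            e.1 (e.1.symm a.1) = a.1 :=
        (continuousAt_fst (p := (e.1 b, y, w))).eventually
          (p := fun x => (ChartRel e.1 e'.1 M (e.1.symm x) ∧ ChartRel e'.1 e.1 N (e.1.symm x)) ∧
            e.1 (e.1.symm x) = x) h1
      filter_upwards [h2] with a h3
      have h4 := key _ h3.1.1 h3.1.2 a.2.1 a.2.2
      rw [h3.2] at h4
      change L.plotsZ.map e (a.1, a.2.1, a.2.2) = _
      rw [h4, plotsZ_eq_iff e' h3.1.1.2.1]
      simpa using h
  injOn := by
    rintro e ⟨x, y, w⟩ ha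
    refine ⟨e.1.target ×ˢ (ball y (1 / 2) ×ˢ ball w (1 / 2)),
      e.1.open_target.prod (isOpen_ball.prod isOpen_ball), ⟨ha.1, by simp, by simp⟩,
      fun a h => ⟨h.1, trivial⟩, ?_⟩
    rintro ⟨x1, y1, w1⟩ ⟨h1, h2, h3⟩ ⟨x2, y2, w2⟩ ⟨h1', h2', h3'⟩ h
    have hx : x1 = x2 := e.1.symm.injOn h1 h1' (congrArg Z.base h)
    subst hx
    simp only at h1 h2 h3 h2' h3'
    rw [← e.1.right_inv h1, plotsZ_eq_iff e (e.1.map_target h1)] at h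
    have hd : ∀ {c u v : Model g}, u ∈ ball c (1 / 2) → v ∈ ball c (1 / 2) →
        IsIntegral (u - v) → u = v := by
      intro c u v hu hv hi
      refine sub_eq_zero.1 (hi.eq_zero fun j => ?_)
      have h4 : dist u v < 1 := by
        have := dist_triangle_right u v c
        rw [mem_ball] at hu hv
        linarith
      have h5 := dist_le_pi_dist u v j
      rw [Real.dist_eq] at h5
      exact h5.trans_lt h4
    rw [hd h2 h2' h.1, hd h3 h3' h.2]

/-- The zero section of the missing factor embeds `L.X` into `L.Z`; this reduces everything about
`L.X` to the fibre product. -/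
lemma X_eq_iff {e e' : L.ActionChart} {a a' : Model g × Model g} (ha : a.1 ∈ e.1.target)
    (ha' : a'.1 ∈ e'.1.target) : L.plotsX.map e a = L.plotsX.map e' a' ↔
      L.plotsZ.map e (a.1, a.2, 0) = L.plotsZ.map e' (a'.1, a'.2, 0) := by
  refine ⟨fun h => ?_, fun h => congrArg Z.left h⟩
  obtain ⟨x, y⟩ := a
  obtain ⟨x', y'⟩ := a'
  simp only at ha ha'
  rw [← e.1.right_inv ha, ← e'.1.right_inv ha'] at h ⊢
  rw [plotsX_apply e (e.1.map_target ha), plotsX_apply e' (e'.1.map_target ha')] at h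
  rw [plotsZ_apply e (e.1.map_target ha), plotsZ_apply e' (e'.1.map_target ha'), coordVec_zero,
    coordVec_zero]
  have : ∀ p p' : L.X, p = p' → (⟨p.base, p.angle, ((0 : Tan g p.base) : Tan g _ ⧸ _)⟩ : L.Z) =
      ⟨p'.base, p'.angle, ((0 : Tan g p'.base) : Tan g _ ⧸ _)⟩ := by
    rintro p p' rfl
    rfl
  exact this _ _ h

lemma Xhat_eq_iff {e e' : L.ActionChart} {a a' : Model g × Model g} (ha : a.1 ∈ e.1.target)
    (ha' : a'.1 ∈ e'.1.target) : L.plotsXhat.map e a = L.plotsXhat.map e' a' ↔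
      L.plotsZ.map e (a.1, 0, a.2) = L.plotsZ.map e' (a'.1, 0, a'.2) := by
  refine ⟨fun h => ?_, fun h => congrArg Z.right h⟩
  obtain ⟨x, y⟩ := a
  obtain ⟨x', y'⟩ := a'
  simp only at ha ha'
  rw [← e.1.right_inv ha, ← e'.1.right_inv ha'] at h ⊢
  rw [plotsXhat_apply e (e.1.map_target ha), plotsXhat_apply e' (e'.1.map_target ha')] at h
  rw [plotsZ_apply e (e.1.map_target ha), plotsZ_apply e' (e'.1.map_target ha'), covec_zero,
    covec_zero]
  have : ∀ p p' : L.Xhat, p = p' → (⟨p.base, ((0 : Cot g p.base) : Cot g _ ⧸ _), p.angle⟩ : L.Z) =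
      ⟨p'.base, ((0 : Cot g p'.base) : Cot g _ ⧸ _), p'.angle⟩ := by
    rintro p p' rfl
    rfl
  exact this _ _ h

/-- Good parametrizations of a retract. -/
lemma Plots.Good.of_retract {Y Y' F F' : Type*} [NormedAddCommGroup F] [NormedSpace ℝ F]
    [NormedAddCommGroup F'] [NormedSpace ℝ F'] {P : Plots Y F} (hP : P.Good) (Q : Plots Y' F')
    (t : Q.ι → P.ι) (s : F' → F) (p : F → F') (π : Y → Y') (hs : ContDiff ℝ ∞ s)
    (hp : ContDiff ℝ ∞ p) (hps : ∀ a, p (s a) = a) (hdom : ∀ i, Q.dom i = s ⁻¹' P.dom (t i))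
    (hπ : ∀ i a, π (P.map (t i) a) = Q.map i (p a))
    (heq : ∀ i, ∀ a ∈ Q.dom i, ∀ i', ∀ a' ∈ Q.dom i', Q.map i a = Q.map i' a' ↔
      P.map (t i) (s a) = P.map (t i') (s a'))
    (hsurj : ∀ y, ∃ i, ∃ a ∈ Q.dom i, Q.map i a = y) : Q.Good where
  isOpen_dom i := by
    rw [hdom]
    exact (hP.isOpen_dom _).preimage hs.continuous
  surj := hsurj
  transition i a ha i' a' ha' h := by
    rw [heq i a ha i' a' ha'] at h
    rw [hdom] at ha ha'
    obtain ⟨k, hk, hka, hmap⟩ := hP.transition _ _ ha _ _ ha' h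
    refine ⟨p ∘ k ∘ s, ?_, by simp [hka, hps], ?_⟩
    · filter_upwards [hs.continuous.continuousAt.eventually hk] with x hx
      exact hp.contDiffAt.comp x (hx.comp x hs.contDiffAt)
    · filter_upwards [hs.continuous.continuousAt.eventually hmap] with x hx
      have := congrArg π hx
      rw [hπ, hπ, hps] at this
      exact this
  injOn i a ha := by
    have ha2 := ha
    rw [hdom] at ha2
    obtain ⟨O, hO, haO, hOd, hinj⟩ := hP.injOn _ _ ha2
    refine ⟨s ⁻¹' O, hO.preimage hs.continuous, haO, ?_, ?_⟩
    · rw [hdom]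
      exact Set.preimage_mono hOd
    · intro x hx x' hx' h
      have hxd : x ∈ Q.dom i := by rw [hdom]; exact hOd hx
      have hxd' : x' ∈ Q.dom i := by rw [hdom]; exact hOd hx'
      have := hinj hx hx' ((heq i x hxd i x' hxd').1 h)
      rw [← hps x, this, hps]

lemma exists_plotsX_eq (e : L.ActionChart) (p : L.X) (hp : p.base ∈ e.1.source) :
    ∃ y, L.plotsX.map e (e.1 p.base, y) = p := by
  obtain ⟨y, w, h⟩ := exists_plotsZ_eq e ⟨p.base, p.angle, ((0 : Tan g p.base) : Tan g _ ⧸ _)⟩ hp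
  exact ⟨y, congrArg Z.left h⟩

lemma exists_plotsXhat_eq (e : L.ActionChart) (ξ : L.Xhat) (hξ : ξ.base ∈ e.1.source) :
    ∃ w, L.plotsXhat.map e (e.1 ξ.base, w) = ξ := by
  obtain ⟨y, w, h⟩ := exists_plotsZ_eq e ⟨ξ.base, ((0 : Cot g ξ.base) : Cot g _ ⧸ _), ξ.angle⟩ hξ
  exact ⟨w, congrArg Z.right h⟩

lemma goodX (L : LagrangianLattice g B) : L.plotsX.Good :=
  (goodZ L).of_retract L.plotsX id (fun a => (a.1, a.2, 0)) (fun a => (a.1, a.2.1)) Z.left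
    (by fun_prop) (by fun_prop) (fun _ => rfl)
    (fun _ => by ext a; simp [plotsX, plotsZ]; rfl) (fun _ _ => rfl)
    (fun _ _ ha _ _ ha' => X_eq_iff ha.1 ha'.1) fun p => by
      obtain ⟨e, he⟩ := exists_action_chart L p.base
      obtain ⟨y, h⟩ := exists_plotsX_eq e p he
      exact ⟨e, _, ⟨e.1.map_source he, trivial⟩, h⟩

lemma goodXhat (L : LagrangianLattice g B) : L.plotsXhat.Good :=
  (goodZ L).of_retract L.plotsXhat id (fun a => (a.1, 0, a.2)) (fun a => (a.1, a.2.2)) Z.right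
    (by fun_prop) (by fun_prop) (fun _ => rfl)
    (fun _ => by ext a; simp [plotsXhat, plotsZ]; rfl) (fun _ _ => rfl)
    (fun _ _ ha _ _ ha' => Xhat_eq_iff ha.1 ha'.1) fun p => by
      obtain ⟨e, he⟩ := exists_action_chart L p.base
      obtain ⟨w, h⟩ := exists_plotsXhat_eq e p he
      exact ⟨e, _, ⟨e.1.map_source he, trivial⟩, h⟩

end GoodPlots

end FourierMukai

end

noncomputable section

namespace FourierMukai

open Filter Metric LagrangianLattice

set_option linter.unusedSectionVars false

/-- The space has smooth charts around all of its points. -/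
class HasCharts (Y : Type*) [SmoothSpace Y] : Prop where
  exists_chart : ∀ y : Y, ∃ (n : ℕ) (κ : OpenPartialHomeomorph Y (Fin n → ℝ)),
    IsSmoothChart κ ∧ y ∈ κ.source

lemma HasCharts.of_forall {Y : Type*} [SmoothSpace Y] {W : Type*} [NormedAddCommGroup W]
    [NormedSpace ℝ W] [FiniteDimensional ℝ W]
    (h : ∀ y : Y, ∃ (W₀ : Submodule ℝ W) (κ : OpenPartialHomeomorph Y W₀),
      IsSmoothChart κ ∧ y ∈ κ.source) : HasCharts Y where
  exists_chart y := by
    obtain ⟨W₀, κ, hκ, hy⟩ := h y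
    let l : W₀ ≃L[ℝ] (Fin (Module.finrank ℝ W₀) → ℝ) :=
      (Module.finBasis ℝ W₀).equivFun.toContinuousLinearEquiv
    refine ⟨_, κ.trans l.toHomeomorph.toOpenPartialHomeomorph, hκ.trans ?_ ?_, by simpa using hy⟩
    · exact l.contDiff.contDiffOn
    · exact l.symm.contDiff.contDiffOn

/-! ### Smooth functions and derivations on spaces that have charts. -/

section Api

variable {Y : Type*} [SmoothSpace Y] [HasCharts Y] {y : Y}

lemma mem_of_eventuallyEq {φ ψ : Y → ℂ} (hφ : φ ∈ smoothNear y) (h : φ =ᶠ[𝓝 y] ψ) :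
    ψ ∈ smoothNear y := by
  obtain ⟨n, κ, hκ, hy⟩ := HasCharts.exists_chart y
  exact hκ.mem_of_eventuallyEq hy hφ h

lemma germ_congr {φ ψ : Y → ℂ} (h : φ =ᶠ[𝓝 y] ψ) : germ y φ = germ y ψ := by
  obtain ⟨n, κ, hκ, hy⟩ := HasCharts.exists_chart y
  exact hκ.germ_congr hy h

variable {V V' : Type*} [NormedAddCommGroup V] [NormedSpace ℝ V] [FiniteDimensional ℝ V]
  [NormedAddCommGroup V'] [NormedSpace ℝ V'] [FiniteDimensional ℝ V']

lemma SmoothVec.continuousAt {u : Y → V} (hu : SmoothVec y u) : ContinuousAt u y := by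
  obtain ⟨n, κ, hκ, hy⟩ := HasCharts.exists_chart y
  exact hκ.continuousAt_vec hy hu

lemma SmoothVec.comp {u : Y → V} (hu : SmoothVec y u) {Φ : V → V'}
    (hΦ : ∀ᶠ x in 𝓝 (u y), ContDiffAt ℝ ∞ Φ x) : SmoothVec y (fun y' => Φ (u y')) := by
  obtain ⟨n, κ, hκ, hy⟩ := HasCharts.exists_chart y
  exact hκ.smoothVec_comp hy hu hΦ

lemma SmoothVec.comp_mem {u : Y → V} (hu : SmoothVec y u) {Φ : V → ℂ} (hΦ : SmoothNear (u y) Φ) :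
    (fun y' => Φ (u y')) ∈ smoothNear y := by
  obtain ⟨n, κ, hκ, hy⟩ := HasCharts.exists_chart y
  exact hκ.vec_comp_mem hy hu hΦ

lemma smoothVec_complex {φ : Y → ℂ} : SmoothVec y φ ↔ φ ∈ smoothNear y := by
  obtain ⟨n, κ, hκ, hy⟩ := HasCharts.exists_chart y
  exact hκ.smoothVec_complex hy

lemma SmoothVec.eventually {u : Y → V} (hu : SmoothVec y u) : ∀ᶠ y' in 𝓝 y, SmoothVec y' u := by
  obtain ⟨n, κ, hκ, hy⟩ := HasCharts.exists_chart y
  have h1 := (hκ.smoothVec_iff hy).1 hu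
  filter_upwards [eventually_apply hy h1.eventually_nhds, eventually_left_inv hy] with y' h2 h3
  exact (hκ.smoothVec_iff h3.1).2 h2

lemma smoothVec_pi {ι : Type*} [Fintype ι] {u : Y → ι → ℝ} :
    SmoothVec y u ↔ ∀ i, (fun y' => (u y' i : ℂ)) ∈ smoothNear y := by
  refine ⟨fun h i => h (ContinuousLinearMap.proj i), fun h => ?_⟩
  obtain ⟨n, κ, hκ, hy⟩ := HasCharts.exists_chart y
  rw [hκ.smoothVec_iff hy]
  filter_upwards [eventually_all.2 fun i => (hκ y hy _).1 (h i)] with x hx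
  exact contDiffAt_pi.2 fun i => contDiffAt_ofReal_iff.1 (hx i)

lemma der_comp (θ : Der y) {ι : Type*} [Fintype ι] (b : Module.Basis ι ℝ V) {u : Y → V}
    (hu : SmoothVec y u) {Φ : V → ℂ} (hΦ : SmoothNear (u y) Φ) :
    θ (germ y fun y' => Φ (u y')) = ∑ i, germ y (fun y' => fderiv ℝ Φ (u y') (b i)) *
      θ (germ y fun y' => (b.coord i (u y') : ℂ)) := by
  obtain ⟨n, κ, hκ, hy⟩ := HasCharts.exists_chart y
  exact hκ.der_comp hy θ b hu hΦ

/-- The chain rule for a holomorphic function. -/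
lemma der_comp_holomorphic (θ : Der y) {φ : Y → ℂ} (hφ : φ ∈ smoothNear y) {Φ Φ' : ℂ → ℂ}
    (hΦs : ContDiff ℝ ∞ Φ) (hΦ : ∀ x, HasDerivAt Φ (Φ' x) x) :
    θ (germ y fun y' => Φ (φ y')) = germ y (fun y' => Φ' (φ y')) * θ (germ y φ) := by
  have hd : ∀ x v, fderiv ℝ Φ x v = Φ' x * v := by
    intro x v
    have h1 : HasFDerivAt Φ (((ContinuousLinearMap.toSpanSingleton ℂ (Φ' x) : ℂ →L[ℂ] ℂ)).restrictScalars ℝ) x :=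
      (hΦ x).hasFDerivAt.restrictScalars ℝ
    rw [h1.fderiv]
    simp [mul_comm]
  have hΦ'm : (fun y' => Φ' (φ y')) ∈ smoothNear y := by
    have : Φ' = fun x => fderiv ℝ Φ x 1 := by
      funext x
      rw [hd, mul_one]
    rw [this]
    exact (smoothVec_complex.2 hφ).comp_mem
      (((hΦs.fderiv_right (m := ∞) (by simp)).clm_apply contDiff_const).smoothNear _)
  have hre : (fun y' => ((φ y').re : ℂ)) ∈ smoothNear y := smoothVec_complex.2 hφ Complex.reCLM
  have him : (fun y' => ((φ y').im : ℂ)) ∈ smoothNear y := smoothVec_complex.2 hφ Complex.imCLM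
  rw [der_comp θ Complex.basisOneI (smoothVec_complex.2 hφ) (hΦs.smoothNear _)]
  simp only [Fin.sum_univ_two, hd, Complex.coe_basisOneI, Matrix.cons_val_zero, Matrix.cons_val_one,
    mul_one]
  have e1 : germ y (fun y' => Φ' (φ y') * Complex.I) =
      germ y (fun y' => Φ' (φ y')) * algebraMap ℂ _ Complex.I := by
    rw [← germ_const, ← germ_mul hΦ'm (const_mem _)]
    rfl
  have e2 : germ y φ = germ y (fun y' => ((φ y').re : ℂ)) +
      algebraMap ℂ _ Complex.I * germ y (fun y' => ((φ y').im : ℂ)) := by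
    rw [← germ_const, ← germ_mul (const_mem _) him, ← germ_add hre (mul_mem (const_mem _) him)]
    congr 1
    funext y'
    simp only [Pi.add_apply, Pi.mul_apply]
    rw [mul_comm]
    exact (Complex.re_add_im (φ y')).symm
  rw [e1, e2, map_add, Derivation.leibniz, Derivation.map_algebraMap, smul_zero, add_zero,
    smul_eq_mul]
  have e3 : (fun y' => (Complex.basisOneI.coord 0 (φ y') : ℂ)) = fun y' => ((φ y').re : ℂ) := by
    funext y'
    simp
  have e4 : (fun y' => (Complex.basisOneI.coord 1 (φ y') : ℂ)) = fun y' => ((φ y').im : ℂ) := by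
    funext y'
    simp
  rw [e3, e4]
  ring

end Api

/-! ### Charts on closed submanifolds. -/

section Subspaces

variable {Y F : Type*} [NormedAddCommGroup F] [NormedSpace ℝ F] [FiniteDimensional ℝ F]
  {P : Plots Y F}

/-- A chart that straightens a closed submanifold. -/
lemma Plots.Good.exists_straightening (hP : P.Good) {A : Set Y} (hA : P.IsClosedSubmanifold A)
    (i : P.ι) {a : F} (ha : a ∈ P.dom i) (haA : P.map i a ∈ A) :
    letI := P.smoothSpace
    ∃ (κ : OpenPartialHomeomorph Y F) (W : Submodule ℝ F), IsSmoothChart κ ∧ P.map i a ∈ κ.source ∧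
      ∀ y ∈ κ.source, y ∈ A ↔ κ y ∈ W := by
  let _ := P.smoothSpace
  obtain ⟨φ, W, haφ, hφ, h1, h2, h3⟩ := hA.2 i a ⟨ha, haA⟩
  obtain ⟨κ, hκ, hs, hκa, ht, hsymm⟩ := hP.exists_chart i ha
  refine ⟨κ.trans φ, W, hκ.trans h1 h2, ?_, ?_⟩
  · rw [OpenPartialHomeomorph.trans_source]
    exact ⟨hs, by rw [Set.mem_preimage, hκa]; exact haφ⟩
  · intro y hy
    rw [OpenPartialHomeomorph.trans_source] at hy
    have h4 := h3 (κ y) hy.2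
    have h5 : P.map i (κ y) = y := by rw [← hsymm, κ.left_inv hy.1]
    rw [OpenPartialHomeomorph.coe_trans, Function.comp_apply, ← h4, Plots.preim, Set.mem_inter_iff,
      Set.mem_preimage, h5]
    exact ⟨fun h => ⟨hφ hy.2, h⟩, fun h => h.2⟩

lemma Plots.Good.hasCharts_of_range (hP : P.Good) {A : Type*} [SmoothSpace A] {ι : A → Y}
    (hι : @Topology.IsInducing A Y _ P.topology ι) (hinj : Function.Injective ι)
    (hA : P.IsClosedSubmanifold (Set.range ι))
    (hmem : letI := P.smoothSpace
      ∀ (a : A) (φ : A → ℂ), φ ∈ smoothNear a ↔ ∃ ψ ∈ smoothNear (ι a), φ =ᶠ[𝓝 a] ψ ∘ ι) :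
    HasCharts A := by
  let _ := P.smoothSpace
  refine HasCharts.of_forall (W := F) fun y => ?_
  have : Nonempty A := ⟨y⟩
  obtain ⟨i, a, ha, e⟩ := hP.surj (ι y)
  obtain ⟨κ, W, hκ, hs, hW⟩ := hP.exists_straightening hA i ha (by rw [e]; exact ⟨y, rfl⟩)
  rw [e] at hs
  exact ⟨W, subChart hι hinj κ W hW, isSmoothChart_subChart hι hinj hW hκ hmem, hs⟩

lemma hasCharts_subset {P : Plots Y F} (hP : P.Good) {A : Set Y} (hA : P.IsClosedSubmanifold A) :
    letI := P.smoothSpace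
    HasCharts A := by
  let _ := P.smoothSpace
  exact hP.hasCharts_of_range (ι := (Subtype.val : A → Y)) Topology.IsInducing.subtypeVal
    Subtype.val_injective (by simpa using hA) fun a φ => Iff.rfl

end Subspaces

/-! ### Charts on the spaces attached to `S`. -/

section Spaces

variable {g : ℕ} {B : Type*} [TopologicalSpace B] [ChartedSpace (Model g) B]
  {L : LagrangianLattice g B} [IsManifold 𝓘(ℝ, Model g) ∞ B] {S : Set L.X}

lemma hasCharts_S (hS : L.plotsX.IsClosedSubmanifold S) : HasCharts S :=
  hasCharts_subset (goodX L) hS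

lemma hasCharts_XhatS (hXS : L.plotsXhat.IsClosedSubmanifold (XhatS S)) : HasCharts (XhatS S) :=
  hasCharts_subset (goodXhat L) hXS

/-- `Shat` is a subset of the subset `XhatS S`, but its smooth functions are also the local
restrictions of those on `L.Xhat`, where it is a submanifold. -/
lemma hasCharts_Shat {Shat : Set (XhatS S)}
    (hShat : L.plotsXhat.IsClosedSubmanifold (Subtype.val '' Shat)) : HasCharts Shat := by
  refine (goodXhat L).hasCharts_of_range (ι := fun ξ : Shat => (ξ.1.1 : L.Xhat))
    (Topology.IsInducing.subtypeVal.comp Topology.IsInducing.subtypeVal)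
    (Subtype.val_injective.comp Subtype.val_injective) ?_ fun a φ => ?_
  · convert hShat using 1
    ext ξ
    simp
  · constructor
    · rintro ⟨ψ, ⟨χ, hχ, h1⟩, h2⟩
      refine ⟨χ, hχ, ?_⟩
      filter_upwards [h2, continuous_subtype_val.continuousAt.eventually h1] with a' h3 h4
      rw [h3, h4]
      rfl
    · rintro ⟨χ, hχ, h⟩
      exact ⟨χ ∘ Subtype.val, (isSmoothMap_val (XhatS S)).comp_mem a.1 χ hχ, h⟩

/-- In coordinates `(x, y, w)` the condition of lying in `ZS S` involves `(x, y)` only; so a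
straightening of `S`, extended by the identity in `w`, straightens it to `W.prod ⊤`. -/
lemma hasCharts_ZS (hS : L.plotsX.IsClosedSubmanifold S) : HasCharts (ZS S) := by
  refine HasCharts.of_forall (W := (Model g × Model g) × Model g) fun z => ?_
  have : Nonempty (ZS S) := ⟨z⟩
  obtain ⟨e, he⟩ := exists_action_chart L z.1.base
  obtain ⟨y, w, hz⟩ := exists_plotsZ_eq e z.1 he
  have ha : ((e.1 z.1.base, y, w) : Model g × Model g × Model g) ∈ L.plotsZ.dom e :=
    ⟨e.1.map_source he, trivial⟩
  have haX : ((e.1 z.1.base, y) : Model g × Model g) ∈ L.plotsX.dom e :=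
    ⟨e.1.map_source he, trivial⟩
  obtain ⟨κ, hκ, hs, hκa, ht, hsymm⟩ := (goodZ L).exists_chart e ha
  have hleft : ∀ a : Model g × Model g × Model g, (L.plotsZ.map e a).left =
      L.plotsX.map e (a.1, a.2.1) := fun _ => rfl
  have hzS : L.plotsX.map e (e.1 z.1.base, y) ∈ S := by
    have := z.2
    rw [← hz] at this
    exact this
  obtain ⟨φ, W, haφ, hφ, h1, h2, h3⟩ := hS.2 e _ ⟨haX, hzS⟩
  let as : (Model g × Model g × Model g) ≃L[ℝ] ((Model g × Model g) × Model g) :=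
    (ContinuousLinearEquiv.prodAssoc ℝ (Model g) (Model g) (Model g)).symm
  have has : ∀ a, as a = ((a.1, a.2.1), a.2.2) := fun a => rfl
  let φ' := φ.prod (OpenPartialHomeomorph.refl (Model g))
  have hφ'1 : ContDiffOn ℝ ∞ φ' φ'.source :=
    (h1.comp contDiff_fst.contDiffOn fun a ha => ha.1).prodMk contDiff_snd.contDiffOn
  have hφ'2 : ContDiffOn ℝ ∞ φ'.symm φ'.target :=
    (h2.comp contDiff_fst.contDiffOn fun a ha => ha.1).prodMk contDiff_snd.contDiffOn
  have hκ1 : IsSmoothChart (κ.trans as.toHomeomorph.toOpenPartialHomeomorph) :=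
    hκ.trans as.contDiff.contDiffOn as.symm.contDiff.contDiffOn
  have hκ2 := hκ1.trans hφ'1 hφ'2
  set κ' := (κ.trans as.toHomeomorph.toOpenPartialHomeomorph).trans φ' with hκ'
  have hsrc : ∀ z', z' ∈ κ'.source ↔ z' ∈ κ.source ∧ ((κ z').1, (κ z').2.1) ∈ φ.source := by
    intro z'
    simp [hκ', φ', has]
  have hval : ∀ z', κ' z' = (φ ((κ z').1, (κ z').2.1), (κ z').2.2) := fun z' => rfl
  have hW : ∀ z' ∈ κ'.source, z' ∈ Set.range (Subtype.val : ZS S → L.Z) ↔ κ' z' ∈ W.prod ⊤ := by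
    intro z' hz'
    rw [hsrc] at hz'
    have h4 : L.plotsZ.map e (κ z') = z' := by rw [← hsymm, κ.left_inv hz'.1]
    rw [hval, Submodule.mem_prod, ← h3 _ hz'.2, Subtype.range_coe, ← h4]
    simp only [h4, Submodule.mem_top, and_true]
    change z'.left ∈ S ↔ _
    rw [← h4, hleft, h4]
    exact ⟨fun h => ⟨hφ hz'.2, h⟩, fun h => h.2⟩
  rw [hz] at hs hκa
  refine ⟨W.prod ⊤, subChart Topology.IsInducing.subtypeVal Subtype.val_injective κ' _ hW,
    isSmoothChart_subChart Topology.IsInducing.subtypeVal Subtype.val_injective hW hκ2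
      fun a φ => Iff.rfl, ?_⟩
  change z.1 ∈ κ'.source
  refine (hsrc _).2 ⟨hs, ?_⟩
  rw [hκa]
  exact haφ

end Spaces

end FourierMukai

end

noncomputable section

namespace FourierMukai

open Filter Metric LagrangianLattice

set_option linter.unusedSectionVars false

/-! ### Separation, compact fibres and tubes around fibres. -/

section Topology

variable {g : ℕ} {B : Type*} [TopologicalSpace B] [ChartedSpace (Model g) B]
  {L : LagrangianLattice g B} [IsManifold 𝓘(ℝ, Model g) ∞ B] {S : Set L.X}

lemma continuous_Z_base : Continuous (Z.base : L.Z → B) := by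
  refine continuous_def.2 fun U hU => ((goodZ L).isOpen_iff _).2 fun e => ?_
  have h1 : IsOpen (e.1.target ∩ e.1.symm ⁻¹' U) := e.1.symm.isOpen_inter_preimage hU
  have h2 : L.plotsZ.dom e ∩ L.plotsZ.map e ⁻¹' (Z.base ⁻¹' U) =
      (e.1.target ∩ e.1.symm ⁻¹' U) ×ˢ Set.univ := ?_
  · rw [h2]
    exact h1.prod (isOpen_univ (X := Model g × Model g))
  ext a
  constructor
  · rintro ⟨⟨h2, -⟩, h3⟩
    exact ⟨⟨h2, h3⟩, trivial⟩
  · rintro ⟨⟨h2, h3⟩, -⟩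
    exact ⟨⟨h2, trivial⟩, h3⟩

lemma plotsXhat_eq_iff (e : L.ActionChart) {b : B} (hb : b ∈ e.1.source) (w w' : Model g) :
    L.plotsXhat.map e (e.1 b, w) = L.plotsXhat.map e (e.1 b, w') ↔ IsIntegral (w - w') := by
  refine (Xhat_eq_iff (e.1.map_source hb) (e.1.map_source hb)).trans
    ((plotsZ_eq_iff e hb 0 w 0 w').trans ?_)
  simp only [sub_self, and_iff_right_iff_imp]
  exact fun _ => ⟨0, fun _ => by simp⟩

lemma isClosed_isIntegral : IsClosed {y : Model g | IsIntegral y} := by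
  have : {y : Model g | IsIntegral y} = ⋂ j, {y | y j ∈ Set.range ((↑) : ℤ → ℝ)} := by
    ext y
    simp only [Set.mem_ofPred_eq, Set.mem_iInter, Set.mem_range, IsIntegral]
    refine ⟨fun ⟨n, hn⟩ j => ⟨n j, (hn j).symm⟩, fun h => ?_⟩
    choose n hn using h
    exact ⟨n, fun j => (hn j).symm⟩
  rw [this]
  exact isClosed_iInter fun j =>
    Int.isClosedEmbedding_coe_real.isClosed_range.preimage (continuous_apply j)

/-- Points over different base points are separated in `B`. Over the same base point, the set of
pairs of fibre coordinates whose difference is not integral is open, and a product neighbourhood in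
it gives disjoint images. -/
instance [T2Space B] : T2Space L.Z where
  t2 := by
    intro z z' hne
    by_cases hb : z.base = z'.base
    · obtain ⟨e, he⟩ := exists_action_chart L z.base
      obtain ⟨y, w, hz⟩ := exists_plotsZ_eq e z he
      obtain ⟨y', w', hz'⟩ := exists_plotsZ_eq e z' (hb ▸ he)
      rw [← hb] at hz'
      have hopen : IsOpen {q : (Model g × Model g) × (Model g × Model g) |
          ¬ (IsIntegral (q.1.1 - q.2.1) ∧ IsIntegral (q.1.2 - q.2.2))} := by
        have h1 : IsClosed {q : (Model g × Model g) × (Model g × Model g) |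
            IsIntegral (q.1.1 - q.2.1)} := isClosed_isIntegral.preimage
          (f := fun q : (Model g × Model g) × (Model g × Model g) => q.1.1 - q.2.1) (by fun_prop)
        have h2 : IsClosed {q : (Model g × Model g) × (Model g × Model g) |
            IsIntegral (q.1.2 - q.2.2)} := isClosed_isIntegral.preimage
          (f := fun q : (Model g × Model g) × (Model g × Model g) => q.1.2 - q.2.2) (by fun_prop)
        exact (h1.inter h2).isOpen_compl
      have hmem : ((y, w), (y', w')) ∈ {q : (Model g × Model g) × (Model g × Model g) |
          ¬ (IsIntegral (q.1.1 - q.2.1) ∧ IsIntegral (q.1.2 - q.2.2))} := by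
        intro h
        exact hne (by rw [← hz, ← hz']; exact (plotsZ_eq_iff e he _ _ _ _).2 h)
      obtain ⟨u, v, hu, hv, hyu, hyv, huv⟩ := isOpen_prod_iff.1 hopen _ _ hmem
      refine ⟨L.plotsZ.map e '' (e.1.target ×ˢ u), L.plotsZ.map e '' (e.1.target ×ˢ v),
        (goodZ L).isOpen_image e (e.1.open_target.prod hu) (fun a h => ⟨h.1, trivial⟩),
        (goodZ L).isOpen_image e (e.1.open_target.prod hv) (fun a h => ⟨h.1, trivial⟩),
        ⟨_, ⟨e.1.map_source he, hyu⟩, hz⟩, ⟨_, ⟨e.1.map_source he, hyv⟩, hz'⟩, ?_⟩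
      rw [Set.disjoint_left]
      rintro _ ⟨⟨x1, p⟩, ⟨h1, h2⟩, rfl⟩ ⟨⟨x2, q⟩, ⟨h3, h4⟩, h⟩
      have hx : x2 = x1 := e.1.symm.injOn h3 h1 (congrArg Z.base h)
      subst hx
      simp only at h1
      rw [← e.1.right_inv h1] at h
      exact huv (⟨h2, h4⟩ : (p, q) ∈ u ×ˢ v)
        ((plotsZ_eq_iff e (e.1.map_target h1) p.1 p.2 q.1 q.2).1 h.symm)
    · obtain ⟨U, V, hU, hV, hzU, hzV, hUV⟩ := t2_separation hb
      exact ⟨_, _, hU.preimage continuous_Z_base, hV.preimage continuous_Z_base, hzU, hzV,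
        hUV.preimage _⟩

/-- The inclusion of the dual fibration by the zero section. -/
def zeroSection (ξ : L.Xhat) : L.Z := ⟨ξ.base, ((0 : Cot g ξ.base) : Cot g _ ⧸ _), ξ.angle⟩

lemma isSmoothMap_zeroSection : IsSmoothMap (zeroSection : L.Xhat → L.Z) :=
  Plots.isSmoothMap L.plotsZ L.plotsXhat zeroSection id (fun a => (a.1, 0, a.2)) (by fun_prop)
    (fun _ _ ha => ⟨ha.1, trivial⟩) (fun e a => by
      have h1 : ∀ b, ((covec e.1 b (0 : Model g) : Cot g b) : Cot g b ⧸ L.lattice b) =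
        ((0 : Cot g b) : Cot g b ⧸ L.lattice b) := fun b => by rw [covec_zero]
      exact congrArg (fun η => (⟨_, η, _⟩ : L.Z)) (h1 (e.1.symm a.1)).symm)

instance [T2Space B] : T2Space L.Xhat :=
  T2Space.of_injective_continuous (f := zeroSection)
    (fun _ _ h => congrArg Z.right h) isSmoothMap_zeroSection.continuous

/-- The unit cube. -/
def cube (g : ℕ) : Set (Model g) := Set.Icc 0 1

lemma isCompact_cube : IsCompact (cube g) := isCompact_Icc

lemma exists_mem_cube (y : Model g) : ∃ y' ∈ cube g, IsIntegral (y' - y) :=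
  ⟨fun j => Int.fract (y j), ⟨fun j => Int.fract_nonneg _, fun j => (Int.fract_lt_one _).le⟩,
    fun j => -⌊y j⌋, fun j => by
      have := Int.floor_add_fract (y j)
      simp only [Pi.sub_apply]
      push_cast
      linarith⟩

/-- A neighbourhood of a fibre of the projection of `Z` contains the fibres over a
neighbourhood. -/
lemma exists_tube_Z {O : Set L.Z} (hO : IsOpen O) {ξ : L.Xhat} (h : ∀ z : L.Z, z.right = ξ → z ∈ O) :
    ∃ U : Set L.Xhat, IsOpen U ∧ ξ ∈ U ∧ ∀ z : L.Z, z.right ∈ U → z ∈ O := by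
  obtain ⟨e, he⟩ := exists_action_chart L ξ.base
  obtain ⟨w, hw⟩ := exists_plotsXhat_eq e ξ he
  let k : (Model g × Model g) × Model g → Model g × Model g × Model g := fun q => (q.1.1, q.2, q.1.2)
  have hk : Continuous k := by fun_prop
  have hn := ((goodZ L).isOpen_iff O).1 hO e
  -- Every point of a fibre has angle coordinates in the compact unit cube, so the tube lemma
  -- applies to the cube.
  obtain ⟨u, v, hu, hv, hwu, hcv, huv⟩ := generalized_tube_lemma
    (s := {(e.1 ξ.base, w)}) isCompact_singleton (t := cube g) isCompact_cube (hn.preimage hk) (by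
      rintro ⟨a, y⟩ ⟨ha, -⟩
      rw [Set.mem_singleton_iff] at ha
      subst ha
      exact ⟨⟨e.1.map_source he, trivial⟩, h _ hw⟩)
  refine ⟨L.plotsXhat.map e '' (u ∩ e.1.target ×ˢ Set.univ), (goodXhat L).isOpen_image e
    (hu.inter (e.1.open_target.prod isOpen_univ)) (fun a h => h.2),
    ⟨_, ⟨hwu rfl, e.1.map_source he, trivial⟩, hw⟩, ?_⟩
  rintro z ⟨⟨x, w'⟩, ⟨hxu, hx, -⟩, hz⟩
  have hb : e.1.symm x = z.base := congrArg Xhat.base hz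
  have hbs : z.base ∈ e.1.source := hb ▸ e.1.map_target hx
  have hxe : x = e.1 z.base := by rw [← hb, e.1.right_inv hx]
  subst hxe
  obtain ⟨y, w'', hyw⟩ := exists_plotsZ_eq e z hbs
  have hw'' : IsIntegral (w'' - w') := by
    have h1 : L.plotsXhat.map e (e.1 z.base, w'') = L.plotsXhat.map e (e.1 z.base, w') := by
      rw [hz]
      exact congrArg Z.right hyw
    exact (plotsXhat_eq_iff e hbs _ _).1 h1
  obtain ⟨y', hy', hyy⟩ := exists_mem_cube y
  have h1 := (plotsZ_eq_iff e hbs y' w' y w'').2 ⟨hyy, by simpa using hw''.neg⟩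
  have h2 := huv (show ((e.1 z.base, w'), y') ∈ u ×ˢ v from ⟨hxu, hcv hy'⟩)
  have h3 : L.plotsZ.map e (e.1 z.base, y', w') ∈ O := h2.2
  rwa [h1, hyw] at h3

lemma isCompact_fibre_Z (ξ : L.Xhat) : IsCompact {z : L.Z | z.right = ξ} := by
  obtain ⟨e, he⟩ := exists_action_chart L ξ.base
  obtain ⟨w, hw⟩ := exists_plotsXhat_eq e ξ he
  have : {z : L.Z | z.right = ξ} = (fun y => L.plotsZ.map e (e.1 ξ.base, y, w)) '' cube g := by
    ext z
    constructor
    · intro hz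
      have hb : z.base = ξ.base := congrArg Xhat.base hz
      obtain ⟨y, w', h⟩ := exists_plotsZ_eq e z (hb ▸ he)
      rw [hb] at h
      obtain ⟨y', hy', hyy⟩ := exists_mem_cube y
      refine ⟨y', hy', ?_⟩
      simp only
      rw [← h, plotsZ_eq_iff e he]
      refine ⟨hyy, ?_⟩
      have h1 : L.plotsXhat.map e (e.1 ξ.base, w) = L.plotsXhat.map e (e.1 ξ.base, w') := by
        exact hw.trans (hz.symm.trans (congrArg Z.right h).symm)
      exact (plotsXhat_eq_iff e he _ _).1 h1
    · rintro ⟨y, -, rfl⟩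
      exact hw
  rw [this]
  refine isCompact_cube.image_of_continuousOn ?_
  exact ((goodZ L).continuousOn e).comp (by fun_prop) fun y _ => ⟨e.1.map_source he, trivial⟩

lemma isClosed_ZS (hS : L.plotsX.IsClosedSubmanifold S) : IsClosed (ZS S) :=
  IsClosed.preimage isSmoothMap_left.continuous (show IsClosed S from hS.1)

/-- The complement of the closed set `ZS S` is added to the open set; this reduces the claim to
`L.Z`. -/
lemma exists_tube (hS : L.plotsX.IsClosedSubmanifold S) {O : Set (ZS S)} (hO : IsOpen O)
    {ξ : XhatS S} (h : ∀ z : ZS S, phatS z = ξ → z ∈ O) :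
    ∃ U : Set (XhatS S), IsOpen U ∧ ξ ∈ U ∧ ∀ z, phatS z ∈ U → z ∈ O := by
  obtain ⟨O', hO', rfl⟩ := isOpen_induced_iff.1 hO
  obtain ⟨U, hU, hξU, hUO⟩ := exists_tube_Z (O := O' ∪ (ZS S)ᶜ)
    (hO'.union (isClosed_ZS hS).isOpen_compl) (ξ := ξ.1) (by
      intro z hz
      by_cases hzS : z ∈ ZS S
      · exact Or.inl (h ⟨z, hzS⟩ (Subtype.ext hz))
      · exact Or.inr hzS)
  refine ⟨Subtype.val ⁻¹' U, hU.preimage continuous_subtype_val, hξU, fun z hz => ?_⟩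
  exact (hUO z.1 hz).resolve_right fun h => h z.2

lemma isCompact_fibre (hS : L.plotsX.IsClosedSubmanifold S) (ξ : XhatS S) :
    IsCompact {z : ZS S | phatS z = ξ} := by
  rw [Topology.IsInducing.subtypeVal.isCompact_iff]
  have : (Subtype.val '' {z : ZS S | phatS z = ξ}) = {z : L.Z | z.right = ξ.1} ∩ ZS S := by
    ext z
    simp only [Set.mem_image, Set.mem_ofPred_eq, Subtype.exists, exists_and_right, exists_eq_right,
      Set.mem_inter_iff]
    constructor
    · rintro ⟨hz, h⟩
      exact ⟨congrArg Subtype.val h, hz⟩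
    · rintro ⟨h, hz⟩
      exact ⟨hz, Subtype.ext h⟩
  rw [this]
  exact (isCompact_fibre_Z ξ.1).inter_right (isClosed_ZS hS)

/-- Needed for partitions of unity: countably many compact sets of `B`, each inside an action chart,
are multiplied with the unit cube. -/
instance [SecondCountableTopology B] : SigmaCompactSpace L.Xhat := by
  have : LocallyCompactSpace B := ChartedSpace.locallyCompactSpace (Model g) B
  have hK : ∀ b : B, ∃ (e : L.ActionChart) (K : Set B), K ∈ 𝓝 b ∧ IsCompact K ∧ K ⊆ e.1.source := by
    intro b
    obtain ⟨e, he⟩ := exists_action_chart L b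
    obtain ⟨K, h1, h2, h3⟩ := local_compact_nhds (e.1.open_source.mem_nhds he)
    exact ⟨e, K, h1, h3, h2⟩
  choose e K hK1 hK2 hK3 using hK
  obtain ⟨s, hs, hcov⟩ := TopologicalSpace.countable_cover_nhds hK1
  have hcomp : ∀ b, IsCompact (L.plotsXhat.map (e b) '' (((e b).1 '' K b) ×ˢ cube g)) := by
    intro b
    refine (((hK2 b).image_of_continuousOn ((e b).1.continuousOn.mono (hK3 b))).prod
      isCompact_cube).image_of_continuousOn (((goodXhat L).continuousOn (e b)).mono ?_)
    rintro ⟨x, w⟩ ⟨⟨b', hb', rfl⟩, -⟩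
    exact ⟨(e b).1.map_source (hK3 b hb'), trivial⟩
  have : Countable s := hs
  refine SigmaCompactSpace.of_countable
    ((fun b => L.plotsXhat.map (e b) '' (((e b).1 '' K b) ×ˢ cube g)) '' s) (hs.image _) ?_ ?_
  · rintro _ ⟨b, -, rfl⟩
    exact hcomp b
  · refine Set.eq_univ_of_forall fun ξ => ?_
    have h1 : ξ.base ∈ ⋃ b ∈ s, K b := hcov ▸ Set.mem_univ _
    obtain ⟨b, hb, hξ⟩ := Set.mem_iUnion₂.1 h1
    refine Set.mem_sUnion.2 ⟨_, ⟨b, hb, rfl⟩, ?_⟩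
    obtain ⟨w, hw⟩ := exists_plotsXhat_eq (e b) ξ (hK3 b hξ)
    obtain ⟨w', hw', hww⟩ := exists_mem_cube w
    refine ⟨((e b).1 ξ.base, w'), ⟨⟨_, hξ, rfl⟩, hw'⟩, ?_⟩
    exact ((plotsXhat_eq_iff (e b) (hK3 b hξ) _ _).2 hww).trans hw

end Topology

/-! ### Partitions of unity. -/

section Partition

variable {Y F : Type*} [SmoothSpace Y] [NormedAddCommGroup F] [NormedSpace ℝ F]
  [FiniteDimensional ℝ F]

/-- The manifold structure given by the smooth charts. -/
@[reducible]
def chartedSpaceOfCharts (h : ∀ y : Y, ∃ κ : OpenPartialHomeomorph Y F,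
    IsSmoothChart κ ∧ y ∈ κ.source) : ChartedSpace F Y where
  atlas := {κ | IsSmoothChart κ}
  chartAt y := (h y).choose
  mem_chart_source y := (h y).choose_spec.2
  chart_mem_atlas y := (h y).choose_spec.1

lemma isManifold_of_charts (h : ∀ y : Y, ∃ κ : OpenPartialHomeomorph Y F,
    IsSmoothChart κ ∧ y ∈ κ.source) :
    letI := chartedSpaceOfCharts h
    IsManifold 𝓘(ℝ, F) ∞ Y := by
  let _ := chartedSpaceOfCharts h
  refine isManifold_of_contDiffOn _ _ _ fun κ κ' hκ hκ' => ?_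
  rintro x ⟨hx, -⟩
  have hx' : x ∈ (κ.symm.trans κ').source := hx
  rw [OpenPartialHomeomorph.trans_source] at hx'
  have h1 : x ∈ κ.target := hx'.1
  have h2 : κ.symm x ∈ κ'.source := hx'.2
  have hκ : IsSmoothChart κ := hκ
  have hκ' : IsSmoothChart κ' := hκ'
  have h3 := (hκ.smoothVec_iff (κ.map_target h1)).1 (hκ'.smoothVec_self h2)
  rw [κ.right_inv h1] at h3
  exact h3.self_of_nhds.contDiffWithinAt

lemma exists_partition [T2Space Y] [SigmaCompactSpace Y]
    (h : ∀ y : Y, ∃ κ : OpenPartialHomeomorph Y F, IsSmoothChart κ ∧ y ∈ κ.source) {A : Set Y}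
    (hA : IsClosed A) {ι : Type*} (U : ι → Set Y) (hU : ∀ i, IsOpen (U i)) (hAU : A ⊆ ⋃ i, U i) :
    ∃ f : ι → Y → ℝ, (∀ i y, (fun y' => (f i y' : ℂ)) ∈ smoothNear y) ∧
      LocallyFinite (fun i => Function.support (f i)) ∧ (∀ y ∈ A, ∑ᶠ i, f i y = 1) ∧
      ∀ i, tsupport (f i) ⊆ U i := by
  let _ := chartedSpaceOfCharts h
  have := isManifold_of_charts h
  obtain ⟨f, hf⟩ := SmoothPartitionOfUnity.exists_isSubordinate 𝓘(ℝ, F) hA U hU hAU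
  refine ⟨fun i => f i, fun i y => ?_, f.locallyFinite, fun y hy => f.sum_eq_one hy, hf⟩
  obtain ⟨κ, hκ, hy⟩ := h y
  rw [hκ y hy]
  have hmem : κ ∈ IsManifold.maximalAtlas 𝓘(ℝ, F) ∞ Y :=
    IsManifold.subset_maximalAtlas (show κ ∈ {κ | IsSmoothChart κ} from hκ)
  filter_upwards [eventually_right_inv hy] with x hx
  have h1 : ContMDiffAt 𝓘(ℝ, F) 𝓘(ℝ) ∞ (f i) (κ.symm x) := (f i).contMDiff _
  have h2 := h1.comp x (contMDiffAt_symm_of_mem_maximalAtlas hmem hx.1)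
  exact contDiffAt_ofReal_iff.2 (contMDiffAt_iff_contDiffAt.1 h2)

end Partition

section PartitionXhatS

variable {g : ℕ} {B : Type*} [TopologicalSpace B] [ChartedSpace (Model g) B]
  {L : LagrangianLattice g B} [IsManifold 𝓘(ℝ, Model g) ∞ B] {S : Set L.X}

/-- A partition of unity along `Shat`. -/
lemma exists_partition_Shat [T2Space B] [SecondCountableTopology B] {Shat : Set (XhatS S)}
    (hShat : L.plotsXhat.IsClosedSubmanifold (Subtype.val '' Shat)) (U : Shat → Set (XhatS S))
    (hU : ∀ i, IsOpen (U i)) (hmem : ∀ i : Shat, i.1 ∈ U i) :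
    ∃ f : Shat → XhatS S → ℂ, (∀ i ξ, f i ∈ smoothNear ξ) ∧
      LocallyFinite (fun i => Function.support (f i)) ∧ (∀ ξ ∈ Shat, ∑ᶠ i, f i ξ = 1) ∧
      ∀ i, tsupport (f i) ⊆ U i := by
  -- The partition of unity is constructed on `L.Xhat`, whose charts all have the same model space,
  -- and then restricted to `XhatS S`.
  have hV : ∀ i, ∃ V : Set L.Xhat, IsOpen V ∧ Subtype.val ⁻¹' V = U i := fun i =>
    isOpen_induced_iff.1 (hU i)
  choose V hVo hVU using hV
  obtain ⟨f, h1, h2, h3, h4⟩ := exists_partition (F := Model g × Model g) (fun ξ : L.Xhat => by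
    obtain ⟨e, a, ha, rfl⟩ := (goodXhat L).surj ξ
    obtain ⟨κ, hκ, hs, -⟩ := (goodXhat L).exists_chart e ha
    exact ⟨κ, hκ, hs⟩) (A := Subtype.val '' Shat) hShat.1 V hVo (by
      rintro _ ⟨ξ, hξ, rfl⟩
      refine Set.mem_iUnion.2 ⟨⟨ξ, hξ⟩, ?_⟩
      have := hmem ⟨ξ, hξ⟩
      rw [← hVU] at this
      exact this)
  refine ⟨fun i ξ => (f i ξ.1 : ℂ), fun i ξ => ?_, ?_, ?_, ?_⟩
  · exact (isSmoothMap_val (XhatS S)).comp_mem ξ _ (h1 i ξ.1)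
  · have := h2.preimage_continuous (continuous_subtype_val (p := fun x => x ∈ XhatS S))
    refine this.subset fun i ξ hξ => ?_
    simpa using hξ
  · intro ξ hξ
    have := h3 ξ.1 ⟨ξ, hξ, rfl⟩
    have hfin : (Function.support fun i => f i ξ.1).Finite := by
      exact h2.point_finite ξ.1
    have h5 := (Complex.ofRealHom.toAddMonoidHom).map_finsum hfin
    rw [this] at h5
    simpa using h5.symm
  · intro i
    have h5 : tsupport (fun ξ : XhatS S => (f i ξ.1 : ℂ)) ⊆ Subtype.val ⁻¹' tsupport (f i) := by
      refine closure_minimal ?_ ((isClosed_tsupport (f i)).preimage continuous_subtype_val)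
      intro ξ hξ
      refine subset_tsupport _ ?_
      simpa using hξ
    refine h5.trans ?_
    rw [← hVU]
    exact Set.preimage_mono (h4 i)

end PartitionXhatS

end FourierMukai

end

noncomputable section

namespace FourierMukai

open Filter Metric LagrangianLattice

set_option linter.unusedSectionVars false

/-! ### Angle and dual coordinates; the connection form and its curvature. -/

section Lifts

variable {g : ℕ} {B : Type*} [TopologicalSpace B] [ChartedSpace (Model g) B]
  {L : LagrangianLattice g B} {S : Set L.X}

/-- `y` are angle coordinates near `z₀`, in the action chart `e`. -/
structure AngleLift (e : L.ActionChart) (z₀ : ZS S) (y : ZS S → Model g) : Prop where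
  smooth : SmoothVec z₀ y
  eq : ∀ᶠ z in 𝓝 z₀, z.1.base ∈ e.1.source ∧ z.1.angle = (covec e.1 z.1.base (y z) : Cot g _)

/-- `w` are dual coordinates near `ξ₀`, in the action chart `e`. -/
structure DualLift (e : L.ActionChart) (ξ₀ : XhatS S) (w : XhatS S → Model g) : Prop where
  smooth : SmoothVec ξ₀ w
  eq : ∀ᶠ ξ in 𝓝 ξ₀, ξ.1.base ∈ e.1.source ∧ ξ.1.angle = (coordVec e.1 ξ.1.base (w ξ) : Tan g _)

variable [IsManifold 𝓘(ℝ, Model g) ∞ B]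

lemma Z_angle_eq {e : L.ActionChart} {z : L.Z} (hb : z.base ∈ e.1.source) {y w : Model g}
    (h : L.plotsZ.map e (e.1 z.base, y, w) = z) : z.angle = (covec e.1 z.base y : Cot g _) := by
  rw [plotsZ_apply e hb] at h
  obtain ⟨b, η, v⟩ := z
  simp only [Z.mk.injEq, heq_eq_eq, true_and] at h
  exact h.1.symm

lemma Xhat_angle_eq {e : L.ActionChart} {ξ : L.Xhat} (hb : ξ.base ∈ e.1.source) {w : Model g}
    (h : L.plotsXhat.map e (e.1 ξ.base, w) = ξ) : ξ.angle = (coordVec e.1 ξ.base w : Tan g _) := by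
  rw [plotsXhat_apply e hb] at h
  obtain ⟨b, v⟩ := ξ
  simp only [Xhat.mk.injEq, heq_eq_eq, true_and] at h
  exact h.symm

lemma Xhat_map_eq {e : L.ActionChart} {ξ : L.Xhat} (hb : ξ.base ∈ e.1.source) {w : Model g}
    (h : ξ.angle = (coordVec e.1 ξ.base w : Tan g _)) : L.plotsXhat.map e (e.1 ξ.base, w) = ξ := by
  rw [plotsXhat_apply e hb]
  obtain ⟨b, v⟩ := ξ
  simp only [Xhat.mk.injEq, heq_eq_eq, true_and]
  exact h.symm

lemma exists_angleLift (e : L.ActionChart) (z₀ : ZS S) (hb : z₀.1.base ∈ e.1.source) :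
    ∃ y : ZS S → Model g, AngleLift e z₀ y := by
  obtain ⟨y, w, hz⟩ := exists_plotsZ_eq e z₀.1 hb
  have ha : ((e.1 z₀.1.base, y, w) : Model g × Model g × Model g) ∈ L.plotsZ.dom e :=
    ⟨e.1.map_source hb, trivial⟩
  obtain ⟨κ, hκ, hs, hκa, ht, hsymm⟩ := (goodZ L).exists_chart e ha
  rw [hz] at hs hκa
  refine ⟨fun z => (κ z.1).2.1, fun ℓ => ?_, ?_⟩
  · exact (isSmoothMap_val (ZS S)).comp_mem z₀ _ (hκ.smoothVec_self hs
      (ℓ.comp ((ContinuousLinearMap.fst ℝ _ _).comp (ContinuousLinearMap.snd ℝ _ _))))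
  · have h1 : ∀ᶠ z : L.Z in 𝓝 z₀.1, z ∈ κ.source := κ.open_source.mem_nhds hs
    have h2 : ∀ᶠ z : ZS S in 𝓝 z₀, z.1 ∈ κ.source :=
      continuous_subtype_val.continuousAt.eventually h1
    filter_upwards [h2] with z hz'
    have h3 : L.plotsZ.map e (κ z.1) = z.1 := by rw [← hsymm, κ.left_inv hz']
    have h4 : (κ z.1).1 ∈ e.1.target := (ht (κ.map_source hz')).1
    have h5 : e.1.symm (κ z.1).1 = z.1.base := congrArg Z.base h3
    have h6 : z.1.base ∈ e.1.source := h5 ▸ e.1.map_target h4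
    refine ⟨h6, Z_angle_eq (w := (κ z.1).2.2) h6 ?_⟩
    rw [← h5, e.1.right_inv h4]
    exact h3

lemma exists_dualLift (e : L.ActionChart) (ξ₀ : XhatS S) (hb : ξ₀.1.base ∈ e.1.source)
    {w₀ : Model g} (hw₀ : ξ₀.1.angle = (coordVec e.1 ξ₀.1.base w₀ : Tan g _)) :
    ∃ w : XhatS S → Model g, DualLift e ξ₀ w ∧ w ξ₀ = w₀ := by
  have hz := Xhat_map_eq hb hw₀
  have ha : ((e.1 ξ₀.1.base, w₀) : Model g × Model g) ∈ L.plotsXhat.dom e :=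
    ⟨e.1.map_source hb, trivial⟩
  obtain ⟨κ, hκ, hs, hκa, ht, hsymm⟩ := (goodXhat L).exists_chart e ha
  rw [hz] at hs hκa
  refine ⟨fun z => (κ z.1).2, ⟨fun ℓ => ?_, ?_⟩, by simp [hκa]⟩
  · exact (isSmoothMap_val (XhatS S)).comp_mem ξ₀ _ (hκ.smoothVec_self hs
      (ℓ.comp (ContinuousLinearMap.snd ℝ _ _)))
  · have h1 : ∀ᶠ z : L.Xhat in 𝓝 ξ₀.1, z ∈ κ.source := κ.open_source.mem_nhds hs
    have h2 : ∀ᶠ z : XhatS S in 𝓝 ξ₀, z.1 ∈ κ.source :=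
      continuous_subtype_val.continuousAt.eventually h1
    filter_upwards [h2] with z hz'
    have h3 : L.plotsXhat.map e (κ z.1) = z.1 := by rw [← hsymm, κ.left_inv hz']
    have h4 : (κ z.1).1 ∈ e.1.target := (ht (κ.map_source hz')).1
    have h5 : e.1.symm (κ z.1).1 = z.1.base := congrArg Xhat.base h3
    have h6 : z.1.base ∈ e.1.source := h5 ▸ e.1.map_target h4
    refine ⟨h6, Xhat_angle_eq h6 ?_⟩
    rw [← h5, e.1.right_inv h4]
    exact h3

lemma AngleLift.eventually [HasCharts (ZS S)] {e : L.ActionChart} {z₀ : ZS S} {y : ZS S → Model g}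
    (h : AngleLift e z₀ y) : ∀ᶠ z in 𝓝 z₀, AngleLift e z y := by
  filter_upwards [h.smooth.eventually, h.eq.eventually_nhds] with z h1 h2
  exact ⟨h1, h2⟩

lemma DualLift.eventually [HasCharts (XhatS S)] {e : L.ActionChart} {ξ₀ : XhatS S}
    {w : XhatS S → Model g} (h : DualLift e ξ₀ w) : ∀ᶠ ξ in 𝓝 ξ₀, DualLift e ξ w := by
  filter_upwards [h.smooth.eventually, h.eq.eventually_nhds] with z h1 h2
  exact ⟨h1, h2⟩

/-- An angle coordinate as a complex-valued function. -/
def angleFun (y : ZS S → Model g) (j : Fin g) (z : ZS S) : ℂ := (y z j : ℂ)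

/-- A dual coordinate as a complex-valued function. -/
def dualFun (w : XhatS S → Model g) (j : Fin g) (ξ : XhatS S) : ℂ := (w ξ j : ℂ)

lemma AngleLift.mem {e : L.ActionChart} {z₀ : ZS S} {y : ZS S → Model g} (h : AngleLift e z₀ y)
    (j : Fin g) : angleFun y j ∈ smoothNear z₀ := h.smooth (ContinuousLinearMap.proj j)

lemma DualLift.mem {e : L.ActionChart} {ξ₀ : XhatS S} {w : XhatS S → Model g}
    (h : DualLift e ξ₀ w) (j : Fin g) : dualFun w j ∈ smoothNear ξ₀ :=
  h.smooth (ContinuousLinearMap.proj j)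

/-- Two representatives of the angle differ by a lattice covector, whose value on the integral
vector `m` is an integer; the exponential does not see it. -/
lemma character_eq {e : L.ActionChart} {z : ZS S} (hb : z.1.base ∈ e.1.source) {y : Model g}
    (hy : z.1.angle = (covec e.1 z.1.base y : Cot g _)) {m : Model g} (hm : IsIntegral m) :
    character e.1 m z = Complex.exp (2 * Real.pi * Complex.I * ∑ j, ((y j : ℂ) * (m j : ℂ))) := by
  have h1 : ((Quotient.out z.1.angle : Cot g z.1.base) : Cot g z.1.base ⧸ L.lattice z.1.base) =
      (covec e.1 z.1.base y : Cot g _) := by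
    rw [← hy]
    exact Quotient.out_eq _
  have h2 : (Quotient.out z.1.angle : Cot g z.1.base) - covec e.1 z.1.base y ∈ L.lattice z.1.base := by
    rw [eq_comm, QuotientAddGroup.eq, neg_add_eq_sub] at h1
    exact h1
  have h3 : coordVec e.1 z.1.base m ∈ L.dualLattice z.1.base :=
    (coordVec_mem_dualLattice_iff e.2 hb m).2 hm
  obtain ⟨n, hn⟩ := h3 _ h2
  have h4 : (Quotient.out z.1.angle : Cot g z.1.base) (coordVec e.1 z.1.base m) =
      ∑ j, y j * m j + n := by
    rw [← hn, ← covec_coordVec e.2 hb y m]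
    change _ = _ + ((Quotient.out z.1.angle : Cot g z.1.base) (coordVec e.1 z.1.base m) -
      covec e.1 z.1.base y (coordVec e.1 z.1.base m))
    ring
  rw [character, h4]
  push_cast
  rw [mul_add, Complex.exp_add]
  have h5 : Complex.exp (2 * Real.pi * Complex.I * n) = 1 := by
    rw [Complex.exp_eq_one_iff]
    exact ⟨n, by ring⟩
  rw [h5, mul_one]

/-- The half-open interval of length `1` centred at the coordinate of `w₀` contains exactly one
representative modulo `ℤ`; a coordinate at distance less than `1 / 2` from the centre must be that
one. -/
lemma branch_eq {e : L.ActionChart} {z₀ z : ZS S} (w₀ : WLift z₀) (hb : z.1.base ∈ e.1.source)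
    {w : Model g} (hw : z.1.dual = (coordVec e.1 z.1.base w : Tan g _)) (j : Fin g)
    (h : |w j - w₀.coord e.1 j| < 1 / 2) : branch e.1 w₀ j z = (w j : ℂ) := by
  have h1 : ((Quotient.out z.1.dual : Tan g z.1.base) : Tan g z.1.base ⧸ L.dualLattice z.1.base) =
      (coordVec e.1 z.1.base w : Tan g _) := by
    rw [← hw]
    exact Quotient.out_eq _
  have h2 : (Quotient.out z.1.dual : Tan g z.1.base) - coordVec e.1 z.1.base w ∈
      L.dualLattice z.1.base := by
    rw [eq_comm, QuotientAddGroup.eq, neg_add_eq_sub] at h1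
    exact h1
  rw [← coordVec_dcoord e.2 hb (Quotient.out z.1.dual : Tan g z.1.base), ← coordVec_sub] at h2
  obtain ⟨n, hn⟩ := (coordVec_mem_dualLattice_iff e.2 hb _).1 h2
  have h3 := hn j
  simp only [Pi.sub_apply] at h3
  rw [branch, Complex.ofReal_inj, toIcoMod_eq_iff]
  rw [abs_lt] at h
  refine ⟨⟨by linarith [h.1], by linarith [h.2]⟩, n j, ?_⟩
  rw [zsmul_eq_mul, mul_one]
  linarith

variable [HasCharts (ZS S)]

lemma AngleLift.character_eventuallyEq {e : L.ActionChart} {z₀ : ZS S} {y : ZS S → Model g}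
    (h : AngleLift e z₀ y) {m : Model g} (hm : IsIntegral m) :
    character e.1 m =ᶠ[𝓝 z₀] fun z =>
      Complex.exp
        ((∑ j, (fun _ => 2 * Real.pi * Complex.I * (m j : ℂ)) * angleFun y j : ZS S → ℂ) z) := by
  filter_upwards [h.eq] with z hz
  rw [character_eq hz.1 hz.2 hm, Finset.mul_sum, Finset.sum_apply]
  congr 1
  refine Finset.sum_congr rfl fun j _ => ?_
  simp only [Pi.mul_apply, angleFun]
  ring

lemma AngleLift.sum_mem {e : L.ActionChart} {z₀ : ZS S} {y : ZS S → Model g}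
    (h : AngleLift e z₀ y) (c : Fin g → ℂ) :
    (∑ j, (fun _ => c j) * angleFun y j) ∈ smoothNear z₀ :=
  _root_.sum_mem fun j _ => mul_mem (const_mem _) (h.mem j)

lemma contDiff_exp_real : ContDiff ℝ ∞ Complex.exp := 
  (Complex.contDiff_exp (𝕜 := ℂ)).restrict_scalars ℝ

lemma character_mem {e : L.ActionChart} {z₀ : ZS S} (hb : z₀.1.base ∈ e.1.source) {m : Model g}
    (hm : IsIntegral m) : character e.1 m ∈ smoothNear z₀ := by
  obtain ⟨y, hy⟩ := exists_angleLift e z₀ hb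
  refine mem_of_eventuallyEq ?_ (hy.character_eventuallyEq hm).symm
  exact (smoothVec_complex.2 (hy.sum_mem _)).comp_mem (contDiff_exp_real.smoothNear _)

/-- The logarithmic derivative of a character. -/
lemma AngleLift.der_character {e : L.ActionChart} {z₀ : ZS S} {y : ZS S → Model g}
    (h : AngleLift e z₀ y) {m : Model g} (hm : IsIntegral m) (θ : Der z₀) :
    θ (germ z₀ (character e.1 m)) = germ z₀ (character e.1 m) *
      ∑ j, algebraMap ℂ _ (2 * Real.pi * Complex.I * (m j : ℂ)) * θ (germ z₀ (angleFun y j)) := by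
  rw [germ_congr (h.character_eventuallyEq hm), der_comp_holomorphic θ (h.sum_mem _)
    contDiff_exp_real Complex.hasDerivAt_exp, germ_sum _ fun j => mul_mem (const_mem _) (h.mem j),
    map_sum]
  congr 1
  refine Finset.sum_congr rfl fun j _ => ?_
  rw [germ_mul (const_mem _) (h.mem j), germ_const, Derivation.leibniz, Derivation.map_algebraMap,
    smul_zero, add_zero, smul_eq_mul]

lemma character_neg_mul {e : L.ActionChart} {z₀ : ZS S} (hb : z₀.1.base ∈ e.1.source) {m : Model g}
    (hm : IsIntegral m) : germ z₀ (character e.1 (-m)) * germ z₀ (character e.1 m) = 1 := by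
  rw [← germ_mul (character_mem hb hm.neg) (character_mem hb hm), ← germ_const_one]
  congr 1
  funext z
  simp only [character, Pi.mul_apply]
  rw [← Complex.exp_add]
  have : coordVec e.1 z.1.base (-m) = - coordVec e.1 z.1.base m := map_neg _ _
  rw [this, map_neg]
  simp

lemma DualLift.comp_mem {e : L.ActionChart} {z : ZS S} {w : XhatS S → Model g}
    (h : DualLift e (phatS z) w) (j : Fin g) : dualFun w j ∘ phatS ∈ smoothNear z :=
  isSmoothMap_phatS.comp_mem z _ (h.mem j)

lemma DualLift.comp_eq {e : L.ActionChart} {z : ZS S} {w : XhatS S → Model g}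
    (h : DualLift e (phatS z) w) : ∀ᶠ z' in 𝓝 z, z'.1.base ∈ e.1.source ∧
      z'.1.dual = (coordVec e.1 z'.1.base (w (phatS z')) : Tan g _) :=
  isSmoothMap_phatS.continuous.continuousAt.eventually h.eq

lemma branch_eventuallyEq [HasCharts (XhatS S)] {e : L.ActionChart} {z₀ : ZS S} {w : XhatS S → Model g}
    (hw : DualLift e (phatS z₀) w) {z : ZS S} (w₀ : WLift z) (j : Fin g)
    (h : |w (phatS z₀) j - w₀.coord e.1 j| < 1 / 2) :
    branch e.1 w₀ j =ᶠ[𝓝 z₀] dualFun w j ∘ phatS := by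
  have hc : ContinuousAt (fun z' : ZS S => |w (phatS z') j - w₀.coord e.1 j|) z₀ := by
    have h1 : ContinuousAt (fun z' : ZS S => w (phatS z')) z₀ :=
      ContinuousAt.comp (g := w) hw.smooth.continuousAt isSmoothMap_phatS.continuous.continuousAt
    exact (((continuous_apply j).continuousAt.comp h1).sub continuousAt_const).abs
  filter_upwards [hw.comp_eq, hc.eventually (gt_mem_nhds h)] with z' h1 h2
  exact branch_eq w₀ h1.1 h1.2 j h2

/-- The chosen action chart. -/
def stdChart (L : LagrangianLattice g B) (b : B) : L.ActionChart :=
  ⟨L.chart b, (L.exists_chart b).choose_spec.1⟩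

lemma mem_stdChart (b : B) : b ∈ (stdChart L b).1.source := (L.exists_chart b).choose_spec.2

lemma WLift.coordVec_coord {z : ZS S} (w : WLift z) (e : L.ActionChart) (hb : z.1.base ∈ e.1.source) :
    coordVec e.1 z.1.base (w.coord e.1) = w.1 := coordVec_dcoord e.2 hb w.1

lemma WLift.dual_eq {z : ZS S} (w : WLift z) (e : L.ActionChart) (hb : z.1.base ∈ e.1.source) :
    z.1.dual = (coordVec e.1 z.1.base (w.coord e.1) : Tan g _) := by
  rw [w.coordVec_coord e hb]
  exact w.2.symm

lemma WLift.isIntegral_sub {z : ZS S} (w w' : WLift z) (e : L.ActionChart)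
    (hb : z.1.base ∈ e.1.source) : IsIntegral (fun j => w.coord e.1 j - w'.coord e.1 j) := by
  have h1 : (w.1 : Tan g z.1.base ⧸ L.dualLattice z.1.base) = w'.1 := w.2.trans w'.2.symm
  rw [eq_comm, QuotientAddGroup.eq, neg_add_eq_sub, ← w.coordVec_coord e hb,
    ← w'.coordVec_coord e hb, ← coordVec_sub] at h1
  exact (coordVec_mem_dualLattice_iff e.2 hb _).1 h1

variable [HasCharts (XhatS S)]

/-- Near `z` the branch of `w^j` is the smooth dual coordinate, and the logarithmic differential of
`exp (2πi y_j)` is `2πi dy_j`. -/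
lemma connForm_eq_std {z : ZS S} {y : ZS S → Model g} (hy : AngleLift (stdChart L z.1.base) z y)
    {w : XhatS S → Model g} (hw : DualLift (stdChart L z.1.base) (phatS z) w) (wl : WLift z)
    (h : w (phatS z) = wl.coord (stdChart L z.1.base).1) (θ : Der z) :
    connForm z wl θ = ∑ j, germ z (dualFun w j ∘ phatS) *
      (algebraMap ℂ _ (2 * Real.pi * Complex.I) * θ (germ z (angleFun y j))) := by
  refine Finset.sum_congr rfl fun j _ => ?_
  congr 1
  · refine germ_congr (branch_eventuallyEq hw wl j ?_)
    rw [h]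
    simp
  · change germ z (character (stdChart L z.1.base).1 _) *
      θ (germ z (character (stdChart L z.1.base).1 _)) = _
    rw [hy.der_character (isIntegral_single j), ← mul_assoc,
      character_neg_mul (mem_stdChart _) (isIntegral_single j), one_mul, Finset.sum_eq_single j]
    · simp
    · intro i _ hi
      simp [hi]
    · simp

/-- The connection form in any action chart. -/
theorem connForm_eq {e : L.ActionChart} {z : ZS S} {y : ZS S → Model g} (hy : AngleLift e z y)
    {w : XhatS S → Model g} (hw : DualLift e (phatS z) w) (wl : WLift z)
    (h : w (phatS z) = wl.coord e.1) (θ : Der z) :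
    connForm z wl θ = ∑ j, germ z (dualFun w j ∘ phatS) *
      (algebraMap ℂ _ (2 * Real.pi * Complex.I) * θ (germ z (angleFun y j))) := by
  have hb := hy.eq.self_of_nhds.1
  have hb' := mem_stdChart (L := L) z.1.base
  set e₀ := stdChart L z.1.base with he₀
  obtain ⟨M, hM⟩ := exists_chartRel e₀.2 e.2 hb' hb
  obtain ⟨N, hN⟩ := exists_chartRel e.2 e₀.2 hb hb'
  have hbase : Continuous fun z' : ZS S => z'.1.base := continuous_Z_base.comp continuous_subtype_val
  have hbase' : Tendsto (fun ξ : XhatS S => ξ.1.base) (𝓝 (phatS z)) (𝓝 z.1.base) := by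
    have h1 : Continuous fun ξ : L.Xhat => ξ.base :=
      continuous_Z_base.comp isSmoothMap_zeroSection.continuous
    exact (h1.comp continuous_subtype_val).continuousAt
  let y₀ : ZS S → Model g := fun z' j => ∑ i, y z' i * M i j
  let w₀ : XhatS S → Model g := fun ξ j => ∑ i, N j i * w ξ i
  have hy₀ : AngleLift e₀ z y₀ := by
    refine ⟨?_, ?_⟩
    · refine hy.smooth.comp (Φ := fun (v : Model g) j => ∑ i, v i * (M i j : ℝ))
        (Eventually.of_forall fun v => ?_)
      exact ContDiff.contDiffAt (by fun_prop)
    · filter_upwards [hy.eq, hbase.continuousAt.eventually hM] with z' h1 h2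
      exact ⟨h2.1, by rw [h1.2, h2.covec_eq]⟩
  have hw₀ : DualLift e₀ (phatS z) w₀ := by
    refine ⟨?_, ?_⟩
    · refine hw.smooth.comp (Φ := fun (v : Model g) j => ∑ i, (N j i : ℝ) * v i)
        (Eventually.of_forall fun v => ?_)
      exact ContDiff.contDiffAt (by fun_prop)
    · filter_upwards [hw.eq, hbase'.eventually hN] with ξ h1 h2
      exact ⟨h2.2.1, by rw [h1.2, h2.coordVec_eq e₀.2 e.2]⟩
  -- The `w^j` transform by `N` and the `y_j` by the transpose of `M`; as these matrices are inverse
  -- to each other, `∑ w^j dy_j` does not change.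
  have hNM : M * N = 1 := hN.self_of_nhds.mul_eq_one e.2 hM.self_of_nhds
  rw [connForm_eq_std hy₀ hw₀ wl (by
    funext j
    change ∑ i, (N j i : ℝ) * w (phatS z) i = dcoord e₀.1 z.1.base j wl.1
    rw [hN.self_of_nhds.2.2 j, h]
    simp [WLift.coord]) θ]
  have hwij : ∀ i, germ z (dualFun w i ∘ phatS) =
      ∑ j, algebraMap ℂ _ (M i j : ℂ) * germ z (dualFun w₀ j ∘ phatS) := by
    intro i
    simp_rw [← germ_const, ← germ_mul (const_mem _) (hw₀.comp_mem _)]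
    rw [← germ_sum _ fun j => mul_mem (const_mem _) (hw₀.comp_mem j)]
    congr 1
    funext z'
    simp only [Finset.sum_apply, Pi.mul_apply, Function.comp_apply, dualFun, w₀]
    push_cast
    simp only [Finset.mul_sum]
    rw [Finset.sum_comm]
    have h2 : ∀ k, ∑ j, (M i j : ℂ) * ((N j k : ℂ) * (w (phatS z') k : ℂ)) =
        (if i = k then 1 else 0) * (w (phatS z') k : ℂ) := by
      intro k
      have h3 := congrFun (congrFun hNM i) k
      rw [Matrix.mul_apply, Matrix.one_apply] at h3
      have h4 : ∑ j, (M i j : ℂ) * (N j k : ℂ) = if i = k then 1 else 0 := by exact_mod_cast h3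
      rw [← h4, Finset.sum_mul]
      exact Finset.sum_congr rfl fun j _ => by ring
    simp [h2]
  have hyj : ∀ j, θ (germ z (angleFun y₀ j)) =
      ∑ i, algebraMap ℂ _ (M i j : ℂ) * θ (germ z (angleFun y i)) := by
    intro j
    have h2 : angleFun y₀ j = ∑ i, (fun _ => (M i j : ℂ)) * angleFun y i := by
      funext z'
      simp only [Finset.sum_apply, Pi.mul_apply, angleFun, y₀]
      push_cast
      exact Finset.sum_congr rfl fun i _ => mul_comm _ _
    rw [h2, germ_sum _ fun i => mul_mem (const_mem _) (hy.mem i), map_sum]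
    refine Finset.sum_congr rfl fun i _ => ?_
    rw [germ_mul (const_mem _) (hy.mem i), germ_const, Derivation.leibniz,
      Derivation.map_algebraMap, smul_zero, add_zero, smul_eq_mul]
  simp only [hwij, hyj, Finset.mul_sum, Finset.sum_mul]
  rw [Finset.sum_comm]
  exact Finset.sum_congr rfl fun i _ => Finset.sum_congr rfl fun j _ => by ring

/-- Existence of the data used to compute the connection form. -/
lemma exists_lifts (e : L.ActionChart) {z : ZS S} (hb : z.1.base ∈ e.1.source) (wl : WLift z) :
    ∃ y w, AngleLift e z y ∧ DualLift e (phatS z) w ∧ w (phatS z) = wl.coord e.1 := by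
  obtain ⟨y, hy⟩ := exists_angleLift e z hb
  obtain ⟨w, hw, h⟩ := exists_dualLift e (phatS z) hb (wl.dual_eq e hb)
  exact ⟨y, w, hy, hw, h⟩

lemma vertical_dual {e : L.ActionChart} {z : ZS S} {w : XhatS S → Model g}
    (hw : DualLift e (phatS z) w) (j : Fin g) {u : Der z} (hu : u ∈ vertical z) :
    u (germ z (dualFun w j ∘ phatS)) = 0 := by
  have := hu (germ (phatS z) (dualFun w j))
  rwa [pullHat, pullback_germ _ _ _ (hw.mem j)] at this

/-- The curvature when one argument is vertical. -/
theorem curvature_eq {e : L.ActionChart} {z : ZS S} {y : ZS S → Model g} (hy : AngleLift e z y)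
    {w : XhatS S → Model g} (hw : DualLift e (phatS z) w) (wl : WLift z)
    (h : w (phatS z) = wl.coord e.1) (θ : Der z) {u : Der z} (hu : u ∈ vertical z) :
    curvature z wl θ u = ∑ j, θ (germ z (dualFun w j ∘ phatS)) *
      (algebraMap ℂ _ (2 * Real.pi * Complex.I) * u (germ z (angleFun y j))) := by
  rw [curvature, connForm_eq hy hw wl h, connForm_eq hy hw wl h, connForm_eq hy hw wl h, map_sum,
    map_sum, ← Finset.sum_sub_distrib, ← Finset.sum_sub_distrib]
  refine Finset.sum_congr rfl fun j _ => ?_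
  -- The vertical field kills the `w^j`, and the second derivatives of `y_j` cancel against the
  -- bracket; of `dw^j ∧ dy_j` there remains one term.
  simp only [Derivation.leibniz, vertical_dual hw j hu, smul_eq_mul, Derivation.map_algebraMap,
    Derivation.commutator_apply]
  ring

/-- Change of gauge in the connection form. -/
lemma connForm_gauge {z : ZS S} (w w' : WLift z) (θ : Der z) :
    θ (germ z (character (L.chart z.1.base)
      (fun j => w.coord (L.chart z.1.base) j - w'.coord (L.chart z.1.base) j))) =
    germ z (character (L.chart z.1.base)
      (fun j => w.coord (L.chart z.1.base) j - w'.coord (L.chart z.1.base) j)) *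
      (connForm z w θ - connForm z w' θ) := by
  have hb := mem_stdChart (L := L) z.1.base
  obtain ⟨y, dw, hy, hdw, hdwz⟩ := exists_lifts (stdChart L z.1.base) hb w
  obtain ⟨dw', hdw', hdwz'⟩ := exists_dualLift (stdChart L z.1.base) (phatS z) hb (w'.dual_eq _ hb)
  have hint := w.isIntegral_sub w' (stdChart L z.1.base) hb
  change θ (germ z (character (stdChart L z.1.base).1 fun j =>
      w.coord (stdChart L z.1.base).1 j - w'.coord (stdChart L z.1.base).1 j)) =
    germ z (character (stdChart L z.1.base).1 fun j =>
      w.coord (stdChart L z.1.base).1 j - w'.coord (stdChart L z.1.base).1 j) * _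
  rw [hy.der_character hint, connForm_eq hy hdw w hdwz, connForm_eq hy hdw' w' hdwz',
    ← Finset.sum_sub_distrib]
  congr 1
  refine Finset.sum_congr rfl fun j _ => ?_
  rw [← sub_mul, ← mul_assoc]
  congr 1
  -- Two dual coordinate systems in one chart differ by a continuous function with integral values,
  -- which near `z` is constant.
  have h1 : germ z (dualFun dw j ∘ phatS) - germ z (dualFun dw' j ∘ phatS) =
      algebraMap ℂ _ ((w.coord (stdChart L z.1.base).1 j - w'.coord (stdChart L z.1.base).1 j : ℝ) : ℂ) := by
    rw [← germ_sub (hdw.comp_mem j) (hdw'.comp_mem j), ← germ_const]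
    refine germ_congr ?_
    have hc : ∀ {v : XhatS S → Model g}, DualLift (stdChart L z.1.base) (phatS z) v →
        ContinuousAt (fun z' => v (phatS z') j) z := fun {v} hv =>
      ContinuousAt.comp (g := fun v : Model g => v j) (continuous_apply j).continuousAt
        (ContinuousAt.comp (g := v) hv.smooth.continuousAt isSmoothMap_phatS.continuous.continuousAt)
    have h2 := Metric.continuousAt_iff'.1 ((hc hdw).sub (hc hdw')) 1 one_pos
    filter_upwards [hdw.comp_eq, hdw'.comp_eq, h2] with z' h3 h4 h5
    have h6 : IsIntegral (dw (phatS z') - dw' (phatS z')) := by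
      have h7 := h3.2.symm.trans h4.2
      rw [eq_comm, QuotientAddGroup.eq, neg_add_eq_sub, ← coordVec_sub] at h7
      exact (coordVec_mem_dualLattice_iff (stdChart L z.1.base).2 h3.1 _).1 h7
    obtain ⟨n, hn⟩ := h6
    obtain ⟨n', hn'⟩ := hint
    have h8 := hn j
    have h9 := hn' j
    simp only [Pi.sub_apply] at h8
    rw [Real.dist_eq] at h5
    change |dw (phatS z') j - dw' (phatS z') j - (dw (phatS z) j - dw' (phatS z) j)| < 1 at h5
    simp only at h9
    rw [hdwz, hdwz', h8, h9] at h5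
    have h10 : |n j - n' j| < 1 := by exact_mod_cast h5
    rw [Int.abs_lt_one_iff, sub_eq_zero] at h10
    simp only [Pi.sub_apply, Function.comp_apply, dualFun]
    rw [← Complex.ofReal_sub, h8, h9, h10]
  rw [h1, ← map_mul]
  congr 1
  push_cast
  ring

end Lifts

end FourierMukai

end

noncomputable section

namespace FourierMukai

open Filter Metric LagrangianLattice

set_option linter.unusedSectionVars false

/-! ### The pulled-back connection in a frame, the coupled connection and its sections. -/

section Coupled

variable {g : ℕ} {B : Type*} [TopologicalSpace B] [ChartedSpace (Model g) B]
  {L : LagrangianLattice g B} {S : Set L.X}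

lemma algebraMap_germ (z : ZS S) {φ : S → ℂ} (hφ : φ ∈ smoothNear (pS z)) :
    algebraMap (SGerm (pS z)) (SGerm z) (germ (pS z) φ) = germ z (φ ∘ pS) :=
  pullback_germ isSmoothMap_pS z rfl hφ

/-- `x` and `D` behave at `pS z` like a coordinate system and its partial derivatives. -/
structure IsFrameAt {n : ℕ} (z : ZS S) (x : Fin n → S → ℂ) (D : Fin n → ∀ p : S, Der p) : Prop where
  mem : ∀ k, x k ∈ smoothNear (pS z)
  der : ∀ (θ : Der z) (r : SGerm (pS z)), θ (algebraMap _ (SGerm z) r) =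
    ∑ k, θ (germ z (x k ∘ pS)) * algebraMap _ (SGerm z) (D k (pS z) r)
  eq_sum : ∀ v : Der (pS z), v = ∑ k, v (germ (pS z) (x k)) • D k (pS z)
  apply : ∀ k l, D k (pS z) (germ (pS z) (x l)) = if k = l then 1 else 0

/-- The bracket kills the coordinates, since the first derivatives of these are constants; and a
derivation is determined by its values on coordinates. -/
lemma IsFrameAt.bracket {n : ℕ} {z : ZS S} {x : Fin n → S → ℂ} {D : Fin n → ∀ p : S, Der p}
    (h : IsFrameAt z x D) (k l : Fin n) : ⁅D k (pS z), D l (pS z)⁆ = 0 := by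
  rw [h.eq_sum ⁅D k (pS z), D l (pS z)⁆]
  refine Finset.sum_eq_zero fun m _ => ?_
  have h1 : ∀ a b c, D a (pS z) (D b (pS z) (germ (pS z) (x c))) = 0 := by
    intro a b c
    rw [h.apply]
    split_ifs <;> simp
  rw [Derivation.commutator_apply, h1, h1, sub_zero, zero_smul]

lemma exists_frame [HasCharts S] [HasCharts (ZS S)] (z₀ : ZS S) :
    ∃ (n : ℕ) (x : Fin n → S → ℂ) (D : Fin n → ∀ p : S, Der p),
      (∀ k, IsVectorFieldNear (D k) (pS z₀)) ∧ ∀ᶠ z in 𝓝 z₀, IsFrameAt z x D := by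
  obtain ⟨n, κ, hκ, hs⟩ := HasCharts.exists_chart (pS z₀)
  have hX : ∀ (v p : Fin n → ℝ), ∀ᶠ x in 𝓝 p, ContDiffAt ℝ ∞ (fun _ : Fin n → ℝ => v) x :=
    fun v p => Eventually.of_forall fun _ => contDiffAt_const
  refine ⟨n, fun k p => (κ p k : ℂ), fun k => chartField κ fun _ => Pi.basisFun ℝ _ k,
    fun k => isVectorFieldNear_chartField hκ hs (hX _ _), ?_⟩
  have h1 : ∀ᶠ z in 𝓝 z₀, pS z ∈ κ.source :=
    isSmoothMap_pS.continuous.continuousAt.eventually (κ.open_source.mem_nhds hs)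
  filter_upwards [h1] with z hz
  have hm : ∀ k, (fun p => (κ p k : ℂ)) ∈ smoothNear (pS z) := fun k =>
    hκ.smoothVec_self hz (ContinuousLinearMap.proj k)
  refine ⟨hm, fun θ r => ?_, fun v => ?_, fun k l => ?_⟩
  · obtain ⟨φ, hφ, rfl⟩ := exists_germ r
    have hu : SmoothVec z (fun z' => κ (pS z')) := fun ℓ =>
      isSmoothMap_pS.comp_mem z _ (hκ.smoothVec_self hz ℓ)
    have hφ' : SmoothNear (κ (pS z)) (φ ∘ κ.symm) := (hκ _ hz φ).1 hφ
    -- The chain rule for an arbitrary derivation of germs on `ZS S` shows that it acts on functions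
    -- pulled back from `S` through finitely many coordinates.
    have h2 := der_comp θ (Pi.basisFun ℝ (Fin n)) hu hφ'
    rw [algebraMap_germ z hφ]
    have h3 : φ ∘ pS =ᶠ[𝓝 z] fun z' => (φ ∘ κ.symm) (κ (pS z')) := by
      have h4 : ∀ᶠ z' in 𝓝 z, pS z' ∈ κ.source :=
        isSmoothMap_pS.continuous.continuousAt.eventually (κ.open_source.mem_nhds hz)
      filter_upwards [h4] with z' hz'
      simp [κ.left_inv hz']
    rw [germ_congr h3, h2]
    refine Finset.sum_congr rfl fun k _ => ?_
    rw [chartField_germ hκ hz (hX _ _) hφ, algebraMap_germ z (fieldOp_mem hκ hz (hX _ _) hφ),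
      mul_comm]
    rfl
  · exact hκ.der_eq_sum hz v (Pi.basisFun ℝ (Fin n))
  · rw [chartField_germ hκ hz (hX _ _) (hm l)]
    have h3 : fieldOp κ (fun _ => Pi.basisFun ℝ _ k) (fun p => (κ p l : ℂ)) =ᶠ[𝓝 (pS z)]
        fun _ => if k = l then 1 else 0 := by
      filter_upwards [κ.open_source.mem_nhds hz] with p hp
      have h4 : (fun p => (κ p l : ℂ)) ∘ κ.symm =ᶠ[𝓝 (κ p)] fun x => (x l : ℂ) := by
        filter_upwards [eventually_right_inv hp] with x hx
        simp [hx.2]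
      have h5 : HasFDerivAt (fun x : Fin n → ℝ => (x l : ℂ))
          (Complex.ofRealCLM.comp (ContinuousLinearMap.proj (R := ℝ) (φ := fun _ : Fin n => ℝ) l))
          (κ p) :=
        (Complex.ofRealCLM.comp (ContinuousLinearMap.proj (R := ℝ)
          (φ := fun _ : Fin n => ℝ) l)).hasFDerivAt
      simp only [fieldOp]
      rw [h4.fderiv_eq, h5.fderiv]
      simp only [Pi.basisFun_apply, ContinuousLinearMap.comp_apply, ContinuousLinearMap.proj_apply,
        Complex.ofRealCLM_apply, Pi.single_apply, eq_comm (a := l)]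
      split_ifs <;> simp
    rw [germ_congr h3]
    split_ifs
    · exact germ_const_one
    · exact germ_const_zero

variable {E : FlatModule S}

lemma PullStalk.sub_smul {z : ZS S} (a b : SGerm z) (m : PullStalk E z) :
    (a - b) • m = a • m - b • m := _root_.sub_smul a b m

lemma PullStalk.neg_smul {z : ZS S} (a : SGerm z) (m : PullStalk E z) : -a • m = -(a • m) :=
  _root_.neg_smul a m

lemma FlatModule.conn_zero_left (p : S) (e : E.stalk p) : E.conn p 0 e = 0 := by
  have := E.conn_smul_left p 0 0 e
  rwa [zero_smul, zero_smul] at this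

lemma FlatModule.conn_sum_left {ι : Type*} (s : Finset ι) (p : S) (v : ι → Der p) (e : E.stalk p) :
    E.conn p (∑ i ∈ s, v i) e = ∑ i ∈ s, E.conn p (v i) e := by
  classical
  induction s using Finset.induction_on with
  | empty => simp [FlatModule.conn_zero_left]
  | insert i s hi ih => rw [Finset.sum_insert hi, Finset.sum_insert hi, E.conn_add_left, ih]

section Frame

variable {n : ℕ} {z : ZS S} {x : Fin n → S → ℂ} {D : Fin n → ∀ p : S, Der p}

/-- The pull-back of the connection in a frame. -/
theorem pullConn_tmul (h : IsFrameAt z x D) (θ : Der z) (a : SGerm z) (e : E.stalk (pS z)) :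
    pullConn E θ (a ⊗ₜ e) =
      θ a ⊗ₜ e + ∑ k, (a * θ (germ z (x k ∘ pS))) ⊗ₜ E.conn _ (D k (pS z)) e := by
  have hR : Nonempty (DerRep θ) := ⟨⟨n, fun k => θ (germ z (x k ∘ pS)), fun k => D k (pS z), h.der θ⟩⟩
  rw [pullConn, dif_pos hR]
  -- The definition uses an arbitrarily chosen representation of `θ`. Expanding its fields in the
  -- frame shows that the result does not depend on the choice.
  generalize hR.some = R
  simp only [pullConnAux, TensorProduct.liftAddHom_tmul, AddMonoidHom.mk'_apply]
  congr 1
  have h1 : ∀ i, E.conn _ (R.field i) e =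
      ∑ k, R.field i (germ (pS z) (x k)) • E.conn _ (D k (pS z)) e := by
    intro i
    conv_lhs => rw [h.eq_sum (R.field i)]
    rw [FlatModule.conn_sum_left]
    exact Finset.sum_congr rfl fun k _ => E.conn_smul_left _ _ _ _
  simp only [h1, TensorProduct.tmul_sum]
  rw [Finset.sum_comm]
  refine Finset.sum_congr rfl fun k _ => ?_
  rw [← algebraMap_germ z (h.mem k), R.spec, Finset.mul_sum, TensorProduct.sum_tmul]
  refine Finset.sum_congr rfl fun i _ => ?_
  rw [← TensorProduct.smul_tmul, Algebra.smul_def]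
  congr 1
  ring

end Frame

variable [HasCharts S] [HasCharts (ZS S)]

lemma exists_frameAt (z : ZS S) : ∃ (n : ℕ) (x : Fin n → S → ℂ) (D : Fin n → ∀ p : S, Der p),
    IsFrameAt z x D := by
  obtain ⟨n, x, D, -, h⟩ := exists_frame z
  exact ⟨n, x, D, h.self_of_nhds⟩

lemma pullConn_add_left {z : ZS S} (θ θ' : Der z) (m : PullStalk E z) :
    pullConn E (θ + θ') m = pullConn E θ m + pullConn E θ' m := by
  obtain ⟨n, x, D, h⟩ := exists_frameAt z
  induction m using TensorProduct.induction_on with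
  | zero => simp
  | add m m' h1 h2 => rw [map_add, map_add, map_add, h1, h2]; abel
  | tmul a e =>
    simp only [pullConn_tmul h, Derivation.add_apply, TensorProduct.add_tmul, mul_add,
      Finset.sum_add_distrib]
    abel

lemma pullConn_smul_left {z : ZS S} (r : SGerm z) (θ : Der z) (m : PullStalk E z) :
    pullConn E (r • θ) m = r • pullConn E θ m := by
  obtain ⟨n, x, D, h⟩ := exists_frameAt z
  induction m using TensorProduct.induction_on with
  | zero => simp
  | add m m' h1 h2 => rw [map_add, map_add, h1, h2, smul_add]
  | tmul a e =>
    simp only [pullConn_tmul h, Derivation.smul_apply, smul_add, Finset.smul_sum,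
      TensorProduct.smul_tmul', smul_eq_mul]
    congr 1
    exact Finset.sum_congr rfl fun k _ => by rw [mul_left_comm]

lemma pullConn_leibniz {z : ZS S} (θ : Der z) (r : SGerm z) (m : PullStalk E z) :
    pullConn E θ (r • m) = r • pullConn E θ m + θ r • m := by
  obtain ⟨n, x, D, h⟩ := exists_frameAt z
  induction m using TensorProduct.induction_on with
  | zero => simp
  | add m m' h1 h2 => rw [smul_add, map_add, map_add, h1, h2, smul_add, smul_add]; abel
  | tmul a e =>
    simp only [pullConn_tmul h, smul_add, Finset.smul_sum, TensorProduct.smul_tmul', smul_eq_mul,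
      Derivation.leibniz, TensorProduct.add_tmul, mul_assoc]
    rw [mul_comm a (θ r)]
    abel

/-- The fields of the frame commute, so by flatness their covariant derivatives commute, and the
terms of second order are symmetric in `θ` and `θ'`. The remaining terms assemble to the derivative
along the bracket. -/
theorem pullConn_flat {z : ZS S} (θ θ' : Der z) (m : PullStalk E z) :
    pullConn E θ (pullConn E θ' m) - pullConn E θ' (pullConn E θ m) = pullConn E ⁅θ, θ'⁆ m := by
  obtain ⟨n, x, D, h⟩ := exists_frameAt z
  induction m using TensorProduct.induction_on with
  | zero => simp
  | add m m' h1 h2 => simp only [map_add, ← h1, ← h2]; abel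
  | tmul a e =>
    have hc : ∀ k l, E.conn _ (D k (pS z)) (E.conn _ (D l (pS z)) e) =
        E.conn _ (D l (pS z)) (E.conn _ (D k (pS z)) e) := by
      intro k l
      rw [← sub_eq_zero, ← E.flat, h.bracket, FlatModule.conn_zero_left]
    simp only [pullConn_tmul h, map_add, map_sum, Derivation.commutator_apply, Derivation.leibniz,
      smul_eq_mul, TensorProduct.add_tmul, TensorProduct.sub_tmul, Finset.sum_add_distrib,
      mul_sub, Finset.sum_sub_distrib]
    have h2 : ∑ k, ∑ l, (a * θ' (germ z (x k ∘ pS)) * θ (germ z (x l ∘ pS))) ⊗ₜ[SGerm (pS z)]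
          E.conn _ (D l (pS z)) (E.conn _ (D k (pS z)) e) =
        ∑ k, ∑ l, (a * θ (germ z (x k ∘ pS)) * θ' (germ z (x l ∘ pS))) ⊗ₜ[SGerm (pS z)]
          E.conn _ (D l (pS z)) (E.conn _ (D k (pS z)) e) := by
      rw [Finset.sum_comm]
      refine Finset.sum_congr rfl fun k _ => Finset.sum_congr rfl fun l _ => ?_
      rw [hc k l, mul_right_comm]
    have h3 : ∀ η η' : Der z, ∑ k, (η' (germ z (x k ∘ pS)) * η a) ⊗ₜ[SGerm (pS z)]
        E.conn _ (D k (pS z)) e = ∑ k, (η a * η' (germ z (x k ∘ pS))) ⊗ₜ[SGerm (pS z)]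
        E.conn _ (D k (pS z)) e := fun η η' =>
      Finset.sum_congr rfl fun k _ => by rw [mul_comm]
    rw [h2, h3, h3]
    abel

/-! ### The coupled connection -/

lemma cov_apply {z : ZS S} (θ : Der z) (m : TwStalk E z) (w : WLift z) :
    cov θ m w = pullConn E θ (m w) + connForm z w θ • m w := rfl

lemma cov_add_left {z : ZS S} (θ θ' : Der z) (m : TwStalk E z) :
    cov (θ + θ') m = cov θ m + cov θ' m := by
  funext w
  simp only [cov_apply, Pi.add_apply, pullConn_add_left, connForm, Derivation.add_apply, mul_add,
    Finset.sum_add_distrib, add_smul]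
  abel

lemma cov_smul_left {z : ZS S} (r : SGerm z) (θ : Der z) (m : TwStalk E z) :
    cov (r • θ) m = r • cov θ m := by
  funext w
  simp only [cov_apply, Pi.smul_apply, pullConn_smul_left, smul_add, ← mul_smul]
  congr 2
  simp only [connForm, Derivation.smul_apply, smul_eq_mul, Finset.mul_sum]
  exact Finset.sum_congr rfl fun i _ => by ring

lemma cov_leibniz {z : ZS S} (θ : Der z) (r : SGerm z) (m : TwStalk E z) :
    cov θ (r • m) = r • cov θ m + θ r • m := by
  funext w
  simp only [cov_apply, Pi.smul_apply, Pi.add_apply, pullConn_leibniz, smul_add]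
  rw [smul_comm (connForm z w θ) r]
  abel

/-- The pulled-back connection is flat, so the failure of commutation comes from the line bundle
alone. -/
lemma cov_comm {z : ZS S} (θ θ' : Der z) (m : TwStalk E z) (w : WLift z) :
    cov θ (cov θ' m) w - cov θ' (cov θ m) w = cov ⁅θ, θ'⁆ m w + curvature z w θ θ' • m w := by
  rw [curvature, PullStalk.sub_smul, PullStalk.sub_smul]
  simp only [cov_apply, map_add, smul_add, ← pullConn_flat, pullConn_leibniz]
  rw [smul_comm (connForm z w θ') (connForm z w θ)]
  abel

variable [IsManifold 𝓘(ℝ, Model g) ∞ B] [HasCharts (XhatS S)]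

/-- The derivative of the transition character cancels the difference of the two connection forms,
by `connForm_gauge`. -/
lemma IsAutomorphic.cov {z : ZS S} {m : TwStalk E z} (hm : IsAutomorphic m) (θ : Der z) :
    IsAutomorphic (cov θ m) := by
  intro w w'
  rw [cov_apply, cov_apply, hm w w', pullConn_leibniz, connForm_gauge, mul_smul, smul_add, sub_smul,
    smul_sub, smul_comm (connForm z w' θ)]
  abel

lemma IsAutomorphic.add {z : ZS S} {m m' : TwStalk E z} (hm : IsAutomorphic m)
    (hm' : IsAutomorphic m') : IsAutomorphic (m + m') := by
  intro w w'
  rw [Pi.add_apply, hm w w', hm' w w', Pi.add_apply, smul_add]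

lemma IsAutomorphic.smul {z : ZS S} {m : TwStalk E z} (hm : IsAutomorphic m) (r : SGerm z) :
    IsAutomorphic (r • m) := by
  intro w w'
  rw [Pi.smul_apply, hm w w', Pi.smul_apply, smul_comm]

lemma IsAutomorphic.zero {z : ZS S} : IsAutomorphic (0 : TwStalk E z) := by
  intro w w'
  simp

lemma IsAutomorphic.neg {z : ZS S} {m : TwStalk E z} (hm : IsAutomorphic m) :
    IsAutomorphic (-m) := by
  intro w w'
  rw [Pi.neg_apply, hm w w', Pi.neg_apply, smul_neg]

lemma IsAutomorphic.sum {ι : Type*} (s : Finset ι) {z : ZS S} {m : ι → TwStalk E z}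
    (hm : ∀ i, IsAutomorphic (m i)) : IsAutomorphic (∑ i ∈ s, m i) := by
  classical
  induction s using Finset.induction_on with
  | empty => exact IsAutomorphic.zero
  | insert i s hi ih => rw [Finset.sum_insert hi]; exact (hm i).add ih

/-! ### Sections -/

lemma IsTwSectionNear.of_fintype {c : ∀ z : ZS S, TwStalk E z} {z₀ : ZS S}
    (h : ∀ w₀ : WLift z₀, ∃ (ι : Type) (_ : Fintype ι) (a : ι → ZS S → ℂ)
      (s : ι → ∀ p, E.stalk p), (∀ i, a i ∈ smoothNear z₀) ∧
      (∀ i, E.IsSectionNear (s i) (pS z₀)) ∧ ∀ᶠ z in 𝓝 z₀, ∀ w : WLift z,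
      (∀ j, |w.coord (L.chart z₀.1.base) j - w₀.coord (L.chart z₀.1.base) j| < 1 / 2) →
      c z w = ∑ i, germ z (a i) ⊗ₜ s i (pS z)) : IsTwSectionNear c z₀ := by
  intro w₀
  obtain ⟨ι, _, a, s, ha, hs, e⟩ := h w₀
  let f := Fintype.equivFin ι
  refine ⟨Fintype.card ι, fun i => a (f.symm i), fun i => s (f.symm i), fun i => ha _,
    fun i => hs _, ?_⟩
  filter_upwards [e] with z hz w hw
  rw [hz w hw, ← f.symm.sum_comp]

lemma IsTwSectionNear.congr {c c' : ∀ z : ZS S, TwStalk E z} {z₀ : ZS S}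
    (h : IsTwSectionNear c z₀) (e : ∀ᶠ z in 𝓝 z₀, c z = c' z) : IsTwSectionNear c' z₀ := by
  intro w₀
  obtain ⟨n, a, s, ha, hs, e'⟩ := h w₀
  refine ⟨n, a, s, ha, hs, ?_⟩
  filter_upwards [e, e'] with z h1 h2
  rwa [← h1]

lemma IsTwSectionNear.smul {c : ∀ z : ZS S, TwStalk E z} {z₀ : ZS S}
    (h : IsTwSectionNear c z₀) {φ : ZS S → ℂ} (hφ : φ ∈ smoothNear z₀) :
    IsTwSectionNear (fun z => germ z φ • c z) z₀ := by
  intro w₀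
  obtain ⟨n, a, s, ha, hs, e⟩ := h w₀
  refine ⟨n, fun i => φ * a i, s, fun i => mul_mem hφ (ha i), hs, ?_⟩
  have ha' : ∀ᶠ z' in 𝓝 z₀, ∀ i, a i ∈ smoothNear z' :=
    Filter.eventually_all.2 fun i => SmoothSpace.eventually_mem z₀ _ (ha i)
  filter_upwards [e, ha', SmoothSpace.eventually_mem z₀ _ hφ] with z' h3 h4 h5 w hw
  rw [Pi.smul_apply, h3 w hw, Finset.smul_sum]
  refine Finset.sum_congr rfl fun i _ => ?_
  rw [germ_mul h5 (h4 i), TensorProduct.smul_tmul', smul_eq_mul]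

lemma IsTwSectionNear.zero {z₀ : ZS S} : IsTwSectionNear (fun z => (0 : TwStalk E z)) z₀ :=
  fun _ => ⟨0, Fin.elim0, Fin.elim0, fun i => i.elim0, fun i => i.elim0,
    Eventually.of_forall fun z w _ => by simp⟩

lemma IsTwSectionNear.sum {ι : Type*} (s : Finset ι) {c : ι → ∀ z : ZS S, TwStalk E z} {z₀ : ZS S}
    (h : ∀ i, IsTwSectionNear (c i) z₀) : IsTwSectionNear (fun z => ∑ i ∈ s, c i z) z₀ := by
  classical
  induction s using Finset.induction_on with
  | empty => simpa using IsTwSectionNear.zero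
  | insert i s hi ih =>
    simp only [Finset.sum_insert hi]
    exact (h i).add ih

lemma IsTwSectionNear.neg {c : ∀ z : ZS S, TwStalk E z} {z₀ : ZS S}
    (h : IsTwSectionNear c z₀) : IsTwSectionNear (fun z => - c z) z₀ := by
  refine (h.smul (const_mem (-1))).congr (Eventually.of_forall fun z => ?_)
  funext w
  rw [germ_const, map_neg, map_one, Pi.smul_apply, PullStalk.neg_smul, one_smul, Pi.neg_apply]

lemma DualLift.eq_coord {e : L.ActionChart} {z : ZS S} {w : XhatS S → Model g}
    (hw : DualLift e (phatS z) w) (wl : WLift z) {w₀ : Model g}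
    (h : ∀ j, |w (phatS z) j - w₀ j| < 1 / 2) (h' : ∀ j, |wl.coord e.1 j - w₀ j| < 1 / 2) :
    w (phatS z) = wl.coord e.1 := by
  have hb := hw.eq.self_of_nhds.1
  have h1 : ((coordVec e.1 z.1.base (w (phatS z)) : Tan g z.1.base) :
      Tan g z.1.base ⧸ L.dualLattice z.1.base) =
      (coordVec e.1 z.1.base (wl.coord e.1) : Tan g z.1.base) :=
    hw.eq.self_of_nhds.2.symm.trans (wl.dual_eq e hb)
  rw [eq_comm, QuotientAddGroup.eq, neg_add_eq_sub, ← coordVec_sub] at h1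
  obtain ⟨n, hn⟩ := (coordVec_mem_dualLattice_iff e.2 hb _).1 h1
  funext j
  have h2 := hn j
  rw [Pi.sub_apply] at h2
  have h3 := abs_lt.1 (h j)
  have h4 := abs_lt.1 (h' j)
  have h5 : |(n j : ℝ)| < 1 := by
    rw [← h2, abs_lt]
    constructor <;> linarith [h3.1, h3.2, h4.1, h4.2]
  have h6 : |n j| < 1 := by exact_mod_cast h5
  rw [Int.abs_lt_one_iff] at h6
  rw [h6] at h2
  push_cast at h2
  linarith

/-- The connection form along a vector field is smooth. -/
lemma exists_connForm_eq (θ : ∀ z : ZS S, Der z) {z₀ : ZS S} (hθ : IsVectorFieldNear θ z₀)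
    (w₀ : WLift z₀) : ∃ ψ ∈ smoothNear z₀, ∀ᶠ z in 𝓝 z₀, ∀ w : WLift z,
      (∀ j, |w.coord (L.chart z₀.1.base) j - w₀.coord (L.chart z₀.1.base) j| < 1 / 2) →
      connForm z w (θ z) = germ z ψ := by
  obtain ⟨y, dw, hy, hdw, hdwz⟩ := exists_lifts (stdChart L z₀.1.base) (mem_stdChart _) w₀
  choose η hη hθη using fun j => hθ _ (hy.mem j)
  refine ⟨∑ j, (dualFun dw j ∘ phatS) * ((fun _ => 2 * Real.pi * Complex.I) * η j),
    sum_mem fun j _ => mul_mem (hdw.comp_mem j) (mul_mem (const_mem _) (hη j)), ?_⟩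
  have h1 : ∀ᶠ z in 𝓝 z₀, ∀ j, |dw (phatS z) j - w₀.coord (stdChart L z₀.1.base).1 j| < 1 / 2 := by
    refine eventually_all.2 fun j => ?_
    have hc : ContinuousAt
        (fun z : ZS S => |dw (phatS z) j - w₀.coord (stdChart L z₀.1.base).1 j|) z₀ := by
      have h1 : ContinuousAt (fun z' : ZS S => dw (phatS z')) z₀ :=
        ContinuousAt.comp (g := dw) hdw.smooth.continuousAt
          isSmoothMap_phatS.continuous.continuousAt
      exact (((continuous_apply j).continuousAt.comp h1).sub continuousAt_const).abs
    refine hc.eventually (gt_mem_nhds ?_)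
    simp [hdwz]
  filter_upwards [h1, hy.eventually, isSmoothMap_phatS.continuous.continuousAt.eventually
    hdw.eventually, eventually_all.2 hθη, eventually_all.2 fun j => SmoothSpace.eventually_mem z₀ _
    (hη j)] with z h2 h3 h4 h5 h6 w hw
  have h7 : ∀ j, ((fun _ => 2 * Real.pi * Complex.I) * η j : ZS S → ℂ) ∈ smoothNear z :=
    fun j => mul_mem (const_mem _) (h6 j)
  rw [connForm_eq h3 h4 w (h4.eq_coord w h2 hw), germ_sum _ fun j => mul_mem (h4.comp_mem j) (h7 j)]
  refine Finset.sum_congr rfl fun j _ => ?_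
  rw [germ_mul (h4.comp_mem j) (h7 j), germ_mul (const_mem _) (h6 j), germ_const, h5 j]

/-- In a frame, the derivative of `a ⊗ s` is a combination of `s` and of the derivatives of `s`
along the fields of the frame, with smooth coefficients. This doubles the list of summands in kind,
hence the index type `Fin n ⊕ (Fin n × Fin N)`. -/
theorem IsTwSectionNear.cov {c : ∀ z : ZS S, TwStalk E z} {z₀ : ZS S} (h : IsTwSectionNear c z₀)
    {θ : ∀ z : ZS S, Der z} (hθ : IsVectorFieldNear θ z₀) :
    IsTwSectionNear (fun z => cov (θ z) (c z)) z₀ := by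
  refine IsTwSectionNear.of_fintype fun w₀ => ?_
  obtain ⟨n, a, s, ha, hs, e⟩ := h w₀
  obtain ⟨cf, hcf, ecf⟩ := exists_connForm_eq θ hθ w₀
  obtain ⟨N, x, D, hD, hx⟩ := exists_frame z₀
  choose ψ hψ eψ using fun i => hθ _ (ha i)
  choose η hη eη using fun k =>
    hθ _ (isSmoothMap_pS.comp_mem z₀ (x k) (hx.self_of_nhds.mem k))
  refine ⟨Fin n ⊕ (Fin n × Fin N), inferInstance,
    Sum.elim (fun i => ψ i + cf * a i) (fun q => a q.1 * η q.2),
    Sum.elim s (fun q p => E.conn p (D q.2 p) (s q.1 p)), ?_, ?_, ?_⟩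
  · rintro (i | q)
    · exact add_mem (hψ i) (mul_mem hcf (ha i))
    · exact mul_mem (ha q.1) (hη q.2)
  · rintro (i | q)
    · exact hs i
    · exact E.conn_section _ _ _ (hD q.2) (hs q.1)
  · filter_upwards [e, ecf, hx, eventually_all.2 eψ, eventually_all.2 eη,
      eventually_all.2 fun i => SmoothSpace.eventually_mem z₀ _ (ha i),
      eventually_all.2 fun i => SmoothSpace.eventually_mem z₀ _ (hψ i),
      eventually_all.2 fun i => SmoothSpace.eventually_mem z₀ _ (hη i),
      SmoothSpace.eventually_mem z₀ _ hcf] with z h1 h2 h3 h4 h5 h6 h7 h8 h9 w hw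
    rw [cov_apply, h1 w hw, h2 w hw, map_sum, Finset.smul_sum, ← Finset.sum_add_distrib,
      Fintype.sum_sum_type, Fintype.sum_prod_type, ← Finset.sum_add_distrib]
    refine Finset.sum_congr rfl fun i _ => ?_
    simp only [Sum.elim_inl, Sum.elim_inr]
    rw [pullConn_tmul h3, germ_add (h7 i) (mul_mem h9 (h6 i)), germ_mul h9 (h6 i), h4 i,
      TensorProduct.add_tmul, TensorProduct.smul_tmul', smul_eq_mul]
    have h10 : ∀ k, germ z (a i * η k) = germ z (a i) * θ z (germ z (x k ∘ pS)) := fun k => by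
      rw [h5 k, germ_mul (h6 i) (h8 k)]
    simp only [h10]
    abel

end Coupled

end FourierMukai

end

noncomputable section

namespace FourierMukai

open Filter Metric LagrangianLattice

set_option linter.unusedSectionVars false

lemma IsVectorFieldNear.bracket {Y : Type*} [SmoothSpace Y] {v v' : ∀ y : Y, Der y} {y₀ : Y}
    (h : IsVectorFieldNear v y₀) (h' : IsVectorFieldNear v' y₀) :
    IsVectorFieldNear (fun y => ⁅v y, v' y⁆) y₀ := by
  intro φ hφ
  obtain ⟨a, ha, ea⟩ := h φ hφ
  obtain ⟨b, hb, eb⟩ := h' φ hφ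
  obtain ⟨c, hc, ec⟩ := h b hb
  obtain ⟨d, hd, ed⟩ := h' a ha
  refine ⟨c - d, sub_mem hc hd, ?_⟩
  filter_upwards [ea, eb, ec, ed, SmoothSpace.eventually_mem _ _ hc,
    SmoothSpace.eventually_mem _ _ hd] with y h1 h2 h3 h4 h5 h6
  rw [Derivation.commutator_apply, h1, h2, h3, h4, germ_sub h5 h6]

/-! ### The corrected complementary derivative on relative forms. -/

section Forms

variable {g : ℕ} {B : Type*} [TopologicalSpace B] [ChartedSpace (Model g) B]
  {L : LagrangianLattice g B} {S : Set L.X} {E : FlatModule S}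

/-- The complementary part of the coupled connection in the direction `V`, corrected by the
multiplication with `m`. -/
def hatOp (h : Splitting S) {q : ℕ} {z : ZS S} (V : Der (phatS z)) (m : SGerm z)
    (τ : Coch E q z) : Coch E q z := fun u => nablaHat h V τ u + m • τ u

lemma hatOp_apply (h : Splitting S) {q : ℕ} {z : ZS S} (V : Der (phatS z)) (m : SGerm z)
    (τ : Coch E q z) (u : Fin q → vertical z) : hatOp h V m τ u = cov (h.lift z V) (τ u) -
      ∑ k : Fin q, τ (Function.update u k (h.hbracket V (u k))) + m • τ u := rfl

lemma hbracket_vbracket (h : Splitting S) {z : ZS S} (V : Der (phatS z)) (u u' : vertical z) :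
    h.hbracket V (vbracket u u') = vbracket (h.hbracket V u) u' + vbracket u (h.hbracket V u') :=
  Subtype.ext (leibniz_lie (h.lift z V) (u : Der z) (u' : Der z))

lemma hbracket_add (h : Splitting S) {z : ZS S} (V : Der (phatS z)) (u u' : vertical z) :
    h.hbracket V (u + u') = h.hbracket V u + h.hbracket V u' :=
  Subtype.ext (lie_add (h.lift z V) (u : Der z) (u' : Der z))

lemma hbracket_smul (h : Splitting S) {z : ZS S} (V : Der (phatS z)) (r : SGerm z)
    (u : vertical z) :
    h.hbracket V (r • u) = r • h.hbracket V u + h.lift z V r • u := by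
  refine Subtype.ext (Derivation.ext fun a => ?_)
  change ⁅h.lift z V, r • (u : Der z)⁆ a = r * ⁅h.lift z V, (u : Der z)⁆ a +
    h.lift z V r * (u : Der z) a
  simp only [Derivation.commutator_apply, Derivation.smul_apply, smul_eq_mul, Derivation.leibniz]
  ring

lemma hbracket_add_left (h : Splitting S) {z : ZS S} (V V' : Der (phatS z)) (u : vertical z) :
    h.hbracket (V + V') u = h.hbracket V u + h.hbracket V' u := by
  refine Subtype.ext ?_
  change ⁅h.lift z (V + V'), (u : Der z)⁆ = ⁅h.lift z V, (u : Der z)⁆ + ⁅h.lift z V', (u : Der z)⁆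
  rw [h.lift_add, add_lie]

lemma hbracket_smul_left (h : Splitting S) {z : ZS S} (r : SGerm (phatS z)) (V : Der (phatS z))
    (u : vertical z) : h.hbracket (r • V) u = pullHat z _ rfl r • h.hbracket V u := by
  refine Subtype.ext (Derivation.ext fun a => ?_)
  change ⁅h.lift z (r • V), (u : Der z)⁆ a = pullHat z _ rfl r * ⁅h.lift z V, (u : Der z)⁆ a
  rw [h.lift_smul]
  simp only [Derivation.commutator_apply, Derivation.smul_apply, smul_eq_mul, Derivation.leibniz,
    u.2 r, mul_zero, add_zero]
  ring

/-- The terms of the Koszul formula with a given first argument. -/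
def koszulTerm {q : ℕ} {z : ZS S} (τ : Coch E q z) (i : Fin (q + 1)) (x : vertical z)
    (v : Fin q → vertical z) : TwStalk E z :=
  cov (x : Der z) (τ v) +
    ∑ k : Fin q, if k.castSucc < i then τ (Function.update v k (vbracket (v k) x)) else 0

lemma dRel_apply {q : ℕ} {z : ZS S} (τ : Coch E q z) (u : Fin (q + 1) → vertical z) :
    dRel τ u = ∑ i : Fin (q + 1), (-1 : ℤ) ^ (i : ℕ) • koszulTerm τ i (u i) (u ∘ i.succAbove) := by
  refine Finset.sum_congr rfl fun i _ => ?_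
  congr 2
  refine Finset.sum_congr rfl fun k _ => ?_
  split_ifs with hk
  · rw [Function.comp_apply, Fin.succAbove_of_castSucc_lt i k hk]
  · rfl

section

variable [HasCharts S] [HasCharts (ZS S)]

/-- The curvature term in the commutator of `cov θ` and `cov u` is cancelled by the derivative of
`m` along `u`. This is the purpose of the correction. -/
lemma cov_correction {z : ZS S} (θ u : Der z) (m : SGerm z)
    (hm : ∀ w, u m = curvature z w θ u) (x : TwStalk E z) :
    cov u (cov θ x + m • x) = cov θ (cov u x) + m • cov u x - cov ⁅θ, u⁆ x := by
  funext w
  have h1 := cov_comm (E := E) θ u x w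
  rw [map_add, cov_leibniz]
  simp only [Pi.add_apply, Pi.sub_apply, Pi.smul_apply]
  rw [hm w, eq_sub_iff_add_eq, ← sub_eq_zero]
  rw [← sub_eq_zero] at h1
  rw [← neg_eq_zero, ← h1]
  abel

/-- The diagonal term `l = k` splits by the Jacobi identity `hbracket_vbracket`; in the other terms
the two updates concern different arguments and commute. -/
lemma sum_update_bracket (h : Splitting S) {q : ℕ} {z : ZS S} (V : Der (phatS z)) {τ : Coch E q z}
    (hτ : ∀ u k a b, τ (Function.update u k (a + b)) =
      τ (Function.update u k a) + τ (Function.update u k b))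
    (x : vertical z) (v : Fin q → vertical z) (k : Fin q) :
    ∑ l, τ (Function.update (Function.update v k (vbracket (v k) x)) l
      (h.hbracket V (Function.update v k (vbracket (v k) x) l))) =
    τ (Function.update v k (vbracket (v k) (h.hbracket V x))) +
      ∑ l, τ (Function.update (Function.update v l (h.hbracket V (v l))) k
        (vbracket (Function.update v l (h.hbracket V (v l)) k) x)) := by
  rw [← Finset.add_sum_erase _ _ (Finset.mem_univ k), ← Finset.add_sum_erase _
    (fun l => τ (Function.update (Function.update v l (h.hbracket V (v l))) k
        (vbracket (Function.update v l (h.hbracket V (v l)) k) x))) (Finset.mem_univ k), ← add_assoc]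
  congr 1
  · simp only [Function.update_self, Function.update_idem]
    rw [hbracket_vbracket, hτ, add_comm]
  · refine Finset.sum_congr rfl fun l hl => ?_
    have hl' : l ≠ k := Finset.ne_of_mem_erase hl
    rw [Function.update_of_ne hl', Function.update_of_ne hl'.symm, Function.update_comm hl']

/-- The operator passes through each single term of the Koszul formula as a Lie derivative does,
differentiating the coefficient and every argument. Additivity of `τ` is needed to separate the two
brackets given by the Jacobi identity. -/
lemma koszulTerm_hatOp (h : Splitting S) {q : ℕ} {z : ZS S} (V : Der (phatS z)) (m : SGerm z)
    (hm : ∀ u : vertical z, ∀ w, (u : Der z) m = curvature z w (h.lift z V) u) {τ : Coch E q z}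
    (hτ : ∀ u k a b, τ (Function.update u k (a + b)) =
      τ (Function.update u k a) + τ (Function.update u k b))
    (i : Fin (q + 1)) (x : vertical z) (v : Fin q → vertical z) :
    koszulTerm (hatOp h V m τ) i x v = cov (h.lift z V) (koszulTerm τ i x v) +
      m • koszulTerm τ i x v - koszulTerm τ i (h.hbracket V x) v -
      ∑ l, koszulTerm τ i x (Function.update v l (h.hbracket V (v l))) := by
  have h1 : cov (x : Der z) (hatOp h V m τ v) = cov (h.lift z V) (cov (x : Der z) (τ v)) +
      m • cov (x : Der z) (τ v) - cov (h.hbracket V x : Der z) (τ v) -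
      ∑ l, cov (x : Der z) (τ (Function.update v l (h.hbracket V (v l)))) := by
    have h2 : hatOp h V m τ v = (cov (h.lift z V) (τ v) + m • τ v) -
        ∑ k : Fin q, τ (Function.update v k (h.hbracket V (v k))) := by
      rw [hatOp_apply]
      abel
    rw [h2, map_sub, map_sum, cov_correction _ _ m (hm x)]
    rfl
  have h3 : ∀ k : Fin q, (if k.castSucc < i then
        hatOp h V m τ (Function.update v k (vbracket (v k) x)) else 0) =
      cov (h.lift z V) (if k.castSucc < i then τ (Function.update v k (vbracket (v k) x)) else 0) +
      m • (if k.castSucc < i then τ (Function.update v k (vbracket (v k) x)) else 0) -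
      (if k.castSucc < i then τ (Function.update v k (vbracket (v k) (h.hbracket V x))) else 0) -
      ∑ l, (if k.castSucc < i then τ (Function.update (Function.update v l (h.hbracket V (v l))) k
        (vbracket (Function.update v l (h.hbracket V (v l)) k) x)) else 0) := by
    intro k
    split_ifs with hk
    · rw [hatOp_apply, sum_update_bracket h V hτ]
      abel
    · simp
  unfold koszulTerm
  rw [h1, Finset.sum_congr rfl fun k _ => h3 k]
  simp only [Finset.sum_sub_distrib, Finset.sum_add_distrib, map_add, map_sum, smul_add,
    Finset.smul_sum]
  rw [Finset.sum_comm (s := Finset.univ (α := Fin q)) (t := Finset.univ (α := Fin q))]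
  abel

/-- The corrected operator commutes with the relative part of the coupled connection. -/
theorem dRel_hatOp (h : Splitting S) {q : ℕ} {z : ZS S} (V : Der (phatS z)) (m : SGerm z)
    (hm : ∀ u : vertical z, ∀ w, (u : Der z) m = curvature z w (h.lift z V) u) {τ : Coch E q z}
    (hτ : ∀ u k a b, τ (Function.update u k (a + b)) =
      τ (Function.update u k a) + τ (Function.update u k b)) :
    dRel (hatOp h V m τ) = hatOp h V m (dRel τ) := by
  funext u
  rw [hatOp_apply]
  simp only [dRel_apply]
  rw [Finset.sum_comm, map_sum, Finset.smul_sum, ← Finset.sum_sub_distrib,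
    ← Finset.sum_add_distrib]
  refine Finset.sum_congr rfl fun i _ => ?_
  rw [koszulTerm_hatOp h V m hm hτ, map_zsmul, smul_comm m, ← Finset.smul_sum, ← zsmul_sub,
    ← zsmul_add]
  congr 1
  -- Of the `q + 1` arguments, the `i`-th is the differentiating field and the others are those of
  -- the form; these two kinds match the two subtractions in `koszulTerm_hatOp`.
  rw [Fin.sum_univ_succAbove _ i]
  have h1 : Function.update u i (h.hbracket V (u i)) ∘ i.succAbove = u ∘ i.succAbove := by
    funext k
    simp
  have h2 : ∀ l, Function.update u (i.succAbove l) (h.hbracket V (u (i.succAbove l))) ∘ i.succAbove =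
      Function.update (u ∘ i.succAbove) l (h.hbracket V ((u ∘ i.succAbove) l)) := fun l =>
    Function.update_comp_eq_of_injective _ Fin.succAbove_right_injective _ _
  have h3 : ∀ l x, Function.update u (i.succAbove l) x i = u i := fun l x =>
    Function.update_of_ne (Fin.succAbove_ne i l).symm _ _
  simp only [h1, h2, h3, Function.update_self]
  abel

/-! ### The corrected operator on forms -/

lemma hatOp_update (h : Splitting S) {q : ℕ} {z : ZS S} (V : Der (phatS z)) (m : SGerm z)
    (τ : Coch E q z) (u : Fin q → vertical z) (i : Fin q) (x : vertical z) :
    hatOp h V m τ (Function.update u i x) = cov (h.lift z V) (τ (Function.update u i x)) -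
      ∑ k : Fin q, (if k = i then τ (Function.update u i (h.hbracket V x)) else
        τ (Function.update (Function.update u k (h.hbracket V (u k))) i x)) +
      m • τ (Function.update u i x) := by
  rw [hatOp_apply]
  congr 2
  refine Finset.sum_congr rfl fun k _ => ?_
  split_ifs with hk
  · subst hk
    simp
  · rw [Function.update_of_ne hk, Function.update_comm hk]

/-- The corrected operator on alternating maps. -/
def hatOpAlt (h : Splitting S) {q : ℕ} {z : ZS S} (V : Der (phatS z)) (m : SGerm z)
    (α : AlternatingMap (SGerm z) (vertical z) (TwStalk E z) (Fin q)) :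
    AlternatingMap (SGerm z) (vertical z) (TwStalk E z) (Fin q) where
  toFun := hatOp h V m α
  map_update_add' := by
    intro inst u i x y
    obtain rfl : inst = instDecidableEqFin q := Subsingleton.elim _ _
    simp only [hatOp_update, hbracket_add, AlternatingMap.map_update_add, map_add, smul_add]
    have : ∀ k, (if k = i then α (Function.update u i (h.hbracket V x)) +
          α (Function.update u i (h.hbracket V y)) else
          α (Function.update (Function.update u k (h.hbracket V (u k))) i x) +
          α (Function.update (Function.update u k (h.hbracket V (u k))) i y)) =
        (if k = i then α (Function.update u i (h.hbracket V x)) else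
          α (Function.update (Function.update u k (h.hbracket V (u k))) i x)) +
        (if k = i then α (Function.update u i (h.hbracket V y)) else
          α (Function.update (Function.update u k (h.hbracket V (u k))) i y)) := by
      intro k
      split_ifs <;> rfl
    simp only [this, Finset.sum_add_distrib]
    abel
  -- The derivative of the coefficient `r` arises once from the Leibniz rule of `cov` and once, with
  -- the opposite sign, from the bracket with `r • x`; so the operator preserves linearity over
  -- functions.
  map_update_smul' := by
    intro inst u i r x
    obtain rfl : inst = instDecidableEqFin q := Subsingleton.elim _ _
    simp only [hatOp_update, hbracket_smul, AlternatingMap.map_update_add,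
      AlternatingMap.map_update_smul, cov_leibniz]
    have : ∀ k, (if k = i then r • α (Function.update u i (h.hbracket V x)) +
          h.lift z V r • α (Function.update u i x) else
          r • α (Function.update (Function.update u k (h.hbracket V (u k))) i x)) =
        r • (if k = i then α (Function.update u i (h.hbracket V x)) else
          α (Function.update (Function.update u k (h.hbracket V (u k))) i x)) +
        (if k = i then h.lift z V r • α (Function.update u i x) else 0) := by
      intro k
      split_ifs <;> simp
    simp only [this, Finset.sum_add_distrib, Finset.sum_ite_eq', Finset.mem_univ, if_true,
      smul_add, smul_sub, ← Finset.smul_sum]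
    rw [smul_comm m r]
    abel
  map_eq_zero_of_eq' := by
    intro u i j hu hij
    rw [hatOp_apply, α.map_eq_zero_of_eq u hu hij, map_zero, smul_zero, add_zero, zero_sub,
      neg_eq_zero, ← Finset.add_sum_erase _ _ (Finset.mem_univ i),
      ← Finset.add_sum_erase _ _ (Finset.mem_erase.2 ⟨hij.symm, Finset.mem_univ j⟩), ← add_assoc]
    -- If the arguments `i` and `j` agree, the terms that differentiate one or the other are
    -- exchanged by a transposition and cancel; every other term still has two equal arguments.
    have h1 : Function.update u j (h.hbracket V (u j)) =
        Function.update u i (h.hbracket V (u i)) ∘ Equiv.swap i j := by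
      funext k
      rcases eq_or_ne k j with rfl | hkj
      · simp [hu]
      rcases eq_or_ne k i with rfl | hki
      · simp [Function.update_of_ne hij, Function.update_of_ne hij.symm, hu]
      · simp [Function.update_of_ne hkj, Function.update_of_ne hki,
          Equiv.swap_apply_of_ne_of_ne hki hkj]
    rw [h1, α.map_swap _ hij, add_neg_cancel, zero_add]
    refine Finset.sum_eq_zero fun k hk => α.map_eq_zero_of_eq _ ?_ hij
    have hkj : k ≠ j := Finset.ne_of_mem_erase hk
    have hki : k ≠ i := Finset.ne_of_mem_erase (Finset.mem_of_mem_erase hk)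
    rw [Function.update_of_ne hki.symm, Function.update_of_ne hkj.symm, hu]

lemma hatOp_add (h : Splitting S) {q : ℕ} {z : ZS S} (V : Der (phatS z)) (m : SGerm z)
    (τ τ' : Coch E q z) : hatOp h V m (τ + τ') = hatOp h V m τ + hatOp h V m τ' := by
  funext u
  simp only [hatOp_apply, Pi.add_apply, map_add, Finset.sum_add_distrib, smul_add]
  abel

lemma hatOp_smul (h : Splitting S) {q : ℕ} {z : ZS S} (V : Der (phatS z)) (m : SGerm z)
    (r : SGerm (phatS z)) (τ : Coch E q z) : hatOp h V m (pullHat z _ rfl r • τ) =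
      pullHat z _ rfl r • hatOp h V m τ + pullHat z _ rfl (V r) • τ := by
  funext u
  simp only [hatOp_apply, Pi.smul_apply, Pi.add_apply, cov_leibniz, h.lift_apply, smul_add,
    smul_sub, ← Finset.smul_sum]
  rw [smul_comm m]
  abel

lemma nablaHat_add_left (h : Splitting S) {q : ℕ} {z : ZS S} (V V' : Der (phatS z))
    (α : AlternatingMap (SGerm z) (vertical z) (TwStalk E z) (Fin q)) :
    nablaHat h (V + V') α = nablaHat h V α + nablaHat h V' α := by
  funext u
  simp only [nablaHat, Pi.add_apply, h.lift_add, cov_add_left, hbracket_add_left,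
    AlternatingMap.map_update_add, Finset.sum_add_distrib]
  abel

lemma nablaHat_smul_left (h : Splitting S) {q : ℕ} {z : ZS S} (r : SGerm (phatS z))
    (V : Der (phatS z)) (α : AlternatingMap (SGerm z) (vertical z) (TwStalk E z) (Fin q)) :
    nablaHat h (r • V) α = pullHat z _ rfl r • nablaHat h V α := by
  funext u
  simp only [nablaHat, Pi.smul_apply, h.lift_smul, cov_smul_left, hbracket_smul_left,
    AlternatingMap.map_update_smul, smul_sub, Finset.smul_sum]

lemma nablaHat_sum_left (h : Splitting S) {q : ℕ} {z : ZS S} {ι : Type*} (s : Finset ι)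
    (r : ι → SGerm (phatS z)) (V : ι → Der (phatS z))
    (α : AlternatingMap (SGerm z) (vertical z) (TwStalk E z) (Fin q)) :
    nablaHat h (∑ i ∈ s, r i • V i) α = ∑ i ∈ s, pullHat z _ rfl (r i) • nablaHat h (V i) α := by
  classical
  induction s using Finset.induction_on with
  | empty =>
    have h1 := nablaHat_smul_left h (0 : SGerm (phatS z)) 0 α
    rw [zero_smul, map_zero] at h1
    rw [Finset.sum_empty, Finset.sum_empty, h1]
    funext u
    simp
  | insert i s hi ih =>
    rw [Finset.sum_insert hi, Finset.sum_insert hi, nablaHat_add_left, nablaHat_smul_left, ih]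

variable [IsManifold 𝓘(ℝ, Model g) ∞ B] [HasCharts (XhatS S)]

theorem IsFormAt.hatOp {q : ℕ} {T : ∀ z : ZS S, Coch E q z} {z₀ : ZS S} (hT : IsFormAt T z₀)
    (h : Splitting S) {V : ∀ ξ : XhatS S, Der ξ} (hV : IsVectorFieldNear V (phatS z₀))
    {m : ZS S → ℂ} (hm : m ∈ smoothNear z₀) :
    IsFormAt (fun z => hatOp h (V (phatS z)) (germ z m) (T z)) z₀ := by
  obtain ⟨⟨α, hα⟩, h1, h2⟩ := hT
  refine ⟨⟨hatOpAlt h (V (phatS z₀)) (germ z₀ m) α, ?_⟩, fun u => ?_, fun u hu => ?_⟩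
  · change _ = FourierMukai.hatOp h (V (phatS z₀)) (germ z₀ m) (T z₀)
    rw [← hα]
    rfl
  · change IsAutomorphic (FourierMukai.hatOp h (V (phatS z₀)) (germ z₀ m) (T z₀) u)
    rw [hatOp_apply, sub_eq_add_neg]
    exact (((h1 u).cov _).add (IsAutomorphic.sum _ fun k => h1 _).neg).add ((h1 u).smul _)
  · have h3 : ∀ k, IsTwSectionNear (fun z => T z (Function.update (fun k => u k z) k
        (h.hbracket (V (phatS z)) (u k z)))) z₀ := by
      intro k
      have h4 := h2 (Function.update u k fun z => h.hbracket (V (phatS z)) (u k z)) (by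
        intro l
        rcases eq_or_ne l k with rfl | hl
        · simp only [Function.update_self]
          exact (h.smooth z₀ V hV).bracket (hu l)
        · simp only [Function.update_of_ne hl]
          exact hu l)
      refine h4.congr (Eventually.of_forall fun z => ?_)
      congr 1
      funext l
      rcases eq_or_ne l k with rfl | hl
      · simp
      · simp [Function.update_of_ne hl]
    have h5 := (((h2 u hu).cov (h.smooth z₀ V hV)).add
      (IsTwSectionNear.sum Finset.univ h3).neg).add ((h2 u hu).smul hm)
    refine h5.congr (Eventually.of_forall fun z => ?_)
    change _ = FourierMukai.hatOp h (V (phatS z)) (germ z m) (T z) fun k => u k z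
    rw [hatOp_apply, sub_eq_add_neg]

lemma IsFormAt.add {q : ℕ} {T T' : ∀ z : ZS S, Coch E q z} {z₀ : ZS S} (hT : IsFormAt T z₀)
    (hT' : IsFormAt T' z₀) : IsFormAt (fun z => T z + T' z) z₀ := by
  obtain ⟨⟨α, hα⟩, h1, h2⟩ := hT
  obtain ⟨⟨α', hα'⟩, h1', h2'⟩ := hT'
  refine ⟨⟨α + α', ?_⟩, fun u => (h1 u).add (h1' u), fun u hu => (h2 u hu).add (h2' u hu)⟩
  change _ = T z₀ + T' z₀
  rw [← hα, ← hα']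
  rfl

lemma IsFormAt.zero {q : ℕ} {z₀ : ZS S} : IsFormAt (fun z => (0 : Coch E q z)) z₀ :=
  ⟨⟨0, rfl⟩, fun _ => IsAutomorphic.zero, fun _ _ => IsTwSectionNear.zero⟩

lemma IsFormAt.sum {ι : Type*} (s : Finset ι) {q : ℕ} {T : ι → ∀ z : ZS S, Coch E q z} {z₀ : ZS S}
    (hT : ∀ i ∈ s, IsFormAt (T i) z₀) : IsFormAt (fun z => ∑ i ∈ s, T i z) z₀ := by
  classical
  induction s using Finset.induction_on with
  | empty => simpa using IsFormAt.zero
  | insert i s hi ih =>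
    simp only [Finset.sum_insert hi]
    exact (hT i (Finset.mem_insert_self i s)).add
      (ih fun j hj => hT j (Finset.mem_insert_of_mem hj))

lemma IsFormAt.smul {q : ℕ} {T : ∀ z : ZS S, Coch E q z} {z₀ : ZS S} (hT : IsFormAt T z₀)
    {φ : ZS S → ℂ} (hφ : φ ∈ smoothNear z₀) : IsFormAt (fun z => germ z φ • T z) z₀ := by
  obtain ⟨⟨α, hα⟩, h1, h2⟩ := hT
  refine ⟨⟨germ z₀ φ • α, ?_⟩, fun u => (h1 u).smul _, fun u hu => (h2 u hu).smul hφ⟩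
  change _ = germ z₀ φ • T z₀
  rw [← hα]
  rfl

end

end Forms

end FourierMukai

end

noncomputable section

namespace FourierMukai

open Filter Metric LagrangianLattice

set_option linter.unusedSectionVars false

/-! ### Vector fields adapted to a submersion and a retraction. -/

section Calculus

variable {W W' G : Type*} [NormedAddCommGroup W] [NormedSpace ℝ W] [FiniteDimensional ℝ W]
  [NormedAddCommGroup W'] [NormedSpace ℝ W'] [FiniteDimensional ℝ W']
  [NormedAddCommGroup G] [NormedSpace ℝ G] [FiniteDimensional ℝ G]

lemma contDiffAt_fderiv_apply {f : W → G} {x : W} (hf : ContDiffAt ℝ ∞ f x) {k : W' → W}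
    {x' : W'} (hx : k x' = x) (hk : ContDiffAt ℝ ∞ k x') {l : W' → W} (hl : ContDiffAt ℝ ∞ l x') :
    ContDiffAt ℝ ∞ (fun s => fderiv ℝ f (k s) (l s)) x' := by
  subst hx
  have h1 : ContDiffAt ℝ ∞ (fderiv ℝ f) (k x') := hf.fderiv_right (by simp)
  exact (h1.comp x' hk).clm_apply hl

/-- Given a submersion `η`, a parametrized submanifold `σ` with a retraction `σ ∘ ρ`, and a
direction `e`: the image of `e` under the differential of `σ` extends to a vector field `X` for
which the derivative of `η` along `X` is invariant under the retraction. -/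
theorem exists_adapted_field {v₀ : W} {s₀ : W'} {σ : W' → W} {ρ : W → W'} {η : W → G}
    (hσ : ∀ᶠ s in 𝓝 s₀, ContDiffAt ℝ ∞ σ s) (hρ : ∀ᶠ v in 𝓝 v₀, ContDiffAt ℝ ∞ ρ v)
    (hη : ∀ᶠ v in 𝓝 v₀, ContDiffAt ℝ ∞ η v) (hσ₀ : σ s₀ = v₀) (hρ₀ : ρ v₀ = s₀)
    (hρσ : ∀ᶠ s in 𝓝 s₀, ρ (σ s) = s) (hsurj : Function.Surjective (fderiv ℝ η v₀)) (e : W') :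
    ∃ (X : W → W) (c : W' → G), (∀ᶠ v in 𝓝 v₀, ContDiffAt ℝ ∞ X v) ∧
      (∀ᶠ s in 𝓝 s₀, ContDiffAt ℝ ∞ c s) ∧ (∀ᶠ v in 𝓝 v₀, fderiv ℝ η v (X v) = c (ρ v)) ∧
      ∀ᶠ s in 𝓝 s₀, X (σ s) = fderiv ℝ σ s e := by
  -- `R` is a right inverse of the differential of `η` at `v₀`. Nearby, the composition `A v` of
  -- that differential with `R` stays invertible, so `R ∘ (A v)⁻¹` is a right inverse depending
  -- smoothly on `v`.
  obtain ⟨R', hR'⟩ := LinearMap.exists_rightInverse_of_surjective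
    (fderiv ℝ η v₀ : W →ₗ[ℝ] G) (LinearMap.range_eq_top.2 hsurj)
  let R : G →L[ℝ] W := LinearMap.toContinuousLinearMap R'
  have hR : ∀ y, fderiv ℝ η v₀ (R y) = y := fun y => LinearMap.congr_fun hR' y
  let A : W → G →L[ℝ] G := fun v => (fderiv ℝ η v).comp R
  have hA : ∀ᶠ v in 𝓝 v₀, ContDiffAt ℝ ∞ A v := by
    filter_upwards [hη] with v hv
    have h1 : ContDiffAt ℝ ∞ (fderiv ℝ η) v := hv.fderiv_right (by simp)
    exact h1.clm_comp contDiffAt_const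
  have hA₀ : A v₀ = (ContinuousLinearEquiv.refl ℝ G : G →L[ℝ] G) := by
    ext y
    exact hR y
  have hAi : ∀ᶠ v in 𝓝 v₀, ∃ a : G ≃L[ℝ] G, (a : G →L[ℝ] G) = A v := by
    have h1 := ContinuousLinearEquiv.nhds (ContinuousLinearEquiv.refl ℝ G)
    rw [← hA₀] at h1
    exact hA.self_of_nhds.continuousAt.eventually h1
  -- `ζ` continues the tangent vector of the submanifold constantly along the retraction. Correcting
  -- it by the right inverse makes the derivative of `η` at `v` equal to the one at `σ (ρ v)`, which
  -- depends on `ρ v` only. On the submanifold the two points agree and the correction is zero.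
  let ζ : W → W := fun v => fderiv ℝ σ (ρ v) e
  have hσρ : ∀ᶠ v in 𝓝 v₀, ContDiffAt ℝ ∞ σ (ρ v) := by
    have h1 : Tendsto ρ (𝓝 v₀) (𝓝 s₀) := hρ₀ ▸ hρ.self_of_nhds.continuousAt
    exact h1.eventually hσ
  have hησ : ∀ᶠ s in 𝓝 s₀, ContDiffAt ℝ ∞ η (σ s) := by
    have h1 : Tendsto σ (𝓝 s₀) (𝓝 v₀) := hσ₀ ▸ hσ.self_of_nhds.continuousAt
    exact h1.eventually hη
  have hησρ : ∀ᶠ v in 𝓝 v₀, ContDiffAt ℝ ∞ η (σ (ρ v)) := by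
    have h1 : Tendsto ρ (𝓝 v₀) (𝓝 s₀) := hρ₀ ▸ hρ.self_of_nhds.continuousAt
    exact h1.eventually hησ
  have hζ : ∀ᶠ v in 𝓝 v₀, ContDiffAt ℝ ∞ ζ v := by
    filter_upwards [hσρ, hρ] with v h1 h2
    exact contDiffAt_fderiv_apply h1 rfl h2 contDiffAt_const
  refine ⟨fun v => ζ v - R (ContinuousLinearMap.inverse (A v)
    (fderiv ℝ η v (ζ v) - fderiv ℝ η (σ (ρ v)) (ζ v))),
    fun s => fderiv ℝ η (σ s) (fderiv ℝ σ s e), ?_, ?_, ?_, ?_⟩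
  · filter_upwards [hζ, hA, hAi, hη, hησρ, hσρ, hρ] with v h1 h2 h3 h4 h5 h6 h7
    obtain ⟨a, ha⟩ := h3
    have h8 : ContDiffAt ℝ ∞ (fun v => ContinuousLinearMap.inverse (A v)) v := by
      have h9 : ContDiffAt ℝ ∞ ContinuousLinearMap.inverse (A v) := by
        rw [← ha]
        exact contDiffAt_map_inverse a
      exact h9.comp v h2
    refine h1.sub (R.contDiff.contDiffAt.comp v (h8.clm_apply ?_))
    exact (contDiffAt_fderiv_apply h4 rfl contDiffAt_id h1).sub
      (contDiffAt_fderiv_apply (k := fun v => σ (ρ v)) h5 rfl (h6.comp v h7) h1)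
  · filter_upwards [hσ, hησ] with s h1 h2
    exact contDiffAt_fderiv_apply h2 rfl h1 (contDiffAt_fderiv_apply h1 rfl contDiffAt_id
      contDiffAt_const)
  · filter_upwards [hAi] with v h1
    obtain ⟨a, ha⟩ := h1
    have h2 : ∀ y, fderiv ℝ η v (R (ContinuousLinearMap.inverse (A v) y)) = y := by
      intro y
      change A v (ContinuousLinearMap.inverse (A v) y) = y
      rw [← ha, ContinuousLinearMap.inverse_equiv]
      exact a.apply_symm_apply y
    rw [map_sub, h2, sub_sub_cancel]
  · filter_upwards [hρσ] with s h1
    simp only [ζ, h1]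
    simp

end Calculus

/-! ### The dual coordinates on `XhatS S` form a submersion. -/

section BaseData

variable {g : ℕ} {B : Type*} [TopologicalSpace B] [ChartedSpace (Model g) B]
  {L : LagrangianLattice g B} {S : Set L.X} [IsManifold 𝓘(ℝ, Model g) ∞ B] [HasCharts (XhatS S)]

/-- Translation of a point in the direction of the fibre. -/
lemma plotsXhat_mem_XhatS {e : L.ActionChart} {ξ : L.Xhat} (hξ : ξ ∈ XhatS S)
    (hb : ξ.base ∈ e.1.source) (w : Model g) : L.plotsXhat.map e (e.1 ξ.base, w) ∈ XhatS S := by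
  rw [plotsXhat_apply e hb]
  obtain ⟨z, hz, rfl⟩ := hξ
  exact ⟨⟨z.base, z.angle, (coordVec e.1 z.base w : Tan g _)⟩, hz, rfl⟩

/-- The dual coordinates form a submersion. -/
theorem DualLift.surjective {e : L.ActionChart} {ξ₀ : XhatS S} {w : XhatS S → Model g}
    (hw : DualLift e ξ₀ w) {N : ℕ} {κ : OpenPartialHomeomorph (XhatS S) (Fin N → ℝ)}
    (hκ : IsSmoothChart κ) (hs : ξ₀ ∈ κ.source) :
    Function.Surjective (fderiv ℝ (w ∘ κ.symm) (κ ξ₀)) := by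
  have hb := hw.eq.self_of_nhds.1
  intro y
  -- `XhatS S` contains the whole torus through each of its points. A straight curve in the
  -- direction `y` of this torus has a velocity that the differential maps to `y`.
  let x : ℝ → Model g × Model g := fun t => (e.1 ξ₀.1.base, w ξ₀ + t • y)
  let c : ℝ → XhatS S := fun t => ⟨L.plotsXhat.map e (x t), plotsXhat_mem_XhatS ξ₀.2 hb _⟩
  have hx : ContDiff ℝ ∞ x := by
    refine contDiff_const.prodMk ?_
    fun_prop
  have hdom : ∀ t, x t ∈ L.plotsXhat.dom e := fun t => ⟨e.1.map_source hb, trivial⟩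
  have hc0 : c 0 = ξ₀ := by
    apply Subtype.ext
    simp only [c, x, zero_smul, add_zero]
    exact Xhat_map_eq hb hw.eq.self_of_nhds.2
  have hcont : Continuous c := by
    refine Continuous.subtype_mk ?_ _
    have h1 := (goodXhat L).continuousOn e
    exact h1.comp_continuous hx.continuous hdom
  have hct : Tendsto c (𝓝 0) (𝓝 ξ₀) := hc0 ▸ hcont.tendsto 0
  have hκc : ContDiffAt ℝ ∞ (fun t => κ (c t)) 0 := by
    refine contDiffAt_of_forall_dual fun ℓ => contDiffAt_ofReal_iff.1 ?_
    obtain ⟨ψ, hψ, h1⟩ := hκ.smoothVec_self hs ℓ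
    obtain ⟨U, hU, hξU, h2⟩ := hψ
    have h3 : ContDiffAt ℝ ∞ (ψ ∘ L.plotsXhat.map e) (x 0) := by
      have h4 : IsOpen (L.plotsXhat.dom e ∩ L.plotsXhat.map e ⁻¹' U) :=
        ((goodXhat L).isOpen_iff U).1 hU e
      refine (h2 e).contDiffAt (h4.mem_nhds ⟨hdom 0, ?_⟩)
      change (c 0).1 ∈ U
      rw [hc0]
      exact hξU
    have h5 := h3.comp 0 hx.contDiffAt
    refine h5.congr_of_eventuallyEq ?_
    filter_upwards [hct.eventually h1] with t ht
    exact ht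
  -- Both sides are dual coordinates of the same point, so they differ by an integral vector; it is
  -- small near `t = 0`, hence zero.
  have hwc : (fun t => w (c t)) =ᶠ[𝓝 0] fun t => w ξ₀ + t • y := by
    have h1 : ContinuousAt (fun t => w (c t)) 0 := by
      refine ContinuousAt.comp (g := w) ?_ hcont.continuousAt
      rw [hc0]
      exact hw.smooth.continuousAt
    have h2 : ContinuousAt (fun t : ℝ => w (c t) - (w ξ₀ + t • y)) 0 :=
      h1.sub (by fun_prop)
    have h3 : ∀ᶠ t in 𝓝 (0 : ℝ), ∀ j, |(w (c t) - (w ξ₀ + t • y)) j| < 1 := by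
      refine eventually_all.2 fun j => ?_
      have h4 := ((continuous_apply j).continuousAt.comp h2).abs
      refine h4.eventually (gt_mem_nhds ?_)
      simp [hc0]
    filter_upwards [hct.eventually hw.eq, h3] with t h4 h5
    have h6 : (c t).1.base = ξ₀.1.base := by
      change (L.plotsXhat.map e (e.1 ξ₀.1.base, w ξ₀ + t • y)).base = _
      rw [plotsXhat_apply e hb]
    have h7 : (c t).1.angle = (coordVec e.1 (c t).1.base (w ξ₀ + t • y) : Tan g _) := by
      refine Xhat_angle_eq h4.1 ?_
      rw [h6]
    have h8 := h4.2.symm.trans h7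
    rw [eq_comm, QuotientAddGroup.eq, neg_add_eq_sub, ← coordVec_sub] at h8
    obtain ⟨n, hn⟩ := (coordVec_mem_dualLattice_iff e.2 h4.1 _).1 h8
    funext j
    have h9 := h5 j
    rw [hn j] at h9
    have h10 : |n j| < 1 := by exact_mod_cast h9
    rw [Int.abs_lt_one_iff] at h10
    have h11 := hn j
    rw [h10, Pi.sub_apply] at h11
    push_cast at h11
    linarith
  have hd : DifferentiableAt ℝ (w ∘ κ.symm) (κ ξ₀) :=
    ((hκ.smoothVec_iff hs).1 hw.smooth).self_of_nhds.differentiableAt (by simp)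
  have hd' : HasDerivAt (fun t => κ (c t)) (deriv (fun t => κ (c t)) 0) 0 :=
    (hκc.differentiableAt (by simp)).hasDerivAt
  have h1 : HasDerivAt ((w ∘ κ.symm) ∘ fun t => κ (c t))
      (fderiv ℝ (w ∘ κ.symm) (κ ξ₀) (deriv (fun t => κ (c t)) 0)) 0 := by
    have h2 := hd.hasFDerivAt
    rw [← hc0] at h2 ⊢
    exact h2.comp_hasDerivAt 0 hd'
  have h2 : ((w ∘ κ.symm) ∘ fun t => κ (c t)) =ᶠ[𝓝 0] fun t => w ξ₀ + t • y := by
    filter_upwards [hwc, hct.eventually (eventually_left_inv hs)] with t h3 h4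
    simp only [Function.comp_apply]
    rw [h4.2, h3]
  have h3 : HasDerivAt (fun t : ℝ => w ξ₀ + t • y) y 0 := by
    have := ((hasDerivAt_id (0 : ℝ)).smul_const y).const_add (w ξ₀)
    simpa using this
  exact ⟨_, h1.unique (h3.congr_of_eventuallyEq h2)⟩

end BaseData

end FourierMukai

end

noncomputable section

namespace FourierMukai

open Filter Metric LagrangianLattice

set_option linter.unusedSectionVars false

/-! ### Adapted frames near a point of `Shat`. -/

section BaseData

variable {g : ℕ} {B : Type*} [TopologicalSpace B] [ChartedSpace (Model g) B]
  {L : LagrangianLattice g B} {S : Set L.X} {Shat : Set (XhatS S)}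

/-- Near a point of `Shat`: vector fields on `XhatS S` that are tangent to `Shat` and extend a
coordinate frame of `Shat`, together with a retraction to `Shat` under which the derivatives of the
dual coordinates along these vector fields are invariant. -/
structure BaseData (Shat : Set (XhatS S)) (ξ₀ : Shat) where
  e : L.ActionChart
  w : XhatS S → Model g
  dual : DualLift e ξ₀.1 w
  N : ℕ
  κ : OpenPartialHomeomorph (XhatS S) (Fin N → ℝ)
  chart : IsSmoothChart κ
  mem : ξ₀.1 ∈ κ.source
  n : ℕ
  X : Fin n → (Fin N → ℝ) → (Fin N → ℝ)
  smooth : ∀ i, ∀ᶠ x in 𝓝 (κ ξ₀.1), ContDiffAt ℝ ∞ (X i) x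
  C : Fin n → Fin g → XhatS S → ℂ
  C_mem : ∀ i j, C i j ∈ smoothNear ξ₀.1
  der_dual : ∀ i j, ∀ᶠ ξ in 𝓝 ξ₀.1,
    chartField κ (X i) ξ (germ ξ (dualFun w j)) = germ ξ (C i j)
  ret : XhatS S → XhatS S
  ret_mem : ∀ ξ, ret ξ ∈ Shat
  ret_eq : ∀ᶠ ξ in 𝓝 ξ₀.1, ξ ∈ Shat → ret ξ = ξ
  ret_continuousAt : ContinuousAt ret ξ₀.1
  ret_smooth : SmoothVec ξ₀.1 fun ξ => κ (ret ξ)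
  C_ret : ∀ i j, ∀ᶠ ξ in 𝓝 ξ₀.1, C i j (ret ξ) = C i j ξ
  s : Fin n → Shat → ℂ
  s_mem : ∀ i, s i ∈ smoothNear ξ₀
  der_restrict : ∀ᶠ a : Shat in 𝓝 ξ₀, ∀ (v : Der a) (r : SGerm a.1), v (restrictGerm a r) =
    ∑ i, v (germ a (s i)) * restrictGerm a (chartField κ (X i) a.1 r)
  tangent : ∀ i, ∀ᶠ a : Shat in 𝓝 ξ₀, ∀ r : SGerm a.1, restrictGerm a r = 0 →
    restrictGerm a (chartField κ (X i) a.1 r) = 0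

lemma restrictGerm_germ (a : Shat) {φ : XhatS S → ℂ} (hφ : φ ∈ smoothNear a.1) :
    restrictGerm a (germ a.1 φ) = germ a (φ ∘ Subtype.val) :=
  pullback_germ (isSmoothMap_val Shat) a rfl hφ

variable [IsManifold 𝓘(ℝ, Model g) ∞ B] [HasCharts (XhatS S)] [HasCharts Shat]

/-- Coordinates of `Shat`, extended to a neighbourhood, give `ρ`, and `κ'.symm ∘ ρ` is the
retraction. `exists_adapted_field`, applied to each coordinate vector, yields fields that restrict
to the coordinate fields of `Shat`; their derivatives of the dual coordinates depend on `ρ` only. -/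
theorem exists_baseData (ξ₀ : Shat) : Nonempty (BaseData Shat ξ₀) := by
  obtain ⟨e, he⟩ := exists_action_chart L ξ₀.1.1.base
  obtain ⟨w₀, hw₀⟩ := exists_plotsXhat_eq e ξ₀.1.1 he
  obtain ⟨w, hw, -⟩ := exists_dualLift e ξ₀.1 he (Xhat_angle_eq he hw₀)
  obtain ⟨N, κ, hκ, hs⟩ := HasCharts.exists_chart ξ₀.1
  obtain ⟨n, κ', hκ', hs'⟩ := HasCharts.exists_chart ξ₀
  choose ψ hψ hψκ using fun k => hκ'.smoothVec_self hs' (ContinuousLinearMap.proj k)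
  -- The extensions of the coordinates are complex-valued; their real parts still extend the real
  -- coordinates.
  let ρ : XhatS S → Fin n → ℝ := fun ξ k => (ψ k ξ).re
  have hρ : SmoothVec ξ₀.1 ρ := smoothVec_pi.2 fun k =>
    (smoothVec_complex.2 (hψ k)).comp_mem (Φ := fun z => (z.re : ℂ))
      (ContDiff.smoothNear (Complex.ofRealCLM.contDiff.comp Complex.reCLM.contDiff) _)
  have hρκ : ∀ᶠ a : Shat in 𝓝 ξ₀, ρ a.1 = κ' a := by
    filter_upwards [eventually_all.2 hψκ] with a ha
    funext k
    change (ψ k a.1).re = _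
    rw [← ha k]
    rfl
  have hρ₀ : ρ ξ₀.1 = κ' ξ₀ := hρκ.self_of_nhds
  have hval : ContinuousAt (Subtype.val : Shat → XhatS S) ξ₀ := continuous_subtype_val.continuousAt
  let σ : (Fin n → ℝ) → Fin N → ℝ := fun s => κ (κ'.symm s).1
  have hκval : SmoothVec ξ₀ (fun a : Shat => κ a.1) := fun ℓ =>
    (isSmoothMap_val Shat).comp_mem ξ₀ _ (hκ.smoothVec_self hs ℓ)
  have hσ : ∀ᶠ s in 𝓝 (κ' ξ₀), ContDiffAt ℝ ∞ σ s := (hκ'.smoothVec_iff hs').1 hκval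
  have hρ' : ∀ᶠ v in 𝓝 (κ ξ₀.1), ContDiffAt ℝ ∞ (ρ ∘ κ.symm) v := (hκ.smoothVec_iff hs).1 hρ
  have hσρ : ∀ᶠ s in 𝓝 (κ' ξ₀), (κ'.symm s).1 ∈ κ.source ∧
      κ.symm (κ (κ'.symm s).1) = (κ'.symm s).1 :=
    eventually_symm hs' (hval.eventually (eventually_left_inv hs))
  have hρs : ∀ᶠ s in 𝓝 (κ' ξ₀), ρ (κ'.symm s).1 = s := by
    filter_upwards [eventually_symm hs' hρκ, eventually_right_inv hs'] with s h1 h2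
    rw [h1, h2.2]
  choose X c hX hc hXc hXσ using fun i => exists_adapted_field (σ := σ) (ρ := ρ ∘ κ.symm)
    (η := w ∘ κ.symm) hσ hρ' ((hκ.smoothVec_iff hs).1 hw.smooth)
    (by simp only [σ]; rw [κ'.left_inv hs']) (by simp only [Function.comp_apply]; rw [κ.left_inv hs, hρ₀])
    (by
      filter_upwards [hσρ, hρs] with s h1 h2
      simp only [σ, Function.comp_apply]
      rw [h1.2, h2])
    (hw.surjective hκ hs) (Pi.basisFun ℝ (Fin n) i)
  have hconst : ∀ (v p : Fin n → ℝ), ∀ᶠ x in 𝓝 p, ContDiffAt ℝ ∞ (fun _ : Fin n → ℝ => v) x :=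
    fun v p => Eventually.of_forall fun _ => contDiffAt_const
  have hρt : Tendsto ρ (𝓝 ξ₀.1) (𝓝 (κ' ξ₀)) := hρ₀ ▸ hρ.continuousAt
  have hcρ : ∀ i, SmoothVec ξ₀.1 fun ξ => c i (ρ ξ) := fun i =>
    hρ.comp (by rw [hρ₀]; exact hc i)
  -- Along `Shat` the field `X i` is the image of the `i`-th coordinate vector under the
  -- differential of the inclusion, so differentiating and restricting commute.
  have hrest : ∀ i, ∀ᶠ a : Shat in 𝓝 ξ₀, ∀ r : SGerm a.1,
      restrictGerm a (chartField κ (X i) a.1 r) =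
        chartField κ' (fun _ => Pi.basisFun ℝ (Fin n) i) a (restrictGerm a r) := by
    intro i
    filter_upwards [(eventually_left_inv hs').eventually_nhds,
      hval.eventually (eventually_left_inv hs), eventually_apply hs' (hXσ i).eventually_nhds,
      eventually_apply hs' hσ.eventually_nhds,
      hval.eventually (eventually_apply hs (hX i).eventually_nhds),
      eventually_apply hs' hσρ.eventually_nhds] with a h1 h2 h3 h4 h5 h6 r
    obtain ⟨φ, hφ, rfl⟩ := exists_germ r
    have hφ' : φ ∘ Subtype.val ∈ smoothNear a := (isSmoothMap_val Shat).comp_mem a φ hφ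
    rw [chartField_germ hκ h2.1 h5 hφ, restrictGerm_germ a (fieldOp_mem hκ h2.1 h5 hφ),
      restrictGerm_germ a hφ, chartField_germ hκ' h1.self_of_nhds.1 (hconst _ _) hφ']
    refine germ_congr ?_
    have hval' : ContinuousAt (Subtype.val : Shat → XhatS S) a := continuous_subtype_val.continuousAt
    have hφs : ∀ᶠ a' : Shat in 𝓝 a, ContDiffAt ℝ ∞ (φ ∘ κ.symm) (κ a'.1) :=
      hval'.eventually (eventually_apply h2.1 ((hκ _ h2.1 φ).1 hφ))
    filter_upwards [h1, eventually_apply h1.self_of_nhds.1 h3, eventually_apply h1.self_of_nhds.1 h4,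
      hφs, eventually_apply h1.self_of_nhds.1 h6.eventually_nhds] with a' h7 h8 h9 h10 h11
    have h12 : σ (κ' a') = κ a'.1 := by simp only [σ]; rw [h7.2]
    simp only [fieldOp, Function.comp_apply]
    rw [← h12] at h10 ⊢
    rw [h8]
    have h13 := fderiv_comp (κ' a') (h10.differentiableAt (by simp)) (h9.differentiableAt (by simp))
    have h14 : (φ ∘ κ.symm) ∘ σ =ᶠ[𝓝 (κ' a')] (φ ∘ Subtype.val) ∘ κ'.symm := by
      filter_upwards [h11] with s hs
      simp only [Function.comp_apply, σ]
      rw [hs.2]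
    rw [← h14.fderiv_eq, h13]
    rfl
  refine ⟨⟨e, w, hw, N, κ, hκ, hs, n, X, hX, fun i j ξ => (c i (ρ ξ) j : ℂ), ?_, ?_,
    fun ξ => (κ'.symm (ρ ξ)).1, fun ξ => (κ'.symm (ρ ξ)).2, ?_, ?_, ?_, ?_,
    fun i a => (κ' a i : ℂ), ?_, ?_, ?_⟩⟩
  · exact fun i j => hcρ i (ContinuousLinearMap.proj j)
  · intro i j
    have h1 : ∀ᶠ ξ in 𝓝 ξ₀.1, fieldOp κ (X i) (dualFun w j) ξ = (c i (ρ ξ) j : ℂ) := by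
      filter_upwards [eventually_apply hs (hXc i), eventually_left_inv hs,
        eventually_apply hs ((hκ.smoothVec_iff hs).1 hw.smooth)] with ξ h1 h2 h3
      have h4 : HasFDerivAt (dualFun w j ∘ κ.symm) ((Complex.ofRealCLM.comp
          (ContinuousLinearMap.proj (R := ℝ) (φ := fun _ : Fin g => ℝ) j)).comp
          (fderiv ℝ (w ∘ κ.symm) (κ ξ))) (κ ξ) :=
        HasFDerivAt.comp (κ ξ) (Complex.ofRealCLM.comp (ContinuousLinearMap.proj (R := ℝ)
          (φ := fun _ : Fin g => ℝ) j)).hasFDerivAt (h3.differentiableAt (by simp)).hasFDerivAt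
      rw [fieldOp, h4.fderiv]
      simp only [ContinuousLinearMap.comp_apply, h1, Function.comp_apply, h2.2]
      rfl
    filter_upwards [h1.eventually_nhds, eventually_left_inv hs,
      eventually_apply hs (hX i).eventually_nhds, hw.eventually] with ξ h2 h3 h4 h5
    rw [chartField_germ hκ h3.1 h4 (h5.mem j)]
    exact germ_congr h2
  · have h1 : ∀ᶠ a : Shat in 𝓝 ξ₀, κ'.symm (ρ a.1) = a := by
      filter_upwards [hρκ, eventually_left_inv hs'] with a h1 h2
      rw [h1, h2.2]
    rw [nhds_subtype_eq_comap, eventually_comap] at h1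
    filter_upwards [h1] with ξ h2 h3
    rw [h2 ⟨ξ, h3⟩ rfl]
  · have h1 : ContinuousAt κ'.symm (κ' ξ₀) := κ'.continuousAt_symm (κ'.map_source hs')
    rw [← hρ₀] at h1
    exact continuous_subtype_val.continuousAt.comp (h1.comp hρ.continuousAt)
  · exact hρ.comp (Φ := σ) (by rw [hρ₀]; exact hσ)
  · intro i j
    filter_upwards [hρt.eventually hρs] with ξ h1
    rw [h1]
  · exact fun i => hκ'.smoothVec_self hs' (ContinuousLinearMap.proj i)
  · filter_upwards [eventually_all.2 hrest, eventually_left_inv hs'] with a h1 h2 v r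
    conv_lhs => rw [hκ'.der_eq_sum h2.1 v (Pi.basisFun ℝ (Fin n))]
    rw [der_sum_apply]
    refine Finset.sum_congr rfl fun i _ => ?_
    rw [Derivation.smul_apply, smul_eq_mul, h1 i r]
    rfl
  · intro i
    filter_upwards [hrest i] with a h1 r hr
    rw [h1 r, hr, map_zero]

end BaseData

end FourierMukai

end

noncomputable section

namespace FourierMukai

open Filter Metric LagrangianLattice

set_option linter.unusedSectionVars false

/-! ### Submersions as projections in suitable charts. -/

section InverseFunction

variable {W W' : Type*} [NormedAddCommGroup W] [NormedSpace ℝ W] [FiniteDimensional ℝ W]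
  [NormedAddCommGroup W'] [NormedSpace ℝ W'] [FiniteDimensional ℝ W']

/-- The inverse function theorem; the source is cut down to the points where the map is smooth with
invertible differential, so that the inverse is smooth on all of the target. -/
lemma exists_diffeo {Ψ : W → W'} {p : W} (hΨ : ∀ᶠ x in 𝓝 p, ContDiffAt ℝ ∞ Ψ x)
    (hbij : Function.Bijective (fderiv ℝ Ψ p)) :
    ∃ φ : OpenPartialHomeomorph W W', p ∈ φ.source ∧ ContDiffOn ℝ ∞ φ φ.source ∧
      ContDiffOn ℝ ∞ φ.symm φ.target ∧ ∀ x, φ x = Ψ x := by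
  have : CompleteSpace W := FiniteDimensional.complete ℝ W
  let A : W ≃L[ℝ] W' :=
    (LinearEquiv.ofBijective (fderiv ℝ Ψ p : W →ₗ[ℝ] W') hbij).toContinuousLinearEquiv
  have hA : (A : W →L[ℝ] W') = fderiv ℝ Ψ p := by
    ext x
    rfl
  have hd : HasFDerivAt Ψ (A : W →L[ℝ] W') p := by
    rw [hA]
    exact (hΨ.self_of_nhds.differentiableAt (by simp)).hasFDerivAt
  let φ₀ := hΨ.self_of_nhds.toOpenPartialHomeomorph Ψ hd (by simp)
  have hφ₀ : ∀ x, φ₀ x = Ψ x := fun x => rfl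
  have h1 : ∀ᶠ x in 𝓝 p, ∃ a : W ≃L[ℝ] W', (a : W →L[ℝ] W') = fderiv ℝ Ψ x := by
    have h2 : ContinuousAt (fderiv ℝ Ψ) p :=
      (hΨ.self_of_nhds.fderiv_right (m := ∞) (by simp)).continuousAt
    have h3 := ContinuousLinearEquiv.nhds A
    rw [hA] at h3
    exact h2.eventually h3
  obtain ⟨O, hO, hOo, hpO⟩ := _root_.eventually_nhds_iff.1 (hΨ.and h1)
  refine ⟨φ₀.restrOpen O hOo, ⟨hΨ.self_of_nhds.mem_toOpenPartialHomeomorph_source hd (by simp), hpO⟩,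
    ?_, ?_, fun x => rfl⟩
  · rintro x ⟨-, hx⟩
    exact (hO x hx).1.contDiffWithinAt
  · intro y hy
    have hx : (φ₀.restrOpen O hOo).symm y ∈ (φ₀.restrOpen O hOo).source :=
      (φ₀.restrOpen O hOo).map_target hy
    obtain ⟨h2, a, ha⟩ := hO _ hx.2
    refine (OpenPartialHomeomorph.contDiffAt_symm (φ₀.restrOpen O hOo) (f₀' := a) hy ?_
      h2).contDiffWithinAt
    rw [ha]
    exact (h2.differentiableAt (by simp)).hasFDerivAt

/-- A submersion is a projection in suitable coordinates. -/
lemma exists_straighten {F : W → W'} {p : W} (hF : ∀ᶠ x in 𝓝 p, ContDiffAt ℝ ∞ F x)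
    (hsurj : Function.Surjective (fderiv ℝ F p)) :
    ∃ (K : Submodule ℝ W) (φ : OpenPartialHomeomorph W (W' × K)), p ∈ φ.source ∧
      ContDiffOn ℝ ∞ φ φ.source ∧ ContDiffOn ℝ ∞ φ.symm φ.target ∧ ∀ x, (φ x).1 = F x := by
  let K : Submodule ℝ W := LinearMap.ker (fderiv ℝ F p : W →ₗ[ℝ] W')
  obtain ⟨P, hP⟩ := exists_projection K
  have h1 : ∀ᶠ x in 𝓝 p, ContDiffAt ℝ ∞ (fun x => (F x, P x)) x := by
    filter_upwards [hF] with x hx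
    exact hx.prodMk P.contDiff.contDiffAt
  have h2 : fderiv ℝ (fun x => (F x, P x)) p = (fderiv ℝ F p).prod P :=
    ((hF.self_of_nhds.differentiableAt (by simp)).hasFDerivAt.prodMk P.hasFDerivAt).fderiv
  obtain ⟨φ, hp, h3, h4, h5⟩ := exists_diffeo h1 (by
    rw [h2]
    refine ⟨(injective_iff_map_eq_zero _).2 fun v hv => ?_, fun ⟨a, k⟩ => ?_⟩
    · have h6 : v ∈ K := congrArg Prod.fst hv
      have h7 : P v = 0 := congrArg Prod.snd hv
      have h8 := hP ⟨v, h6⟩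
      rw [h7] at h8
      exact (congrArg Subtype.val h8).symm
    · obtain ⟨v, hv⟩ := hsurj a
      refine ⟨v - P v + k, Prod.ext ?_ ?_⟩
      · have h6 : ∀ k : K, fderiv ℝ F p k = 0 := fun k => k.2
        simp [h6, hv]
      · simp [hP])
  exact ⟨K, φ, hp, h3, h4, fun x => by rw [h5]⟩

end InverseFunction

section Product

variable {Y Y' : Type*} [SmoothSpace Y] [SmoothSpace Y'] [HasCharts Y'] {f : Y' → Y}

/-- The differential of a submersion is surjective in charts. -/
lemma IsSubmersion.surjective_fderiv {hf : IsSmoothMap f} (hsub : IsSubmersion hf) {y' : Y'}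
    {N M : ℕ} {κ : OpenPartialHomeomorph Y (Fin N → ℝ)} (hκ : IsSmoothChart κ)
    (hs : f y' ∈ κ.source) {κ' : OpenPartialHomeomorph Y' (Fin M → ℝ)} (hκ' : IsSmoothChart κ')
    (hs' : y' ∈ κ'.source) :
    Function.Surjective (fderiv ℝ (fun x => κ (f (κ'.symm x))) (κ' y')) := by
  intro a
  have hX : ∀ᶠ x in 𝓝 (κ (f y')), ContDiffAt ℝ ∞ (fun _ : Fin N → ℝ => a) x :=
    Eventually.of_forall fun _ => contDiffAt_const
  have hvec : SmoothVec y' (fun y => κ (f y)) := fun ℓ =>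
    hf.comp_mem y' _ (hκ.smoothVec_self hs ℓ)
  have hF := ((hκ'.smoothVec_iff hs').1 hvec)
  have hFd := (hF.self_of_nhds.differentiableAt (by simp)).hasFDerivAt
  -- A lift of the constant field `a` has complex coefficients `ζ k`. At `y'` the chain rule
  -- exhibits `a` as the image of these coefficients under the differential; this map and `a` are
  -- real, so the real parts of the coefficients already give a preimage.
  obtain ⟨θ, hθ⟩ := hsub y' (chartField κ (fun _ => a) (f y'))
  choose ζ hζ eζ using fun k : Fin M => exists_germ (θ (germ y' fun y => (κ' y k : ℂ)))
  have hxl : ∀ l, (fun y => (κ y l : ℂ)) ∈ smoothNear (f y') := fun l =>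
    hκ.smoothVec_self hs (ContinuousLinearMap.proj l)
  have key : ∀ l, ∑ k, (fderiv ℝ (fun x => κ (f (κ'.symm x))) (κ' y') (Pi.basisFun ℝ (Fin M) k) l : ℂ)
      * ζ k y' = (a l : ℂ) := by
    intro l
    have hd : HasFDerivAt (fun x => (κ (f (κ'.symm x)) l : ℂ)) ((Complex.ofRealCLM.comp
        (ContinuousLinearMap.proj (R := ℝ) (φ := fun _ : Fin N => ℝ) l)).comp
        (fderiv ℝ (fun x => κ (f (κ'.symm x))) (κ' y'))) (κ' y') :=
      HasFDerivAt.comp (κ' y') (Complex.ofRealCLM.comp (ContinuousLinearMap.proj (R := ℝ)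
        (φ := fun _ : Fin N => ℝ) l)).hasFDerivAt hFd
    have hsm : SmoothNear (κ' y') (fun x => (κ (f (κ'.symm x)) l : ℂ)) :=
      (hκ' y' hs' _).1 (hvec (ContinuousLinearMap.proj l))
    have h1 := der_comp θ (Pi.basisFun ℝ (Fin M)) (hκ'.smoothVec_self hs') hsm
    have h2 : (fun y => (κ (f (κ'.symm (κ' y))) l : ℂ)) =ᶠ[𝓝 y'] (fun y => (κ y l : ℂ)) ∘ f := by
      filter_upwards [eventually_left_inv hs'] with y hy
      rw [hy.2]
      rfl
    have h3 := hθ (germ (f y') fun y => (κ y l : ℂ))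
    rw [pullback_germ hf y' rfl (hxl l), chartField_germ hκ hs hX (hxl l),
      pullback_germ hf y' rfl (fieldOp_mem hκ hs hX (hxl l)), ← germ_congr h2, h1] at h3
    have h4 : ∀ k, (fun y => fderiv ℝ (fun x => (κ (f (κ'.symm x)) l : ℂ)) (κ' y)
        (Pi.basisFun ℝ (Fin M) k)) ∈ smoothNear y' := by
      intro k
      refine hκ'.comp_mem hs' (f := fun x => fderiv ℝ (fun x => (κ (f (κ'.symm x)) l : ℂ)) x
        (Pi.basisFun ℝ (Fin M) k)) ?_
      filter_upwards [hsm] with x hx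
      exact contDiffAt_fderiv_apply hx rfl contDiffAt_id contDiffAt_const
    have h5 : ∀ k, θ (germ y' fun y => ((Pi.basisFun ℝ (Fin M)).coord k (κ' y) : ℂ)) =
        germ y' (ζ k) := fun k => (eζ k).symm
    simp only [h5, ← germ_mul (h4 _) (hζ _)] at h3
    rw [← germ_sum _ fun k => mul_mem (h4 k) (hζ k), germ_eq_iff
      (sum_mem fun k _ => mul_mem (h4 k) (hζ k))
      (hf.comp_mem y' _ (fieldOp_mem hκ hs hX (hxl l)))] at h3
    have h6 := h3.self_of_nhds
    simp only [Finset.sum_apply, Pi.mul_apply, hd.fderiv, Function.comp_apply] at h6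
    have h7 : fieldOp κ (fun _ => a) (fun y => (κ y l : ℂ)) (f y') = a l := by
      have h8 : (fun y => (κ y l : ℂ)) ∘ κ.symm =ᶠ[𝓝 (κ (f y'))] fun x => (x l : ℂ) := by
        filter_upwards [eventually_right_inv hs] with x hx
        simp [hx.2]
      have h9 : HasFDerivAt (fun x : Fin N → ℝ => (x l : ℂ))
          (Complex.ofRealCLM.comp (ContinuousLinearMap.proj (R := ℝ) (φ := fun _ : Fin N => ℝ) l))
          (κ (f y')) := (Complex.ofRealCLM.comp (ContinuousLinearMap.proj (R := ℝ)
          (φ := fun _ : Fin N => ℝ) l)).hasFDerivAt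
      simp only [fieldOp]
      rw [h8.fderiv_eq, h9.fderiv]
      rfl
    rw [← h7, ← h6]
    rfl
  refine ⟨∑ k, (ζ k y').re • Pi.basisFun ℝ (Fin M) k, ?_⟩
  funext l
  have h1 := congrArg Complex.re (key l)
  rw [Complex.re_sum] at h1
  simp only [Complex.re_ofReal_mul, Complex.ofReal_re] at h1
  rw [map_sum, Finset.sum_apply, ← h1]
  refine Finset.sum_congr rfl fun k _ => ?_
  rw [map_smul, Pi.smul_apply, smul_eq_mul, mul_comm]

lemma IsSmoothChart.restrOpen {W : Type*} [NormedAddCommGroup W] [NormedSpace ℝ W]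
    {κ : OpenPartialHomeomorph Y W} (hκ : IsSmoothChart κ) {O : Set Y} (hO : IsOpen O) :
    IsSmoothChart (κ.restrOpen O hO) := fun y hy φ => hκ y hy.1 φ

/-- Near every point, a submersion is a projection in suitable charts. -/
theorem exists_product_chart {hf : IsSmoothMap f} (hsub : IsSubmersion hf) (y' : Y') {N : ℕ}
    {κ : OpenPartialHomeomorph Y (Fin N → ℝ)} (hκ : IsSmoothChart κ) (hs : f y' ∈ κ.source) :
    ∃ (M : ℕ) (K : Submodule ℝ (Fin M → ℝ)) (Q : OpenPartialHomeomorph Y' ((Fin N → ℝ) × K)),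
      IsSmoothChart Q ∧ y' ∈ Q.source ∧ ∀ q ∈ Q.source, f q ∈ κ.source ∧ (Q q).1 = κ (f q) := by
  obtain ⟨M, κ', hκ', hs'⟩ := HasCharts.exists_chart y'
  have hvec : SmoothVec y' (fun y => κ (f y)) := fun ℓ =>
    hf.comp_mem y' _ (hκ.smoothVec_self hs ℓ)
  obtain ⟨K, φ, hp, h1, h2, h3⟩ := exists_straighten ((hκ'.smoothVec_iff hs').1 hvec)
    (hsub.surjective_fderiv hκ hs hκ' hs')
  have hO : IsOpen (f ⁻¹' κ.source) := κ.open_source.preimage hf.continuous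
  refine ⟨M, K, (κ'.trans φ).restrOpen _ hO, (hκ'.trans h1 h2).restrOpen hO,
    ⟨⟨hs', hp⟩, hs⟩, fun q hq => ⟨hq.2, ?_⟩⟩
  change (φ (κ' q)).1 = κ (f q)
  rw [h3, Function.comp_apply, κ'.left_inv hq.1.1]

end Product

end FourierMukai

end

noncomputable section

namespace FourierMukai

open Filter Metric LagrangianLattice

set_option linter.unusedSectionVars false

/-! ### Functions and vector fields in a product chart of a submersion. -/

section ProductChart

variable {Y Y' : Type*} [SmoothSpace Y] [SmoothSpace Y'] {f : Y' → Y} {W K : Type*}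
  [NormedAddCommGroup W] [NormedSpace ℝ W] [FiniteDimensional ℝ W]
  [NormedAddCommGroup K] [NormedSpace ℝ K] [FiniteDimensional ℝ K]
  {κ : OpenPartialHomeomorph Y W} {Q : OpenPartialHomeomorph Y' (W × K)}

/-- The chart `Q` straightens `f` with respect to the chart `κ`. -/
def IsProductChart (f : Y' → Y) (κ : OpenPartialHomeomorph Y W)
    (Q : OpenPartialHomeomorph Y' (W × K)) : Prop :=
  ∀ q ∈ Q.source, f q ∈ κ.source ∧ (Q q).1 = κ (f q)

lemma IsProductChart.apply_symm (hQ : IsProductChart f κ Q) {p : W × K} (hp : p ∈ Q.target) :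
    f (Q.symm p) ∈ κ.source ∧ f (Q.symm p) = κ.symm p.1 := by
  obtain ⟨h1, h2⟩ := hQ _ (Q.map_target hp)
  rw [Q.right_inv hp] at h2
  exact ⟨h1, by rw [h2, κ.left_inv h1]⟩

lemma IsProductChart.comp_symm_eventuallyEq (hQ : IsProductChart f κ Q) {q : Y'}
    (hq : q ∈ Q.source) (φ : Y → ℂ) : (φ ∘ f) ∘ Q.symm =ᶠ[𝓝 (Q q)] fun p => (φ ∘ κ.symm) p.1 := by
  filter_upwards [Q.open_target.mem_nhds (Q.map_source hq)] with p hp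
  simp only [Function.comp_apply, (hQ.apply_symm hp).2]

/-- The derivative of a pulled-back function along a field that lifts `X`. -/
lemma IsProductChart.fieldOp_comp (hQ : IsProductChart f κ Q) (hκ : IsSmoothChart κ)
    {X' : W × K → W × K} {X : W → W} (hX : ∀ p, (X' p).1 = X p.1) {q : Y'} (hq : q ∈ Q.source)
    {φ : Y → ℂ} (hφ : φ ∈ smoothNear (f q)) : fieldOp Q X' (φ ∘ f) q = fieldOp κ X φ (f q) := by
  obtain ⟨h1, h2⟩ := hQ q hq
  have h3 := ((hκ _ h1 φ).1 hφ).self_of_nhds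
  have h4 : HasFDerivAt (fun p : W × K => (φ ∘ κ.symm) p.1)
      ((fderiv ℝ (φ ∘ κ.symm) (Q q).1).comp (ContinuousLinearMap.fst ℝ W K)) (Q q) := by
    refine HasFDerivAt.comp (g := φ ∘ κ.symm) (Q q) ?_ hasFDerivAt_fst
    rw [h2]
    exact (h3.differentiableAt (by simp)).hasFDerivAt
  simp only [fieldOp]
  rw [(hQ.comp_symm_eventuallyEq hq φ).fderiv_eq, h4.fderiv]
  simp only [ContinuousLinearMap.comp_apply, ContinuousLinearMap.coe_fst', hX, h2]

lemma IsProductChart.chartField_comp [HasCharts Y'] (hQ : IsProductChart f κ Q)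
    (hf : IsSmoothMap f) (hκ : IsSmoothChart κ) (hQs : IsSmoothChart Q)
    {X' : W × K → W × K} {X : W → W} (hX : ∀ p, (X' p).1 = X p.1) {q : Y'} (hq : q ∈ Q.source)
    (hX' : ∀ᶠ p in 𝓝 (Q q), ContDiffAt ℝ ∞ X' p) {φ : Y → ℂ} (hφ : φ ∈ smoothNear (f q)) :
    chartField Q X' q (germ q (φ ∘ f)) = germ q (fieldOp κ X φ ∘ f) := by
  rw [chartField_germ hQs hq hX' (hf.comp_mem q φ hφ)]
  refine germ_congr ?_
  filter_upwards [Q.open_source.mem_nhds hq, hf.continuous.continuousAt.eventually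
    (SmoothSpace.eventually_mem _ φ hφ)] with q' h1 h2
  exact hQ.fieldOp_comp hκ hX h1 h2

/-- A function on the total space of `f`, restricted to a slice of the product chart. -/
lemma IsProductChart.slice (hQ : IsProductChart f κ Q) (hκ : IsSmoothChart κ)
    (hQs : IsSmoothChart Q) {q : Y'} (hq : q ∈ Q.source) {φ : Y' → ℂ} (hφ : φ ∈ smoothNear q) :
    (fun y => φ (Q.symm (κ y, (Q q).2))) ∈ smoothNear (f q) ∧
    ∀ (X : W → W), fieldOp κ X (fun y => φ (Q.symm (κ y, (Q q).2))) (f q) =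
      fieldOp Q (fun p => (X p.1, 0)) φ q := by
  obtain ⟨h1, h2⟩ := hQ q hq
  have h3 : SmoothNear (Q q) (φ ∘ Q.symm) := (hQs q hq φ).1 hφ
  have h4 : (κ (f q), (Q q).2) = Q q := by rw [← h2]
  have h5 : SmoothNear (κ (f q)) ((φ ∘ Q.symm) ∘ fun x => (x, (Q q).2)) := by
    refine SmoothNear.comp (k := fun x => (x, (Q q).2)) (by rw [h4]; exact h3)
      (Eventually.of_forall fun x => ?_)
    exact contDiffAt_id.prodMk contDiffAt_const
  refine ⟨hκ.comp_mem h1 h5, fun X => ?_⟩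
  simp only [fieldOp]
  have h6 : (fun y => φ (Q.symm (κ y, (Q q).2))) ∘ κ.symm =ᶠ[𝓝 (κ (f q))]
      (φ ∘ Q.symm) ∘ fun x => (x, (Q q).2) := by
    filter_upwards [eventually_right_inv h1] with x hx
    simp [hx.2]
  have h7 : HasFDerivAt (φ ∘ Q.symm) (fderiv ℝ (φ ∘ Q.symm) (Q q)) (κ (f q), (Q q).2) := by
    rw [h4]
    exact (h3.self_of_nhds.differentiableAt (by simp)).hasFDerivAt
  have h8 := h7.comp (κ (f q)) (hasFDerivAt_prodMk_left (𝕜 := ℝ) (κ (f q)) (Q q).2)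
  rw [h6.fderiv_eq, h8.fderiv, h2]
  rfl

end ProductChart

/-! ### Vanishing curvature as local constancy along the fibres over `Shat`. -/

section Constancy

variable {g : ℕ} {B : Type*} [TopologicalSpace B] [ChartedSpace (Model g) B]
  {L : LagrangianLattice g B} {S : Set L.X} {Shat : Set (XhatS S)}

lemma eventually_eq_of_isIntegral {Y : Type*} [TopologicalSpace Y] {y : Y} {d : Y → Model g}
    (hd : ContinuousAt d y) (h : ∀ᶠ y' in 𝓝 y, IsIntegral (d y')) : ∀ᶠ y' in 𝓝 y, d y' = d y := by
  have h1 : ∀ᶠ y' in 𝓝 y, ∀ j, |(d y' - d y) j| < 1 := by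
    refine eventually_all.2 fun j => ?_
    have h2 : ContinuousAt (fun y' => |(d y' - d y) j|) y :=
      ((continuous_apply j).continuousAt.comp (hd.sub continuousAt_const)).abs
    exact h2.eventually (gt_mem_nhds (by simp))
  filter_upwards [h, h1] with y' h2 h3
  have h4 : IsIntegral (d y' - d y) := sub_eq_add_neg (d y') (d y) ▸ h2.add h.self_of_nhds.neg
  exact sub_eq_zero.1 (h4.eq_zero h3)

variable [IsManifold 𝓘(ℝ, Model g) ∞ B] [HasCharts (ZS S)] [HasCharts (XhatS S)]

lemma AngleLift.sub_eventually_const {e : L.ActionChart} {z : ZS S} {y y' : ZS S → Model g}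
    (hy : AngleLift e z y) (hy' : AngleLift e z y') :
    ∀ᶠ q in 𝓝 z, y q - y' q = y z - y' z := by
  refine eventually_eq_of_isIntegral (d := fun q => y q - y' q)
    (hy.smooth.continuousAt.sub hy'.smooth.continuousAt) ?_
  filter_upwards [hy.eq, hy'.eq] with q h1 h2
  have h3 := h1.2.symm.trans h2.2
  rw [eq_comm, QuotientAddGroup.eq, neg_add_eq_sub, ← covec_sub] at h3
  exact (covec_mem_lattice_iff e.2 h1.1 _).1 h3

lemma DualLift.sub_eventually_const {e : L.ActionChart} {ξ : XhatS S} {w w' : XhatS S → Model g}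
    (hw : DualLift e ξ w) (hw' : DualLift e ξ w') : ∀ᶠ ξ' in 𝓝 ξ, w ξ' - w' ξ' = w ξ - w' ξ := by
  refine eventually_eq_of_isIntegral (d := fun q => w q - w' q)
    (hw.smooth.continuousAt.sub hw'.smooth.continuousAt) ?_
  filter_upwards [hw.eq, hw'.eq] with q h1 h2
  have h3 := h1.2.symm.trans h2.2
  rw [eq_comm, QuotientAddGroup.eq, neg_add_eq_sub, ← coordVec_sub] at h3
  exact (coordVec_mem_dualLattice_iff e.2 h1.1 _).1 h3

/-- The curvature, computed with any dual coordinates. -/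
theorem curvature_eq_of_dualLift {e : L.ActionChart} {z : ZS S} {y : ZS S → Model g}
    (hy : AngleLift e z y) {w : XhatS S → Model g} (hw : DualLift e (phatS z) w) (wl : WLift z)
    (θ : Der z) {u : Der z} (hu : u ∈ vertical z) :
    curvature z wl θ u = ∑ j, θ (germ z (dualFun w j ∘ phatS)) *
      (algebraMap ℂ _ (2 * Real.pi * Complex.I) * u (germ z (angleFun y j))) := by
  have hb := hy.eq.self_of_nhds.1
  obtain ⟨w', hw', h⟩ := exists_dualLift e (phatS z) hb (wl.dual_eq e hb)
  rw [curvature_eq hy hw' wl h θ hu]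
  refine Finset.sum_congr rfl fun j _ => ?_
  congr 1
  have h1 : dualFun w j ∘ phatS =ᶠ[𝓝 z] (dualFun w' j ∘ phatS) +
      fun _ => ((w (phatS z) - w' (phatS z)) j : ℂ) := by
    filter_upwards [isSmoothMap_phatS.continuous.continuousAt.eventually
      (hw.sub_eventually_const hw')] with q hq
    rw [← hq]
    simp [dualFun]
  rw [germ_congr h1, germ_add (hw'.comp_mem j) (const_mem _), germ_const, map_add,
    Derivation.map_algebraMap, add_zero]

variable [HasCharts Shat]

lemma restrictGerm_eq_zero_iff {Y : Type*} [SmoothSpace Y] {A : Set Y} (a : A) {φ : Y → ℂ}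
    (hφ : φ ∈ smoothNear a.1) :
    restrictGerm a (germ a.1 φ) = 0 ↔ ∀ᶠ a' : A in 𝓝 a, φ a'.1 = 0 := by
  have h1 : restrictGerm a (germ a.1 φ) = germ a (φ ∘ Subtype.val) :=
    pullback_germ (isSmoothMap_val A) a rfl hφ
  rw [h1, ← germ_const_zero, germ_eq_iff ((isSmoothMap_val A).comp_mem a φ hφ) (const_mem 0)]
  rfl

lemma eventually_subtype_iff {Y : Type*} [TopologicalSpace Y] {A : Set Y} (a : A) {P : Y → Prop} :
    (∀ᶠ a' : A in 𝓝 a, P a'.1) ↔ ∀ᶠ y in 𝓝 a.1, y ∈ A → P y := by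
  rw [nhds_subtype_eq_comap, eventually_comap]
  exact eventually_congr (Eventually.of_forall fun y =>
    ⟨fun h hy => h ⟨y, hy⟩ rfl, fun h a' ha' => ha' ▸ h (ha' ▸ a'.2)⟩)

namespace BaseData

variable {ξ₀ : Shat} (D : BaseData Shat ξ₀)

/-- Vanishing of the curvature, in a product chart. -/
theorem sum_fderiv_eq_zero (hF : CurvatureVanishes Shat) (i : Fin D.n) {K : Type*}
    [NormedAddCommGroup K] [NormedSpace ℝ K] [FiniteDimensional ℝ K]
    {Q : OpenPartialHomeomorph (ZS S) ((Fin D.N → ℝ) × K)} (hQs : IsSmoothChart Q)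
    (hQ : IsProductChart phatS D.κ Q) {p : ZS S} (hp : p ∈ Q.source) (hpξ : phatS p = ξ₀.1)
    {y : ZS S → Model g} (hy : AngleLift D.e p y) :
    ∀ᶠ q in 𝓝 p, phatS q ∈ Shat → ∀ t : K, ∑ j, D.C i j (phatS q) *
      fderiv ℝ (angleFun y j ∘ Q.symm) (Q q) (0, t) = 0 := by
  have hph : Tendsto phatS (𝓝 p) (𝓝 ξ₀.1) := hpξ ▸ isSmoothMap_phatS.continuous.continuousAt
  have htan : ∀ᶠ ξ in 𝓝 ξ₀.1, ∀ hξ : ξ ∈ Shat, ∀ r : SGerm ξ,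
      restrictGerm (⟨ξ, hξ⟩ : Shat) r = 0 →
      restrictGerm (⟨ξ, hξ⟩ : Shat) (chartField D.κ (D.X i) ξ r) = 0 := by
    have h1 := D.tangent i
    rw [nhds_subtype_eq_comap, eventually_comap] at h1
    filter_upwards [h1] with ξ h2 hξ
    exact h2 ⟨ξ, hξ⟩ rfl
  have hXs := eventually_apply D.mem (D.smooth i).eventually_nhds
  have hsrc : ∀ᶠ q in 𝓝 p, q ∈ Q.source := Q.open_source.mem_nhds hp
  filter_upwards [hsrc.eventually_nhds,
    (hph.eventually htan).eventually_nhds, hy.eventually,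
    hph.eventually D.dual.eventually, hph.eventually (eventually_all.2 (D.der_dual i)),
    (hph.eventually hXs).eventually_nhds, hph.eventually (eventually_all.2 fun j =>
      SmoothSpace.eventually_mem _ _ (D.C_mem i j))] with q h1 h2 h3 h4 h5 h6 h7 hqS t
  have hq := h1.self_of_nhds
  have hX' : ∀ q', q' ∈ Q.source → (∀ᶠ x in 𝓝 (D.κ (phatS q')), ContDiffAt ℝ ∞ (D.X i) x) →
      ∀ᶠ v in 𝓝 (Q q'), ContDiffAt ℝ ∞ (fun v : (Fin D.N → ℝ) × K => (D.X i v.1, (0 : K))) v := by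
    intro q' hq' h8
    rw [← (hQ q' hq').2] at h8
    filter_upwards [continuous_fst.continuousAt.eventually h8] with v hv
    exact (hv.comp v contDiffAt_fst).prodMk contDiffAt_const
  have ht : ∀ᶠ v in 𝓝 (Q q), ContDiffAt ℝ ∞
      (fun _ : (Fin D.N → ℝ) × K => ((0 : Fin D.N → ℝ), t)) v :=
    Eventually.of_forall fun _ => contDiffAt_const
  let qz : ZSS Shat := ⟨q, hqS⟩
  let wl : WLift q := ⟨Quotient.out q.1.dual, Quotient.out_eq _⟩
  -- `θ` lifts `D.X i` with no component along the fibre, and `u` is a coordinate field of the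
  -- fibre. For this pair the curvature is `2πi ∑ C_ij u(y_j)`.
  let θ : Der q := chartField Q (fun v => (D.X i v.1, 0)) q
  let u : Der q := chartField Q (fun _ => (0, t)) q
  -- In the product chart `θ` differentiates along the slices. A function that vanishes over `Shat`
  -- restricts on a slice to one that vanishes on `Shat`, and `D.X i` is tangent to `Shat`.
  have hθ : ∀ a ∈ vanishingIdeal qz, θ a ∈ vanishingIdeal qz := by
    intro a ha
    obtain ⟨φ, hφ, rfl⟩ := exists_germ a
    have ha' : ∀ᶠ q' in 𝓝 q, q' ∈ ZSS Shat → φ q' = 0 :=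
      (eventually_subtype_iff qz).1 ((restrictGerm_eq_zero_iff qz hφ).1 ha)
    change restrictGerm qz (θ (germ q φ)) = 0
    simp only [θ]
    rw [chartField_germ hQs hq (hX' q hq h6.self_of_nhds) hφ]
    refine (restrictGerm_eq_zero_iff qz (fieldOp_mem hQs hq (hX' q hq h6.self_of_nhds) hφ)).2
      ((eventually_subtype_iff (P := fun q' => fieldOp Q (fun v => (D.X i v.1, 0)) φ q' = 0) qz).2 ?_)
    filter_upwards [h1, h2, h6, ha'.eventually_nhds, SmoothSpace.eventually_mem _ _ hφ] with
      q' h8 h9 h10 h11 h12 hq'S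
    obtain ⟨h13, h14⟩ := hQ.slice D.chart hQs h8 h12
    obtain ⟨h15, h16⟩ := hQ q' h8
    have hr : restrictGerm (⟨phatS q', hq'S⟩ : Shat)
        (germ (phatS q') fun ξ => φ (Q.symm (D.κ ξ, (Q q').2))) = 0 := by
      refine (restrictGerm_eq_zero_iff (⟨phatS q', hq'S⟩ : Shat) h13).2
        ((eventually_subtype_iff (P := fun ξ => φ (Q.symm (D.κ ξ, (Q q').2)) = 0)
          (⟨phatS q', hq'S⟩ : Shat)).2 ?_)
      have hc : ContinuousAt (fun ξ => (D.κ ξ, (Q q').2)) (phatS q') :=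
        (D.κ.continuousAt h15).prodMk continuousAt_const
      have he : (D.κ (phatS q'), (Q q').2) = Q q' := by rw [← h16]
      have hc' : Tendsto (fun ξ => (D.κ ξ, (Q q').2)) (𝓝 (phatS q')) (𝓝 (Q q')) := by
        rw [← he]
        exact hc
      filter_upwards [hc'.eventually (eventually_symm h8 h11),
        hc'.eventually (Q.open_target.mem_nhds (Q.map_source h8)), eventually_left_inv h15]
        with ξ h17 h18 h19 hξ
      refine h17 ?_
      change phatS (Q.symm (D.κ ξ, (Q q').2)) ∈ Shat
      rw [(hQ.apply_symm h18).2]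
      change D.κ.symm (D.κ ξ) ∈ Shat
      rwa [h19.2]
    have h17 := h9 hq'S _ hr
    rw [chartField_germ D.chart h15 h10 h13] at h17
    have h18 := ((restrictGerm_eq_zero_iff (⟨phatS q', hq'S⟩ : Shat)
      (fieldOp_mem D.chart h15 h10 h13)).1 h17).self_of_nhds
    rw [← h14 (D.X i)]
    exact h18
  have hu : u ∈ vertical q := by
    intro r
    obtain ⟨φ, hφ, rfl⟩ := exists_germ r
    rw [pullHat, pullback_germ _ _ _ hφ]
    simp only [u]
    rw [hQ.chartField_comp isSmoothMap_phatS D.chart hQs (X := fun _ => 0) (fun _ => rfl) hq ht hφ]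
    have h8 : fieldOp D.κ (fun _ => 0) φ ∘ phatS = fun _ : ZS S => (0 : ℂ) := by
      funext q'
      simp [fieldOp]
    rw [h8, germ_const_zero]
  have hcurv := hF qz wl θ hθ u hu
  rw [curvature_eq_of_dualLift (z := q) h3 h4 wl θ hu] at hcurv
  have hθw : ∀ j, θ (germ q (dualFun D.w j ∘ phatS)) = germ q (D.C i j ∘ phatS) := by
    intro j
    have h8 := h5 j
    have h15 := (hQ q hq).1
    rw [chartField_germ D.chart h15 h6.self_of_nhds (h4.mem j)] at h8
    simp only [θ]
    rw [hQ.chartField_comp isSmoothMap_phatS D.chart hQs (fun _ => rfl) hq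
      (hX' q hq h6.self_of_nhds) (h4.mem j), ← pullback_germ isSmoothMap_phatS q rfl (h7 j), ← h8,
      pullback_germ isSmoothMap_phatS q rfl (fieldOp_mem D.chart h15 h6.self_of_nhds (h4.mem j))]
  have huy : ∀ j, u (germ q (angleFun y j)) = germ q (fieldOp Q (fun _ => (0, t)) (angleFun y j)) :=
    fun j => chartField_germ hQs hq ht (h3.mem j)
  have hCm : ∀ j, D.C i j ∘ phatS ∈ smoothNear q := fun j => isSmoothMap_phatS.comp_mem q _ (h7 j)
  have hym : ∀ j, fieldOp Q (fun _ => (0, t)) (angleFun y j) ∈ smoothNear q :=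
    fun j => fieldOp_mem hQs hq ht (h3.mem j)
  have hm : ∀ j, (D.C i j ∘ phatS) * ((fun _ => (2 * Real.pi * Complex.I : ℂ)) *
      fieldOp Q (fun _ => (0, t)) (angleFun y j)) ∈ smoothNear q := fun j =>
    mul_mem (hCm j) (mul_mem (const_mem _) (hym j))
  have h8 : ∀ j, germ q (D.C i j ∘ phatS) * (algebraMap ℂ _ (2 * Real.pi * Complex.I) *
      germ q (fieldOp Q (fun _ => (0, t)) (angleFun y j))) = germ q ((D.C i j ∘ phatS) *
      ((fun _ => (2 * Real.pi * Complex.I : ℂ)) * fieldOp Q (fun _ => (0, t)) (angleFun y j))) := by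
    intro j
    rw [germ_mul (hCm j) (mul_mem (const_mem _) (hym j)), germ_mul (const_mem _) (hym j), germ_const]
  simp only [hθw, huy, h8] at hcurv
  rw [← germ_sum _ hm] at hcurv
  have h9 := ((restrictGerm_eq_zero_iff qz (sum_mem fun j _ => hm j)).1 hcurv).self_of_nhds
  simp only [Finset.sum_apply, Pi.mul_apply, Function.comp_apply, fieldOp, qz] at h9
  have h10 : (2 * Real.pi * Complex.I : ℂ) ≠ 0 := Complex.two_pi_I_ne_zero
  refine mul_left_cancel₀ h10 ?_
  rw [mul_zero, ← h9, Finset.mul_sum]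
  exact Finset.sum_congr rfl fun j _ => by ring

/-- The sum of the angle coordinates, weighted by the derivatives of the dual coordinates, is
locally constant along the fibres over `Shat`. -/
theorem sum_sub_eq_zero (hsub : IsSubmersion (isSmoothMap_phatS (S := S)))
    (hF : CurvatureVanishes Shat) (i : Fin D.n) {p : ZS S} (hpξ : phatS p = ξ₀.1)
    {y : ZS S → Model g} (hy : AngleLift D.e p y) :
    ∀ᶠ x in 𝓝 p ×ˢ 𝓝 p, phatS x.1 = phatS x.2 → phatS x.1 ∈ Shat →
      ∑ j, D.C i j (phatS x.1) * (angleFun y j x.1 - angleFun y j x.2) = 0 := by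
  obtain ⟨M, K, Q, hQs, hp, hQ'⟩ := exists_product_chart hsub p D.chart (hpξ ▸ D.mem)
  have hQ : IsProductChart phatS D.κ Q := hQ'
  have hsrc : ∀ᶠ q in 𝓝 p, q ∈ Q.source := Q.open_source.mem_nhds hp
  have h1 : ∀ᶠ q in 𝓝 p, ∀ j, ContDiffAt ℝ ∞ (angleFun y j ∘ Q.symm) (Q q) :=
    eventually_all.2 fun j => eventually_apply hp ((hQs p hp _).1 (hy.mem j))
  have h2 : ∀ᶠ v in 𝓝 (Q p), v ∈ Q.target := Q.open_target.mem_nhds (Q.map_source hp)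
  obtain ⟨ε, hε, hball⟩ := Metric.eventually_nhds_iff_ball.1 (h2.and
    (eventually_symm hp (h1.and (D.sum_fderiv_eq_zero hF i hQs hQ hp hpξ hy))))
  have h3 : ∀ᶠ q in 𝓝 p, q ∈ Q.source ∧ Q q ∈ ball (Q p) ε :=
    hsrc.and (eventually_apply hp (ball_mem_nhds _ hε))
  filter_upwards [h3.prod_mk h3] with x hx heq hS
  obtain ⟨⟨h4, h5⟩, h6, h7⟩ := hx
  have h8 : (Q x.2).1 = (Q x.1).1 := by rw [(hQ _ h6).2, (hQ _ h4).2, heq]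
  rw [← ball_prod_same] at h5 h7 hball
  -- In the product chart the relevant part of the fibre is a ball of `K`. Over `Shat` the
  -- derivative of `G` vanishes on it, and a ball is connected.
  let G : K → ℂ := fun t => ∑ j, D.C i j (phatS x.1) * (angleFun y j ∘ Q.symm) ((Q x.1).1, t)
  have hG : ∀ t ∈ ball (Q p).2 ε, HasFDerivAt G (0 : K →L[ℝ] ℂ) t := by
    intro t ht
    obtain ⟨h9, h10, h11⟩ := hball ((Q x.1).1, t) ⟨h5.1, ht⟩
    rw [Q.right_inv h9] at h10 h11
    have h12 : phatS (Q.symm ((Q x.1).1, t)) = phatS x.1 := by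
      rw [(hQ.apply_symm h9).2]
      change D.κ.symm (Q x.1).1 = _
      rw [(hQ _ h4).2, D.κ.left_inv (hQ _ h4).1]
    rw [h12] at h11
    have h13 : HasFDerivAt G (∑ j, D.C i j (phatS x.1) •
        (fderiv ℝ (angleFun y j ∘ Q.symm) ((Q x.1).1, t)).comp
          (ContinuousLinearMap.inr ℝ (Fin D.N → ℝ) K)) t := by
      refine HasFDerivAt.fun_sum fun j _ => HasFDerivAt.const_mul ?_ _
      exact ((h10 j).differentiableAt (by simp)).hasFDerivAt.comp t
        (hasFDerivAt_prodMk_right (𝕜 := ℝ) (Q x.1).1 t)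
    have h14 : (∑ j, D.C i j (phatS x.1) •
        (fderiv ℝ (angleFun y j ∘ Q.symm) ((Q x.1).1, t)).comp
          (ContinuousLinearMap.inr ℝ (Fin D.N → ℝ) K)) = 0 := by
      ext τ
      rw [sum_apply]
      exact h11 hS τ
    rwa [h14] at h13
  have h9 := isOpen_ball.is_const_of_fderiv_eq_zero (𝕜 := ℝ) (f := G)
    (convex_ball (Q p).2 ε).isPreconnected (fun t ht => (hG t ht).differentiableAt.differentiableWithinAt)
    (fun t ht => (hG t ht).fderiv) h5.2 h7.2
  have h10 : Q.symm ((Q x.1).1, (Q x.1).2) = x.1 := Q.left_inv h4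
  have h11 : Q.symm ((Q x.1).1, (Q x.2).2) = x.2 := by
    rw [← h8]
    exact Q.left_inv h6
  simp only [G, Function.comp_apply, h10, h11] at h9
  simp only [mul_sub, Finset.sum_sub_distrib]
  rw [h9, sub_self]

end BaseData

end Constancy

end FourierMukai

end

noncomputable section

namespace FourierMukai

open Filter Metric LagrangianLattice

set_option linter.unusedSectionVars false

/-! ### Gluing germs of functions along a compact set. -/

section Gluing

variable {Y : Type*} [SmoothSpace Y] [HasCharts Y] [T2Space Y]

lemma exists_closed_subset {y : Y} {O : Set Y} (hO : O ∈ 𝓝 y) :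
    ∃ F, IsClosed F ∧ F ∈ 𝓝 y ∧ F ⊆ O := by
  obtain ⟨N, κ, -, hs⟩ := HasCharts.exists_chart y
  obtain ⟨ε, hε, hball⟩ := Metric.nhds_basis_closedBall.eventually_iff.1
    ((eventually_right_inv hs).and (eventually_symm hs hO))
  refine ⟨κ.symm '' closedBall (κ y) ε, ?_, ?_, ?_⟩
  · exact ((isCompact_closedBall _ _).image_of_continuousOn
      (κ.continuousOn_symm.mono fun x hx => (hball hx).1.1)).isClosed
  · filter_upwards [eventually_apply hs (closedBall_mem_nhds _ hε), eventually_left_inv hs] with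
      q h1 h2
    exact ⟨κ q, h1, h2.2⟩
  · rintro _ ⟨x, hx, rfl⟩
    exact (hball hx).2

/-- Germs of functions along a compact set that are locally induced by functions are induced by a
single function. -/
theorem exists_glue {K : Set Y} (hK : IsCompact K) {P : (Y → ℂ) → Y → Prop}
    (hcongr : ∀ m m' p, P m p → m =ᶠ[𝓝 p] m' → P m' p)
    (hloc : ∀ z ∈ K, ∃ m, ∀ᶠ p in 𝓝 z, P m p)
    (huniq : ∀ m m', ∀ p ∈ K, P m p → P m' p → m =ᶠ[𝓝 p] m') : ∃ m, ∀ p ∈ K, P m p := by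
  classical
  choose! m hm using hloc
  have hF : ∀ z ∈ K, ∃ F, IsClosed F ∧ F ∈ 𝓝 z ∧ F ⊆ {p | P (m z) p} := fun z hz =>
    exists_closed_subset (hm z hz)
  choose! F hFc hFn hFP using hF
  obtain ⟨t, htK, htc⟩ := hK.elim_nhds_subcover (fun z => interior (F z)) fun z hz =>
    interior_mem_nhds.2 (hFn z hz)
  -- Any member of the finite cover may be chosen at `q`. The sets `F z` being closed, near a point
  -- `p` of `K` only those containing `p` are met, and the corresponding functions all agree near
  -- `p`.
  let f : Y → ℂ := fun q => if h : ∃ z ∈ t, q ∈ F z then m h.choose q else 0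
  refine ⟨f, fun p hp => ?_⟩
  obtain ⟨z₀, hz₀, hpi⟩ := Set.mem_iUnion₂.1 (htc hp)
  have hpz₀ := interior_subset hpi
  refine hcongr _ _ _ (hFP z₀ (htK _ hz₀) hpz₀) ?_
  have h1 : ∀ᶠ q in 𝓝 p, ∀ z ∈ t, q ∈ F z → p ∈ F z := by
    refine (eventually_all_finset t).2 fun z hz => ?_
    by_cases h : p ∈ F z
    · exact Eventually.of_forall fun _ _ => h
    · filter_upwards [(hFc z (htK _ hz)).isOpen_compl.mem_nhds h] with q hq hq'
      exact absurd hq' hq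
  have h2 : ∀ᶠ q in 𝓝 p, ∀ z ∈ t, p ∈ F z → m z q = m z₀ q := by
    refine (eventually_all_finset t).2 fun z hz => ?_
    by_cases h : p ∈ F z
    · filter_upwards [huniq _ _ p hp (hFP z (htK _ hz) h) (hFP z₀ (htK _ hz₀) hpz₀)] with q hq _
      exact hq
    · exact Eventually.of_forall fun _ h' => absurd h' h
  have h3 : ∀ᶠ q in 𝓝 p, ∃ z ∈ t, q ∈ F z := by
    filter_upwards [mem_interior_iff_mem_nhds.1 hpi] with q hq
    exact ⟨z₀, hz₀, hq⟩
  filter_upwards [h1, h2, h3] with q h4 h5 h6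
  simp only [f, dif_pos h6]
  exact (h5 _ h6.choose_spec.1 (h4 _ h6.choose_spec.1 h6.choose_spec.2)).symm

end Gluing

/-! ### Fibrewise primitives of the contracted curvature. -/

section Primitive

variable {g : ℕ} {B : Type*} [TopologicalSpace B] [ChartedSpace (Model g) B]
  {L : LagrangianLattice g B} {S : Set L.X} {Shat : Set (XhatS S)}
  [IsManifold 𝓘(ℝ, Model g) ∞ B] [HasCharts (ZS S)] [HasCharts (XhatS S)] [HasCharts Shat]

namespace BaseData

variable {ξ₀ : Shat} (D : BaseData Shat ξ₀)

lemma ret_self : D.ret ξ₀.1 = ξ₀.1 := D.ret_eq.self_of_nhds ξ₀.2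

lemma tendsto_ret : Tendsto D.ret (𝓝 ξ₀.1) (𝓝 ξ₀.1) := by
  have := D.ret_continuousAt
  rwa [ContinuousAt, D.ret_self] at this

/-- Through every point over `ξ₀` there is a smooth lift of the retraction to `Shat`. -/
lemma exists_lift_ret (hsub : IsSubmersion (isSmoothMap_phatS (S := S))) {z : ZS S}
    (hz : phatS z = ξ₀.1) : ∃ σ : XhatS S → ZS S, Tendsto σ (𝓝 ξ₀.1) (𝓝 z) ∧
      (∀ᶠ ξ in 𝓝 ξ₀.1, phatS (σ ξ) = D.ret ξ) ∧ ∀ φ ∈ smoothNear z, φ ∘ σ ∈ smoothNear ξ₀.1 := by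
  obtain ⟨M, K, Q, hQs, hzQ, hQ'⟩ := exists_product_chart hsub z D.chart (hz ▸ D.mem)
  have hQ : IsProductChart phatS D.κ Q := hQ'
  have h1 : (D.κ (D.ret ξ₀.1), (Q z).2) = Q z := by
    rw [D.ret_self, ← hz, ← (hQ z hzQ).2]
  have h2 : Tendsto (fun ξ => (D.κ (D.ret ξ), (Q z).2)) (𝓝 ξ₀.1) (𝓝 (Q z)) := by
    rw [← h1]
    refine (Tendsto.prodMk_nhds ?_ tendsto_const_nhds)
    rw [D.ret_self]
    exact (D.κ.continuousAt D.mem).tendsto.comp D.tendsto_ret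
  refine ⟨fun ξ => Q.symm (D.κ (D.ret ξ), (Q z).2), ?_, ?_, fun φ hφ => ?_⟩
  · have h3 := (Q.continuousAt_symm (Q.map_source hzQ)).tendsto
    rw [Q.left_inv hzQ] at h3
    exact h3.comp h2
  · filter_upwards [h2.eventually (Q.open_target.mem_nhds (Q.map_source hzQ)),
      D.tendsto_ret.eventually (eventually_left_inv D.mem)] with ξ h3 h4
    rw [(hQ.apply_symm h3).2]
    exact h4.2
  · have h3 : SmoothNear (Q z) (φ ∘ Q.symm) := (hQs z hzQ φ).1 hφ
    rw [← h1] at h3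
    exact D.ret_smooth.comp_mem (Φ := fun x => (φ ∘ Q.symm) (x, (Q z).2))
      (SmoothNear.comp (k := fun x => (x, (Q z).2)) h3
        (Eventually.of_forall fun x => contDiffAt_id.prodMk contDiffAt_const))

/-- The function `m` is, near `p`, the primitive of the curvature in the direction of the `i`-th
vector field that vanishes over `Shat`. -/
def IsPrimitive (i : Fin D.n) (m : ZS S → ℂ) (p : ZS S) : Prop :=
  -- Every branch `y` and every reference point near `p` over the retraction are admitted. The germ
  -- of `m` at such a `p` over the base point is thereby unique, and existence carries the content.
  ∀ y, AngleLift D.e p y → ∀ᶠ x in 𝓝 p ×ˢ 𝓝 p, phatS x.2 = D.ret (phatS x.1) →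
    m x.1 = 2 * Real.pi * Complex.I *
      ∑ j, D.C i j (phatS x.1) * (angleFun y j x.1 - angleFun y j x.2)

variable {D} {i : Fin D.n}

lemma IsPrimitive.congr {m m' : ZS S → ℂ} {p : ZS S} (hm : D.IsPrimitive i m p)
    (h : m =ᶠ[𝓝 p] m') : D.IsPrimitive i m' p := by
  intro y hy
  filter_upwards [hm y hy, tendsto_fst.eventually h] with x h1 h2 h3
  rw [← h2, h1 h3]

lemma base_mem {p : ZS S} (hp : phatS p = ξ₀.1) : p.1.base ∈ D.e.1.source := by
  have h1 := D.dual.eq.self_of_nhds.1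
  rw [← hp] at h1
  exact h1

lemma IsPrimitive.eventuallyEq {m : ZS S → ℂ} {p : ZS S} (hm : D.IsPrimitive i m p)
    {y : ZS S → Model g} (hy : AngleLift D.e p y) (hp : phatS p = ξ₀.1)
    {σ : XhatS S → ZS S} (h1 : Tendsto σ (𝓝 ξ₀.1) (𝓝 p))
    (h2 : ∀ᶠ ξ in 𝓝 ξ₀.1, phatS (σ ξ) = D.ret ξ) :
    m =ᶠ[𝓝 p] fun q => 2 * Real.pi * Complex.I *
      ∑ j, D.C i j (phatS q) * (angleFun y j q - angleFun y j (σ (phatS q))) := by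
  have hph : Tendsto phatS (𝓝 p) (𝓝 ξ₀.1) := hp ▸ isSmoothMap_phatS.continuous.continuousAt
  have h3 : Tendsto (fun q => (q, σ (phatS q))) (𝓝 p) (𝓝 p ×ˢ 𝓝 p) :=
    tendsto_id.prodMk (h1.comp hph)
  filter_upwards [h3.eventually (hm y hy), hph.eventually h2] with q h4 h5
  exact h4 h5

/-- A smooth lift of the retraction through `p` provides a reference point for every nearby point;
both functions are then given by the same formula. -/
lemma IsPrimitive.unique (hsub : IsSubmersion (isSmoothMap_phatS (S := S))) {m m' : ZS S → ℂ}
    {p : ZS S} (hp : phatS p = ξ₀.1) (hm : D.IsPrimitive i m p) (hm' : D.IsPrimitive i m' p) :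
    m =ᶠ[𝓝 p] m' := by
  obtain ⟨y, hy⟩ := exists_angleLift D.e p (base_mem hp)
  obtain ⟨σ, h1, h2, -⟩ := D.exists_lift_ret hsub hp
  exact (hm.eventuallyEq hy hp h1 h2).trans (hm'.eventuallyEq hy hp h1 h2).symm

/-- The formula is taken with the lift `σ` of the retraction as reference point. Another reference
point lies in the same fibre over `Shat` and changes the sum by an expression that vanishes by
`sum_sub_eq_zero`; that lemma evaluates the coefficients on `Shat`, and their invariance under the
retraction brings them to the given point. Another branch of `y` differs by a constant, which
cancels. -/
lemma exists_isPrimitive_nhds (hsub : IsSubmersion (isSmoothMap_phatS (S := S)))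
    (hF : CurvatureVanishes Shat) {z : ZS S} (hz : phatS z = ξ₀.1) :
    ∃ m, ∀ᶠ p in 𝓝 z, D.IsPrimitive i m p := by
  obtain ⟨y, hy⟩ := exists_angleLift D.e z (base_mem hz)
  obtain ⟨σ, h1, h2, -⟩ := D.exists_lift_ret hsub hz
  refine ⟨fun q => 2 * Real.pi * Complex.I *
      ∑ j, D.C i j (phatS q) * (angleFun y j q - angleFun y j (σ (phatS q))), ?_⟩
  have hph : Tendsto phatS (𝓝 z) (𝓝 ξ₀.1) := hz ▸ isSmoothMap_phatS.continuous.continuousAt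
  have h3 : Tendsto (fun x : ZS S × ZS S => (x.2, σ (phatS x.1))) (𝓝 z ×ˢ 𝓝 z) (𝓝 z ×ˢ 𝓝 z) :=
    tendsto_snd.prodMk ((h1.comp hph).comp tendsto_fst)
  have h4 : ∀ᶠ x in 𝓝 z ×ˢ 𝓝 z, phatS x.2 = D.ret (phatS x.1) →
      ∑ j, D.C i j (phatS x.1) * (angleFun y j x.2 - angleFun y j (σ (phatS x.1))) = 0 := by
    filter_upwards [h3.eventually (D.sum_sub_eq_zero hsub hF i hz hy),
      tendsto_fst.eventually (hph.eventually h2),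
      tendsto_fst.eventually (hph.eventually (eventually_all.2 (D.C_ret i)))] with x h5 h6 h7 h8
    rw [← h5 (h8.trans h6.symm) (h8 ▸ D.ret_mem _)]
    exact Finset.sum_congr rfl fun j _ => by rw [h8, h7 j]
  have h5 : ∀ᶠ p in 𝓝 z, ∀ᶠ x in 𝓝 p ×ˢ 𝓝 p, phatS x.2 = D.ret (phatS x.1) →
      ∑ j, D.C i j (phatS x.1) * (angleFun y j x.2 - angleFun y j (σ (phatS x.1))) = 0 := by
    rw [← nhds_prod_eq] at h4
    have h6 : Tendsto (fun p : ZS S => (p, p)) (𝓝 z) (𝓝 (z, z)) :=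
      (continuous_id.prodMk continuous_id).continuousAt
    filter_upwards [h6.eventually h4.eventually_nhds] with p hp
    rwa [← nhds_prod_eq]
  filter_upwards [h5, hy.eventually] with p h6 h7 y' hy'
  have h8 := hy'.sub_eventually_const h7
  filter_upwards [h6, tendsto_fst.eventually h8, tendsto_snd.eventually h8] with x h9 h10 h11 h12
  have h13 : ∀ j, angleFun y' j x.1 - angleFun y' j x.2 = angleFun y j x.1 - angleFun y j x.2 := by
    intro j
    have h14 : y' x.1 j - y' x.2 j = y x.1 j - y x.2 j := by
      have h15 := congrFun (h10.trans h11.symm) j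
      simp only [Pi.sub_apply] at h15
      linarith
    simp only [angleFun]
    exact_mod_cast h14
  congr 1
  rw [← sub_eq_zero, ← Finset.sum_sub_distrib, ← h9 h12]
  refine Finset.sum_congr rfl fun j _ => ?_
  rw [h13 j]
  ring

/-- The properties of a primitive near a point over `ξ₀`. -/
theorem IsPrimitive.eventually (hsub : IsSubmersion (isSmoothMap_phatS (S := S))) (h : Splitting S)
    {m : ZS S → ℂ} {p : ZS S} (hp : phatS p = ξ₀.1) (hm : D.IsPrimitive i m p) :
    ∀ᶠ q in 𝓝 p, m ∈ smoothNear q ∧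
      (∀ u ∈ vertical q, ∀ wl, u (germ q m) =
        curvature q wl (h.lift q (chartField D.κ (D.X i) (phatS q))) u) ∧
      ∀ hq : phatS q ∈ Shat, germ q m ∈ vanishingIdeal (⟨q, hq⟩ : ZSS Shat) := by
  obtain ⟨y, hy⟩ := exists_angleLift D.e p (base_mem hp)
  obtain ⟨σ, h1, h2, h3⟩ := D.exists_lift_ret hsub hp
  have hph : Tendsto phatS (𝓝 p) (𝓝 ξ₀.1) := hp ▸ isSmoothMap_phatS.continuous.continuousAt
  have h4 := hm.eventuallyEq hy hp h1 h2
  have hdiag : Tendsto (fun q : ZS S => (q, q)) (𝓝 p) (𝓝 p ×ˢ 𝓝 p) := tendsto_id.prodMk tendsto_id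
  -- Over `Shat` the retraction is the identity, so a point can serve as its own reference point.
  have h5 : ∀ᶠ q in 𝓝 p, phatS q ∈ Shat → m q = 0 := by
    filter_upwards [hdiag.eventually (hm y hy), hph.eventually D.ret_eq] with q h5 h6 h7
    rw [h5 (h6 h7).symm]
    simp
  filter_upwards [h4.eventually_nhds, h5.eventually_nhds, hy.eventually,
    hph.eventually D.dual.eventually, hph.eventually (eventually_all.2 (D.der_dual i)),
    hph.eventually (eventually_all.2 fun j => SmoothSpace.eventually_mem _ _ (D.C_mem i j)),
    hph.eventually (eventually_all.2 fun j => SmoothSpace.eventually_mem _ _ (h3 _ (hy.mem j)))]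
    with q h6 h7 h8 h9 h10 h11 h12
  have hC : ∀ j, D.C i j ∘ phatS ∈ smoothNear q := fun j => isSmoothMap_phatS.comp_mem q _ (h11 j)
  have hσ : ∀ j, (angleFun y j ∘ σ) ∘ phatS ∈ smoothNear q := fun j =>
    isSmoothMap_phatS.comp_mem q _ (h12 j)
  have hj : ∀ j, (D.C i j ∘ phatS) * (angleFun y j - (angleFun y j ∘ σ) ∘ phatS) ∈ smoothNear q :=
    fun j => mul_mem (hC j) (sub_mem (h8.mem j) (hσ j))
  have h13 : m =ᶠ[𝓝 q] (fun _ => (2 * Real.pi * Complex.I : ℂ)) *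
      ∑ j, (D.C i j ∘ phatS) * (angleFun y j - (angleFun y j ∘ σ) ∘ phatS) := by
    filter_upwards [h6] with q' hq'
    rw [hq']
    simp
  have h14 := mul_mem (const_mem (y := q) (2 * Real.pi * Complex.I : ℂ))
    (sum_mem (t := Finset.univ) fun j _ => hj j)
  have h15 : m ∈ smoothNear q := mem_of_eventuallyEq h14 h13.symm
  refine ⟨h15, fun u hu wl => ?_, fun hq => ?_⟩
  -- The coefficients `C i j` and the reference values of `y_j` come from the base, so a vertical
  -- field kills them. What remains is `2πi ∑ C_ij u(y_j)`, the contraction of the curvature.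
  · have h16 : ∀ j, u (germ q (D.C i j ∘ phatS)) = 0 := fun j => by
      rw [← pullback_germ isSmoothMap_phatS q rfl (h11 j)]
      exact hu _
    have h17 : ∀ j, u (germ q ((angleFun y j ∘ σ) ∘ phatS)) = 0 := fun j => by
      rw [← pullback_germ isSmoothMap_phatS q rfl (h12 j)]
      exact hu _
    rw [curvature_eq_of_dualLift (z := q) h8 h9 wl _ hu, germ_congr h13,
      germ_mul (const_mem _) (sum_mem fun j _ => hj j), germ_const, germ_sum _ hj,
      Derivation.leibniz, Derivation.map_algebraMap, smul_zero, add_zero, map_sum, smul_eq_mul,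
      Finset.mul_sum]
    refine Finset.sum_congr rfl fun j _ => ?_
    rw [germ_mul (hC j) (sub_mem (h8.mem j) (hσ j)), germ_sub (h8.mem j) (hσ j), Derivation.leibniz,
      h16, map_sub, h17, ← pullback_germ isSmoothMap_phatS q rfl (h9.mem j), h.lift_apply, h10 j,
      pullback_germ isSmoothMap_phatS q rfl (h11 j)]
    simp only [smul_eq_mul]
    ring
  · refine (restrictGerm_eq_zero_iff (⟨q, hq⟩ : ZSS Shat) h15).2
      ((eventually_subtype_iff (P := fun q' => m q' = 0) (⟨q, hq⟩ : ZSS Shat)).2 ?_)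
    exact h7

/-- Local existence, uniqueness of germs and compactness of the fibre allow gluing, although the
angle coordinates are in general not single-valued along the fibre. -/
theorem exists_isPrimitive [T2Space B] (hS : L.plotsX.IsClosedSubmanifold S)
    (hsub : IsSubmersion (isSmoothMap_phatS (S := S))) (hF : CurvatureVanishes Shat) :
    ∃ m, ∀ p, phatS p = ξ₀.1 → D.IsPrimitive i m p :=
  exists_glue (isCompact_fibre hS ξ₀.1) (fun _ _ _ h1 h2 => h1.congr h2)
    (fun _ hz => exists_isPrimitive_nhds hsub hF hz)
    (fun _ _ _ hp h1 h2 => IsPrimitive.unique hsub hp h1 h2)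

end BaseData

/-- Local data from which a connection is built near `ξ₀`: vector fields that restrict to a frame of
`Shat`, with the dual functions on `Shat`, and primitives of the contractions of their lifts with
the curvature, vanishing over `Shat`. -/
structure LocalData (h : Splitting S) (Shat : Set (XhatS S)) (ξ₀ : Shat) where
  U : Set (XhatS S)
  isOpen : IsOpen U
  mem : ξ₀.1 ∈ U
  n : ℕ
  V : Fin n → ∀ ξ : XhatS S, Der ξ
  field : ∀ i, ∀ ξ ∈ U, IsVectorFieldNear (V i) ξ
  m : Fin n → ZS S → ℂ
  m_mem : ∀ i z, phatS z ∈ U → m i ∈ smoothNear z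
  der_m : ∀ i z, phatS z ∈ U → ∀ u ∈ vertical z, ∀ wl,
    u (germ z (m i)) = curvature z wl (h.lift z (V i (phatS z))) u
  vanish : ∀ i (z : ZSS Shat), phatS z.1 ∈ U → germ z.1 (m i) ∈ vanishingIdeal z
  s : Fin n → Shat → ℂ
  s_mem : ∀ i (ξ : Shat), ξ.1 ∈ U → s i ∈ smoothNear ξ
  der_restrict : ∀ ξ : Shat, ξ.1 ∈ U → ∀ (v : Der ξ) (r : SGerm ξ.1), v (restrictGerm ξ r) =
    ∑ i, v (germ ξ (s i)) * restrictGerm ξ (V i ξ.1 r)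

/-- The properties of the primitives hold near each point of the fibre over `ξ₀`, hence by the tube
lemma over a neighbourhood of `ξ₀`. -/
theorem exists_localData [T2Space B] (hS : L.plotsX.IsClosedSubmanifold S)
    (hsub : IsSubmersion (isSmoothMap_phatS (S := S))) (hF : CurvatureVanishes Shat)
    (h : Splitting S) (ξ₀ : Shat) : Nonempty (LocalData h Shat ξ₀) := by
  obtain ⟨D⟩ := exists_baseData ξ₀
  choose m hm using fun i => BaseData.exists_isPrimitive (D := D) (i := i) hS hsub hF
  have h1 : ∀ p, phatS p = ξ₀.1 → ∀ᶠ q in 𝓝 p, ∀ i, m i ∈ smoothNear q ∧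
      (∀ u ∈ vertical q, ∀ wl, u (germ q (m i)) =
        curvature q wl (h.lift q (chartField D.κ (D.X i) (phatS q))) u) ∧
      ∀ hq : phatS q ∈ Shat, germ q (m i) ∈ vanishingIdeal (⟨q, hq⟩ : ZSS Shat) := fun p hp =>
    eventually_all.2 fun i => (hm i p hp).eventually hsub h hp
  obtain ⟨U₁, hU₁, hξ₁, h2⟩ := exists_tube hS isOpen_interior fun z hz =>
    mem_interior_iff_mem_nhds.2 (h1 z hz)
  have h3 : ∀ᶠ ξ in 𝓝 ξ₀.1, ∀ i, IsVectorFieldNear (chartField D.κ (D.X i)) ξ := by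
    filter_upwards [D.κ.open_source.mem_nhds D.mem, eventually_all.2 fun i =>
      eventually_apply D.mem (D.smooth i).eventually_nhds] with ξ h4 h5 i
    exact isVectorFieldNear_chartField D.chart h4 (h5 i)
  have h4 : ∀ᶠ ξ in 𝓝 ξ₀.1, ∀ hξ : ξ ∈ Shat, (∀ i, D.s i ∈ smoothNear (⟨ξ, hξ⟩ : Shat)) ∧
      ∀ (v : Der (⟨ξ, hξ⟩ : Shat)) (r : SGerm ξ), v (restrictGerm (⟨ξ, hξ⟩ : Shat) r) =
        ∑ i, v (germ (⟨ξ, hξ⟩ : Shat) (D.s i)) *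
          restrictGerm (⟨ξ, hξ⟩ : Shat) (chartField D.κ (D.X i) ξ r) := by
    have h5 := (eventually_all.2 fun i => SmoothSpace.eventually_mem _ _ (D.s_mem i)).and
      D.der_restrict
    rw [nhds_subtype_eq_comap, eventually_comap] at h5
    filter_upwards [h5] with ξ h6 hξ
    exact h6 ⟨ξ, hξ⟩ rfl
  obtain ⟨U₂, h5, hU₂, hξ₂⟩ := _root_.eventually_nhds_iff.1 (h3.and h4)
  have h6 : ∀ z, phatS z ∈ U₁ ∩ U₂ → _ := fun z hz => interior_subset (h2 z hz.1)
  exact ⟨{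
    U := U₁ ∩ U₂
    isOpen := hU₁.inter hU₂
    mem := ⟨hξ₁, hξ₂⟩
    n := D.n
    V := fun i => chartField D.κ (D.X i)
    field := fun i ξ hξ => (h5 ξ hξ.2).1 i
    m := m
    m_mem := fun i z hz => (h6 z hz i).1
    der_m := fun i z hz => (h6 z hz i).2.1
    vanish := fun i z hz => (h6 z.1 hz i).2.2 z.2
    s := D.s
    s_mem := fun i ξ hξ => ((h5 ξ.1 hξ.2).2 ξ.2).1 i
    der_restrict := fun ξ hξ => ((h5 ξ.1 hξ.2).2 ξ.2).2 }⟩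

end Primitive

end FourierMukai

end

noncomputable section

namespace FourierMukai

open Filter Metric LagrangianLattice

set_option linter.unusedSectionVars false

/-! ### Local data combined by a partition of unity. -/

section Global

variable {g : ℕ} {B : Type*} [TopologicalSpace B] [ChartedSpace (Model g) B]
  {L : LagrangianLattice g B} {S : Set L.X}

/-- Local data over an open cover of `Shat`, with the functions `f` of a partition of unity; near
`ξ` only the indices in `t ξ` contribute. -/
structure GlobalData (h : Splitting S) (Shat : Set (XhatS S)) (ι : Type*) where
  U : ι → Set (XhatS S)
  isOpen : ∀ k, IsOpen (U k)
  V : ι → ∀ ξ : XhatS S, Der ξ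
  field : ∀ k, ∀ ξ ∈ U k, IsVectorFieldNear (V k) ξ
  m : ι → ZS S → ℂ
  m_mem : ∀ k z, phatS z ∈ U k → m k ∈ smoothNear z
  der_m : ∀ k z, phatS z ∈ U k → ∀ u ∈ vertical z, ∀ wl,
    u (germ z (m k)) = curvature z wl (h.lift z (V k (phatS z))) u
  vanish : ∀ k (z : ZSS Shat), phatS z.1 ∈ U k → germ z.1 (m k) ∈ vanishingIdeal z
  s : ι → Shat → ℂ
  s_mem : ∀ k (ξ : Shat), ξ.1 ∈ U k → s k ∈ smoothNear ξ
  f : ι → XhatS S → ℂ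
  f_mem : ∀ k ξ, f k ∈ smoothNear ξ
  t : Shat → Finset ι
  mem : ∀ ξ, ∀ k ∈ t ξ, ξ.1 ∈ U k
  germ_eq_zero : ∀ (ξ : Shat) k, k ∉ t ξ → germ ξ.1 (f k) = 0
  eventually_subset : ∀ ξ, ∀ᶠ ξ' in 𝓝 ξ, t ξ' ⊆ t ξ
  der_restrict : ∀ (ξ : Shat) (v : Der ξ) (r : SGerm ξ.1), v (restrictGerm ξ r) =
    ∑ k ∈ t ξ, restrictGerm ξ (germ ξ.1 (f k)) * v (germ ξ (s k)) * restrictGerm ξ (V k ξ.1 r)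

variable {Shat : Set (XhatS S)}
  [IsManifold 𝓘(ℝ, Model g) ∞ B] [HasCharts (ZS S)] [HasCharts (XhatS S)] [HasCharts Shat]

theorem exists_globalData [T2Space B] [SecondCountableTopology B]
    (hS : L.plotsX.IsClosedSubmanifold S)
    (hsub : IsSubmersion (isSmoothMap_phatS (S := S)))
    (hShat : L.plotsXhat.IsClosedSubmanifold (Subtype.val '' Shat)) (hF : CurvatureVanishes Shat)
    (h : Splitting S) :
    ∃ n : Shat → ℕ, Nonempty (GlobalData h Shat (Σ a : Shat, Fin (n a))) := by
  have D : ∀ ξ : Shat, LocalData h Shat ξ := fun ξ => (exists_localData hS hsub hF h ξ).some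
  obtain ⟨f, hf, hlf, hsum, hsupp⟩ := exists_partition_Shat hShat (fun a => (D a).U)
    (fun a => (D a).isOpen) (fun a => (D a).mem)
  -- Closed supports are used: outside the resulting index set the functions have germ zero, not
  -- only value zero, and nearby the index set can only shrink.
  have hfin : ∀ ξ : XhatS S, {a | ξ ∈ tsupport (f a)}.Finite := hlf.closure.point_finite
  let t₀ : Shat → Finset Shat := fun ξ => (hfin ξ.1).toFinset
  have ht₀ : ∀ ξ a, a ∈ t₀ ξ ↔ ξ.1 ∈ tsupport (f a) := fun ξ a => (hfin ξ.1).mem_toFinset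
  have hev : ∀ ξ, ∀ᶠ ξ' in 𝓝 ξ, t₀ ξ' ⊆ t₀ ξ := by
    intro ξ
    filter_upwards [continuous_subtype_val.continuousAt.eventually
      (hlf.closure.eventually_subset (fun _ => isClosed_closure) ξ.1)] with ξ' h1 a ha
    exact (ht₀ ξ a).2 (h1 ((ht₀ ξ' a).1 ha))
  have hone : ∀ ξ : Shat, ∑ a ∈ t₀ ξ, restrictGerm ξ (germ ξ.1 (f a)) = 1 := by
    intro ξ
    have h1 : ∀ a, restrictGerm ξ (germ ξ.1 (f a)) = germ ξ (f a ∘ Subtype.val) := fun a =>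
      restrictGerm_germ ξ (hf a ξ.1)
    simp only [h1]
    rw [← germ_sum _ (fun a => (isSmoothMap_val Shat).comp_mem ξ _ (hf a ξ.1)), ← germ_const_one]
    refine germ_congr ?_
    filter_upwards [hev ξ] with ξ' h2
    rw [Finset.sum_apply, ← hsum ξ'.1 ξ'.2]
    refine (finsum_eq_sum_of_support_subset _ fun a ha => ?_).symm
    exact h2 ((ht₀ ξ' a).2 (subset_tsupport _ ha))
  exact ⟨fun a => (D a).n, ⟨{
    U := fun k => (D k.1).U
    isOpen := fun k => (D k.1).isOpen
    V := fun k => (D k.1).V k.2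
    field := fun k => (D k.1).field k.2
    m := fun k => (D k.1).m k.2
    m_mem := fun k => (D k.1).m_mem k.2
    der_m := fun k => (D k.1).der_m k.2
    vanish := fun k => (D k.1).vanish k.2
    s := fun k => (D k.1).s k.2
    s_mem := fun k => (D k.1).s_mem k.2
    f := fun k => f k.1
    f_mem := fun k => hf k.1
    t := fun ξ => (t₀ ξ).sigma fun _ => Finset.univ
    mem := fun ξ k hk => hsupp k.1 ((ht₀ ξ k.1).1 (Finset.mem_sigma.1 hk).1)
    germ_eq_zero := by
      intro ξ k hk
      have h1 : ξ.1 ∉ tsupport (f k.1) := fun h2 =>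
        hk (Finset.mem_sigma.2 ⟨(ht₀ ξ k.1).2 h2, Finset.mem_univ _⟩)
      rw [germ_congr (notMem_tsupport_iff_eventuallyEq.1 h1)]
      exact germ_const_zero
    eventually_subset := by
      intro ξ
      filter_upwards [hev ξ] with ξ' h1
      exact Finset.sigma_mono h1 fun _ => subset_rfl
    der_restrict := by
      intro ξ v r
      rw [Finset.sum_sigma, ← one_mul (v _), ← hone ξ, Finset.sum_mul]
      refine Finset.sum_congr rfl fun a ha => ?_
      rw [(D a).der_restrict ξ (hsupp a ((ht₀ ξ a).1 ha)) v r, Finset.mul_sum]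
      exact Finset.sum_congr rfl fun i _ => (mul_assoc _ _ _).symm }⟩⟩

end Global

end FourierMukai

end

noncomputable section

namespace FourierMukai

open Filter Metric LagrangianLattice

set_option linter.unusedSectionVars false

/-! ### Action of the corrected derivative on the higher direct image. -/

section Cohomology

variable {g : ℕ} {B : Type*} [TopologicalSpace B] [ChartedSpace (Model g) B]
  {L : LagrangianLattice g B} {S : Set L.X} {E : FlatModule S}
  [IsManifold 𝓘(ℝ, Model g) ∞ B] [HasCharts S] [HasCharts (ZS S)] [HasCharts (XhatS S)]

/-- The corrected complementary derivative along a fibre. -/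
def fibOp (h : Splitting S) (V : ∀ ξ : XhatS S, Der ξ) (m : ZS S → ℂ) (q : ℕ) (ξ : XhatS S) :
    FibCoch E q ξ →+ FibCoch E q ξ :=
  AddMonoidHom.mk' (fun τ z => hatOp h (V (phatS z.1)) (germ z.1 m) (τ z)) fun τ τ' => by
    funext z
    exact hatOp_add h _ _ (τ z) (τ' z)

lemma fibOp_smul (h : Splitting S) (V : ∀ ξ : XhatS S, Der ξ) (m : ZS S → ℂ) {q : ℕ} {ξ : XhatS S}
    (r : SGerm ξ) (τ : FibCoch E q ξ) :
    fibOp h V m q ξ (r • τ) = r • fibOp h V m q ξ τ + V ξ r • τ := by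
  funext z
  obtain ⟨z, rfl⟩ := z
  exact hatOp_smul h _ _ r (τ ⟨z, rfl⟩)

/-- The conditions under which the corrected derivative acts on the complex over `U`. -/
structure IsAdmissible (h : Splitting S) (V : ∀ ξ : XhatS S, Der ξ) (m : ZS S → ℂ)
    (U : Set (XhatS S)) : Prop where
  isOpen : IsOpen U
  field : ∀ ξ ∈ U, IsVectorFieldNear V ξ
  mem : ∀ z, phatS z ∈ U → m ∈ smoothNear z
  der : ∀ z, phatS z ∈ U → ∀ u ∈ vertical z, ∀ wl,
    u (germ z m) = curvature z wl (h.lift z (V (phatS z))) u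

variable {h : Splitting S} {V : ∀ ξ : XhatS S, Der ξ} {m : ZS S → ℂ} {U : Set (XhatS S)}

lemma IsFormAt.map_update_add {q : ℕ} {T : ∀ z : ZS S, Coch E q z} {z : ZS S} (hT : IsFormAt T z)
    (u : Fin q → vertical z) (k : Fin q) (a b : vertical z) : T z (Function.update u k (a + b)) =
      T z (Function.update u k a) + T z (Function.update u k b) := by
  obtain ⟨α, hα⟩ := hT.1
  rw [← hα]
  exact α.map_update_add u k a b

namespace IsAdmissible

lemma isFormOn (hA : IsAdmissible h V m U) {q : ℕ} {T : ∀ z : ZS S, Coch E q z} {U' : Set (XhatS S)} (hT : IsFormOn T U') :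
    IsFormOn (fun z => hatOp h (V (phatS z)) (germ z m) (T z)) (U' ∩ U) := fun z hz =>
  (hT z hz.1).hatOp h (hA.field _ hz.2) (hA.mem z hz.2)

lemma dRel_hatOp (hA : IsAdmissible h V m U) {q : ℕ} {T : ∀ z : ZS S, Coch E q z} {z : ZS S} (hz : phatS z ∈ U)
    (hT : IsFormAt T z) : dRel (hatOp h (V (phatS z)) (germ z m) (T z)) =
      hatOp h (V (phatS z)) (germ z m) (dRel (T z)) :=
  FourierMukai.dRel_hatOp h _ _ (fun u w => hA.der z hz u u.2 w) hT.map_update_add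

lemma isClosedOn (hA : IsAdmissible h V m U) {q : ℕ} {T : ∀ z : ZS S, Coch E q z} {U' : Set (XhatS S)} (hT : IsClosedOn T U') :
    IsClosedOn (fun z => hatOp h (V (phatS z)) (germ z m) (T z)) (U' ∩ U) := by
  refine ⟨hA.isFormOn hT.1, fun z hz => ?_⟩
  rw [hA.dRel_hatOp hz.2 (hT.1 z hz.1), hT.2 z hz.1]
  funext u
  simp [hatOp_apply]

lemma fibOp_mem_formStalk (hA : IsAdmissible h V m U) {q : ℕ} {ξ : XhatS S} (hξ : ξ ∈ U) {τ : FibCoch E q ξ}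
    (hτ : τ ∈ formStalk q ξ) : fibOp h V m q ξ τ ∈ formStalk q ξ := by
  obtain ⟨U', hU', hξ', T, hT, rfl⟩ := hτ
  exact ⟨U' ∩ U, hU'.inter hA.isOpen, ⟨hξ', hξ⟩, _, hA.isFormOn hT, rfl⟩

lemma dFib_fibOp (hA : IsAdmissible h V m U) {q : ℕ} {ξ : XhatS S} (hξ : ξ ∈ U) {τ : FibCoch E q ξ} (hτ : τ ∈ formStalk q ξ) :
    dFib q ξ (fibOp h V m q ξ τ) = fibOp h V m (q + 1) ξ (dFib q ξ τ) := by
  obtain ⟨U', hU', hξ', T, hT, rfl⟩ := hτ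
  funext z
  obtain ⟨z, rfl⟩ := z
  exact hA.dRel_hatOp hξ (hT z hξ')

lemma fibOp_mem_cocycles (hA : IsAdmissible h V m U) {q : ℕ} {ξ : XhatS S} (hξ : ξ ∈ U) {τ : FibCoch E q ξ}
    (hτ : τ ∈ cocycles E q ξ) : fibOp h V m q ξ τ ∈ cocycles E q ξ := by
  refine ⟨hA.fibOp_mem_formStalk hξ hτ.1, ?_⟩
  change dFib q ξ (fibOp h V m q ξ τ) = 0
  rw [hA.dFib_fibOp hξ hτ.1, LinearMap.mem_ker.1 hτ.2, map_zero]

lemma fibOp_mem_coboundaries (hA : IsAdmissible h V m U) : ∀ {q : ℕ} {ξ : XhatS S} (_ : ξ ∈ U) {τ : FibCoch E q ξ}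
    (_ : τ ∈ coboundaries E q ξ), fibOp h V m q ξ τ ∈ coboundaries E q ξ
  | 0, ξ, _, τ, hτ => by
    have h1 : τ = 0 := hτ
    rw [h1, map_zero]
    exact Submodule.zero_mem _
  | q + 1, ξ, hξ, τ, hτ => by
    obtain ⟨σ, hσ, rfl⟩ := hτ
    exact ⟨_, hA.fibOp_mem_formStalk hξ hσ, hA.dFib_fibOp hξ hσ⟩

/-- The action of the corrected derivative on the higher direct image. -/
def classOp (hA : IsAdmissible h V m U) (q : ℕ) (ξ : XhatS S) (hξ : ξ ∈ U) : RStalk E q ξ →+ RStalk E q ξ :=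
  AddMonoidHom.mk' (Quotient.map' (fun τ => ⟨fibOp h V m q ξ τ.1, hA.fibOp_mem_cocycles hξ τ.2⟩)
    (by
      intro τ τ' hτ
      rw [Submodule.quotientRel_def] at hτ ⊢
      have h1 := hA.fibOp_mem_coboundaries hξ hτ
      change fibOp h V m q ξ (τ.1 - τ'.1) ∈ _ at h1
      rw [map_sub] at h1
      exact h1)) (by
    intro s s'
    obtain ⟨τ, rfl⟩ := Submodule.Quotient.mk_surjective _ s
    obtain ⟨τ', rfl⟩ := Submodule.Quotient.mk_surjective _ s'
    refine congrArg (Submodule.Quotient.mk (p := (coboundaries E q ξ).submoduleOf _)) ?_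
    exact Subtype.ext (map_add (fibOp h V m q ξ) τ.1 τ'.1))

lemma classOp_smul (hA : IsAdmissible h V m U) {q : ℕ} {ξ : XhatS S} (hξ : ξ ∈ U) (r : SGerm ξ) (s : RStalk E q ξ) :
    hA.classOp q ξ hξ (r • s) = r • hA.classOp q ξ hξ s + V ξ r • s := by
  obtain ⟨τ, rfl⟩ := Submodule.Quotient.mk_surjective _ s
  refine congrArg (Submodule.Quotient.mk (p := (coboundaries E q ξ).submoduleOf _)) ?_
  exact Subtype.ext (fibOp_smul h V m r τ.1)

end IsAdmissible

lemma toFib_sum {ι : Type*} (t : Finset ι) {q : ℕ} (T : ι → ∀ z : ZS S, Coch E q z)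
    {φ : ι → XhatS S → ℂ} {ξ : XhatS S} (hφ : ∀ k ∈ t, φ k ∈ smoothNear ξ) :
    toFib (fun z => ∑ k ∈ t, germ z (φ k ∘ phatS) • T k z) ξ =
      ∑ k ∈ t, germ ξ (φ k) • toFib (T k) ξ := by
  funext z
  refine Eq.trans ?_ (map_sum (Pi.evalAddMonoidHom (fun z : Fib ξ => Coch E q z.1) z)
    (fun k => germ ξ (φ k) • toFib (T k) ξ) t).symm
  refine Finset.sum_congr rfl fun k hk => ?_
  change germ z.1 (φ k ∘ phatS) • T k z.1 = pullHat z.1 ξ z.2 (germ ξ (φ k)) • T k z.1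
  obtain ⟨z, rfl⟩ := z
  rw [pullHat, pullback_germ _ _ _ (hφ k hk)]

/-- A linear combination of closed forms is closed. -/
lemma IsClosedOn.sum {ι : Type*} (t : Finset ι) {q : ℕ} {T : ι → ∀ z : ZS S, Coch E q z}
    {φ : ι → XhatS S → ℂ} (hT : ∀ k ∈ t, IsClosedOn (T k) U)
    (hφ : ∀ k ∈ t, ∀ ξ ∈ U, φ k ∈ smoothNear ξ) :
    IsClosedOn (fun z => ∑ k ∈ t, germ z (φ k ∘ phatS) • T k z) U := by
  refine ⟨fun z hz => IsFormAt.sum t fun k hk => ((hT k hk).1 z hz).smul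
    (isSmoothMap_phatS.comp_mem z _ (hφ k hk _ hz)), fun z hz => ?_⟩
  have h1 : dFib q (phatS z)
      (toFib (fun z => ∑ k ∈ t, germ z (φ k ∘ phatS) • T k z) (phatS z)) = 0 := by
    rw [toFib_sum t T fun k hk => hφ k hk _ hz, map_sum]
    refine Finset.sum_eq_zero fun k hk => ?_
    rw [map_smul]
    have h2 : dFib q (phatS z) (toFib (T k) (phatS z)) = 0 := by
      funext z'
      exact (hT k hk).2 z'.1 (by rw [z'.2]; exact hz)
    rw [h2, smul_zero]
  exact congrFun h1 ⟨z, rfl⟩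

lemma IsClosedOn.cls_sum {ι : Type*} (t : Finset ι) {q : ℕ} {T : ι → ∀ z : ZS S, Coch E q z}
    {φ : ι → XhatS S → ℂ} (hT : ∀ k ∈ t, IsClosedOn (T k) U)
    (hφ : ∀ k ∈ t, ∀ ξ ∈ U, φ k ∈ smoothNear ξ) (hU : IsOpen U) {ξ : XhatS S} (hξ : ξ ∈ U) :
    (IsClosedOn.sum t hT hφ).cls hU ξ hξ =
      ∑ k ∈ t.attach, germ ξ (φ k) • (hT k.1 k.2).cls hU ξ hξ := by
  let c : t → cocycles E q ξ := fun k => ⟨toFib (T k) ξ, ⟨U, hU, hξ, T k, (hT k.1 k.2).1, rfl⟩, by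
    funext z
    exact (hT k.1 k.2).2 z.1 (by rw [z.2]; exact hξ)⟩
  have h1 := map_sum ((coboundaries E q ξ).submoduleOf (cocycles E q ξ)).mkQ
    (fun k => germ ξ (φ k.1) • c k) t.attach
  simp only [map_smul] at h1
  refine Eq.trans ?_ h1
  refine congrArg (Submodule.Quotient.mk (p := (coboundaries E q ξ).submoduleOf _)) (Subtype.ext ?_)
  refine (toFib_sum t T fun k hk => hφ k hk _ hξ).trans ?_
  rw [← Finset.sum_attach]
  exact (map_sum (cocycles E q ξ).subtype (fun k => germ ξ (φ k.1) • c k) t.attach).symm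

end Cohomology

end FourierMukai

end

noncomputable section

namespace FourierMukai

open Filter Metric LagrangianLattice

set_option linter.unusedSectionVars false

/-! ### The glued connection. -/

section Construction

variable {g : ℕ} {B : Type*} [TopologicalSpace B] [ChartedSpace (Model g) B]
  {L : LagrangianLattice g B} {S : Set L.X} {E : FlatModule S}
  [IsManifold 𝓘(ℝ, Model g) ∞ B] [HasCharts S] [HasCharts (ZS S)] [HasCharts (XhatS S)]
  {Shat : Set (XhatS S)} [HasCharts Shat] {h : Splitting S} {ι : Type*}

namespace GlobalData

lemma isAdmissible (G : GlobalData h Shat ι) (k : ι) : IsAdmissible h (G.V k) (G.m k) (G.U k) :=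
  ⟨G.isOpen k, G.field k, G.m_mem k, G.der_m k⟩

open Classical in
/-- The action of the `k`-th corrected derivative on the stalks of the higher direct image. -/
def op (G : GlobalData h Shat ι) (k : ι) (q : ℕ) (ξ : XhatS S) : RStalk E q ξ →+ RStalk E q ξ :=
  if hξ : ξ ∈ G.U k then (G.isAdmissible k).classOp q ξ hξ else 0

lemma op_of_mem (G : GlobalData h Shat ι) {k : ι} (q : ℕ) {ξ : XhatS S} (hξ : ξ ∈ G.U k) :
    G.op (E := E) k q ξ = (G.isAdmissible k).classOp q ξ hξ := dif_pos hξ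

/-- The covariant derivatives of the glued connection. -/
def covDer (G : GlobalData h Shat ι) (q : ℕ) (ξ : Shat) (v : Der ξ) (s : RStalk E q ξ.1) :
    SGerm ξ ⊗[SGerm ξ.1] RStalk E q ξ.1 :=
  ∑ k ∈ G.t ξ, (restrictGerm ξ (germ ξ.1 (G.f k)) * v (germ ξ (G.s k))) ⊗ₜ G.op k q ξ.1 s

/-- Each operator contributes the term `V k r` to the Leibniz rule; with the weights of the sum
these terms add up to `v (restrictGerm ξ r)`, by `der_restrict`. -/
lemma covDer_leibniz (G : GlobalData h Shat ι) {q : ℕ} (ξ : Shat) (v : Der ξ) (r : SGerm ξ.1)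
    (s : RStalk E q ξ.1) :
    G.covDer q ξ v (r • s) = r • G.covDer q ξ v s + v (restrictGerm ξ r) ⊗ₜ s := by
  simp only [covDer]
  rw [G.der_restrict ξ v r, TensorProduct.sum_tmul, Finset.smul_sum, ← Finset.sum_add_distrib]
  refine Finset.sum_congr rfl fun k hk => ?_
  rw [G.op_of_mem q (G.mem ξ k hk), IsAdmissible.classOp_smul, TensorProduct.tmul_add,
    TensorProduct.tmul_smul, ← TensorProduct.smul_tmul]
  congr 2
  rw [Algebra.smul_def, mul_comm]
  rfl

/-- The form that represents the covariant derivative of the class of `T`. -/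
def form (G : GlobalData h Shat ι) (t : Finset ι) (a : ι → XhatS S → ℂ) {q : ℕ}
    (T : ∀ z : ZS S, Coch E q z) (z : ZS S) : Coch E q z :=
  ∑ k ∈ t, germ z ((G.f k * a k) ∘ phatS) • hatOp h (G.V k (phatS z)) (germ z (G.m k)) (T z)

/-- The functions `v (s k)` live on `Shat` only. Extending them to functions `a k` on `XhatS S`
turns the covariant derivative into the class of a closed form over an open set. The predicate `P`
carries conditions that are to hold on this set as well. -/
theorem exists_form (G : GlobalData h Shat ι) (ξ₀ : Shat) {v : ∀ ξ : Shat, Der ξ}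
    (hv : IsVectorFieldNear v ξ₀) {P : XhatS S → Prop} (hP : ∀ᶠ ξ in 𝓝 ξ₀.1, P ξ) {q : ℕ}
    {T : ∀ z : ZS S, Coch E q z} {U : Set (XhatS S)} (hT : IsClosedOn T U) (hU : IsOpen U)
    (hξ₀ : ξ₀.1 ∈ U) : ∃ (a : ι → XhatS S → ℂ) (U' : Set (XhatS S)) (hU' : IsOpen U') (hs : U' ⊆ U)
      (hT' : IsClosedOn (G.form (G.t ξ₀) a T) U'), ξ₀.1 ∈ U' ∧ (∀ ξ ∈ U', P ξ ∧ ∀ k ∈ G.t ξ₀,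
        ξ ∈ G.U k ∧ a k ∈ smoothNear ξ) ∧
      (∀ ξ : Shat, ξ.1 ∈ U' → G.t ξ ⊆ G.t ξ₀ ∧
        ∀ k ∈ G.t ξ₀, v ξ (germ ξ (G.s k)) = restrictGerm ξ (germ ξ.1 (a k))) ∧
      ∀ (ξ : Shat) (hξ : ξ.1 ∈ U'),
        G.covDer q ξ (v ξ) (hT.cls hU ξ.1 (hs hξ)) = 1 ⊗ₜ hT'.cls hU' ξ.1 hξ := by
  have h1 : ∀ k ∈ G.t ξ₀, ∃ a ∈ smoothNear ξ₀.1, ∀ᶠ ξ in 𝓝 ξ₀,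
      v ξ (germ ξ (G.s k)) = germ ξ (a ∘ Subtype.val) := by
    intro k hk
    obtain ⟨ψ, ⟨a, ha, h2⟩, h3⟩ := hv _ (G.s_mem k ξ₀ (G.mem ξ₀ k hk))
    refine ⟨a, ha, ?_⟩
    filter_upwards [h3, h2.eventually_nhds] with ξ h4 h5
    rw [h4]
    exact germ_congr h5
  choose! a ha hva using h1
  have h2 : ∀ᶠ ξ in 𝓝 ξ₀.1, ∀ hξ : ξ ∈ Shat, G.t ⟨ξ, hξ⟩ ⊆ G.t ξ₀ ∧ ∀ k ∈ G.t ξ₀,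
      v ⟨ξ, hξ⟩ (germ _ (G.s k)) = germ (⟨ξ, hξ⟩ : Shat) (a k ∘ Subtype.val) := by
    have h3 := (G.eventually_subset ξ₀).and ((eventually_all_finset (G.t ξ₀)).2 hva)
    rw [nhds_subtype_eq_comap, eventually_comap] at h3
    filter_upwards [h3] with ξ h4 hξ
    exact h4 ⟨ξ, hξ⟩ rfl
  have h3 : ∀ᶠ ξ in 𝓝 ξ₀.1, ∀ k ∈ G.t ξ₀, ξ ∈ G.U k ∧ a k ∈ smoothNear ξ :=
    (eventually_all_finset _).2 fun k hk => Eventually.and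
      ((G.isOpen k).mem_nhds (G.mem ξ₀ k hk)) (SmoothSpace.eventually_mem _ _ (ha k hk))
  have hUn : ∀ᶠ ξ in 𝓝 ξ₀.1, ξ ∈ U := hU.mem_nhds hξ₀
  obtain ⟨U', h4, hU', hξ'⟩ := _root_.eventually_nhds_iff.1
    (((hP.and h3).and h2).and hUn)
  have hk : ∀ k ∈ G.t ξ₀, IsClosedOn
      (fun z => hatOp h (G.V k (phatS z)) (germ z (G.m k)) (T z)) U' := by
    intro k hk
    obtain ⟨h5, h6⟩ := (G.isAdmissible k).isClosedOn hT
    have h7 : ∀ ξ ∈ U', ξ ∈ U ∩ G.U k := fun ξ hξ => ⟨(h4 ξ hξ).2, ((h4 ξ hξ).1.1.2 k hk).1⟩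
    exact ⟨fun z hz => h5 z (h7 _ hz), fun z hz => h6 z (h7 _ hz)⟩
  have hφ : ∀ k ∈ G.t ξ₀, ∀ ξ ∈ U', G.f k * a k ∈ smoothNear ξ := fun k hk ξ hξ =>
    mul_mem (G.f_mem k ξ) ((h4 ξ hξ).1.1.2 k hk).2
  have h5 : ∀ ξ : Shat, ξ.1 ∈ U' → G.t ξ ⊆ G.t ξ₀ ∧
      ∀ k ∈ G.t ξ₀, v ξ (germ ξ (G.s k)) = restrictGerm ξ (germ ξ.1 (a k)) := by
    intro ξ hξ
    refine ⟨((h4 ξ.1 hξ).1.2 ξ.2).1, fun k hk => ?_⟩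
    rw [restrictGerm_germ ξ ((h4 ξ.1 hξ).1.1.2 k hk).2]
    exact ((h4 ξ.1 hξ).1.2 ξ.2).2 k hk
  refine ⟨a, U', hU', fun ξ hξ => (h4 ξ hξ).2, IsClosedOn.sum (G.t ξ₀) hk hφ, hξ',
    fun ξ hξ => (h4 ξ hξ).1.1, h5, fun ξ hξ => ?_⟩
  refine Eq.trans ?_ (congrArg (fun s => (1 : SGerm ξ) ⊗ₜ[SGerm ξ.1] s)
    (IsClosedOn.cls_sum (G.t ξ₀) hk hφ hU' hξ).symm)
  obtain ⟨h6, h7⟩ := h5 ξ hξ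
  have h8 : G.covDer q ξ (v ξ) (hT.cls hU ξ.1 (h4 ξ hξ).2) = ∑ k ∈ G.t ξ₀,
      (restrictGerm ξ (germ ξ.1 (G.f k)) * v ξ (germ ξ (G.s k))) ⊗ₜ
        G.op k q ξ.1 (hT.cls hU ξ.1 (h4 ξ hξ).2) := by
    -- The sum may run over the indices at `ξ₀` instead of those at `ξ`, since for the additional
    -- ones the germ of `f k` at `ξ` is zero.
    refine Finset.sum_subset h6 fun k _ hk => ?_
    rw [G.germ_eq_zero ξ k hk, map_zero, zero_mul, TensorProduct.zero_tmul]
  rw [h8, TensorProduct.tmul_sum, ← Finset.sum_attach]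
  refine Finset.sum_congr rfl fun k _ => ?_
  rw [h7 k.1 k.2, TensorProduct.tmul_smul, TensorProduct.smul_tmul', ← map_mul,
    ← germ_mul (G.f_mem k.1 ξ.1) ((h4 ξ.1 hξ).1.1.2 k.1 k.2).2,
    G.op_of_mem q ((h4 ξ.1 hξ).1.1.2 k.1 k.2).1, Algebra.smul_def, mul_one]
  rfl

/-- The connection glued from local data. -/
def connection (G : GlobalData h Shat ι) (E : FlatModule S) (q : ℕ) : Connection E Shat q where
  toFun := G.covDer q
  add_left ξ v v' s := by
    simp only [covDer, ← Finset.sum_add_distrib, ← TensorProduct.add_tmul, ← mul_add]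
    rfl
  smul_left ξ r v s := by
    simp only [covDer, Finset.smul_sum, TensorProduct.smul_tmul']
    refine Finset.sum_congr rfl fun k _ => ?_
    congr 1
    exact mul_left_comm _ _ _
  add ξ v s s' := by
    simp only [covDer, map_add, TensorProduct.tmul_add, Finset.sum_add_distrib]
  leibniz := G.covDer_leibniz
  smooth ξ₀ v hv T U hT hU hξ₀ := by
    obtain ⟨a, U', hU', hs, hT', h1, -, -, h2⟩ :=
      G.exists_form ξ₀ hv (P := fun _ => True) (Eventually.of_forall fun _ => trivial) hT hU hξ₀
    exact ⟨U', hU', hs, _, hT', h1, h2⟩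

end GlobalData

lemma pullHat_mem_vanishingIdeal (z : ZSS Shat) {r : SGerm (phatS z.1)}
    (hr : restrictGerm (⟨phatS z.1, z.2⟩ : Shat) r = 0) :
    pullHat z.1 _ rfl r ∈ vanishingIdeal z := by
  obtain ⟨φ, hφ, rfl⟩ := exists_germ r
  have h1 := (eventually_subtype_iff (P := fun ξ => φ ξ = 0) (⟨phatS z.1, z.2⟩ : Shat)).1
    ((restrictGerm_eq_zero_iff (⟨phatS z.1, z.2⟩ : Shat) hφ).1 hr)
  rw [pullHat, pullback_germ _ _ _ hφ]
  refine (restrictGerm_eq_zero_iff z (isSmoothMap_phatS.comp_mem z.1 _ hφ)).2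
    ((eventually_subtype_iff (P := fun q => φ (phatS q) = 0) z).2 ?_)
  exact isSmoothMap_phatS.continuous.continuousAt.eventually h1

/-- The complementary derivative along a field that vanishes on `Shat` vanishes over `Shat`. -/
lemma nablaHat_mem (h : Splitting S) {q : ℕ} (z : ZSS Shat) {θ : Der (phatS z.1)}
    (hθ : ∀ r, restrictGerm (⟨phatS z.1, z.2⟩ : Shat) (θ r) = 0)
    (α : AlternatingMap (SGerm z.1) (vertical z.1) (TwStalk E z.1) (Fin q))
    (u : Fin q → vertical z.1) (w : WLift z.1) : nablaHat h θ α u w ∈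
      vanishingIdeal z • (⊤ : Submodule (SGerm z.1) (PullStalk E z.1)) := by
  obtain ⟨N, κ, hκ, hs⟩ := HasCharts.exists_chart (phatS z.1)
  -- The coefficients of `θ` in a coordinate frame vanish on `Shat`, and the complementary
  -- derivative is linear over functions in its direction.
  rw [hκ.der_eq_sum hs θ (Pi.basisFun ℝ (Fin N)), nablaHat_sum_left, Finset.sum_apply,
    Finset.sum_apply]
  refine Submodule.sum_mem _ fun i _ => ?_
  exact Submodule.smul_mem_smul (pullHat_mem_vanishingIdeal z (hθ _)) trivial

/-- The field `θ`, the difference of `v` and the combination of the `V k`, vanishes along `Shat` by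
the expansion of `v'` in the local frames. So the form differs from the derivative along `v` by the
derivative along `θ` and by multiples of the `m k`, all of which lie in the ideal of the functions
vanishing over `Shat`. -/
theorem GlobalData.isInducedBy (G : GlobalData h Shat ι) (E : FlatModule S) (q : ℕ) :
    (G.connection E q).IsInducedBy h := by
  intro ξ₀ v v' hv hv' hvv T U hT hU hξ₀
  have hP : ∀ᶠ ξ in 𝓝 ξ₀.1, ∀ hξ : ξ ∈ Shat, ∀ r : SGerm ξ,
      v' ⟨ξ, hξ⟩ (restrictGerm (⟨ξ, hξ⟩ : Shat) r) = restrictGerm (⟨ξ, hξ⟩ : Shat) (v ξ r) := by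
    rw [nhds_subtype_eq_comap, eventually_comap] at hvv
    filter_upwards [hvv] with ξ h4 hξ
    exact h4 ⟨ξ, hξ⟩ rfl
  obtain ⟨a, U', hU', hs, hT', h1, h2, h3, h4⟩ := G.exists_form ξ₀ hv' hP hT hU hξ₀
  refine ⟨U', hU', hs, _, hT', h1, fun z hz u w => ?_, h4⟩
  let ξ : Shat := ⟨phatS z.1, z.2⟩
  obtain ⟨⟨α, hα⟩, -, -⟩ := hT.1 z.1 (hs hz)
  obtain ⟨h5, h6⟩ := h2 _ hz
  obtain ⟨h7, h8⟩ := h3 ξ hz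
  let c : ι → SGerm (phatS z.1) := fun k => germ (phatS z.1) (G.f k * a k)
  let θ : Der (phatS z.1) := v (phatS z.1) - ∑ k ∈ G.t ξ₀, c k • G.V k (phatS z.1)
  have hc : ∀ k ∈ G.t ξ₀, restrictGerm ξ (c k) =
      restrictGerm ξ (germ ξ.1 (G.f k)) * v' ξ (germ ξ (G.s k)) := by
    intro k hk
    rw [h8 k hk, ← map_mul, ← germ_mul (G.f_mem k ξ.1) (h6 k hk).2]
  have hθ : ∀ r, restrictGerm ξ (θ r) = 0 := by
    intro r
    have h9 : θ r = v (phatS z.1) r - ∑ k ∈ G.t ξ₀, c k * G.V k (phatS z.1) r := by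
      simp only [θ]
      rw [Derivation.sub_apply, der_sum_apply]
      rfl
    rw [h9, map_sub, map_sum, ← h5 z.2 r, G.der_restrict ξ (v' ξ) r, sub_eq_zero]
    refine Eq.trans (Finset.sum_subset h7 fun k _ hk => ?_) (Finset.sum_congr rfl fun k hk => ?_)
    · rw [G.germ_eq_zero ξ k hk, map_zero, zero_mul, zero_mul]
    · rw [map_mul, hc k hk]
  have hv1 : v (phatS z.1) = θ + ∑ k ∈ G.t ξ₀, c k • G.V k (phatS z.1) :=
    (sub_add_cancel _ _).symm
  have hpull : ∀ k ∈ G.t ξ₀, germ z.1 ((G.f k * a k) ∘ phatS) = pullHat z.1 _ rfl (c k) :=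
    fun k hk => (pullback_germ isSmoothMap_phatS z.1 rfl (mul_mem (G.f_mem k _) (h6 k hk).2)).symm
  have hform : G.form (G.t ξ₀) a T z.1 u w = ∑ k ∈ G.t ξ₀, (pullHat z.1 _ rfl (c k) •
      nablaHat h (G.V k (phatS z.1)) α u w +
      pullHat z.1 _ rfl (c k) • germ z.1 (G.m k) • α u w) := by
    rw [GlobalData.form, Finset.sum_apply, Finset.sum_apply]
    refine Finset.sum_congr rfl fun k hk => ?_
    rw [hpull k hk, ← smul_add, ← hα]
    rfl
  have hnab : nablaHat h (v (phatS z.1)) (T z.1) u w = nablaHat h θ α u w +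
      ∑ k ∈ G.t ξ₀, pullHat z.1 _ rfl (c k) • nablaHat h (G.V k (phatS z.1)) α u w := by
    rw [hv1, ← hα, nablaHat_add_left, nablaHat_sum_left, Pi.add_apply, Pi.add_apply,
      Finset.sum_apply, Finset.sum_apply]
    rfl
  have habel : ∀ x y y' : PullStalk E z.1, x + y - (y + y') = x - y' := fun x y y' => by abel
  rw [hnab, hform, Finset.sum_add_distrib, habel]
  refine Submodule.sub_mem _ (nablaHat_mem h z hθ α u w) (Submodule.sum_mem _ fun k hk => ?_)
  exact Submodule.smul_mem _ _ (Submodule.smul_mem_smul (G.vanish k z (h6 k hk).1) trivial)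

end Construction

end FourierMukai

end

open scoped Manifold ContDiff in
theorem mainTheorem10 {g : ℕ} {B : Type*} [TopologicalSpace B] [T2Space B]
    [SecondCountableTopology B] [ChartedSpace (FourierMukai.Model g) B]
    [IsManifold 𝓘(ℝ, FourierMukai.Model g) ∞ B]
    (L : FourierMukai.LagrangianLattice g B)
    (S : Set L.X) (hS : L.plotsX.IsClosedSubmanifold S)
    (hXS : L.plotsXhat.IsClosedSubmanifold (FourierMukai.XhatS S))
    (hsub : FourierMukai.IsSubmersion (FourierMukai.isSmoothMap_phatS (S := S)))
    (E : FourierMukai.FlatModule S) (j : ℕ)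
    (Shat : Set (FourierMukai.XhatS S))
    (hShat : L.plotsXhat.IsClosedSubmanifold (Subtype.val '' Shat))
    (hsupp : ∀ ξ : FourierMukai.XhatS S, ξ ∉ Shat → Subsingleton (FourierMukai.RStalk E j ξ))
    (hF : FourierMukai.CurvatureVanishes Shat)
    (h : FourierMukai.Splitting S) :
    ∃ D : FourierMukai.Connection E Shat j, D.IsInducedBy h := by
  have := FourierMukai.hasCharts_S hS
  have := FourierMukai.hasCharts_ZS hS
  have := FourierMukai.hasCharts_XhatS hXS
  have := FourierMukai.hasCharts_Shat hShat
  obtain ⟨n, ⟨G⟩⟩ := FourierMukai.exists_globalData hS hsub hShat hF h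
  exact ⟨G.connection E j, G.isInducedBy E j⟩
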